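/- **Setting.** Let $h=(h_{ij})$ be a smooth Riemannian metric on $\mathbb R^3$, let $h^{ij}$ be its inverse, and let $L^2(\mathcal M_h)=L^2(\mathbb R^3,\sqrt{\det h}\,dx)$. Repeated indices are summed over $1,2,3$. Put $\Gamma^i_{jk}=\tfrac12h^{il}(\partial_jh_{lk}+\partial_kh_{jl}-\partial_lh_{jk})$ and $\mathcal R_h=h^{jk}(\partial_i\Gamma^i_{jk}-\partial_k\Gamma^i_{ji}+\Gamma^l_{jk}\Gamma^i_{il}-\Gamma^l_{ji}\Gamma^i_{kl})$ (the scalar curvature). Let $\gamma^0=\beta=\mathrm{diag}(1,1,-1,-1)$ and $\gamma^j=\gamma^0\alpha_j$, where $\alpha_j=\begin{pmatrix}0&\sigma_j\\ \sigma_j&0\end{pmatrix}$ and $\sigma_j$ are the Pauli matrices; put $\gamma_a=-\gamma^a$ for $a=1,2,3$. A (smooth) *dreibein* is a smooth matrix field $e=(e^i_{\ a})$ with $h^{ij}=e^i_{\ a}\delta^{ab}e^j_{\ b}$. Let $e_i^{\ a}$ be its inverse, $e_i^{\ a}e^i_{\ b}=\delta^a_b$, and put $e^{ib}=-e^i_{\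 b}$ (frame indices are raised with the Minkowski metric $\mathrm{diag}(1,-1,-1,-1)$). Define $$\omega_j^{\ ab}=e_i^{\ a}\partial_je^{ib}+e_i^{\ a}\Gamma^i_{jk}e^{kb},\qquad B_j=\tfrac18[\gamma_a,\gamma_b]\,\omega_j^{\ ab},\qquad B^i=h^{ij}B_j,\qquad D_j=\partial_j+B_j,$$ and, for $m\ge0$, the Dirac operator $\mathcal D_m=-i\gamma^0\gamma^ae^i_{\ a}D_i-\gamma^0m$ on $\mathbb C^4$-valued fields. Let $\Delta_hv=D^iD_iv=h^{ij}(D_jD_iv-\Gamma^k_{ij}D_kv)$ be the spinorial Laplacian, $\widetilde\Delta_hv=(\det h)^{-1/2}\partial_i((\det h)^{1/2}h^{ij}\partial_jv)$ the scalar Laplace–Beltrami operator acting on each component, and $\widetilde D^i\Psi_k=h^{ij}(\partial_j\Psi_k-\Gamma^l_{jk}\Psi_l)$. Let $\langle x\rangle=(1+|x|^2)^{1/2}$. A *classical* solution of $i\partial_tu-\mathcal D_mu=0$, $u(0)=u_0$, is a $C^2$ map $u:[0,\infty)\times\mathbb R^3\to\mathbb C^4$ satisfying these equations pointwise. A *weak*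 solution has $u_0\in L^2(\mathcal M_h)$, $u\in L^2((0,T);L^2(\mathcal M_h))$ for all $T>0$, and satisfies the equation with its initial condition in the sense of distributions: it is tested against all $\varphi\in C_c^\infty(\mathbb R\times\mathbb R^3;\mathbb C^4)$ over $t>0$ with the measure $\sqrt{\det h}\,dx\,dt$, the formally self-adjoint spatial operator being put on $\varphi$. The same conventions apply to the system in (1), whose initial velocity is understood as a distribution in the weak case. **Theorem 2.2.** (1) For every such $h$, every dreibein $e$ and every $m\ge0$: if $u$ is a solution of $i\partial_tu-\mathcal D_mu=0$, $u(0)=u_0$, then $u$ also solves $$\partial_t^2u+m^2u-\Delta_hu+\tfrac14\mathcal R_hu=0,\qquad u(0)=u_0,\qquad \partial_tu(0)=-i\mathcal D_mu_0 .$$ This holds for classical solutions (in the classical sense) and for weak solutions (in the weak sense). (2) For every such $h$, every dreibein $e$ and every $v\in C^2(\mathbb R^3;\mathbb C^4)$, $$\Delta_hv=\widetilde\Delta_hv+B^i\partial_iv+\widetilde D^i(B_iv)+B^iB_iv .$$ (3) For every $\sigma\in(0,1)$ there is $\varepsilon>0$ with the following properties. Consider metrics $h$ as above for which there is $C_h\le\varepsilon$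 with $$|\partial^\alpha(h_{ij}-\delta_{ij})(x)|\le C_h\langle x\rangle^{-|\alpha|-1-\sigma}\qquad\text{for all }i,j,\ |\alpha|\le3,\ x\in\mathbb R^3 .$$ (a) There is a constant $C_B>0$, depending only on $\sigma$, such that each such $h$ has a smooth dreibein, namely the symmetric positive definite one, for which all entries of the matrices $B_j(x)$ are bounded by $C_BC_h\langle x\rangle^{-2-\sigma}$. (b) For all $m\ge0$, $\eta>0$ and $K$ there is a constant $C$, depending only on $\sigma,m,\eta,K$, such that for every such $h$, every dreibein $e$ of $h$ for which all entries of the matrices $B_j(x)$ are bounded by $K\langle x\rangle^{-2-\sigma}$, and every weak solution $u$ of $i\partial_tu-\mathcal D_mu=0$, $u(0)=u_0\in L^2(\mathcal M_h)$, with $\mathcal D_mu_0\in L^2(\mathcal M_h)$ (in the sense of distributions), the distributional derivatives $\partial_iu$ are locally integrable functions on $(0,\infty)\times\mathbb R^3$ and $$\|\langle x\rangle^{-3/2-\eta}u\|_{L^2_tL^2(\mathcal M_h)}+\|\langle x\rangle^{-1/2-\eta}\widetilde\nabla u\|_{L^2_tL^2(\mathcal M_h)}\le C\,\|\mathcal D_mu_0\|_{L^2(\mathcal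 M_h)},$$ where $L^2_t$ is taken over $t>0$ and $$\|\langle x\rangle^{-1/2-\eta}\widetilde\nabla u\|^2_{L^2_tL^2(\mathcal M_h)}=\int_0^\infty\!\!\int_{\mathbb R^3}\langle x\rangle^{-1-2\eta}\,h^{ij}\langle\partial_iu,\partial_ju\rangle_{\mathbb C^4}\sqrt{\det h}\,dx\,dt .$$ -/

import Mathlib

open MeasureTheory Set
open scoped ContDiff ENNReal NNReal

noncomputable section

namespace CurvedDirac

/-- Coordinate space `ℝ³` with its Euclidean norm. -/
abbrev Space := EuclideanSpace ℝ (Fin 3)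

/-- The space `ℂ⁴` of Dirac bispinors, with its Hermitian inner product
(conjugate linear in the first argument). -/
abbrev Spinor := EuclideanSpace ℂ (Fin 4)

/-- The coordinate derivative `∂_i f`. -/
def pd {F : Type*} [NormedAddCommGroup F] [NormedSpace ℝ F]
    (i : Fin 3) (f : Space → F) (x : Space) : F :=
  fderiv ℝ f x (EuclideanSpace.single i 1)

/-- The iterated derivative `∂^α = ∂_1^{α_1} ∂_2^{α_2} ∂_3^{α_3}`. -/
def multiPd (α : Fin 3 → ℕ) (f : Space → ℝ) : Space → ℝ :=
  (pd 0)^[α 0] ((pd 1)^[α 1] ((pd 2)^[α 2] f))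

/-- The Japanese bracket `⟨x⟩ = (1 + |x|²)^{1/2}`. -/
def bracket (x : Space) : ℝ := Real.sqrt (1 + ‖x‖ ^ 2)

/-! ### Riemannian geometry of `(ℝ³, h)` -/

/-- `h` is a smooth Riemannian metric on `ℝ³`; `h x i j` is `h_{ij}(x)`. -/
structure IsMetric (h : Space → Matrix (Fin 3) (Fin 3) ℝ) : Prop where
  smooth : ∀ i j, ContDiff ℝ ∞ (fun x => h x i j)
  posDef : ∀ x, (h x).PosDef

/-- The asymptotic flatness bounds
`|∂^α (h_{ij} - δ_{ij})(x)| ≤ C_h ⟨x⟩^{-|α|-1-σ}` for `|α| ≤ 3`. -/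
def AsymptoticallyFlat (h : Space → Matrix (Fin 3) (Fin 3) ℝ) (Ch σ : ℝ) : Prop :=
  ∀ α : Fin 3 → ℕ, ∑ k, α k ≤ 3 → ∀ (i j : Fin 3) (x : Space),
    |multiPd α (fun y => h y i j - (if i = j then 1 else 0)) x|
      ≤ Ch * bracket x ^ (-((∑ k, α k : ℕ) : ℝ) - 1 - σ)

/-- `h^{ij}`, the entries of the inverse matrix. -/
def hInv (h : Space → Matrix (Fin 3) (Fin 3) ℝ) (i j : Fin 3) (x : Space) : ℝ :=
  (h x)⁻¹ i j

/-- `√(det h)`. -/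
def volDensity (h : Space → Matrix (Fin 3) (Fin 3) ℝ) (x : Space) : ℝ :=
  Real.sqrt (h x).det

/-- The Riemannian measure `√(det h(x)) dx`. -/
def riemVol (h : Space → Matrix (Fin 3) (Fin 3) ℝ) : Measure Space :=
  (volume : Measure Space).withDensity (fun x => ENNReal.ofReal (volDensity h x))

/-- The measure `dt ⊗ √(det h(x)) dx` on `I × ℝ³`. -/
def spacetimeVol (h : Space → Matrix (Fin 3) (Fin 3) ℝ) (I : Set ℝ) :
    Measure (ℝ × Space) :=
  ((volume : Measure ℝ).restrict I).prod (riemVol h)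

/-- `Γ^i_{jk} = ½ h^{il} (∂_j h_{lk} + ∂_k h_{jl} - ∂_l h_{jk})`. -/
def christoffel (h : Space → Matrix (Fin 3) (Fin 3) ℝ) (i j k : Fin 3) (x : Space) : ℝ :=
  (1 / 2) * ∑ l, hInv h i l x *
    (pd j (fun y => h y l k) x + pd k (fun y => h y j l) x - pd l (fun y => h y j k) x)

/-- The scalar curvature
`R_h = h^{jk} (∂_i Γ^i_{jk} - ∂_k Γ^i_{ji} + Γ^l_{jk} Γ^i_{il} - Γ^l_{ji} Γ^i_{kl})`. -/
def scalarCurvature (h : Space → Matrix (Fin 3) (Fin 3) ℝ) (x : Space) : ℝ :=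
  ∑ j, ∑ k, hInv h j k x *
    (∑ i, (pd i (christoffel h i j k) x - pd k (christoffel h i j i) x) +
      ∑ i, ∑ l, (christoffel h l j k x * christoffel h i i l x
        - christoffel h l j i x * christoffel h i k l x))

/-- The scalar Laplace–Beltrami operator, acting on each component of a spinor field:
`(det h)^{-1/2} ∂_i ((det h)^{1/2} h^{ij} ∂_j v)`. -/
def laplaceBeltrami (h : Space → Matrix (Fin 3) (Fin 3) ℝ) (v : Space → Spinor)
    (x : Space) : Spinor :=
  (volDensity h x)⁻¹ • ∑ i, ∑ j, pd i (fun y => (volDensity h y * hInv h i j y) • pd j v y) x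

/-! ### Dirac matrices -/

/-- The Pauli matrices `σ_1, σ_2, σ_3`. -/
def pauli : Fin 3 → Matrix (Fin 2) (Fin 2) ℂ :=
  ![!![0, 1; 1, 0], !![0, -Complex.I; Complex.I, 0], !![1, 0; 0, -1]]

/-- The matrices `α_j`, with off-diagonal blocks `σ_j`. -/
def diracAlpha (j : Fin 3) : Matrix (Fin 4) (Fin 4) ℂ :=
  Matrix.reindex finSumFinEquiv finSumFinEquiv (Matrix.fromBlocks 0 (pauli j) (pauli j) 0)

/-- `γ^0 = β = diag(1, 1, -1, -1)`. -/
def gammaZero : Matrix (Fin 4) (Fin 4) ℂ :=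
  Matrix.reindex finSumFinEquiv finSumFinEquiv
    (Matrix.fromBlocks (1 : Matrix (Fin 2) (Fin 2) ℂ) 0 0 (-1 : Matrix (Fin 2) (Fin 2) ℂ))

/-- `γ^j = γ^0 α_j`, `j = 1, 2, 3`. -/
def gammaUp (j : Fin 3) : Matrix (Fin 4) (Fin 4) ℂ := gammaZero * diracAlpha j

/-- `γ_a = η_{ab} γ^b = -γ^a` for spatial `a`, with `η = diag(1, -1, -1, -1)`. -/
def gammaDown (a : Fin 3) : Matrix (Fin 4) (Fin 4) ℂ := -gammaUp a

/-- A matrix acting on a spinor. -/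
def act (M : Matrix (Fin 4) (Fin 4) ℂ) (v : Spinor) : Spinor := Matrix.toEuclideanLin M v

/-! ### Dreibein, spin connection, Dirac operator -/

/-- `e` is a smooth dreibein for `h`, i.e. `h^{ij} = e^i_a δ^{ab} e^j_b`;
`e x i a` is `e^i_a(x)`. -/
structure IsDreibein (h e : Space → Matrix (Fin 3) (Fin 3) ℝ) : Prop where
  smooth : ∀ i a, ContDiff ℝ ∞ (fun x => e x i a)
  frame : ∀ x i j, hInv h i j x = ∑ a, e x i a * e x j a

/-- `e^{ib} = η^{bc} e^i_c = -e^i_b` (spatial frame indices are raised with the Minkowski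
metric `η`). -/
def frameUp (e : Space → Matrix (Fin 3) (Fin 3) ℝ) (i b : Fin 3) (x : Space) : ℝ :=
  -e x i b

/-- The dual coframe `e_i^a`, determined by `e_i^a e^i_b = δ^a_b`. -/
def coframe (e : Space → Matrix (Fin 3) (Fin 3) ℝ) (i a : Fin 3) (x : Space) : ℝ :=
  (e x)⁻¹ a i

/-- The spin connection `ω_j^{ab} = e_i^a ∂_j e^{ib} + e_i^a Γ^i_{jk} e^{kb}`. -/
def spinConnection (h e : Space → Matrix (Fin 3) (Fin 3) ℝ) (j a b : Fin 3)
    (x : Space) : ℝ :=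
  ∑ i, coframe e i a x * pd j (frameUp e i b) x +
    ∑ i, ∑ k, coframe e i a x * christoffel h i j k x * frameUp e k b x

/-- `B_j = ⅛ [γ_a, γ_b] ω_j^{ab}`. -/
def spinB (h e : Space → Matrix (Fin 3) (Fin 3) ℝ) (j : Fin 3) (x : Space) :
    Matrix (Fin 4) (Fin 4) ℂ :=
  (1 / 8 : ℂ) • ∑ a, ∑ b, ((spinConnection h e j a b x : ℝ) : ℂ) •
    (gammaDown a * gammaDown b - gammaDown b * gammaDown a)

/-- `B^i = h^{ij} B_j`. -/
def spinBUp (h e : Space → Matrix (Fin 3) (Fin 3) ℝ) (i : Fin 3) (x : Space) :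
    Matrix (Fin 4) (Fin 4) ℂ :=
  ∑ j, ((hInv h i j x : ℝ) : ℂ) • spinB h e j x

/-- The spinorial covariant derivative `D_j = ∂_j + B_j`. -/
def covD (h e : Space → Matrix (Fin 3) (Fin 3) ℝ) (j : Fin 3) (v : Space → Spinor)
    (x : Space) : Spinor :=
  pd j v x + act (spinB h e j x) (v x)

/-- The Dirac operator `D_m = -i γ^0 γ^a e^i_a D_i - γ^0 m`. -/
def dirac (h e : Space → Matrix (Fin 3) (Fin 3) ℝ) (m : ℝ) (v : Space → Spinor)
    (x : Space) : Spinor :=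
  -(Complex.I • ∑ a, ∑ i, e x i a • act (gammaZero * gammaUp a) (covD h e i v x))
    - m • act gammaZero (v x)

/-- The covariant derivative `D_j Ψ_k = ∂_j Ψ_k + B_j Ψ_k - Γ^l_{jk} Ψ_l` of a spinor-valued
one-form. -/
def covDForm (h e : Space → Matrix (Fin 3) (Fin 3) ℝ) (j k : Fin 3)
    (Ψ : Fin 3 → Space → Spinor) (x : Space) : Spinor :=
  pd j (Ψ k) x + act (spinB h e j x) (Ψ k x) - ∑ l, christoffel h l j k x • Ψ l x

/-- The spinorial Laplacian `Δ_h = D^i D_i = h^{ij} D_j D_i`. -/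
def spinLaplacian (h e : Space → Matrix (Fin 3) (Fin 3) ℝ) (v : Space → Spinor)
    (x : Space) : Spinor :=
  ∑ i, ∑ j, hInv h i j x • covDForm h e j i (fun k => covD h e k v) x

/-- `D̃^i Ψ_k = ∂^i Ψ_k - Γ^{l i}_k Ψ_l = h^{ij} (∂_j Ψ_k - Γ^l_{jk} Ψ_l)`. -/
def scalarCovUp (h : Space → Matrix (Fin 3) (Fin 3) ℝ) (i k : Fin 3)
    (Ψ : Fin 3 → Space → Spinor) (x : Space) : Spinor :=
  ∑ j, hInv h i j x • (pd j (Ψ k) x - ∑ l, christoffel h l j k x • Ψ l x)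

/-- The spatial part `m² - Δ_h + ¼ R_h` of the spinorial Klein–Gordon operator. -/
def kgSpatial (h e : Space → Matrix (Fin 3) (Fin 3) ℝ) (m : ℝ) (v : Space → Spinor)
    (x : Space) : Spinor :=
  m ^ 2 • v x - spinLaplacian h e v x + (1 / 4 * scalarCurvature h x) • v x

/-! ### Classical solutions -/

/-- `u` is of class `C²` on `[0,∞) × ℝ³` (derivatives at `t = 0` are one-sided) and satisfies
`i ∂_t u - D_m u = 0`, `u(0) = u₀`. -/
structure IsClassicalDiracSolution (h e : Space → Matrix (Fin 3) (Fin 3) ℝ) (m : ℝ)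
    (u₀ : Space → Spinor) (u : ℝ → Space → Spinor) : Prop where
  regular : ContDiffOn ℝ 2 (Function.uncurry u) (Ici 0 ×ˢ univ)
  equation : ∀ t, 0 ≤ t → ∀ x,
    Complex.I • derivWithin (fun s => u s x) (Ici 0) t - dirac h e m (u t) x = 0
  initial : u 0 = u₀

/-- `u` is of class `C²` on `[0,∞) × ℝ³` and satisfies
`∂_t² u + m² u - Δ_h u + ¼ R_h u = 0`, `u(0) = u₀`, `∂_t u(0) = u₁`. -/
structure IsClassicalKGSolution (h e : Space → Matrix (Fin 3) (Fin 3) ℝ) (m : ℝ)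
    (u₀ u₁ : Space → Spinor) (u : ℝ → Space → Spinor) : Prop where
  regular : ContDiffOn ℝ 2 (Function.uncurry u) (Ici 0 ×ˢ univ)
  equation : ∀ t, 0 ≤ t → ∀ x,
    iteratedDerivWithin 2 (fun s => u s x) (Ici 0) t + kgSpatial h e m (u t) x = 0
  initial : u 0 = u₀
  initial_velocity : ∀ x, derivWithin (fun s => u s x) (Ici 0) 0 = u₁ x

/-! ### Weak solutions

The operators `D_m` and `m² - Δ_h + ¼ R_h` are formally self-adjoint for the pairing
`∫ ⟨φ, ψ⟩ √(det h) dx`, so in the distributional formulations they fall unchanged on the test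
field. Test fields do not have to vanish at `t = 0`; this encodes the initial data. -/

/-- Space-time test spinors: smooth and compactly supported in `ℝ × ℝ³`. -/
structure IsTestField (φ : ℝ → Space → Spinor) : Prop where
  smooth : ContDiff ℝ ∞ (Function.uncurry φ)
  compact : HasCompactSupport (Function.uncurry φ)

/-- `D_m u₀ = f` in the sense of distributions on `ℝ³`. -/
def IsWeakDirac (h e : Space → Matrix (Fin 3) (Fin 3) ℝ) (m : ℝ)
    (u₀ f : Space → Spinor) : Prop :=
  ∀ φ : Space → Spinor, ContDiff ℝ ∞ φ → HasCompactSupport φ →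
    ∫ x, inner ℂ (dirac h e m φ x) (u₀ x) ∂(riemVol h) = ∫ x, inner ℂ (φ x) (f x) ∂(riemVol h)

/-- `u` is a weak solution of `i ∂_t u - D_m u = 0` on `(0,∞) × ℝ³` with `u(0) = u₀`, where
`u₀ ∈ L²(M_h)` and `u ∈ L²((0,T); L²(M_h))` for every `T`. -/
structure IsWeakDiracSolution (h e : Space → Matrix (Fin 3) (Fin 3) ℝ) (m : ℝ)
    (u₀ : Space → Spinor) (u : ℝ → Space → Spinor) : Prop where
  memLp_initial : MemLp u₀ 2 (riemVol h)
  memLp : ∀ T : ℝ, 0 < T → MemLp (Function.uncurry u) 2 (spacetimeVol h (Ioo 0 T))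
  equation : ∀ φ, IsTestField φ →
    ∫ p, inner ℂ (Complex.I • deriv (fun s => φ s p.2) p.1 - dirac h e m (φ p.1) p.2)
        (u p.1 p.2) ∂(spacetimeVol h (Ioi 0))
      = Complex.I * ∫ x, inner ℂ (φ 0 x) (u₀ x) ∂(riemVol h)

/-- `u` is a weak solution on `(0,∞) × ℝ³` of
`∂_t² u + m² u - Δ_h u + ¼ R_h u = 0`, `u(0) = u₀`, `∂_t u(0) = -i D_m u₀`, where `D_m u₀` is
understood as a distribution. -/
def IsWeakKGSolution (h e : Space → Matrix (Fin 3) (Fin 3) ℝ) (m : ℝ)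
    (u₀ : Space → Spinor) (u : ℝ → Space → Spinor) : Prop :=
  ∀ φ, IsTestField φ →
    ∫ p, inner ℂ (iteratedDeriv 2 (fun s => φ s p.2) p.1 + kgSpatial h e m (φ p.1) p.2)
        (u p.1 p.2) ∂(spacetimeVol h (Ioi 0))
      = -(Complex.I * ∫ x, inner ℂ (dirac h e m (φ 0) x) (u₀ x) ∂(riemVol h))
        - ∫ x, inner ℂ (deriv (fun s => φ s x) 0) (u₀ x) ∂(riemVol h)

/-- `w` is the spatial gradient `(∂_1 u, ∂_2 u, ∂_3 u)` of `u` in the sense of distributions on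
`(0,∞) × ℝ³`. -/
structure IsWeakGradient (u : ℝ → Space → Spinor) (w : Fin 3 → ℝ → Space → Spinor) : Prop where
  locallyIntegrable : ∀ i,
    LocallyIntegrableOn (Function.uncurry (w i)) (Ioi (0 : ℝ) ×ˢ (univ : Set Space))
  byParts : ∀ i φ, IsTestField φ →
    tsupport (Function.uncurry φ) ⊆ Ioi (0 : ℝ) ×ˢ (univ : Set Space) →
    ∫ p : ℝ × Space, inner ℂ (pd i (φ p.1) p.2) (u p.1 p.2)
      = -∫ p : ℝ × Space, inner ℂ (φ p.1 p.2) (w i p.1 p.2)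

/-! ### Norms -/

/-- The pointwise norm `(h^{ij} ⟨w_i, w_j⟩)^{1/2}` of a spinor-valued one-form. -/
def formNorm (h : Space → Matrix (Fin 3) (Fin 3) ℝ) (w : Fin 3 → Spinor) (x : Space) : ℝ :=
  Real.sqrt (∑ i, ∑ j, hInv h i j x * (inner ℂ (w i) (w j)).re)

/-- `‖⟨x⟩^{-s} u‖_{L²_t L²(M_h)}` with `t ∈ (0,∞)`. -/
def weightedNorm (h : Space → Matrix (Fin 3) (Fin 3) ℝ) (s : ℝ)
    (u : ℝ → Space → Spinor) : ℝ≥0∞ :=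
  eLpNorm (fun p : ℝ × Space => bracket p.2 ^ (-s) • u p.1 p.2) 2 (spacetimeVol h (Ioi 0))

/-- `‖⟨x⟩^{-s} w‖_{L²_t L²(M_h)}` with `t ∈ (0,∞)`, for a spinor-valued one-form `w`. -/
def weightedFormNorm (h : Space → Matrix (Fin 3) (Fin 3) ℝ) (s : ℝ)
    (w : Fin 3 → ℝ → Space → Spinor) : ℝ≥0∞ :=
  eLpNorm (fun p : ℝ × Space => bracket p.2 ^ (-s) * formNorm h (fun i => w i p.1 p.2) p.2) 2
    (spacetimeVol h (Ioi 0))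

end CurvedDirac

end

open Filter Topology
open scoped RealInnerProductSpace Convolution
open Function (uncurry)
open EuclideanSpace (single)
open Finset (sum_congr sum_comm mul_sum sum_mul sum_add_distrib sum_sub_distrib sum_neg_distrib smul_sum sum_nonneg sum_le_sum sum_smul single_le_sum)
noncomputable section
namespace CurvedDirac
set_option linter.unusedSectionVars false
local notation "𝔳" => volDensity
local notation "Γ" => christoffel
local notation:max "𝔯" h:max => riemVol h
local notation:max "𝔪" h:max => spacetimeVol h (Ioi 0)
local notation:max "𝔫" h:max T:max => spacetimeVol h (Ioo 0 T)
local notation "DiffAt" => DifferentiableAt ℝ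
local notation "Diff" => Differentiable ℝ
local notation "𝒞" => ContDiff ℝ
abbrev MatField := Space → Matrix (Fin 3) (Fin 3) ℝ
variable {h e : MatField} {F : Type*} [NormedAddCommGroup F] [InnerProductSpace ℝ F] {κ m s : ℝ} {φ ψ : Space → F} (hh : IsMetric h)
  (he : IsDreibein h e) (hs : 1 ≤ s)

lemma sum_ext {ι M : Type*} [Fintype ι] [AddCommMonoid M] {f g : ι → M} (h : ∀ i, f i = g i) :
    ∑ i, f i = ∑ i, g i := sum_congr rfl fun i _ => h i

instance : NeZero (∞ : WithTop ℕ∞) := ⟨by simp⟩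

lemma _root_.ContDiff.diff {E G : Type*} [NormedAddCommGroup E] [NormedSpace ℝ E] [NormedAddCommGroup G] [NormedSpace ℝ G]
    {f : E → G} {n : WithTop ℕ∞} [hn : NeZero n] (hf : 𝒞 n f) : Diff f := hf.differentiable hn.out

lemma off_tsupport {X M : Type*} [TopologicalSpace X] [Zero M] {f : X → M} {x : X} (hx : x ∉ tsupport f) :
    f x = 0 := image_eq_zero_of_notMem_tsupport hx


/-- A representation of the Dirac algebra on a real inner product space: the operators `α_a`,
`β` and the complex structure. -/
structure CliffordRep (F : Type*) [NormedAddCommGroup F] [InnerProductSpace ℝ F] where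
  al : Fin 3 → F →L[ℝ] F
  bt : F →L[ℝ] F
  J : F →L[ℝ] F
  anticomm : ∀ a b, al a * al b + al b * al a = (if a = b then (2:ℝ) else 0) • 1
  bt_al : ∀ a, bt * al a = -(al a * bt)
  bt_sq : bt * bt = 1
  J_sq : J * J = -1
  J_al : ∀ a, J * al a = al a * J
  J_bt : J * bt = bt * J
  inner_al : ∀ a v w, ⟪al a v, w⟫ = ⟪v, al a w⟫
  inner_bt : ∀ v w, ⟪bt v, w⟫ = ⟪v, bt w⟫
  inner_J : ∀ v w, ⟪J v, w⟫ = - ⟪v, J w⟫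

variable (c : CliffordRep F)

namespace CliffordRep

/-- The generators `⅛ [γ_a, γ_b]` of the spin representation. -/
def sgen (a b : Fin 3) : F →L[ℝ] F := (-(1 / 8 : ℝ)) • (c.al a * c.al b - c.al b * c.al a)

lemma bt_sgen (a b : Fin 3) : c.bt * c.sgen a b = c.sgen a b * c.bt := by
  have : ∀ a b, c.bt * (c.al a * c.al b) = c.al a * c.al b * c.bt := by
    intro a b; rw [← mul_assoc, c.bt_al, neg_mul, mul_assoc, c.bt_al, mul_neg, neg_neg, mul_assoc]
  rw [sgen, mul_smul_comm, smul_mul_assoc, mul_sub, sub_mul, this, this]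

lemma J_sgen (a b : Fin 3) : c.J * c.sgen a b = c.sgen a b * c.J := by
  have : ∀ a b, c.J * (c.al a * c.al b) = c.al a * c.al b * c.J := by intro a b; rw [← mul_assoc, c.J_al, mul_assoc, c.J_al, mul_assoc]
  rw [sgen, mul_smul_comm, smul_mul_assoc, mul_sub, sub_mul, this, this]

lemma inner_sgen (a b : Fin 3) (v w : F) : ⟪c.sgen a b v, w⟫ = - ⟪v, c.sgen a b w⟫ := by
  simp only [sgen, smul_apply, sub_apply, mul_apply_eq_comp, inner_smul_left, inner_smul_right, inner_sub_left, inner_sub_right, c.inner_al]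
  simp; ring

lemma sgen_al (a b d : Fin 3) : c.sgen a b * c.al d - c.al d * c.sgen a b
      = (-(1 / 2 : ℝ)) • ((if b = d then (1:ℝ) else 0) • c.al a - (if a = d then (1:ℝ) else 0) • c.al b) := by
  have key : ∀ a b, c.al a * c.al b * c.al d - c.al d * (c.al a * c.al b)
      = (if b = d then (2:ℝ) else 0) • c.al a - (if a = d then (2:ℝ) else 0) • c.al b := by
    intro a b; have h1 := congrArg (fun x => c.al a * x) (c.anticomm b d); have h2 := congrArg (fun x => x * c.al b) (c.anticomm a d)
    simp only [mul_smul_comm, smul_mul_assoc, mul_one, one_mul] at h1 h2; rw [← h1, ← h2]; noncomm_ring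
  have : c.sgen a b * c.al d - c.al d * c.sgen a b = (-(1 / 8 : ℝ)) • ((c.al a * c.al b * c.al d - c.al d * (c.al a * c.al b))
        - (c.al b * c.al a * c.al d - c.al d * (c.al b * c.al a))) := by
    rw [sgen, smul_mul_assoc, mul_smul_comm, ← smul_sub]; congr 1; noncomm_ring
  rw [this, key, key]
  split_ifs <;> module

lemma sgen_comm (a b d f : Fin 3) : c.sgen a b * c.sgen d f - c.sgen d f * c.sgen a b = (-(1 / 2 : ℝ)) •
      ((if b = d then (1:ℝ) else 0) • c.sgen a f - (if a = d then (1:ℝ) else 0) • c.sgen b f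
        + (if b = f then (1:ℝ) else 0) • c.sgen d a - (if a = f then (1:ℝ) else 0) • c.sgen d b) := by
  have h := fun d => c.sgen_al a b d
  have key : ∀ d f, c.sgen a b * (c.al d * c.al f) - c.al d * c.al f * c.sgen a b
      = (c.sgen a b * c.al d - c.al d * c.sgen a b) * c.al f + c.al d * (c.sgen a b * c.al f - c.al f * c.sgen a b) := by
    intro d f; noncomm_ring
  have : c.sgen a b * c.sgen d f - c.sgen d f * c.sgen a b = (-(1 / 8 : ℝ)) •
      ((c.sgen a b * (c.al d * c.al f) - c.al d * c.al f * c.sgen a b) -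
        (c.sgen a b * (c.al f * c.al d) - c.al f * c.al d * c.sgen a b)) := by
    conv_lhs => rw [sgen.eq_1 c d f]
    rw [smul_mul_assoc, mul_smul_comm, ← smul_sub]; congr 1; noncomm_ring
  rw [this, key, key, h, h]; simp only [sgen, smul_mul_assoc, mul_smul_comm, sub_mul, mul_sub]; module

lemma sum_al_sgen (a b : Fin 3) : ∑ d, c.al d * (c.sgen a b * c.al d - c.al d * c.sgen a b) = (-4 : ℝ) • c.sgen a b := by
  simp only [sgen_al, mul_smul_comm, mul_sub, sum_sub_distrib, ← smul_sum]
  simp only [ite_smul, one_smul, zero_smul, Finset.sum_ite_eq, Finset.mem_univ, if_true]; rw [sgen]; module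

lemma al_sq (a : Fin 3) : c.al a * c.al a = 1 := by
  have := c.anticomm a a; simp only [if_true, ← two_smul ℝ (c.al a * c.al a)] at this; exact smul_right_injective _ (two_ne_zero' ℝ) this

lemma al_ne {a b : Fin 3} (h : a ≠ b) : c.al b * c.al a = -(c.al a * c.al b) := by
  have := c.anticomm a b; simp only [h, if_false, zero_smul] at this; exact (neg_eq_of_add_eq_zero_right this).symm

/-- The Clifford contraction of a curvature-like tensor. -/
lemma sum_curvature (R : Fin 3 → Fin 3 → Fin 3 → Fin 3 → ℝ)
    (h1 : ∀ a b d f, R a b d f = - R b a d f) (h2 : ∀ a b d f, R a b d f = - R a b f d)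
    (h3 : ∀ a b d f, R a b d f + R a d f b + R a f b d = 0) :
    ∑ a, ∑ b, ∑ d, ∑ f, R a b d f • (c.al d * c.al f * (c.al a * c.al b)) = (-2 * ∑ a, ∑ b, R a b a b) • 1 := by
  have s1 : ∀ a d f, R a a d f = 0 := fun a d f => by linarith [h1 a a d f]
  have s2 : ∀ a b d, R a b d d = 0 := fun a b d => by linarith [h2 a b d d]
  have hs : ∀ a b d f, R a b d f = R d f a b := by
    intro a b d f
    linarith [h3 a b d f, h3 b d f a, h3 d f a b, h3 f a b d, h1 a b d f, h1 b d f a,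
      h1 a d f b, h1 a f b d, h2 a b d f, h2 a d f b, h2 a f b d, h1 d f a b, h1 d a b f, h1 d b f a,
      h2 d f a b, h2 d a b f, h2 d b f a, h1 b d f a, h1 b f a d, h1 b a d f, h2 b d f a, h2 b f a d,
      h2 b a d f, h1 f a b d, h1 f b d a, h1 f d a b, h2 f a b d, h2 f b d a, h2 f d a b]
  have b : ∀ i j : Fin 3, j ≠ i → ∀ x, c.al i * (c.al j * x) = -(c.al j * (c.al i * x)) := fun i j h x => by
    rw [← mul_assoc, c.al_ne h, neg_mul, mul_assoc]
  have q : ∀ a x, c.al a * (c.al a * x) = x := fun a x => by rw [← mul_assoc, c.al_sq, one_mul]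
  simp only [Fin.sum_univ_three, s1, s2, h1 1 0, h1 2, fun a b => h2 a b 1 0, fun a b => h2 a b 2, zero_smul, zero_add, add_zero,
    mul_assoc, c.al_ne zero_ne_one, c.al_ne (a := 0) (b := 2) (by decide), c.al_ne (a := 1) (b := 2) (by decide),
    b 1 0 (by decide), b 2 0 (by decide), b 2 1 (by decide), q, c.al_sq, mul_neg, neg_neg]
  rw [hs 0 2 0 1, hs 1 2 0 1, hs 1 2 0 2]; module

end CliffordRep

section Calculus

variable {F G : Type*} [NormedAddCommGroup F] [NormedSpace ℝ F] [NormedAddCommGroup G] [NormedSpace ℝ G]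

lemma ContDiff.pd {n m : WithTop ℕ∞} {f : Space → F} (hf : 𝒞 n f) (hmn : m + 1 ≤ n) (i : Fin 3) : 𝒞 m (pd i f) :=
  (hf.fderiv_right hmn).clm_apply contDiff_const

lemma ContDiff.pd_infty {f : Space → F} (hf : 𝒞 ∞ f) (i : Fin 3) : 𝒞 ∞ (CurvedDirac.pd i f) := ContDiff.pd hf (by simp) i

lemma pd_add {f g : Space → F} {x : Space} (hf : DiffAt f x) (hg : DiffAt g x) (i : Fin 3) :
    pd i (fun y => f y + g y) x = pd i f x + pd i g x := by
  simp [pd, fderiv_fun_add hf hg]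

lemma pd_sub {f g : Space → F} {x : Space} (hf : DiffAt f x) (hg : DiffAt g x) (i : Fin 3) :
    pd i (fun y => f y - g y) x = pd i f x - pd i g x := by
  simp [pd, fderiv_fun_sub hf hg]

lemma pd_neg {f : Space → F} {x : Space} (i : Fin 3) : pd i (fun y => - f y) x = - pd i f x := by simp [pd, fderiv_fun_neg]

lemma pd_const (c : F) (i : Fin 3) (x : Space) : pd i (fun _ => c) x = 0 := by simp [pd]

lemma pd_sum {ι : Type*} {s : Finset ι} {f : ι → Space → F} {x : Space} (hf : ∀ k ∈ s, DiffAt (f k) x) (i : Fin 3) :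
    pd i (fun y => ∑ k ∈ s, f k y) x = ∑ k ∈ s, pd i (f k) x := by
  simp only [pd]; rw [fderiv_fun_sum hf]; simp

lemma pd_smul {f : Space → ℝ} {g : Space → F} {x : Space} (hf : DiffAt f x) (hg : DiffAt g x) (i : Fin 3) :
    pd i (fun y => f y • g y) x = pd i f x • g x + f x • pd i g x := by
  simp [pd, fderiv_fun_smul hf hg, add_comm]

lemma pd_smul_const {f : Space → ℝ} {x : Space} (hf : DiffAt f x) (g : F) (i : Fin 3) : pd i (fun y => f y • g) x = pd i f x • g := by
  rw [pd_smul hf (differentiableAt_const g), pd_const, smul_zero, add_zero]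

lemma pd_mul {f g : Space → ℝ} {x : Space} (hf : DiffAt f x) (hg : DiffAt g x) (i : Fin 3) :
    pd i (fun y => f y * g y) x = pd i f x * g x + f x * pd i g x :=
  pd_smul hf hg i

lemma pd_const_mul {g : Space → ℝ} {x : Space} (a : ℝ) (hg : DiffAt g x) (i : Fin 3) : pd i (fun y => a * g y) x = a * pd i g x := by
  rw [pd_mul (differentiableAt_const a) hg, pd_const, zero_mul, zero_add]

lemma pd_comp_mul {f g : Space → F →L[ℝ] F} {x : Space} (hf : DiffAt f x) (hg : DiffAt g x) (i : Fin 3) :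
    pd i (fun y => f y * g y) x = pd i f x * g x + f x * pd i g x := by
  simp only [pd, ContinuousLinearMap.mul_def]; rw [(hf.hasFDerivAt.clm_comp hg.hasFDerivAt).fderiv]; simp [add_comm]

lemma pd_clm_apply {f : Space → F →L[ℝ] G} {g : Space → F} {x : Space} (hf : DiffAt f x) (hg : DiffAt g x) (i : Fin 3) :
    pd i (fun y => f y (g y)) x = pd i f x (g x) + f x (pd i g x) := by
  simp only [pd]; rw [(hf.hasFDerivAt.clm_apply hg.hasFDerivAt).fderiv]; simp [add_comm]

lemma pd_const_clm {g : Space → F} {x : Space} (T : F →L[ℝ] G) (hg : DiffAt g x) (i : Fin 3) :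
    pd i (fun y => T (g y)) x = T (pd i g x) := by
  rw [pd_clm_apply (differentiableAt_const T) hg, pd_const]; simp

lemma pd_inner {F : Type*} [NormedAddCommGroup F] [InnerProductSpace ℝ F] {f g : Space → F}
    {x : Space} (hf : DiffAt f x) (hg : DiffAt g x) (i : Fin 3) :
    pd i (fun y => ⟪f y, g y⟫) x = ⟪pd i f x, g x⟫ + ⟪f x, pd i g x⟫ := by
  simp only [pd]; rw [fderiv_inner_apply ℝ hf hg, add_comm]

lemma pd_pd_comm {f : Space → F} (hf : 𝒞 2 f) (i j : Fin 3) (x : Space) : pd i (pd j f) x = pd j (pd i f) x := by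
  have h1 : Diff (fderiv ℝ f) := (hf.fderiv_right (m := 1) (by norm_num)).diff
  have key : ∀ i j, pd i (pd j f) x = fderiv ℝ (fderiv ℝ f) x (single i 1) (single j 1) := by
    intro i j; change fderiv ℝ (fun y => fderiv ℝ f y (single j 1)) x _ = _; rw [fderiv_clm_apply (h1 x) (differentiableAt_const _)]; simp
  rw [key, key]; exact (hf.contDiffAt.isSymmSndFDerivAt (by simp)).eq _ _

end Calculus

/-! ### Identities for the metric -/

namespace IsMetric

include hh

lemma symm (i j : Fin 3) (x : Space) : h x i j = h x j i := by have := (hh.posDef x).isHermitian.apply i j; simpa using this.symm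

lemma det_pos (x : Space) : 0 < (h x).det := (hh.posDef x).det_pos

lemma hInv_symm (i j : Fin 3) (x : Space) : hInv h i j x = hInv h j i x := by
  have := ((hh.posDef x).isHermitian.inv).apply i j; simpa [hInv] using this.symm

lemma sum_hInv_mul (i j : Fin 3) (x : Space) : ∑ l, hInv h i l x * h x l j = if i = j then 1 else 0 := by
  have : (h x)⁻¹ * h x = 1 := Matrix.nonsing_inv_mul _ (hh.det_pos x).ne'.isUnit; have := congrFun (congrFun this i) j
  simpa [Matrix.mul_apply, Matrix.one_apply, hInv] using this

lemma sum_mul_hInv (i j : Fin 3) (x : Space) : ∑ l, h x i l * hInv h l j x = if i = j then 1 else 0 := by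
  have : h x * (h x)⁻¹ = 1 := Matrix.mul_nonsing_inv _ (hh.det_pos x).ne'.isUnit; have := congrFun (congrFun this i) j
  simpa [Matrix.mul_apply, Matrix.one_apply, hInv] using this

lemma contDiff_det : 𝒞 ∞ (fun x => (h x).det) := by have := hh.smooth; simp only [Matrix.det_fin_three]; fun_prop

lemma contDiff_hInv (i j : Fin 3) : 𝒞 ∞ (hInv h i j) := by
  have hd := hh.contDiff_det; have h1 := hh.smooth
  have : hInv h i j = fun x => (h x).det⁻¹ * (h x).adjugate i j := by funext x; simp [hInv, Matrix.inv_def]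
  rw [this]; refine (hd.inv fun x => (hh.det_pos x).ne').mul ?_; simp only [Matrix.adjugate_fin_three]
  fin_cases i <;> fin_cases j <;> simp <;> fun_prop

lemma volDensity_pos (x : Space) : 0 < 𝔳 h x := Real.sqrt_pos.2 (hh.det_pos x)

lemma contDiff_volDensity : 𝒞 ∞ (𝔳 h) := hh.contDiff_det.sqrt fun x => (hh.det_pos x).ne'

lemma contDiff_christoffel (i j k : Fin 3) : 𝒞 ∞ (Γ h i j k) := by
  refine contDiff_const.mul (ContDiff.sum fun l _ => (hh.contDiff_hInv i l).mul ?_)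
  exact ((ContDiff.pd_infty (hh.smooth l k) j).add (ContDiff.pd_infty (hh.smooth j l) k)).sub (ContDiff.pd_infty (hh.smooth j k) l)

lemma pd_symm (i j k : Fin 3) (x : Space) : pd k (fun y => h y i j) x = pd k (fun y => h y j i) x := by
  congr 1; funext y; exact hh.symm i j y

lemma christoffel_symm (i j k : Fin 3) (x : Space) : Γ h i j k x = Γ h i k j x := by
  simp only [christoffel]; congr 1; refine sum_ext fun l => ?_; rw [hh.pd_symm l k j, hh.pd_symm j l k, hh.pd_symm j k l]; ring

lemma sum_mul_christoffel (m j k : Fin 3) (x : Space) : ∑ i, h x m i * Γ h i j k x =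
      (1 / 2) * (pd j (fun y => h y m k) x + pd k (fun y => h y j m) x - pd m (fun y => h y j k) x) := by
  simp only [christoffel, mul_left_comm _ (1 / 2 : ℝ), ← mul_sum]; congr 1; simp only [mul_sum, ← mul_assoc]
  rw [sum_comm]; simp only [← sum_mul, hh.sum_mul_hInv]; simp

lemma pd_metric (i j k : Fin 3) (x : Space) : pd i (fun y => h y j k) x = ∑ l, (h x j l * Γ h l i k x + h x k l * Γ h l i j x) := by
  rw [sum_add_distrib, hh.sum_mul_christoffel, hh.sum_mul_christoffel, hh.pd_symm k j i, hh.pd_symm i j k, hh.pd_symm i k j]; ring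

lemma diff (i j : Fin 3) : Diff (fun x => h x i j) := (hh.smooth i j).diff
lemma diff_hInv (i j : Fin 3) : Diff (hInv h i j) := (hh.contDiff_hInv i j).diff
lemma contDiff_inv_vol : 𝒞 ∞ fun x => (𝔳 h x)⁻¹ := hh.contDiff_volDensity.inv fun x => (hh.volDensity_pos x).ne'

lemma diff_vol : Diff (𝔳 h) := hh.contDiff_volDensity.diff
lemma diff_christoffel (i j k : Fin 3) : Diff (Γ h i j k) := (hh.contDiff_christoffel i j k).diff

lemma pd_hInv_aux (i j k : Fin 3) (x : Space) :
    pd i (hInv h j k) x = - ∑ a, ∑ b, hInv h j a x * pd i (fun y => h y a b) x * hInv h b k x := by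
  have key : ∀ b, ∑ a, (pd i (hInv h j a) x * h x a b + hInv h j a x * pd i (fun y => h y a b) x) = 0 := by
    intro b
    have h1 : (fun y => ∑ a, hInv h j a y * h y a b) = fun _ => if j = b then (1:ℝ) else 0 := by funext y; exact hh.sum_hInv_mul j b y
    have h2 := congrArg (fun f => pd i f x) h1; simp only [pd_const] at h2
    rw [pd_sum (fun a _ => ((hh.diff_hInv j a).fun_mul (hh.diff a b)) x)] at h2; rw [← h2]; refine sum_ext fun a => ?_
    exact (pd_mul (hh.diff_hInv j a x) (hh.diff a b x) i).symm
  have h3 : ∑ b, (∑ a, (pd i (hInv h j a) x * h x a b + hInv h j a x * pd i (fun y => h y a b) x)) * hInv h b k x = 0 := by simp [key]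
  have h4 : ∑ b, (∑ a, pd i (hInv h j a) x * h x a b) * hInv h b k x = pd i (hInv h j k) x := by
    simp only [sum_mul, mul_assoc]; rw [sum_comm]; simp only [← mul_sum, hh.sum_mul_hInv]; simp
  simp only [sum_add_distrib, add_mul] at h3; rw [h4] at h3; rw [sum_comm]; simp only [sum_mul] at h3; linarith

lemma pd_hInv (i j k : Fin 3) (x : Space) : pd i (hInv h j k) x = - ∑ l, (Γ h j i l x * hInv h l k x + Γ h k i l x * hInv h j l x) := by
  rw [hh.pd_hInv_aux]; congr 1; simp only [hh.pd_metric, sum_add_distrib, mul_add, add_mul]; congr 1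
  · rw [sum_comm]; refine sum_ext fun b => ?_; rw [← sum_mul]; simp only [mul_sum, ← mul_assoc]; rw [sum_comm]
    simp only [← sum_mul, hh.sum_hInv_mul]; simp
  · refine sum_ext fun a => ?_; simp only [mul_sum, sum_mul]; rw [sum_comm]
    have : ∀ l, ∑ b, hInv h j a x * (h x b l * Γ h l i a x) * hInv h b k x = (if l = k then 1 else 0) * (Γ h l i a x * hInv h j a x) := by
      intro l; rw [← hh.sum_mul_hInv l k x, sum_mul]; exact sum_ext fun b => by rw [hh.symm b l]; ring
    simp [this]

lemma sum_christoffel (k : Fin 3) (x : Space) : ∑ i, Γ h i i k x = (1 / 2) * ∑ i, ∑ l, hInv h i l x * pd k (fun y => h y i l) x := by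
  simp only [christoffel, ← mul_sum]; congr 1; simp only [mul_add, mul_sub, sum_add_distrib, sum_sub_distrib]
  have : ∑ i, ∑ l, hInv h i l x * pd l (fun y => h y i k) x = ∑ i, ∑ l, hInv h i l x * pd i (fun y => h y l k) x := by
    rw [sum_comm]; refine sum_ext fun l => sum_ext fun i => ?_; rw [hh.hInv_symm]
  rw [this]; ring

lemma pd_det (k : Fin 3) (x : Space) : pd k (fun y => (h y).det) x = (h x).det * ∑ i, ∑ l, hInv h i l x * pd k (fun y => h y i l) x := by
  have hs := hh.diff
  have key : ∀ i j, (h x).det * hInv h i j x = (h x).adjugate i j := by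
    intro i j
    simp only [hInv, Matrix.inv_def, Matrix.smul_apply, smul_eq_mul, ← mul_assoc,
      Ring.inverse_eq_inv', mul_inv_cancel₀ (hh.det_pos x).ne', one_mul]
  have e1 : (h x).det * ∑ i, ∑ l, hInv h i l x * pd k (fun y => h y i l) x = ∑ i, ∑ l, (h x).adjugate i l * pd k (fun y => h y l i) x := by
    simp only [mul_sum, ← mul_assoc, key]; refine sum_ext fun i => sum_ext fun l => ?_; rw [hh.pd_symm i l]
  rw [e1]; simp only [Matrix.det_fin_three]
  have d3 : ∀ a b c d e f, pd k (fun y => h y a b * h y c d * h y e f) x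
      = (pd k (fun y => h y a b) x * h x c d + h x a b * pd k (fun y => h y c d) x) * h x e f
        + h x a b * h x c d * pd k (fun y => h y e f) x := by
    intro a b c d e f; rw [pd_mul (((hs a b).fun_mul (hs c d)) x) (hs e f x), pd_mul (hs a b x) (hs c d x)]
  have dd : ∀ a b c d e f, DiffAt (fun y => h y a b * h y c d * h y e f) x := fun a b c d e f =>
    ((((hs a b).fun_mul (hs c d))).fun_mul (hs e f)) x
  rw [pd_sub (by fun_prop) (by fun_prop), pd_add (by fun_prop) (by fun_prop), pd_add (by fun_prop) (by fun_prop),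
    pd_sub (by fun_prop) (by fun_prop), pd_sub (by fun_prop) (by fun_prop)]
  simp only [d3, Matrix.adjugate_fin_three, Fin.sum_univ_three]; simp; ring

lemma pd_vol (k : Fin 3) (x : Space) : pd k (𝔳 h) x = 𝔳 h x * ∑ i, Γ h i i k x := by
  have hsq : (fun y => 𝔳 h y * 𝔳 h y) = fun y => (h y).det := by funext y; exact Real.mul_self_sqrt (hh.det_pos y).le
  have h1 := congrArg (fun f => pd k f x) hsq; simp only [hh.pd_det] at h1
  rw [pd_mul (hh.diff_vol x) (hh.diff_vol x), ← congrFun hsq x] at h1; rw [hh.sum_christoffel]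
  have hp := (hh.volDensity_pos x).ne'; apply mul_left_cancel₀ hp; linarith

end IsMetric

/-! ### Dreibein -/

namespace IsDreibein

include hh he

lemma coframe_mul_eq (x : Space) : ((e x).transpose * h x) * e x = 1 := by
  have h0 : e x * (e x).transpose = (h x)⁻¹ := by ext i j; simpa [Matrix.mul_apply, hInv] using (he.frame x i j).symm
  have h1 : e x * ((e x).transpose * h x) = 1 := by rw [← mul_assoc, h0]; exact Matrix.nonsing_inv_mul _ (hh.det_pos x).ne'.isUnit
  exact mul_eq_one_comm.1 h1

lemma inv_eq (x : Space) : (e x)⁻¹ = (e x).transpose * h x := Matrix.inv_eq_left_inv (he.coframe_mul_eq hh x)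

lemma coframe_eq (i a : Fin 3) (x : Space) : coframe e i a x = ∑ j, e x j a * h x j i := by simp [coframe, he.inv_eq hh, Matrix.mul_apply]

lemma sum_coframe_mul (a b : Fin 3) (x : Space) : ∑ i, coframe e i a x * e x i b = if a = b then 1 else 0 := by
  have := congrFun (congrFun (he.coframe_mul_eq hh x) a) b; rw [← he.inv_eq hh] at this
  simpa [Matrix.mul_apply, Matrix.one_apply, coframe] using this

lemma sum_mul_coframe (i j : Fin 3) (x : Space) : ∑ a, e x i a * coframe e j a x = if i = j then 1 else 0 := by
  have := congrFun (congrFun (show e x * ((e x).transpose * h x) = 1 from mul_eq_one_comm.1 (he.coframe_mul_eq hh x)) i) j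
  rw [← he.inv_eq hh] at this; simpa [Matrix.mul_apply, Matrix.one_apply, coframe] using this

lemma contDiff_coframe (i a : Fin 3) : 𝒞 ∞ (coframe e i a) := by
  have : coframe e i a = fun x => ∑ j, e x j a * h x j i := by funext x; exact he.coframe_eq hh i a x
  rw [this]; exact ContDiff.sum fun j _ => (he.smooth j a).mul (hh.smooth j i)

omit hh in
lemma diff (i a : Fin 3) : Diff (fun x => e x i a) := (he.smooth i a).diff

lemma contDiff_spinConnection (j a b : Fin 3) : 𝒞 ∞ (spinConnection h e j a b) := by
  refine (ContDiff.sum fun i _ => (he.contDiff_coframe hh i a).mul (ContDiff.pd_infty (he.smooth i b).neg j)).add ?_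
  exact ContDiff.sum fun i _ => ContDiff.sum fun k _ =>
    ((he.contDiff_coframe hh i a).mul (hh.contDiff_christoffel i j k)).mul (he.smooth k b).neg

omit hh he in
lemma spinConnection_eq (j a b : Fin 3) (x : Space) : spinConnection h e j a b x = - ∑ i, coframe e i a x *
      (pd j (fun y => e y i b) x + ∑ k, Γ h i j k x * e x k b) := by
  simp only [spinConnection, frameUp, mul_add, sum_add_distrib, neg_add, mul_sum]; congr 1
  · rw [← sum_neg_distrib]; refine sum_ext fun i => ?_; have : pd j (frameUp e i b) x = - pd j (fun y => e y i b) x := pd_neg j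
    rw [this, mul_neg]
  · simp only [← sum_neg_distrib]; exact sum_ext fun i => sum_ext fun k => by ring

lemma sum_frame_spinConnection (j i b : Fin 3) (x : Space) : ∑ a, e x i a * spinConnection h e j a b x
      = - (pd j (fun y => e y i b) x + ∑ k, Γ h i j k x * e x k b) := by
  simp only [spinConnection_eq, mul_neg, sum_neg_distrib, mul_sum, ← mul_assoc]; rw [sum_comm]
  simp only [← sum_mul, he.sum_mul_coframe hh]; simp

lemma spinConnection_antisymm (j a b : Fin 3) (x : Space) : spinConnection h e j a b x = - spinConnection h e j b a x := by
  set N : Matrix (Fin 3) (Fin 3) ℝ := Matrix.of fun i b => pd j (fun y => e y i b) x + ∑ k, Γ h i j k x * e x k b with hN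
  have h1 : N * (e x).transpose + e x * N.transpose = 0 := by
    ext i k
    have hp : pd j (hInv h i k) x = ∑ a, (pd j (fun y => e y i a) x * e x k a + e x i a * pd j (fun y => e y k a) x) := by
      have : hInv h i k = fun y => ∑ a, e y i a * e y k a := by funext y; exact he.frame y i k
      rw [this, pd_sum (fun a _ => ((he.diff i a).fun_mul (he.diff k a)) x)]
      exact sum_ext fun a => pd_mul (he.diff i a x) (he.diff k a x) j
    rw [hh.pd_hInv] at hp; simp only [he.frame] at hp
    simp only [Matrix.add_apply, Matrix.mul_apply, Matrix.transpose_apply, hN, Matrix.of_apply, Matrix.zero_apply]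
    simp only [Fin.sum_univ_three] at hp ⊢
    linear_combination -hp
  have h2 : ∀ a b, spinConnection h e j a b x = - ((e x)⁻¹ * N) a b := fun a b => by
    rw [spinConnection_eq]; simp [Matrix.mul_apply, hN, coframe]
  have hu : (e x)⁻¹ * e x = 1 := by rw [he.inv_eq hh]; exact he.coframe_mul_eq hh x
  have h4 : (e x)⁻¹ * N + ((e x)⁻¹ * N).transpose = 0 := by
    have hv : (e x).transpose * (e x)⁻¹.transpose = 1 := by rw [← Matrix.transpose_mul, hu, Matrix.transpose_one]
    calc (e x)⁻¹ * N + ((e x)⁻¹ * N).transpose = (e x)⁻¹ * (N * ((e x).transpose * (e x)⁻¹.transpose))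
          + ((e x)⁻¹ * e x) * N.transpose * (e x)⁻¹.transpose := by rw [hv, hu, mul_one, one_mul, Matrix.transpose_mul]
      _ = (e x)⁻¹ * (N * (e x).transpose + e x * N.transpose) * (e x)⁻¹.transpose := by noncomm_ring
      _ = 0 := by rw [h1]; simp
  have h5 := congrFun (congrFun h4 a) b; simp only [Matrix.add_apply, Matrix.transpose_apply, Matrix.zero_apply] at h5
  rw [h2, h2]; linarith

end IsDreibein

/-- The Riemann tensor `R^p_{lij}`. -/
def riem (h : MatField) (p l i j : Fin 3) (x : Space) : ℝ := pd i (Γ h p j l) x - pd j (Γ h p i l) x +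
    ∑ m, (Γ h p i m x * Γ h m j l x - Γ h p j m x * Γ h m i l x)

/-- The Riemann tensor with its first two indices in the frame `e`. -/
def riemFrame (h e : MatField) (a b i j : Fin 3) (x : Space) : ℝ := ∑ k, ∑ m, coframe e k a x * e x m b * riem h k m i j x

namespace CliffordRep

/-- The Clifford multiplication `α_a e^j_a` by the coordinate covector `dx^j`. -/
def A (e : MatField) (j : Fin 3) (x : Space) : F →L[ℝ] F := ∑ a, e x j a • c.al a

/-- The spin connection coefficients. -/
def B (h e : MatField) (j : Fin 3) (x : Space) : F →L[ℝ] F := ∑ a, ∑ b, spinConnection h e j a b x • c.sgen a b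

/-- The spinorial covariant derivative. -/
def D (h e : MatField) (j : Fin 3) (v : Space → F) (x : Space) : F := pd j v x + c.B h e j x (v x)

/-- The massless part `A^j D_j`. -/
def H0 (h e : MatField) (v : Space → F) (x : Space) : F := ∑ j, c.A e j x (c.D h e j v x)

/-- The Dirac operator. -/
def H (h e : MatField) (m : ℝ) (v : Space → F) (x : Space) : F := -(c.J (c.H0 h e v x)) - m • c.bt (v x)

/-- The second covariant derivative. -/
def D2 (h e : MatField) (j k : Fin 3) (v : Space → F) (x : Space) : F :=
  pd j (c.D h e k v) x + c.B h e j x (c.D h e k v x) - ∑ l, Γ h l j k x • c.D h e l v x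

/-- The spinorial Laplacian. -/
def lap (h e : MatField) (v : Space → F) (x : Space) : F := ∑ i, ∑ j, hInv h i j x • c.D2 h e j i v x

/-- The curvature of the spin connection. -/
def curv (h e : MatField) (i j : Fin 3) (x : Space) : F →L[ℝ] F :=
  pd i (c.B h e j) x - pd j (c.B h e i) x + (c.B h e i x * c.B h e j x - c.B h e j x * c.B h e i x)

include he

lemma contDiff_A (j : Fin 3) : 𝒞 ∞ (c.A e j) := ContDiff.sum fun a _ => (he.smooth j a).smul contDiff_const

include hh

lemma contDiff_B (j : Fin 3) : 𝒞 ∞ (c.B h e j) := ContDiff.sum fun a _ => ContDiff.sum fun b _ =>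
    (he.contDiff_spinConnection hh j a b).smul contDiff_const

omit hh in
lemma diff_A (j : Fin 3) : Diff (c.A e j) := (c.contDiff_A he j).diff

lemma diff_B (j : Fin 3) : Diff (c.B h e j) := (c.contDiff_B hh he j).diff

lemma contDiff_D {n k : WithTop ℕ∞} {v : Space → F} (hv : 𝒞 n v) (hk : k + 1 ≤ n) (hk' : k ≤ (⊤ : ℕ∞)) (j : Fin 3) : 𝒞 k (c.D h e j v) :=
  (ContDiff.pd hv hk j).add (((c.contDiff_B hh he j).of_le hk').clm_apply (hv.of_le (le_trans (by simp) hk)))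

lemma diff_D {v : Space → F} (hv : 𝒞 2 v) (j : Fin 3) : Diff (c.D h e j v) :=
  (c.contDiff_D hh he (k := 1) hv (by norm_num) (mod_cast le_top) j).diff

omit hh in
lemma A_anticomm (i j : Fin 3) (x : Space) : c.A e i x * c.A e j x + c.A e j x * c.A e i x = (2 * hInv h i j x) • 1 := by
  have h1 : c.A e i x * c.A e j x + c.A e j x * c.A e i x = ∑ a, ∑ b, (e x i a * e x j b) • (c.al a * c.al b + c.al b * c.al a) := by
    simp only [A, Finset.sum_mul_sum, smul_mul_smul_comm, smul_add, sum_add_distrib]; congr 1; rw [sum_comm]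
    exact sum_ext fun a => sum_ext fun b => by rw [mul_comm]
  rw [h1, he.frame]; simp only [c.anticomm, smul_smul, ← sum_smul]; congr 1
  simp only [mul_ite, mul_zero, Finset.sum_ite_eq, Finset.mem_univ, if_true, mul_sum]; exact sum_ext fun a => by ring

lemma al_B (d i : Fin 3) (x : Space) : c.al d * c.B h e i x - c.B h e i x * c.al d = ∑ a, spinConnection h e i a d x • c.al a := by
  have h1 : c.al d * c.B h e i x - c.B h e i x * c.al d
      = - ∑ a, ∑ b, spinConnection h e i a b x • (c.sgen a b * c.al d - c.al d * c.sgen a b) := by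
    simp only [B, sum_mul, mul_sum, smul_mul_assoc, mul_smul_comm, smul_sub, sum_sub_distrib]; abel
  rw [h1]; simp only [c.sgen_al, smul_sub, smul_smul, sum_sub_distrib]
  have h2 : ∑ a, ∑ b, (spinConnection h e i a b x * (-(1 / 2) * if a = d then (1:ℝ) else 0)) • c.al b
      = ∑ b, (spinConnection h e i d b x * (-(1 / 2))) • c.al b := by
    rw [sum_comm]; refine sum_ext fun b => ?_; rw [← sum_smul]; simp
  have h3 : ∑ a, ∑ b, (spinConnection h e i a b x * (-(1 / 2) * if b = d then (1:ℝ) else 0)) • c.al a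
      = ∑ b, (spinConnection h e i b d x * (-(1 / 2))) • c.al b := by
    refine sum_ext fun b => ?_; rw [← sum_smul]; simp
  rw [h2, h3, ← sum_sub_distrib, ← sum_neg_distrib]; refine sum_ext fun b => ?_; rw [he.spinConnection_antisymm hh i d b]; module

/-- The Clifford multiplication is covariantly constant. -/
lemma pd_A (i j : Fin 3) (x : Space) : pd i (c.A e j) x = c.A e j x * c.B h e i x - c.B h e i x * c.A e j x
      - ∑ k, Γ h j i k x • c.A e k x := by
  have h1 : pd i (c.A e j) x = ∑ a, pd i (fun y => e y j a) x • c.al a := by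
    have : c.A e j = fun y => ∑ a, e y j a • c.al a := rfl; rw [this, pd_sum (fun a _ => ((he.diff j a) x).smul_const _)]
    exact sum_ext fun a => pd_smul_const (he.diff j a x) _ i
  have h2 : c.A e j x * c.B h e i x - c.B h e i x * c.A e j x = ∑ a, (∑ d, e x j d * spinConnection h e i a d x) • c.al a := by
    have : c.A e j x * c.B h e i x - c.B h e i x * c.A e j x = ∑ d, e x j d • (c.al d * c.B h e i x - c.B h e i x * c.al d) := by
      simp only [A, sum_mul, mul_sum, smul_mul_assoc, mul_smul_comm, smul_sub, sum_sub_distrib]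
    rw [this]; simp only [c.al_B hh he, smul_sum, smul_smul, sum_smul]; rw [sum_comm]
  have h3 : ∑ k, Γ h j i k x • c.A e k x = ∑ a, (∑ k, Γ h j i k x * e x k a) • c.al a := by
    simp only [A, smul_sum, smul_smul, sum_smul]; rw [sum_comm]
  rw [h1, h2, h3, ← sum_sub_distrib]; refine sum_ext fun a => ?_; rw [← sub_smul]; congr 1
  have h4 := he.sum_frame_spinConnection hh i j a x
  have h5 : ∑ d, e x j d * spinConnection h e i a d x = - ∑ d, e x j d * spinConnection h e i d a x := by
    rw [← sum_neg_distrib]; exact sum_ext fun d => by rw [he.spinConnection_antisymm hh i a d, mul_neg]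
  rw [h5, h4]; ring

lemma A_curv (j l i : Fin 3) (x : Space) : c.A e j x * c.curv h e l i x - c.curv h e l i x * c.A e j x
      = ∑ k, riem h j k l i x • c.A e k x := by
  have key : ∀ l i, pd l (pd i (c.A e j)) x = (pd l (c.A e j) x * c.B h e i x + c.A e j x * pd l (c.B h e i) x)
      - (pd l (c.B h e i) x * c.A e j x + c.B h e i x * pd l (c.A e j) x)
      - ∑ k, (pd l (Γ h j i k) x • c.A e k x + Γ h j i k x • pd l (c.A e k) x) := by
    intro l i; have hA := fun j => c.diff_A he j; have hB := fun j => c.diff_B hh he j; have hG := fun a b d => hh.diff_christoffel a b d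
    have h1 : pd i (c.A e j) = fun x => c.A e j x * c.B h e i x - c.B h e i x * c.A e j x - ∑ k, Γ h j i k x • c.A e k x := by
      funext y; exact c.pd_A hh he i j y
    have d1 : Diff fun x => c.A e j x * c.B h e i x := (hA j).clm_comp (hB i)
    have d2 : Diff fun x => c.B h e i x * c.A e j x := (hB i).clm_comp (hA j)
    have d3 : ∀ k, Diff fun x => Γ h j i k x • c.A e k x := fun k => (hG j i k).fun_smul (hA k)
    rw [h1, pd_sub ((d1.fun_sub d2) x) (DifferentiableAt.fun_sum fun k _ => d3 k x),
      pd_sub (d1 x) (d2 x), pd_sum fun k _ => d3 k x, pd_comp_mul (hA j x) (hB i x),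
      pd_comp_mul (hB i x) (hA j x)]
    congr 1; exact sum_ext fun k => pd_smul (hG j i k x) (hA k x) l
  have hc : pd l (pd i (c.A e j)) x = pd i (pd l (c.A e j)) x := pd_pd_comm ((c.contDiff_A he j).of_le (by norm_cast)) _ _ _
  rw [key, key] at hc; simp only [c.pd_A hh he, smul_sub, sum_add_distrib, sum_sub_distrib] at hc
  have e1 : ∀ l i, ∑ k, Γ h j i k x • (c.A e k x * c.B h e l x) = (∑ k, Γ h j i k x • c.A e k x) * c.B h e l x := by
    intro l i; simp only [sum_mul, smul_mul_assoc]
  have e2 : ∀ l i, ∑ k, Γ h j i k x • (c.B h e l x * c.A e k x) = c.B h e l x * (∑ k, Γ h j i k x • c.A e k x) := by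
    intro l i; simp only [mul_sum, mul_smul_comm]
  have e3 : ∀ l i, ∑ k, Γ h j i k x • ∑ m, Γ h k l m x • c.A e m x = ∑ m, (∑ k, Γ h j i k x * Γ h k l m x) • c.A e m x := by
    intro l i; simp only [smul_sum, smul_smul, sum_smul]; rw [sum_comm]
  simp only [e1, e2, e3] at hc
  have e4 : ∑ k, riem h j k l i x • c.A e k x = (∑ k, pd l (Γ h j i k) x • c.A e k x) - (∑ k, pd i (Γ h j l k) x • c.A e k x)
        + (∑ m, (∑ k, Γ h j l k x * Γ h k i m x) • c.A e m x)
        - (∑ m, (∑ k, Γ h j i k x * Γ h k l m x) • c.A e m x) := by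
    simp only [riem, ← sum_add_distrib, ← sum_sub_distrib]; refine sum_ext fun k => ?_; rw [sum_sub_distrib]; module
  rw [e4, curv]; rw [← sub_eq_zero] at hc ⊢; rw [← hc]; noncomm_ring

/-- The span of the generators of the spin representation. -/
def spinSpan : Submodule ℝ (F →L[ℝ] F) := Submodule.span ℝ (range fun p : Fin 3 × Fin 3 => c.sgen p.1 p.2)

omit hh he

lemma sgen_mem (a b : Fin 3) : c.sgen a b ∈ c.spinSpan := Submodule.subset_span ⟨(a, b), rfl⟩

lemma sgen_span_eq {M : F →L[ℝ] F} (hM : M ∈ c.spinSpan) : ∑ d, c.al d * (M * c.al d - c.al d * M) = (-4 : ℝ) • M := by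
  induction hM using Submodule.span_induction with
  | mem x hx => obtain ⟨p, rfl⟩ := hx; exact c.sum_al_sgen p.1 p.2
  | zero => simp
  | add x y _ _ hx hy =>
    rw [smul_add, ← hx, ← hy, ← sum_add_distrib]; exact sum_ext fun d => by noncomm_ring
  | smul a x _ hx =>
    rw [smul_comm, ← hx, smul_sum]; refine sum_ext fun d => ?_; simp only [smul_mul_assoc, mul_smul_comm, mul_sub, smul_sub]

lemma comm_mem {M N : F →L[ℝ] F} (hM : M ∈ c.spinSpan) (hN : N ∈ c.spinSpan) : M * N - N * M ∈ c.spinSpan := by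
  induction hM using Submodule.span_induction with
  | zero => simp
  | add x y _ _ hx hy =>
    convert add_mem hx hy using 1; noncomm_ring
  | smul a x _ hx =>
    convert c.spinSpan.smul_mem a hx using 1
    rw [smul_mul_assoc, mul_smul_comm, smul_sub]
  | mem x hx =>
    obtain ⟨p, rfl⟩ := hx
    induction hN using Submodule.span_induction with
    | zero => simp
    | add x y _ _ hx hy =>
      convert add_mem hx hy using 1; noncomm_ring
    | smul a x _ hx =>
      convert c.spinSpan.smul_mem a hx using 1
      rw [smul_mul_assoc, mul_smul_comm, smul_sub]
    | mem y hy =>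
      obtain ⟨q, rfl⟩ := hy; simp only [c.sgen_comm]; have m := fun r a b => c.spinSpan.smul_mem r (c.sgen_mem a b)
      exact c.spinSpan.smul_mem _ (sub_mem (add_mem (sub_mem (m _ _ _) (m _ _ _)) (m _ _ _)) (m _ _ _))

include hh he

lemma curv_mem (i j : Fin 3) (x : Space) : c.curv h e i j x ∈ c.spinSpan := by
  have hp : ∀ i j, pd i (c.B h e j) x ∈ c.spinSpan := by
    intro i j
    have hd : ∀ a b, Diff fun y => spinConnection h e j a b y • c.sgen a b := fun a b =>
      ((he.contDiff_spinConnection hh j a b).diff).smul_const _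
    have : c.B h e j = fun y => ∑ a, ∑ b, spinConnection h e j a b y • c.sgen a b := rfl
    rw [this, pd_sum fun a _ => DifferentiableAt.fun_sum fun b _ => hd a b x]; refine sum_mem fun a _ => ?_
    rw [pd_sum fun b _ => hd a b x]; refine sum_mem fun b _ => ?_
    rw [pd_smul_const ((he.contDiff_spinConnection hh j a b).diff x)]; exact c.spinSpan.smul_mem _ (c.sgen_mem a b)
  refine add_mem (sub_mem (hp i j) (hp j i)) ?_
  have hB : ∀ j, c.B h e j x ∈ c.spinSpan := fun j => sum_mem fun a _ => sum_mem fun b _ => c.spinSpan.smul_mem _ (c.sgen_mem a b)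
  exact c.comm_mem (hB i) (hB j)

lemma sum_coframe_A (a : Fin 3) (x : Space) : ∑ k, coframe e k a x • c.A e k x = c.al a := by
  simp only [A, smul_sum, smul_smul]; rw [sum_comm]; simp only [← sum_smul, he.sum_coframe_mul hh]; simp

lemma al_curv (a l i : Fin 3) (x : Space) : c.al a * c.curv h e l i x - c.curv h e l i x * c.al a
      = ∑ b, riemFrame h e a b l i x • c.al b := by
  rw [← c.sum_coframe_A hh he a x]
  have : (∑ k, coframe e k a x • c.A e k x) * c.curv h e l i x - c.curv h e l i x * (∑ k, coframe e k a x • c.A e k x)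
      = ∑ k, coframe e k a x • (c.A e k x * c.curv h e l i x - c.curv h e l i x * c.A e k x) := by
    simp only [sum_mul, mul_sum, smul_mul_assoc, mul_smul_comm, smul_sub, sum_sub_distrib]
  rw [this]; simp only [c.A_curv hh he]; simp only [A, riemFrame, smul_sum, smul_smul, sum_smul]; rw [sum_comm]
  conv_lhs => enter [2, m]; rw [sum_comm]
  rw [sum_comm]; refine sum_ext fun b => ?_; rw [sum_comm]; exact sum_ext fun k => sum_ext fun m => by ring_nf

lemma curv_eq (l i : Fin 3) (x : Space) : c.curv h e l i x = (1 / 4 : ℝ) • ∑ a, ∑ b, riemFrame h e a b l i x • (c.al a * c.al b) := by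
  have h1 := c.sgen_span_eq (c.curv_mem hh he l i x)
  have h2 : ∀ d, c.curv h e l i x * c.al d - c.al d * c.curv h e l i x = - ∑ b, riemFrame h e d b l i x • c.al b := by
    intro d; rw [← c.al_curv hh he]; abel
  simp only [h2, mul_neg, sum_neg_distrib, mul_sum, mul_smul_comm] at h1
  have : c.curv h e l i x = (-(1/4) : ℝ) • ((-4 : ℝ) • c.curv h e l i x) := by module
  rw [this, ← h1]; module

include c in
lemma riemFrame_antisymm [Nontrivial F] (a b l i : Fin 3) (x : Space) : riemFrame h e a b l i x = - riemFrame h e b a l i x := by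
  have h1 := c.al_curv hh he a l i x; have h2 := c.al_curv hh he b l i x; set K := c.curv h e l i x
  have h3 : (c.al a * K - K * c.al a) * c.al b + c.al b * (c.al a * K - K * c.al a)
      + (c.al a * (c.al b * K - K * c.al b) + (c.al b * K - K * c.al b) * c.al a)
      = (c.al a * c.al b + c.al b * c.al a) * K - K * (c.al a * c.al b + c.al b * c.al a) := by
    noncomm_ring
  rw [h1, h2, c.anticomm] at h3
  simp only [smul_mul_assoc, mul_smul_comm, one_mul, mul_one, sub_self, sum_mul, mul_sum,
    ← sum_add_distrib, ← smul_add, c.anticomm, smul_smul] at h3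
  simp only [← add_smul, ← sum_smul] at h3; have h4 := (smul_eq_zero.1 h3).resolve_right one_ne_zero; simp [sum_add_distrib] at h4; linarith

/-! ### The Lichnerowicz formula -/

/-- The Riemann tensor in the frame `e`. -/
def riemFrame4 (h e : MatField) (a b d f : Fin 3) (x : Space) : ℝ := ∑ l, ∑ i, e x l d * e x i f * riemFrame h e a b l i x

omit hh he

lemma riem_antisymm (k m l i : Fin 3) (x : Space) : riem h k m l i x = - riem h k m i l x := by simp only [riem, sum_sub_distrib]; ring

include hh in
lemma riem_bianchi (k m l i : Fin 3) (x : Space) : riem h k m l i x + riem h k l i m x + riem h k i m l x = 0 := by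
  have h1 : ∀ a b, Γ h k a b = Γ h k b a := fun a b => by funext y; exact hh.christoffel_symm k a b y
  simp only [riem, sum_sub_distrib, h1 l m, h1 i m, h1 i l]
  have h2 : ∀ p a b, Γ h p a b x = Γ h p b a x := fun p a b => hh.christoffel_symm p a b x
  simp only [fun p => h2 p l m, fun p => h2 p i m, fun p => h2 p i l]; ring

lemma riemFrame_antisymm' (a b l i : Fin 3) (x : Space) : riemFrame h e a b l i x = - riemFrame h e a b i l x := by
  simp only [riemFrame, fun k m => riem_antisymm (h := h) k m l i x, mul_neg, sum_neg_distrib]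

lemma riemFrame4_eq (a b d f : Fin 3) (x : Space) : riemFrame4 h e a b d f x = ∑ k, coframe e k a x *
      ∑ m, ∑ l, ∑ i, e x m b * e x l d * e x i f * riem h k m l i x := by
  simp only [riemFrame4, riemFrame, Fin.sum_univ_three]; ring

include hh

lemma riemFrame4_bianchi (a b d f : Fin 3) (x : Space) :
    riemFrame4 h e a b d f x + riemFrame4 h e a d f b x + riemFrame4 h e a f b d x = 0 := by
  rw [riemFrame4_eq, riemFrame4_eq, riemFrame4_eq, ← sum_add_distrib, ← sum_add_distrib]; refine Finset.sum_eq_zero fun k _ => ?_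
  rw [← mul_add, ← mul_add]; refine mul_eq_zero_of_right _ ?_
  have e1 : ∑ m, ∑ l, ∑ i, e x m d * e x l f * e x i b * riem h k m l i x
      = ∑ m, ∑ l, ∑ i, e x m b * e x l d * e x i f * riem h k l i m x := by simp only [Fin.sum_univ_three]; ring
  have e2 : ∑ m, ∑ l, ∑ i, e x m f * e x l b * e x i d * riem h k m l i x
      = ∑ m, ∑ l, ∑ i, e x m b * e x l d * e x i f * riem h k i m l x := by simp only [Fin.sum_univ_three]; ring
  rw [e1, e2]; simp only [← sum_add_distrib, ← mul_add, riem_bianchi hh, mul_zero, Finset.sum_const_zero]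

include he

lemma sum_riemFrame4 (x : Space) : ∑ a, ∑ b, riemFrame4 h e a b a b x = scalarCurvature h x := by
  have h1 : ∑ a, ∑ b, riemFrame4 h e a b a b x = ∑ m, ∑ i, hInv h m i x * ∑ k, riem h k m k i x := by
    have : ∀ a b, riemFrame4 h e a b a b x = ∑ m, ∑ i, (e x m b * e x i b) * ∑ k, ∑ l, (e x l a * coframe e k a x) * riem h k m l i x := by
      intro a b; simp only [riemFrame4_eq, Fin.sum_univ_three]; ring
    simp only [this]
    have h2 : ∀ m i, ∑ a, ∑ b, (e x m b * e x i b) * ∑ k, ∑ l, (e x l a * coframe e k a x) * riem h k m l i x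
        = hInv h m i x * ∑ k, riem h k m k i x := by
      intro m i; rw [he.frame]
      have : ∑ k, riem h k m k i x = ∑ a, ∑ k, ∑ l, (e x l a * coframe e k a x) * riem h k m l i x := by
        rw [sum_comm]; refine sum_ext fun k => ?_; rw [sum_comm]; simp only [← sum_mul, he.sum_mul_coframe hh]; simp
      rw [this, Finset.sum_mul_sum, sum_comm]
    simp only [← h2]
    conv_lhs => enter [2, a]; rw [sum_comm]
    rw [sum_comm]; refine sum_ext fun m => ?_
    conv_lhs => enter [2, a]; rw [sum_comm]
    rw [sum_comm]
  rw [h1, scalarCurvature]; refine sum_ext fun j => sum_ext fun k => ?_; congr 1; rw [← sum_add_distrib]; refine sum_ext fun i => ?_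
  have h3 : ∀ p a b, Γ h p a b = Γ h p b a := fun p a b => by funext y; exact hh.christoffel_symm p a b y
  rw [riem, h3 i k j, h3 i i j]; congr 1; refine sum_ext fun l => ?_; rw [h3 l k j, h3 l i j]; ring

lemma D_comm {v : Space → F} (hv : 𝒞 2 v) (i j : Fin 3) (x : Space) : c.D2 h e i j v x - c.D2 h e j i v x = c.curv h e i j x (v x) := by
  have hB := fun j => c.diff_B hh he j; have hv1 : Diff v := hv.diff
  have hp : ∀ j, Diff (pd j v) := fun j => (ContDiff.pd (m := 1) hv (by norm_num) j).diff
  have key : ∀ i j, pd i (c.D h e j v) x = pd i (pd j v) x + (pd i (c.B h e j) x (v x) + c.B h e j x (pd i v x)) := by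
    intro i j; have : c.D h e j v = fun y => pd j v y + c.B h e j y (v y) := rfl
    rw [this, pd_add (hp j x) ((hB j x).clm_apply (hv1 x)), pd_clm_apply (hB j x) (hv1 x)]
  simp only [D2, key, curv, D, map_add, pd_pd_comm hv i j, fun l => hh.christoffel_symm l i j x]; simp; abel

omit hh he

lemma sum_comm_4 {ι M : Type*} [Fintype ι] [AddCommMonoid M] (f : ι → ι → ι → ι → M) :
    ∑ a, ∑ b, ∑ d, ∑ g, f a b d g = ∑ d, ∑ g, ∑ a, ∑ b, f a b d g := by
  have h1 := sum_comm (s := (Finset.univ : Finset (ι × ι))) (t := (Finset.univ : Finset (ι × ι))) (f := fun p q => f p.1 p.2 q.1 q.2)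
  simpa only [Fintype.sum_prod_type] using h1

lemma sum_A_A (T : Fin 3 → Fin 3 → F →L[ℝ] F) (x : Space) : ∑ j, ∑ k, c.A e j x * c.A e k x * T j k
      = ∑ d, ∑ f, c.al d * c.al f * ∑ j, ∑ k, (e x j d * e x k f) • T j k := by
  simp only [A, smul_mul_smul_comm, mul_sum, sum_mul]; rw [sum_comm_4]; rw [sum_comm]
  refine sum_ext fun a => sum_ext fun b => sum_ext fun d => sum_ext fun f => ?_; rw [smul_mul_assoc, mul_smul_comm]

include hh he

lemma sum_frame_curv (d f : Fin 3) (x : Space) : ∑ j, ∑ k, (e x j d * e x k f) • c.curv h e j k x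
      = (1/4:ℝ) • ∑ a, ∑ b, riemFrame4 h e a b d f x • (c.al a * c.al b) := by
  simp only [c.curv_eq hh he, smul_comm _ (1/4:ℝ), ← smul_sum, riemFrame4, sum_smul]; congr 1
  rw [sum_comm_4 (f := fun a b d_1 g => ((e x d_1 d * e x g f * riemFrame h e a b d_1 g x) • (c.al a * c.al b)))]
  simp only [smul_sum, smul_smul]

lemma sum_A_curv [Nontrivial F] (x : Space) : ∑ j, ∑ k, c.A e k x * c.A e j x * c.curv h e j k x = (1/2 * scalarCurvature h x) • 1 := by
  have e0 := c.sum_curvature (fun a b d f => riemFrame4 h e a b d f x) (fun a b d f => by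
      simp only [riemFrame4, fun l i => c.riemFrame_antisymm hh he a b l i x, mul_neg, sum_neg_distrib])
    (fun a b d f => by
      simp only [riemFrame4]; rw [sum_comm, ← sum_neg_distrib]; refine sum_ext fun i => ?_; rw [← sum_neg_distrib]
      refine sum_ext fun l => ?_; rw [riemFrame_antisymm' a b l i]; ring)
    (fun a b d f => riemFrame4_bianchi hh a b d f x)
  rw [sum_riemFrame4 hh he] at e0
  have e1 : ∑ j, ∑ k, c.A e j x * c.A e k x * c.curv h e j k x
      = (1/4:ℝ) • ∑ a, ∑ b, ∑ d, ∑ f, riemFrame4 h e a b d f x • (c.al d * c.al f * (c.al a * c.al b)) := by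
    rw [c.sum_A_A, sum_comm_4 (f := fun a b d f => riemFrame4 h e a b d f x • (c.al d * c.al f * (c.al a * c.al b))), smul_sum]
    refine sum_ext fun d => ?_; rw [smul_sum]; refine sum_ext fun f => ?_; rw [c.sum_frame_curv hh he, mul_smul_comm]; congr 1
    rw [mul_sum]; refine sum_ext fun a => ?_; rw [mul_sum]; exact sum_ext fun b => mul_smul_comm _ _ _
  have e3 : ∑ j, ∑ k, c.A e k x * c.A e j x * c.curv h e j k x = - ∑ j, ∑ k, c.A e j x * c.A e k x * c.curv h e j k x := by
    rw [sum_comm, ← sum_neg_distrib]; refine sum_ext fun j => ?_; rw [← sum_neg_distrib]; refine sum_ext fun k => ?_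
    rw [← mul_neg]; congr 1; simp only [curv]; abel
  rw [e3, e1, e0]; module

lemma H0_H0 [Nontrivial F] {v : Space → F} (hv : 𝒞 2 v) (x : Space) :
    c.H0 h e (c.H0 h e v) x = c.lap h e v x - (1 / 4 * scalarCurvature h x) • v x := by
  have hD := c.diff_D hh he hv; have hA := fun j => c.diff_A he j
  have h1 : ∀ j, c.D h e j (c.H0 h e v) x = ∑ k, c.A e k x (c.D2 h e j k v x) := by
    intro j; have : c.H0 h e v = fun y => ∑ k, c.A e k y (c.D h e k v y) := rfl; rw [D, this, pd_sum fun k _ => (hA k x).clm_apply (hD k x)]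
    simp only [fun k => pd_clm_apply (hA k x) (hD k x) j, c.pd_A hh he, D2, map_add, map_sub, map_sum,
      map_smul, sum_add_distrib, sum_sub_distrib]
    have e1 : ∑ k, (c.A e k x * c.B h e j x - c.B h e j x * c.A e k x - ∑ l, Γ h k j l x • c.A e l x) (c.D h e k v x)
      = ∑ k, c.A e k x (c.B h e j x (c.D h e k v x)) - ∑ k, c.B h e j x (c.A e k x (c.D h e k v x))
        - ∑ k, ∑ l, Γ h k j l x • c.A e l x (c.D h e k v x) := by
      simp [sum_sub_distrib]
    rw [e1, sum_comm (f := fun k l => Γ h k j l x • c.A e l x (c.D h e k v x))]; abel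
  have h2 : c.H0 h e (c.H0 h e v) x = ∑ j, ∑ k, (c.A e j x * c.A e k x) (c.D2 h e j k v x) := by rw [H0]; simp only [h1, map_sum]; rfl
  have h3 : ∑ j, ∑ k, (c.A e j x * c.A e k x) (c.D2 h e j k v x) = ∑ j, ∑ k, (c.A e k x * c.A e j x) (c.D2 h e k j v x) := sum_comm
  have h4 : (2:ℝ) • c.H0 h e (c.H0 h e v) x = (∑ j, ∑ k, (c.A e j x * c.A e k x + c.A e k x * c.A e j x) (c.D2 h e j k v x))
        - (∑ j, ∑ k, (c.A e k x * c.A e j x) (c.D2 h e j k v x - c.D2 h e k j v x)) := by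
    rw [two_smul]
    conv_lhs => rw [h2]; arg 2; rw [h3]
    simp only [← sum_sub_distrib, ← sum_add_distrib]; refine sum_ext fun j => sum_ext fun k => ?_
    simp only [add_apply, mul_apply_eq_comp, map_sub]; abel
  have h5 : (∑ j, ∑ k, (c.A e j x * c.A e k x + c.A e k x * c.A e j x) (c.D2 h e j k v x)) = (2:ℝ) • c.lap h e v x := by
    simp only [c.A_anticomm he, lap, smul_sum, smul_smul]; rw [sum_comm]; refine sum_ext fun k => sum_ext fun j => ?_
    rw [hh.hInv_symm j k]; simp
  have h6 := c.sum_A_curv hh he x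
  have h7 : (∑ j, ∑ k, (c.A e k x * c.A e j x) (c.D2 h e j k v x - c.D2 h e k j v x)) = (1/2 * scalarCurvature h x) • v x := by
    have := DFunLike.congr_fun h6 (v x); simp only [smul_apply, one_apply_eq_self] at this; rw [← this]
    simp only [c.D_comm hh he hv, sum_apply, mul_apply_eq_comp]
  rw [h5, h7] at h4; have := congrArg (fun y => (1/2:ℝ) • y) h4; simp only [smul_sub, smul_smul] at this; norm_num at this
  rw [this]; congr 2; ring

omit hh he

lemma J_J (v : F) : c.J (c.J v) = -v := by have := DFunLike.congr_fun c.J_sq v; simpa using this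

lemma B_J (j : Fin 3) (x : Space) (w : F) : c.B h e j x (c.J w) = c.J (c.B h e j x w) := by
  have : c.B h e j x * c.J = c.J * c.B h e j x := by simp only [B, mul_sum, sum_mul, mul_smul_comm, smul_mul_assoc, c.J_sgen]
  exact DFunLike.congr_fun this w

lemma B_bt (j : Fin 3) (x : Space) (w : F) : c.B h e j x (c.bt w) = c.bt (c.B h e j x w) := by
  have : c.B h e j x * c.bt = c.bt * c.B h e j x := by simp only [B, mul_sum, sum_mul, mul_smul_comm, smul_mul_assoc, c.bt_sgen]
  exact DFunLike.congr_fun this w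

lemma A_J (j : Fin 3) (x : Space) (w : F) : c.A e j x (c.J w) = c.J (c.A e j x w) := by
  have : c.A e j x * c.J = c.J * c.A e j x := by simp only [A, mul_sum, sum_mul, mul_smul_comm, smul_mul_assoc, c.J_al]
  exact DFunLike.congr_fun this w

lemma A_bt (j : Fin 3) (x : Space) (w : F) : c.A e j x (c.bt w) = - c.bt (c.A e j x w) := by
  have : c.A e j x * c.bt = - (c.bt * c.A e j x) := by
    simp only [A, mul_sum, sum_mul, mul_smul_comm, smul_mul_assoc, c.bt_al, smul_neg, sum_neg_distrib, neg_neg]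
  exact DFunLike.congr_fun this w

lemma bt_J (w : F) : c.bt (c.J w) = c.J (c.bt w) := (DFunLike.congr_fun c.J_bt w).symm

lemma bt_bt (w : F) : c.bt (c.bt w) = w := DFunLike.congr_fun c.bt_sq w

include hh he

/-- The Lichnerowicz formula. -/
lemma H_H [Nontrivial F] (m : ℝ) {v : Space → F} (hv : 𝒞 2 v) (x : Space) :
    c.H h e m (c.H h e m v) x = m ^ 2 • v x - c.lap h e v x + (1 / 4 * scalarCurvature h x) • v x := by
  have hv1 : Diff v := hv.diff; have hD := c.diff_D hh he hv
  have hH0 : Diff (c.H0 h e v) := by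
    have : c.H0 h e v = fun y => ∑ k, c.A e k y (c.D h e k v y) := rfl; rw [this]
    exact Differentiable.fun_sum fun k _ => (c.diff_A he k).clm_apply (hD k)
  have hDH : ∀ j, c.D h e j (c.H h e m v) x = -(c.J (c.D h e j (c.H0 h e v) x)) - m • c.bt (c.D h e j v x) := by
    intro j; have : c.H h e m v = fun y => -(c.J (c.H0 h e v y)) - m • c.bt (v y) := rfl
    have d1 : DiffAt (fun y => -(c.J (c.H0 h e v y))) x := by fun_prop
    have d2 : DiffAt (fun y => m • c.bt (v y)) x := by fun_prop
    have d3 : DiffAt (fun y => c.bt (v y)) x := by fun_prop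
    rw [D, this, pd_sub d1 d2, pd_neg, pd_const_clm _ (hH0 x), pd_smul (differentiableAt_const m) d3, pd_const, pd_const_clm _ (hv1 x)]
    simp only [D, map_add, map_sub, map_neg, map_smul, c.B_J, c.B_bt]; module
  have hHH : c.H0 h e (c.H h e m v) x = -(c.J (c.H0 h e (c.H0 h e v) x)) + m • c.bt (c.H0 h e v x) := by
    rw [H0.eq_1 c h e (c.H h e m v), H0.eq_1 c h e (c.H0 h e v), H0.eq_1 c h e v x]
    simp only [hDH, map_sub, map_neg, map_smul, c.A_J, c.A_bt, map_sum, sum_sub_distrib, sum_neg_distrib, smul_sum, smul_neg]; abel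
  rw [H.eq_1 c h e m (c.H h e m v), hHH, c.H0_H0 hh he hv]; simp only [H, map_add, map_neg, map_sub, map_smul, c.J_J, c.bt_J, c.bt_bt]
  module

end CliffordRep

/-! ### The Dirac representation -/

lemma act_mul (M N : Matrix (Fin 4) (Fin 4) ℂ) (v : Spinor) : act (M * N) v = act M (act N v) := by simp [act, Matrix.toLpLin_apply]

lemma act_add (M N : Matrix (Fin 4) (Fin 4) ℂ) (v : Spinor) : act (M + N) v = act M v + act N v := by simp [act]

lemma act_sub (M N : Matrix (Fin 4) (Fin 4) ℂ) (v : Spinor) : act (M - N) v = act M v - act N v := by simp [act]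

lemma act_neg (M : Matrix (Fin 4) (Fin 4) ℂ) (v : Spinor) : act (-M) v = - act M v := by simp [act]

lemma act_smul (a : ℂ) (M : Matrix (Fin 4) (Fin 4) ℂ) (v : Spinor) : act (a • M) v = a • act M v := by simp [act]

lemma act_one (v : Spinor) : act 1 v = v := by simp [act]

lemma act_sum {ι : Type*} (s : Finset ι) (f : ι → Matrix (Fin 4) (Fin 4) ℂ) (v : Spinor) : act (∑ i ∈ s, f i) v = ∑ i ∈ s, act (f i) v := by
  simp [act]

lemma act_smul_vec (M : Matrix (Fin 4) (Fin 4) ℂ) (a : ℂ) (v : Spinor) : act M (a • v) = a • act M v := by simp [act]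

/-- A complex matrix as a real-linear operator on spinors. -/
def op (M : Matrix (Fin 4) (Fin 4) ℂ) : Spinor →L[ℝ] Spinor := (Matrix.toEuclideanCLM (n := Fin 4) (𝕜 := ℂ) M).restrictScalars ℝ

lemma inner_real_eq (v w : Spinor) : ⟪v, w⟫ = (inner ℂ v w).re := by simp [PiLp.inner_apply, Complex.inner]

lemma inner_act (M : Matrix (Fin 4) (Fin 4) ℂ) (v w : Spinor) : ⟪act M v, w⟫ = ⟪v, act M.conjTranspose w⟫ := by
  rw [inner_real_eq, inner_real_eq]; congr 1
  change inner ℂ (Matrix.toEuclideanCLM (n := Fin 4) (𝕜 := ℂ) M v) w = inner ℂ v (Matrix.toEuclideanCLM (n := Fin 4) (𝕜 := ℂ) (star M) w)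
  rw [map_star, ContinuousLinearMap.star_eq_adjoint, ContinuousLinearMap.adjoint_inner_right]

lemma gammaZero_sq : gammaZero * gammaZero = 1 := by
  rw [gammaZero, Matrix.reindex_apply, Matrix.submatrix_mul_equiv, Matrix.fromBlocks_multiply]; simp [Matrix.fromBlocks_one]

lemma pauli_anticomm (a b : Fin 3) : pauli a * pauli b + pauli b * pauli a = (if a = b then (2:ℂ) else 0) • 1 := by
  fin_cases a <;> fin_cases b <;>
  · ext i j
    fin_cases i <;> fin_cases j <;> norm_num [pauli, Matrix.mul_apply, Fin.sum_univ_two]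

lemma diracAlpha_anticomm (a b : Fin 3) : diracAlpha a * diracAlpha b + diracAlpha b * diracAlpha a = (if a = b then (2:ℂ) else 0) • 1 := by
  simp only [diracAlpha, Matrix.reindex_apply, Matrix.submatrix_mul_equiv, Matrix.fromBlocks_multiply,
    zero_mul, mul_zero, zero_add, add_zero]
  have : ∀ M N P Q : Matrix (Fin 2 ⊕ Fin 2) (Fin 2 ⊕ Fin 2) ℂ,
      M.submatrix finSumFinEquiv.symm finSumFinEquiv.symm + N.submatrix finSumFinEquiv.symm finSumFinEquiv.symm
      = (M + N).submatrix (finSumFinEquiv (m := 2) (n := 2)).symm (finSumFinEquiv (m := 2) (n := 2)).symm := fun _ _ _ _ => rfl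
  rw [this _ _ 0 0, Matrix.fromBlocks_add, pauli_anticomm, add_zero]
  have h2 : Matrix.fromBlocks ((if a = b then (2:ℂ) else 0) • (1 : Matrix (Fin 2) (Fin 2) ℂ)) 0 0
      ((if a = b then (2:ℂ) else 0) • (1 : Matrix (Fin 2) (Fin 2) ℂ)) = (if a = b then (2:ℂ) else 0) • 1 := by
    rw [← Matrix.fromBlocks_one, Matrix.fromBlocks_smul]; simp
  rw [h2, Matrix.submatrix_smul, Pi.smul_apply, Pi.smul_apply, Matrix.submatrix_one_equiv]

lemma gammaZero_diracAlpha (a : Fin 3) : gammaZero * diracAlpha a = - (diracAlpha a * gammaZero) := by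
  rw [gammaZero, diracAlpha, Matrix.reindex_apply, Matrix.reindex_apply, Matrix.submatrix_mul_equiv,
    Matrix.submatrix_mul_equiv, Matrix.fromBlocks_multiply, Matrix.fromBlocks_multiply]
  refine congrArg (fun M : Matrix (Fin 2 ⊕ Fin 2) (Fin 2 ⊕ Fin 2) ℂ =>
    M.submatrix finSumFinEquiv.symm finSumFinEquiv.symm) (?_ : _ = -(Matrix.fromBlocks _ _ _ _))
  rw [Matrix.fromBlocks_neg]; simp

lemma gammaZero_star : gammaZero.conjTranspose = gammaZero := by simp [gammaZero, Matrix.fromBlocks_conjTranspose]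

lemma diracAlpha_star (a : Fin 3) : (diracAlpha a).conjTranspose = diracAlpha a := by
  have : (pauli a).conjTranspose = pauli a := by
    fin_cases a <;> ext i j <;> fin_cases i <;> fin_cases j <;> simp [pauli, Matrix.conjTranspose_apply]
  simp [diracAlpha, Matrix.fromBlocks_conjTranspose, this]

lemma gammaZero_gammaUp (a : Fin 3) : gammaZero * gammaUp a = diracAlpha a := by rw [gammaUp, ← mul_assoc, gammaZero_sq, one_mul]

lemma coe_smul_spinor (a : ℝ) (v : Spinor) : (a : ℂ) • v = a • v := by ext i; simp

/-- The Dirac matrices acting on `ℂ⁴`. -/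
def drep : CliffordRep Spinor where
  al a := op (diracAlpha a)
  bt := op gammaZero
  J := op (Complex.I • 1)
  anticomm a b := by
    refine ContinuousLinearMap.ext fun v => ?_
    change act (diracAlpha a) (act (diracAlpha b) v) + act (diracAlpha b) (act (diracAlpha a) v) = (_ : ℝ) • v
    rw [← act_mul, ← act_mul, ← act_add, diracAlpha_anticomm, act_smul, act_one, ← coe_smul_spinor]
    split_ifs <;> simp
  bt_al a := by
    refine ContinuousLinearMap.ext fun v => ?_; change act gammaZero (act (diracAlpha a) v) = - act (diracAlpha a) (act gammaZero v)
    rw [← act_mul, ← act_mul, ← act_neg, gammaZero_diracAlpha]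
  bt_sq := by refine ContinuousLinearMap.ext fun v => ?_; change act gammaZero (act gammaZero v) = v; rw [← act_mul, gammaZero_sq, act_one]
  J_sq := by
    refine ContinuousLinearMap.ext fun v => ?_; change act (Complex.I • 1) (act (Complex.I • 1) v) = - v
    simp only [act_smul, act_one, smul_smul, Complex.I_mul_I, neg_smul, one_smul]
  J_al a := by
    refine ContinuousLinearMap.ext fun v => ?_
    change act (Complex.I • 1) (act (diracAlpha a) v) = act (diracAlpha a) (act (Complex.I • 1) v)
    simp only [act_smul, act_one, act_smul_vec]
  J_bt := by
    refine ContinuousLinearMap.ext fun v => ?_; change act (Complex.I • 1) (act gammaZero v) = act gammaZero (act (Complex.I • 1) v)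
    simp only [act_smul, act_one, act_smul_vec]
  inner_al a v w := by change ⟪act _ _, _⟫ = ⟪_, act _ _⟫; rw [inner_act, diracAlpha_star]
  inner_bt v w := by change ⟪act _ _, _⟫ = ⟪_, act _ _⟫; rw [inner_act, gammaZero_star]
  inner_J v w := by
    change ⟪act _ _, _⟫ = - ⟪_, act _ _⟫
    have : (Complex.I • (1 : Matrix (Fin 4) (Fin 4) ℂ)).conjTranspose = -(Complex.I • 1) := by simp [Matrix.conjTranspose_smul]
    rw [inner_act, this, act_neg, inner_neg_right]

lemma drep_J (v : Spinor) : drep.J v = Complex.I • v := by change act _ v = _; rw [act_smul, act_one]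

lemma drep_bt (v : Spinor) : drep.bt v = act gammaZero v := rfl

lemma drep_A (e : MatField) (j : Fin 3) (x : Space) (v : Spinor) : drep.A e j x v = ∑ a, e x j a • act (gammaZero * gammaUp a) v := by
  simp only [CliffordRep.A, sum_apply]; refine sum_ext fun a => ?_; rw [gammaZero_gammaUp]; rfl

lemma drep_sgen (a b : Fin 3) (v : Spinor) :
    drep.sgen a b v = act ((1 / 8 : ℂ) • (gammaDown a * gammaDown b - gammaDown b * gammaDown a)) v := by
  have h1 : ∀ a b, gammaDown a * gammaDown b = - (diracAlpha a * diracAlpha b) := by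
    intro a b
    rw [gammaDown, gammaDown, neg_mul_neg, gammaUp, gammaUp, gammaZero_diracAlpha a, neg_mul,
      mul_assoc, ← mul_assoc gammaZero, gammaZero_sq, one_mul]
  have h2 : drep.sgen a b v = (-(1 / 8 : ℝ)) • (act (diracAlpha a) (act (diracAlpha b) v)
      - act (diracAlpha b) (act (diracAlpha a) v)) := rfl
  rw [h2, h1, h1, act_smul, act_sub, act_neg, act_neg, act_mul, act_mul, ← coe_smul_spinor]; push_cast; module

lemma drep_B (h e : MatField) (j : Fin 3) (x : Space) (v : Spinor) : drep.B h e j x v = act (spinB h e j x) v := by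
  have h1 : drep.B h e j x v = ∑ a, ∑ b, spinConnection h e j a b x • drep.sgen a b v := by simp only [CliffordRep.B, sum_apply]; rfl
  rw [h1, spinB]; simp only [drep_sgen, act_smul, act_sum, smul_sum, ← coe_smul_spinor]
  refine sum_ext fun a => sum_ext fun b => ?_; rw [smul_comm]

lemma covD_eq (h e : MatField) (j : Fin 3) (v : Space → Spinor) : covD h e j v = drep.D h e j v := by
  funext x; simp only [covD, CliffordRep.D, drep_B]

lemma dirac_eq (h e : MatField) (m : ℝ) (v : Space → Spinor) : dirac h e m v = drep.H h e m v := by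
  funext x; simp only [dirac, CliffordRep.H, CliffordRep.H0, drep_J, drep_bt, drep_A, covD_eq]; rw [sum_comm]

lemma spinLaplacian_eq (h e : MatField) (v : Space → Spinor) : spinLaplacian h e v = drep.lap h e v := by
  funext x; simp only [spinLaplacian, CliffordRep.lap, covDForm, CliffordRep.D2, covD_eq, drep_B]

lemma dirac_dirac (hh : IsMetric h) (he : IsDreibein h e) (m : ℝ) {v : Space → Spinor} (hv : 𝒞 2 v) (x : Space) :
    dirac h e m (dirac h e m v) x = kgSpatial h e m v x := by
  rw [dirac_eq, dirac_eq, drep.H_H hh he m hv, kgSpatial, spinLaplacian_eq]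

/-! ### Spacetime fields -/

section Spacetime

variable {F : Type*} [NormedAddCommGroup F] [NormedSpace ℝ F]

/-- The time derivative of a spacetime field. -/
def dT (V : ℝ × Space → F) (p : ℝ × Space) : F := fderiv ℝ V p (1, 0)

/-- The spatial derivatives of a spacetime field. -/
def dX (i : Fin 3) (V : ℝ × Space → F) (p : ℝ × Space) : F := fderiv ℝ V p (0, single i 1)

lemma deriv_slice {V : ℝ × Space → F} {p : ℝ × Space} (hV : DiffAt V p) : HasDerivAt (fun s => V (s, p.2)) (dT V p) p.1 := by
  have h1 : HasFDerivAt (fun s : ℝ => (s, p.2)) (ContinuousLinearMap.inl ℝ ℝ Space) p.1 := hasFDerivAt_prodMk_left p.1 p.2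
  have h2 := (HasFDerivAt.comp (g := V) p.1 hV.hasFDerivAt h1).hasDerivAt; simpa [dT, Function.comp_def] using h2

lemma pd_slice {V : ℝ × Space → F} {p : ℝ × Space} (hV : DiffAt V p) (i : Fin 3) : pd i (fun x => V (p.1, x)) p.2 = dX i V p := by
  have h1 : HasFDerivAt (fun x : Space => (p.1, x)) (ContinuousLinearMap.inr ℝ ℝ Space) p.2 := hasFDerivAt_prodMk_right p.1 p.2
  have h2 := HasFDerivAt.comp (g := V) p.2 hV.hasFDerivAt h1; rw [pd]; change fderiv ℝ (V ∘ fun x : Space => (p.1, x)) p.2 _ = _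
  rw [h2.fderiv]; simp [dX]

lemma contDiff_dT {n m : WithTop ℕ∞} {V : ℝ × Space → F} (hV : 𝒞 n V) (h : m + 1 ≤ n) :
    𝒞 m (dT V) := (hV.fderiv_right h).clm_apply contDiff_const

lemma contDiff_dX {n m : WithTop ℕ∞} {V : ℝ × Space → F} (hV : 𝒞 n V) (h : m + 1 ≤ n)
    (i : Fin 3) : 𝒞 m (dX i V) := (hV.fderiv_right h).clm_apply contDiff_const

lemma contDiff_slice {n : WithTop ℕ∞} {V : ℝ × Space → F} (hV : 𝒞 n V) (t : ℝ) :
    𝒞 n fun x => V (t, x) := hV.comp (contDiff_const.prodMk contDiff_id)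

lemma dT_dX {V : ℝ × Space → F} (hV : 𝒞 2 V) (i : Fin 3) (p : ℝ × Space) : dT (dX i V) p = dX i (dT V) p := by
  have h1 : Diff (fderiv ℝ V) := (hV.fderiv_right (m := 1) (by norm_num)).diff
  have key : ∀ a b : ℝ × Space, fderiv ℝ (fun q => fderiv ℝ V q b) p a = fderiv ℝ (fderiv ℝ V) p a b := by
    intro a b; rw [fderiv_clm_apply (h1 p) (differentiableAt_const _)]; simp
  change fderiv ℝ (fun q => fderiv ℝ V q _) p _ = fderiv ℝ (fun q => fderiv ℝ V q _) p _; rw [key, key]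
  exact (hV.contDiffAt.isSymmSndFDerivAt (by simp)).eq _ _

lemma hasCompactSupport_dT {V : ℝ × Space → F} (hV : HasCompactSupport V) : HasCompactSupport (dT V) :=
  .intro hV fun p hp => by simp [dT, fderiv_of_notMem_tsupport ℝ hp]

omit [NormedSpace ℝ F] in
lemma hasCompactSupport_slice {V : ℝ × Space → F} (hV : HasCompactSupport V) (t : ℝ) : HasCompactSupport fun x => V (t, x) :=
  HasCompactSupport.intro (hV.isCompact.image continuous_snd) fun x hx => by refine off_tsupport fun hx' => hx ⟨(t, x), hx', rfl⟩

lemma hasDerivWithinAt_slice {V : ℝ × Space → F} {V' : ℝ × Space →L[ℝ] F} {I : Set ℝ} {t : ℝ}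
    {x : Space} (hV : HasFDerivWithinAt V V' (I ×ˢ univ) (t, x)) :
    HasDerivWithinAt (fun r => V (r, x)) (V' (1, 0)) I t := by
  have h1 : HasFDerivWithinAt (fun r : ℝ => (r, x)) (ContinuousLinearMap.inl ℝ ℝ Space) I t :=
    (hasFDerivAt_prodMk_left t x).hasFDerivWithinAt
  have h2 := (HasFDerivWithinAt.comp (g := V) t hV h1 fun r hr => (⟨hr, mem_univ x⟩ : (r, x) ∈ I ×ˢ univ)).hasDerivWithinAt
  simpa [Function.comp_def] using h2

lemma pd_slice_within {V : ℝ × Space → F} {V' : ℝ × Space →L[ℝ] F} {I : Set ℝ} {t : ℝ}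
    {x : Space} (ht : t ∈ I) (hV : HasFDerivWithinAt V V' (I ×ˢ univ) (t, x)) (i : Fin 3) :
    pd i (fun y => V (t, y)) x = V' (0, single i 1) := by
  have h1 : HasFDerivWithinAt (fun y : Space => (t, y)) (ContinuousLinearMap.inr ℝ ℝ Space) univ x :=
    (hasFDerivAt_prodMk_right t x).hasFDerivWithinAt
  have h2 := HasFDerivWithinAt.comp (g := V) x hV h1 fun y _ => (⟨ht, mem_univ y⟩ : (t, y) ∈ I ×ˢ univ)
  rw [hasFDerivWithinAt_univ] at h2; rw [pd]; change fderiv ℝ (V ∘ fun y : Space => (t, y)) x _ = _; rw [h2.fderiv]; simp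

end Spacetime

namespace CliffordRep

/-- The Dirac operator acting on the space slices of a spacetime field. -/
def HS (h e : MatField) (m : ℝ) (V : ℝ × Space → F) (p : ℝ × Space) : F := c.H h e m (fun x => V (p.1, x)) p.2

lemma HS_eq (m : ℝ) {V : ℝ × Space → F} {p : ℝ × Space} (hV : DiffAt V p) :
    c.HS h e m V p = -(c.J (∑ j, c.A e j p.2 (dX j V p + c.B h e j p.2 (V p)))) - m • c.bt (V p) := by
  simp only [HS, H, H0, D, pd_slice hV]

include hh he in
lemma contDiff_HS (m : ℝ) {n : WithTop ℕ∞} {V : ℝ × Space → F} (hV : 𝒞 (n + 1) V) (hn : n ≤ (⊤ : ℕ∞)) : 𝒞 n (c.HS h e m V) := by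
  have : c.HS h e m V = fun p => -(c.J (∑ j, c.A e j p.2 (dX j V p + c.B h e j p.2 (V p)))) - m • c.bt (V p) := by
    funext p; exact c.HS_eq m (hV.differentiable (by simp) p)
  rw [this]; have hV' : 𝒞 n V := hV.of_le (by simp)
  have hA : ∀ j, 𝒞 n fun p : ℝ × Space => c.A e j p.2 := fun j => ((c.contDiff_A he j).of_le hn).comp contDiff_snd
  have hB : ∀ j, 𝒞 n fun p : ℝ × Space => c.B h e j p.2 := fun j => ((c.contDiff_B hh he j).of_le hn).comp contDiff_snd
  refine ContDiff.sub (ContDiff.neg (c.J.contDiff.comp (ContDiff.sum fun j _ => ?_))) ?_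
  · exact (hA j).clm_apply ((contDiff_dX hV le_rfl j).add ((hB j).clm_apply hV'))
  · exact contDiff_const.smul (c.bt.contDiff.comp hV')

lemma hasCompactSupport_HS (m : ℝ) {V : ℝ × Space → F} (hV : Diff V) (hc : HasCompactSupport V) : HasCompactSupport (c.HS h e m V) :=
  .intro hc fun p hp => by rw [c.HS_eq m (hV p)]; simp [dX, fderiv_of_notMem_tsupport ℝ hp, off_tsupport hp]

include hh he in
lemma dT_HS (m : ℝ) {V : ℝ × Space → F} (hV : 𝒞 2 V) (p : ℝ × Space) : dT (c.HS h e m V) p = c.HS h e m (dT V) p := by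
  have hV1 : Diff V := hV.diff; have hdX : ∀ i, Diff (dX i V) := fun i => (contDiff_dX (m := 1) hV (by norm_num) i).diff
  have hdT : Diff (dT V) := (contDiff_dT (m := 1) hV (by norm_num)).diff
  have hH : Diff (c.HS h e m V) := (c.contDiff_HS (n := 1) hh he m (hV.of_le (by norm_num)) (mod_cast le_top)).diff
  have h1 := deriv_slice (hH p)
  have h2 : (fun s => c.HS h e m V (s, p.2)) = fun s =>
      -(c.J (∑ j, c.A e j p.2 (dX j V (s, p.2) + c.B h e j p.2 (V (s, p.2))))) - m • c.bt (V (s, p.2)) := by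
    funext s; rw [c.HS_eq m (hV1 _)]
  rw [h2] at h1; refine h1.unique ?_; rw [c.HS_eq m (hdT p)]
  have hx : ∀ j, HasDerivAt (fun s => dX j V (s, p.2)) (dX j (dT V) p) p.1 := by intro j; rw [← dT_dX hV j p]; exact deriv_slice (hdX j p)
  have hv : HasDerivAt (fun s => V (s, p.2)) (dT V p) p.1 := deriv_slice (hV1 p)
  refine HasDerivAt.sub (HasDerivAt.neg (c.J.hasFDerivAt.comp_hasDerivAt _ (HasDerivAt.fun_sum fun j _ => ?_))) ?_
  · exact (c.A e j p.2).hasFDerivAt.comp_hasDerivAt _ ((hx j).add ((c.B h e j p.2).hasFDerivAt.comp_hasDerivAt _ hv))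
  · exact (c.bt.hasFDerivAt.comp_hasDerivAt _ hv).const_smul m

lemma H_J (m : ℝ) {v : Space → F} {x : Space} (hv : DiffAt v x) : c.H h e m (fun y => c.J (v y)) x = c.J (c.H h e m v x) := by
  simp only [H, H0, D, pd_const_clm c.J hv, c.B_J, ← map_add, c.A_J, ← map_sum, c.bt_J, map_sub, map_neg, map_smul]

lemma H_add (m : ℝ) {v w : Space → F} {x : Space} (hv : DiffAt v x) (hw : DiffAt w x) :
    c.H h e m (fun y => v y + w y) x = c.H h e m v x + c.H h e m w x := by
  simp only [H, H0, D, pd_add hv hw, map_add, sum_add_distrib, smul_add, neg_add]; abel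

lemma H_neg (m : ℝ) {v : Space → F} {x : Space} : c.H h e m (fun y => - v y) x = - c.H h e m v x := by
  simp only [H, H0, D, pd_neg, map_add, map_neg, sum_neg_distrib, smul_neg, sum_add_distrib]; abel

end CliffordRep

/-! ### From the Dirac equation to the Klein–Gordon equation -/

lemma classical_kg (hh : IsMetric h) (he : IsDreibein h e)
    (m : ℝ) (u₀ : Space → Spinor) (u : ℝ → Space → Spinor) (hu : IsClassicalDiracSolution h e m u₀ u) :
    IsClassicalKGSolution h e m u₀ (fun x => -(Complex.I • dirac h e m u₀ x)) u := by
  set f := uncurry u with hf; set s : Set (ℝ × Space) := Ici 0 ×ˢ univ with hs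
  have hsU : UniqueDiffOn ℝ s := (uniqueDiffOn_Ici 0).prod uniqueDiffOn_univ; have hreg := hu.regular
  have hf' : ContDiffOn ℝ 1 (fderivWithin ℝ f s) s := hreg.fderivWithin hsU (by norm_num)
  have hmem : ∀ t x, 0 ≤ t → (t, x) ∈ s := fun t x ht => ⟨ht, mem_univ x⟩
  have hfd : ∀ t x, 0 ≤ t → HasFDerivWithinAt f (fderivWithin ℝ f s (t, x)) s (t, x) := fun t x ht =>
    (hreg.differentiableOn (by norm_num) _ (hmem t x ht)).hasFDerivWithinAt
  have hf'd : ∀ t x, 0 ≤ t → HasFDerivWithinAt (fderivWithin ℝ f s) (fderivWithin ℝ (fderivWithin ℝ f s) s (t, x)) s (t, x) := fun t x ht =>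
    (hf'.differentiableOn (by norm_num) _ (hmem t x ht)).hasFDerivWithinAt
  have happ : ∀ t x, 0 ≤ t → ∀ a, HasFDerivWithinAt (fun p => fderivWithin ℝ f s p a)
      ((fderivWithin ℝ (fderivWithin ℝ f s) s (t, x)).flip a) s (t, x) := by
    intro t x ht a; have := (hf'd t x ht).clm_apply (hasFDerivWithinAt_const a (t, x) s); simpa using this
  have hsym : ∀ t x, 0 ≤ t → ∀ a b, fderivWithin ℝ (fderivWithin ℝ f s) s (t, x) a b
      = fderivWithin ℝ (fderivWithin ℝ f s) s (t, x) b a := by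
    intro t x ht a b; refine ((hreg _ (hmem t x ht)).isSymmSndFDerivWithinAt (by simp) hsU ?_ (hmem t x ht)).eq a b
    have : closure (interior s) = s := by rw [hs, interior_prod_eq, closure_prod_eq, interior_Ici, interior_univ, closure_Ioi, closure_univ]
    rw [this]; exact hmem t x ht
  have hslice : ∀ t, 0 ≤ t → 𝒞 2 (u t) := by
    intro t ht; rw [← contDiffOn_univ]
    exact hreg.comp (f := fun y : Space => (t, y)) (contDiff_const.prodMk contDiff_id).contDiffOn fun y _ => hmem t y ht
  set w : ℝ → Space → Spinor := fun t x => fderivWithin ℝ f s (t, x) (1, 0) with hw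
  have hdt : ∀ t x, 0 ≤ t → HasDerivWithinAt (fun r => u r x) (w t x) (Ici 0) t := fun t x ht => hasDerivWithinAt_slice (hfd t x ht)
  have heq : ∀ t, 0 ≤ t → ∀ x, w t x = -(drep.J (drep.H h e m (u t) x)) := by
    intro t ht x; have h1 := hu.equation t ht x; rw [(hdt t x ht).derivWithin (uniqueDiffOn_Ici 0 t ht), dirac_eq] at h1
    rw [← sub_eq_zero.1 h1, ← drep_J, drep.J_J, neg_neg]
  have hw' : ∀ t x, 0 ≤ t → HasDerivWithinAt (fun r => drep.H h e m (u r) x) (drep.H h e m (w t) x) (Ici 0) t := by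
    intro t x ht
    have hx : ∀ j, HasDerivWithinAt (fun r => pd j (u r) x) (pd j (w t) x) (Ici 0) t := by
      intro j; have h1 := hasDerivWithinAt_slice (happ t x ht (0, single j 1)); have h2 := pd_slice_within ht (happ t x ht (1, 0)) j
      have h3 : pd j (w t) x = fderivWithin ℝ (fderivWithin ℝ f s) s (t, x) (1, 0) (0, single j 1) := by rw [hsym t x ht]; exact h2
      rw [h3]; refine h1.congr_of_mem (fun r hr => ?_) ht; exact pd_slice_within hr (hfd r x hr) j
    simp only [CliffordRep.H, CliffordRep.H0, CliffordRep.D]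
    refine HasDerivWithinAt.sub (HasDerivWithinAt.neg (drep.J.hasFDerivAt.comp_hasDerivWithinAt _
      (HasDerivWithinAt.fun_sum fun j _ => ?_))) ?_
    · exact (drep.A e j x).hasFDerivAt.comp_hasDerivWithinAt _
        ((hx j).add ((drep.B h e j x).hasFDerivAt.comp_hasDerivWithinAt _ (hdt t x ht)))
    · exact (drep.bt.hasFDerivAt.comp_hasDerivWithinAt _ (hdt t x ht)).const_smul m
  refine ⟨hreg, fun t ht x => ?_, hu.initial, fun x => ?_⟩
  · have h1 : iteratedDerivWithin 2 (fun r => u r x) (Ici 0) t = derivWithin (derivWithin (fun r => u r x) (Ici 0)) (Ici 0) t := by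
      rw [iteratedDerivWithin_succ]; congr 1; funext r; rw [iteratedDerivWithin_one]
    have h2 : ∀ r ∈ Ici (0:ℝ), derivWithin (fun r => u r x) (Ici 0) r = -(drep.J (drep.H h e m (u r) x)) := fun r hr => by
      rw [(hdt r x hr).derivWithin (uniqueDiffOn_Ici 0 r hr), heq r hr]
    have h3 := ((drep.J.hasFDerivAt.comp_hasDerivWithinAt _ (hw' t x ht)).neg).congr_of_mem h2 ht
    rw [h1, h3.derivWithin (uniqueDiffOn_Ici 0 t ht)]; have h4 : w t = fun y => -(drep.J (drep.H h e m (u t) y)) := funext (heq t ht)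
    have h5 : Diff (drep.H h e m (u t)) := by
      have := drep.contDiff_HS hh he m (n := 1) (V := fun p : ℝ × Space => u t p.2)
        (((hslice t ht).of_le (by norm_num)).comp contDiff_snd) (mod_cast le_top)
      exact ((contDiff_slice this 0).diff)
    rw [h4, drep.H_neg, drep.H_J m (h5 x), map_neg, drep.J_J, neg_neg, ← dirac_eq, ← dirac_eq, dirac_dirac hh he m (hslice t ht)]; simp
  · rw [(hdt 0 x le_rfl).derivWithin (uniqueDiffOn_Ici 0 0 self_mem_Ici), heq 0 le_rfl, hu.initial, dirac_eq, drep_J]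

/-! ### Weak solutions -/

lemma isLocallyFinite_riemVol (hh : IsMetric h) : IsLocallyFiniteMeasure 𝔯 h :=
  IsLocallyFiniteMeasure.withDensity_ofReal hh.contDiff_volDensity.continuous

lemma integrable_inner_test (hh : IsMetric h) {φ w : Space → Spinor} (hφ : Continuous φ) (hc : HasCompactSupport φ) (hw : MemLp w 2 𝔯 h) :
    Integrable (fun x => inner ℂ (φ x) (w x)) 𝔯 h := by
  have := isLocallyFinite_riemVol hh; have h1 : MemLp φ 2 𝔯 h := hφ.memLp_of_hasCompactSupport hc
  refine (h1.norm.integrable_mul hw.norm).mono' (h1.aestronglyMeasurable.inner hw.aestronglyMeasurable)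
    (.of_forall fun x => norm_inner_le_norm _ _)

lemma weak_kg (hh : IsMetric h) (he : IsDreibein h e)
    (m : ℝ) (u₀ : Space → Spinor) (u : ℝ → Space → Spinor) (hu : IsWeakDiracSolution h e m u₀ u) :
    IsWeakKGSolution h e m u₀ u := by
  intro φ hφ; set f := uncurry φ with hf; have hfs : 𝒞 ∞ f := hφ.smooth; have hfd : Diff f := hfs.diff
  have hTs : 𝒞 ∞ (dT f) := contDiff_dT hfs (by simp)
  have hHs : 𝒞 ∞ (drep.HS h e m f) := drep.contDiff_HS hh he m (by simpa using hfs) le_rfl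
  have hTd : Diff (dT f) := hTs.diff; have hHd : Diff (drep.HS h e m f) := hHs.diff
  have hderiv : ∀ t x, deriv (fun s => φ s x) t = dT f (t, x) := fun t x => (deriv_slice (hfd (t, x))).deriv
  have hdirac : ∀ t x, dirac h e m (φ t) x = drep.HS h e m f (t, x) := fun t x => by rw [dirac_eq]; rfl
  set ψ : ℝ → Space → Spinor := fun t x => drep.J (dT f (t, x)) + drep.HS h e m f (t, x) with hψ
  have hψu : uncurry ψ = fun p => drep.J (dT f p) + drep.HS h e m f p := rfl
  have hψt : IsTestField ψ := by
    refine ⟨?_, ?_⟩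
    · rw [hψu]; exact (drep.J.contDiff.comp hTs).add hHs
    · rw [hψu]; refine .intro hφ.compact fun p hp => ?_; rw [drep.HS_eq m (hfd p)]
      simp [dT, dX, fderiv_of_notMem_tsupport ℝ hp, off_tsupport hp, hf]
  have h1 := hu.equation ψ hψt
  have h2 : ∀ p : ℝ × Space, Complex.I • deriv (fun s => ψ s p.2) p.1 - dirac h e m (ψ p.1) p.2
      = -(iteratedDeriv 2 (fun s => φ s p.2) p.1 + kgSpatial h e m (φ p.1) p.2) := by
    intro p
    have d1 : HasDerivAt (fun s => ψ s p.2) (drep.J (dT (dT f) p) + dT (drep.HS h e m f) p) p.1 :=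
      (drep.J.hasFDerivAt.comp_hasDerivAt _ (deriv_slice (hTd p))).add (deriv_slice (hHd p))
    have d2 : iteratedDeriv 2 (fun s => φ s p.2) p.1 = dT (dT f) p := by
      rw [iteratedDeriv_succ, iteratedDeriv_one]
      have : deriv (fun s => φ s p.2) = fun s => dT f (s, p.2) := funext fun s => hderiv s p.2; rw [this]; exact (deriv_slice (hTd p)).deriv
    have d3 : dirac h e m (ψ p.1) p.2 = drep.J (drep.HS h e m (dT f) p) + kgSpatial h e m (φ p.1) p.2 := by
      have e1 : Diff fun x => dT f (p.1, x) := (contDiff_slice hTs p.1).diff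
      have e2 : Diff fun x => drep.HS h e m f (p.1, x) := (contDiff_slice hHs p.1).diff
      have e3 := dirac_dirac hh he m ((contDiff_slice hfs p.1).of_le (by norm_cast)) p.2
      change dirac h e m (dirac h e m (φ p.1)) p.2 = kgSpatial h e m (φ p.1) p.2 at e3
      have e4 := drep.H_add (h := h) (e := e) m (v := fun x => drep.J (dT f (p.1, x))) (w := fun x => drep.HS h e m f (p.1, x)) (x := p.2)
        ((drep.J.differentiableAt).comp _ (e1 p.2)) (e2 p.2)
      rw [drep.H_J m (e1 p.2)] at e4; rw [← e3, funext (hdirac p.1), dirac_eq, dirac_eq]; exact e4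
    rw [d1.deriv, d2, d3, ← drep_J, map_add, drep.J_J, drep.dT_HS hh he m (hfs.of_le (by norm_cast))]; abel
  simp only [h2, inner_neg_left, integral_neg] at h1
  have h3 : ∫ x, inner ℂ (ψ 0 x) (u₀ x) ∂𝔯 h = -(Complex.I * ∫ x, inner ℂ (deriv (fun s => φ s x) 0) (u₀ x) ∂𝔯 h)
        + ∫ x, inner ℂ (dirac h e m (φ 0) x) (u₀ x) ∂𝔯 h := by
    have i1 := integrable_inner_test hh (contDiff_slice hTs 0).continuous
      (hasCompactSupport_slice (hasCompactSupport_dT hφ.compact) 0) hu.memLp_initial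
    have i2 := integrable_inner_test hh (contDiff_slice hHs 0).continuous
      (hasCompactSupport_slice (drep.hasCompactSupport_HS m hfd hφ.compact) 0) hu.memLp_initial
    rw [← integral_const_mul, ← integral_neg, ← integral_add (by simpa only [hderiv] using (i1.const_mul _).fun_neg)
      (by simpa only [hdirac] using i2)]
    refine integral_congr_ae (.of_forall fun x => ?_)
    simp only [hψ, inner_add_left, drep_J, inner_smul_left, Complex.conj_I, hderiv, hdirac]; ring
  rw [h3] at h1; rw [neg_eq_iff_eq_neg] at h1; rw [h1, mul_add, mul_neg, ← mul_assoc, Complex.I_mul_I]; ring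

/-! ### Comparison of the Laplacians -/

lemma IsMetric.sum_pd_vol_hInv (hh : IsMetric h) (j : Fin 3) (x : Space) : ∑ i, pd i (fun y => 𝔳 h y * hInv h i j y) x
      = -𝔳 h x * ∑ i, ∑ k, hInv h i k x * Γ h j i k x := by
  have h1 : ∀ i, pd i (fun y => 𝔳 h y * hInv h i j y) x = 𝔳 h x * ((∑ l, Γ h l l i x * hInv h i j x)
          - ∑ l, Γ h i i l x * hInv h l j x - ∑ l, hInv h i l x * Γ h j i l x) := by
    intro i; rw [pd_mul (hh.diff_vol x) (hh.diff_hInv i j x), hh.pd_vol, hh.pd_hInv, ← sum_mul, sum_add_distrib]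
    simp only [mul_comm (hInv h i _ x) (Γ h j i _ x)]; ring
  simp only [h1, ← mul_sum, sum_sub_distrib]; rw [sum_comm]; ring

lemma laplacian_expansion (hh : IsMetric h) (he : IsDreibein h e) {v : Space → Spinor} (hv : 𝒞 2 v) (x : Space) :
    spinLaplacian h e v x = laplaceBeltrami h v x + ∑ i, act (spinBUp h e i x) (pd i v x)
        + ∑ i, scalarCovUp h i i (fun k y => act (spinB h e k y) (v y)) x
        + ∑ i, act (spinBUp h e i x) (act (spinB h e i x) (v x)) := by
  have hv1 : Diff v := hv.diff; have hp : ∀ j, Diff (pd j v) := fun j => (ContDiff.pd (m := 1) hv (by norm_num) j).diff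
  have hB := fun j => drep.diff_B hh he j
  have hUp : ∀ i w, act (spinBUp h e i x) w = ∑ j, hInv h i j x • drep.B h e j x w := by
    intro i w; simp only [spinBUp, act_sum, act_smul, drep_B, coe_smul_spinor]
  have hLB : laplaceBeltrami h v x = ∑ i, ∑ j, hInv h i j x • (pd j (pd i v) x - ∑ l, Γ h l j i x • pd l v x) := by
    rw [laplaceBeltrami, inv_smul_eq_iff₀ (hh.volDensity_pos x).ne']
    have h1 : ∀ i j, pd i (fun y => (𝔳 h y * hInv h i j y) • pd j v y) x = pd i (fun y => 𝔳 h y * hInv h i j y) x • pd j v x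
          + (𝔳 h x * hInv h i j x) • pd i (pd j v) x := fun i j =>
      pd_smul ((hh.diff_vol.fun_mul (hh.diff_hInv i j)) x) (hp j x) i
    simp only [h1, sum_add_distrib, smul_sub, sum_sub_distrib]; rw [sum_comm]; simp only [← sum_smul, hh.sum_pd_vol_hInv]
    have h2 : ∑ i, ∑ j, hInv h i j x • ∑ l, Γ h l j i x • pd l v x = ∑ l, (∑ i, ∑ j, hInv h i j x * Γ h l i j x) • pd l v x := by
      simp only [smul_sum, smul_smul, sum_smul]
      conv_lhs => enter [2, i]; rw [sum_comm]
      rw [sum_comm]; simp only [fun l j i => hh.christoffel_symm l j i x]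
    rw [h2]; simp only [smul_sum, smul_smul, neg_mul, neg_smul, sum_neg_distrib]
    have h3 : ∑ i, ∑ j, (𝔳 h x * hInv h i j x) • pd i (pd j v) x = ∑ i, ∑ j, (𝔳 h x * hInv h i j x) • pd j (pd i v) x :=
      sum_ext fun i => sum_ext fun j => by rw [pd_pd_comm hv]
    rw [h3]; abel
  rw [hLB]; simp only [hUp, scalarCovUp, ← drep_B, spinLaplacian_eq, CliffordRep.lap, CliffordRep.D2]
  simp only [← sum_add_distrib, ← smul_add]; refine sum_ext fun i => sum_ext fun j => ?_; congr 1
  have h2 : pd j (drep.D h e i v) x = pd j (pd i v) x + pd j (fun y => drep.B h e i y (v y)) x :=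
    pd_add (hp i x) (((hB i).clm_apply hv1) x) j
  rw [h2]; simp only [CliffordRep.D, smul_add, sum_add_distrib, map_add]; abel

/-! ### Metrics close to the flat one -/

lemma one_le_bracket (x : Space) : 1 ≤ bracket x := by rw [bracket, Real.one_le_sqrt]; nlinarith [sq_nonneg ‖x‖]

lemma bracket_pos (x : Space) : 0 < bracket x := lt_of_lt_of_le one_pos (one_le_bracket x)

lemma bracket_sq (x : Space) : bracket x ^ 2 = 1 + ‖x‖ ^ 2 := Real.sq_sqrt (by positivity)

/-- Quantitative closeness to the flat metric, with pointwise constant `κ`. -/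
structure NearFlat (h : MatField) (κ : Space → ℝ) : Prop where
  nonneg : ∀ x, 0 ≤ κ x
  le : ∀ x, κ x ≤ 1 / 100
  zeroth : ∀ i j x, |h x i j - if i = j then 1 else 0| ≤ κ x / bracket x
  first : ∀ k i j x, |pd k (fun y => h y i j) x| ≤ κ x / bracket x ^ 2
  second : ∀ l k i j x, |pd l (pd k (fun y => h y i j)) x| ≤ κ x / bracket x ^ 3

lemma AsymptoticallyFlat.nonneg {Ch σ : ℝ} (hf : AsymptoticallyFlat h Ch σ) : 0 ≤ Ch := by
  have h1 := (abs_nonneg _).trans (hf 0 (by simp) 0 0 0); have h2 : bracket (0 : Space) = 1 := by simp [bracket]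
  simpa [h2] using h1

lemma AsymptoticallyFlat.nearFlat (hh : IsMetric h) {Ch σ : ℝ} (hf : AsymptoticallyFlat h Ch σ) (hσ : 0 < σ) (hC : Ch ≤ 1 / 100) :
    NearFlat h fun x => Ch * bracket x ^ (-σ) := by
  have hC0 := hf.nonneg
  have hb1 : ∀ x : Space, bracket x ^ (-σ) ≤ 1 := fun x => Real.rpow_le_one_of_one_le_of_nonpos (one_le_bracket x) (by linarith)
  have hpow : ∀ (n : ℕ) (x : Space), Ch * bracket x ^ (-(n : ℝ) - 1 - σ) = Ch * bracket x ^ (-σ) / bracket x ^ (n + 1) := by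
    intro n x
    rw [show (-(n : ℝ) - 1 - σ) = -σ - ((n + 1 : ℕ) : ℝ) by push_cast; ring,
      Real.rpow_sub (bracket_pos x), Real.rpow_natCast, mul_div_assoc]
  have hs := hh.smooth
  have hd1 : ∀ k i j, pd k (fun y => h y i j - if i = j then 1 else 0) = pd k (fun y => h y i j) := by
    intro k i j; funext x; rw [pd_sub (hh.diff i j x) (differentiableAt_const _), pd_const, sub_zero]
  refine ⟨fun x => mul_nonneg hC0 (Real.rpow_nonneg (bracket_pos x).le _), fun x => ?_, ?_, ?_, ?_⟩
  · nlinarith [hb1 x, Real.rpow_nonneg (bracket_pos x).le (-σ)]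
  · intro i j x; have := hf 0 (by simp) i j x; rw [hpow] at this; simpa [multiPd] using this
  · intro k i j x; have h1 := hf (Pi.single k 1) (by simp) i j x; rw [hpow] at h1
    have h2 : ∑ k', (Pi.single k 1 : Fin 3 → ℕ) k' = 1 := by simp
    rw [h2] at h1
    have h3 : multiPd (Pi.single k 1) (fun y => h y i j - if i = j then 1 else 0) x = pd k (fun y => h y i j) x := by
      fin_cases k <;> simp [multiPd, hd1]
    rwa [h3] at h1
  · have key : ∀ l k i j x, l ≤ k → |pd l (pd k (fun y => h y i j)) x| ≤ Ch * bracket x ^ (-σ) / bracket x ^ 3 := by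
      intro l k i j x hlk; have h1 := hf (Pi.single l 1 + Pi.single k 1) (by simp [sum_add_distrib]) i j x; rw [hpow] at h1
      have h2 : ∑ k', (Pi.single l 1 + Pi.single k 1 : Fin 3 → ℕ) k' = 2 := by simp [sum_add_distrib]
      rw [h2] at h1
      have h3 : multiPd (Pi.single l 1 + Pi.single k 1) (fun y => h y i j - if i = j then 1 else 0) x
          = pd l (pd k (fun y => h y i j)) x := by
        fin_cases l <;> fin_cases k <;> simp [multiPd, hd1] at hlk ⊢
      rwa [h3] at h1
    intro l k i j x; rcases le_total l k with hlk | hlk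
    · exact key l k i j x hlk
    · rw [pd_pd_comm ((hs i j).of_le (by norm_cast))]; exact key k l i j x hlk

lemma abs_sum3_le {f : Fin 3 → ℝ} {C : ℝ} (hf : ∀ i, |f i| ≤ C) : |∑ i, f i| ≤ 3 * C := by
  refine (Finset.abs_sum_le_sum_abs _ _).trans ((sum_le_sum fun i _ => hf i).trans ?_); simp

lemma abs_mul_le' {a b A B : ℝ} (ha : |a| ≤ A) (hb : |b| ≤ B) : |a * b| ≤ A * B := by
  rw [abs_mul]; exact mul_le_mul ha hb (abs_nonneg _) ((abs_nonneg _).trans ha)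

namespace NearFlat

variable {κ : Space → ℝ} (hf : NearFlat h κ)

include hf in
lemma mono {κ' : Space → ℝ} (h1 : ∀ x, κ x ≤ κ' x) (h2 : ∀ x, κ' x ≤ 1 / 100) : NearFlat h κ' where
  nonneg x := (hf.nonneg x).trans (h1 x)
  le := h2
  zeroth i j x := (hf.zeroth i j x).trans (div_le_div_of_nonneg_right (h1 x) (bracket_pos x).le)
  first k i j x := (hf.first k i j x).trans (div_le_div_of_nonneg_right (h1 x) (pow_nonneg (bracket_pos x).le 2))
  second l k i j x := (hf.second l k i j x).trans (div_le_div_of_nonneg_right (h1 x) (pow_nonneg (bracket_pos x).le 3))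

include hf

lemma div_le (x : Space) : κ x / bracket x ≤ 1 / 100 := (div_le_self (hf.nonneg x) (one_le_bracket x)).trans (hf.le x)

lemma div_nonneg (n : ℕ) (x : Space) : 0 ≤ κ x / bracket x ^ n :=
  _root_.div_nonneg (hf.nonneg x) (pow_nonneg (bracket_pos x).le n)

lemma div_pow_le {n m : ℕ} (hnm : n ≤ m) (x : Space) : κ x / bracket x ^ m ≤ κ x / bracket x ^ n :=
  div_le_div_of_nonneg_left (hf.nonneg x) (pow_pos (bracket_pos x) n) (pow_le_pow_right₀ (one_le_bracket x) hnm)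

include hh

lemma hInv_le (i j : Fin 3) (x : Space) : |hInv h i j x| ≤ 2 := by
  obtain ⟨p, -, hp⟩ := Finset.exists_max_image (Finset.univ : Finset (Fin 3 × Fin 3)) (fun p => |hInv h p.1 p.2 x|) Finset.univ_nonempty
  have hmax : ∀ i j, |hInv h i j x| ≤ |hInv h p.1 p.2 x| := fun i j => hp (i, j) (Finset.mem_univ _); have h1 := hh.sum_hInv_mul p.1 p.2 x
  have h2 : hInv h p.1 p.2 x = (if p.1 = p.2 then 1 else 0) - ∑ l, hInv h p.1 l x * (h x l p.2 - if l = p.2 then 1 else 0) := by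
    simp only [mul_sub, sum_sub_distrib, h1]; simp
  have h3 : |∑ l, hInv h p.1 l x * (h x l p.2 - if l = p.2 then 1 else 0)| ≤ 3 * (|hInv h p.1 p.2 x| * (1 / 100)) :=
    abs_sum3_le fun l => abs_mul_le' (hmax _ _) ((hf.zeroth _ _ x).trans (hf.div_le x))
  have h4 : |(if p.1 = p.2 then (1:ℝ) else 0)| ≤ 1 := by split_ifs <;> simp
  have h5 : |hInv h p.1 p.2 x| ≤ 1 + 3 * (|hInv h p.1 p.2 x| * (1 / 100)) := by
    conv_lhs => rw [h2]
    exact (abs_sub _ _).trans (add_le_add h4 h3)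
  linarith [hmax i j]

lemma hInv_sub_le (i j : Fin 3) (x : Space) :
    |hInv h i j x - if i = j then 1 else 0| ≤ 6 * (κ x / bracket x) := by
  have h2 : hInv h i j x - (if i = j then 1 else 0) = - ∑ l, hInv h i l x * (h x l j - if l = j then 1 else 0) := by
    simp only [mul_sub, sum_sub_distrib, hh.sum_hInv_mul i j x]; simp
  rw [h2, abs_neg]; exact (abs_sum3_le fun l => abs_mul_le' (hf.hInv_le hh _ _ x) (hf.zeroth _ _ x)).trans (by linarith)

lemma pd_hInv_le (k i j : Fin 3) (x : Space) :
    |pd k (hInv h i j) x| ≤ 36 * (κ x / bracket x ^ 2) := by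
  rw [hh.pd_hInv_aux, abs_neg]
  refine (abs_sum3_le fun a => abs_sum3_le fun b => abs_mul_le' (abs_mul_le' (hf.hInv_le hh _ _ x)
    (hf.first _ _ _ x)) (hf.hInv_le hh _ _ x)).trans (by linarith)

lemma christoffel_le (i j k : Fin 3) (x : Space) :
    |Γ h i j k x| ≤ 9 * (κ x / bracket x ^ 2) := by
  have h1 : ∀ l, |pd j (fun y => h y l k) x + pd k (fun y => h y j l) x - pd l (fun y => h y j k) x| ≤ 3 * (κ x / bracket x ^ 2) := by
    intro l; have := abs_le.1 (hf.first j l k x); have := abs_le.1 (hf.first k j l x); have := abs_le.1 (hf.first l j k x)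
    rw [abs_le]; constructor <;> linarith
  have h2 := abs_sum3_le fun l => abs_mul_le' (hf.hInv_le hh i l x) (h1 l)
  rw [christoffel, abs_mul, abs_of_pos (by norm_num : (0:ℝ) < 1 / 2)]; linarith

lemma pd_christoffel_le (m i j k : Fin 3) (x : Space) :
    |pd m (Γ h i j k) x| ≤ 200 * (κ x / bracket x ^ 3) := by
  have hd : ∀ k a b, Diff (pd k (fun y => h y a b)) := fun k a b => (ContDiff.pd_infty (hh.smooth a b) k).diff
  have e1 : pd m (Γ h i j k) x = (1 / 2) * ∑ l,
      (pd m (hInv h i l) x * (pd j (fun y => h y l k) x + pd k (fun y => h y j l) x - pd l (fun y => h y j k) x)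
      + hInv h i l x * (pd m (pd j (fun y => h y l k)) x + pd m (pd k (fun y => h y j l)) x - pd m (pd l (fun y => h y j k)) x)) := by
    have d1 : ∀ l, Diff fun x => pd j (fun y => h y l k) x + pd k (fun y => h y j l) x
        - pd l (fun y => h y j k) x := fun l => ((hd _ _ _).fun_add (hd _ _ _)).fun_sub (hd _ _ _)
    have d2 : ∀ l, Diff fun x => hInv h i l x * (pd j (fun y => h y l k) x
      + pd k (fun y => h y j l) x - pd l (fun y => h y j k) x) := fun l => (hh.diff_hInv i l).fun_mul (d1 l)
    have : Γ h i j k = fun x => (1 / 2) * ∑ l, hInv h i l x *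
      (pd j (fun y => h y l k) x + pd k (fun y => h y j l) x - pd l (fun y => h y j k) x) := rfl
    rw [this, pd_const_mul _ (DifferentiableAt.fun_sum fun l _ => d2 l x), pd_sum fun l _ => d2 l x]; congr 1; refine sum_ext fun l => ?_
    rw [pd_mul (hh.diff_hInv i l x) (d1 l x), pd_sub (((hd _ _ _).fun_add (hd _ _ _)) x) (hd _ _ _ x), pd_add (hd _ _ _ x) (hd _ _ _ x)]
  have h1 : ∀ l, |pd j (fun y => h y l k) x + pd k (fun y => h y j l) x - pd l (fun y => h y j k) x| ≤ 3 * (κ x / bracket x ^ 2) := by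
    intro l; have := abs_le.1 (hf.first j l k x); have := abs_le.1 (hf.first k j l x); have := abs_le.1 (hf.first l j k x)
    rw [abs_le]; constructor <;> linarith
  have h2 : ∀ l, |pd m (pd j (fun y => h y l k)) x + pd m (pd k (fun y => h y j l)) x
        - pd m (pd l (fun y => h y j k)) x| ≤ 3 * (κ x / bracket x ^ 3) := by
    intro l; have := abs_le.1 (hf.second m j l k x); have := abs_le.1 (hf.second m k j l x)
    have := abs_le.1 (hf.second m l j k x); rw [abs_le]; constructor <;> linarith
  have h3 : κ x / bracket x ^ 2 * (κ x / bracket x ^ 2) ≤ 1 / 100 * (κ x / bracket x ^ 3) := by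
    have e : κ x / bracket x ^ 2 * (κ x / bracket x ^ 2) = κ x / bracket x * (κ x / bracket x ^ 3) := by
      have := (bracket_pos x).ne'; field_simp
    rw [e]; exact mul_le_mul_of_nonneg_right (hf.div_le x) (hf.div_nonneg 3 x)
  have h4 := abs_sum3_le fun l => (abs_add_le _ _).trans (add_le_add
    (abs_mul_le' (hf.pd_hInv_le hh m i l x) (h1 l)) (abs_mul_le' (hf.hInv_le hh i l x) (h2 l)))
  rw [e1, abs_mul, abs_of_pos (by norm_num : (0:ℝ) < 1 / 2)]; have h5 := hf.div_nonneg 3 x; nlinarith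

lemma christoffel_mul_le (i j k i' j' k' : Fin 3) (x : Space) :
    |Γ h i j k x * Γ h i' j' k' x| ≤ κ x / bracket x ^ 3 := by
  have h3 : κ x / bracket x ^ 2 * (κ x / bracket x ^ 2) ≤ 1 / 100 * (κ x / bracket x ^ 3) := by
    have e : κ x / bracket x ^ 2 * (κ x / bracket x ^ 2) = κ x / bracket x * (κ x / bracket x ^ 3) := by
      have := (bracket_pos x).ne'; field_simp
    rw [e]; exact mul_le_mul_of_nonneg_right (hf.div_le x) (hf.div_nonneg 3 x)
  refine (abs_mul_le' (hf.christoffel_le hh _ _ _ x) (hf.christoffel_le hh _ _ _ x)).trans ?_; nlinarith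

lemma riem_le (p l i j : Fin 3) (x : Space) : |riem h p l i j x| ≤ 500 * (κ x / bracket x ^ 3) := by
  have h1 := abs_le.1 (hf.pd_christoffel_le hh i p j l x); have h2 := abs_le.1 (hf.pd_christoffel_le hh j p i l x)
  have h3 := abs_le.1 (abs_sum3_le (f := fun m => Γ h p i m x * Γ h m j l x
    - Γ h p j m x * Γ h m i l x) (C := 2 * (κ x / bracket x ^ 3)) fun m =>
      (abs_sub _ _).trans ((add_le_add (hf.christoffel_mul_le hh _ _ _ _ _ _ x)
        (hf.christoffel_mul_le hh _ _ _ _ _ _ x)).trans (by linarith)))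
  have h4 := hf.div_nonneg 3 x; rw [riem, abs_le]; constructor <;> linarith [h1.1, h1.2, h2.1, h2.2, h3.1, h3.2]

lemma scalarCurvature_le (x : Space) : |scalarCurvature h x| ≤ 30000 * (κ x / bracket x ^ 3) := by
  have h4 := hf.div_nonneg 3 x
  have h1 : ∀ j k, |∑ i, (pd i (Γ h i j k) x - pd k (Γ h i j i) x)| ≤ 3 * (400 * (κ x / bracket x ^ 3)) := fun j k => abs_sum3_le fun i =>
    (abs_sub _ _).trans ((add_le_add (hf.pd_christoffel_le hh _ _ _ _ x) (hf.pd_christoffel_le hh _ _ _ _ x)).trans (by linarith))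
  have h2 : ∀ j k, |∑ i, ∑ l, (Γ h l j k x * Γ h i i l x - Γ h l j i x * Γ h i k l x)| ≤ 3 * (3 * (2 * (κ x / bracket x ^ 3))) :=
    fun j k => abs_sum3_le fun i => abs_sum3_le fun l => (abs_sub _ _).trans ((add_le_add (hf.christoffel_mul_le hh _ _ _ _ _ _ x)
        (hf.christoffel_mul_le hh _ _ _ _ _ _ x)).trans (by linarith))
  refine (abs_sum3_le fun j => abs_sum3_le fun k => abs_mul_le' (hf.hInv_le hh j k x)
    ((abs_add_le _ _).trans (add_le_add (h1 j k) (h2 j k)))).trans (by linarith)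

omit hh in
lemma det_sub_le (x : Space) : |(h x).det - 1| ≤ 10 * (κ x / bracket x) := by
  have ht := hf.div_le x; have h0 : 0 ≤ κ x / bracket x := by simpa using hf.div_nonneg 1 x
  have hz := hf.zeroth; set t := κ x / bracket x
  obtain ⟨X, hX⟩ : ∃ X : Fin 3 → Fin 3 → ℝ, X = fun i j => h x i j - if i = j then 1 else 0 := ⟨_, rfl⟩
  have hXt : ∀ i j, |X i j| ≤ t := fun i j => by rw [hX]; exact hz i j x
  have hx : ∀ i j, h x i j = (if i = j then 1 else 0) + X i j := fun i j => by rw [hX]; ring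
  have h2 : ∀ i j k l, |X i j * X k l| ≤ 1 / 100 * t := fun i j k l =>
    (abs_mul_le' (hXt _ _) (hXt _ _)).trans (mul_le_mul_of_nonneg_right ht h0)
  have h3 : ∀ i j k l m n, |X i j * X k l * X m n| ≤ 1 / 10000 * t := fun i j k l m n =>
    (abs_mul_le' (h2 _ _ _ _) (hXt _ _)).trans (by nlinarith)
  have e : (h x).det - 1 = X 0 0 + X 1 1 + X 2 2 + X 0 0 * X 1 1 + X 0 0 * X 2 2 + X 1 1 * X 2 2
      - X 0 1 * X 1 0 - X 0 2 * X 2 0 - X 1 2 * X 2 1 + X 0 0 * X 1 1 * X 2 2 - X 0 0 * X 1 2 * X 2 1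
      - X 0 1 * X 1 0 * X 2 2 + X 0 1 * X 1 2 * X 2 0 + X 0 2 * X 1 0 * X 2 1 - X 0 2 * X 1 1 * X 2 0 := by
    rw [Matrix.det_fin_three]; simp only [hx]; simp; ring
  rw [e, abs_le]; have a := fun i j => abs_le.1 (hXt i j); have b := fun i j k l => abs_le.1 (h2 i j k l)
  have c := fun i j k l m n => abs_le.1 (h3 i j k l m n); constructor
  · linarith [(a 0 0).1, (a 1 1).1, (a 2 2).1, (b 0 0 1 1).1, (b 0 0 2 2).1, (b 1 1 2 2).1, (b 0 1 1 0).2,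
      (b 0 2 2 0).2, (b 1 2 2 1).2, (c 0 0 1 1 2 2).1, (c 0 0 1 2 2 1).2, (c 0 1 1 0 2 2).2,
      (c 0 1 1 2 2 0).1, (c 0 2 1 0 2 1).1, (c 0 2 1 1 2 0).2]
  · linarith [(a 0 0).2, (a 1 1).2, (a 2 2).2, (b 0 0 1 1).2, (b 0 0 2 2).2, (b 1 1 2 2).2, (b 0 1 1 0).1,
      (b 0 2 2 0).1, (b 1 2 2 1).1, (c 0 0 1 1 2 2).2, (c 0 0 1 2 2 1).1, (c 0 1 1 0 2 2).1,
      (c 0 1 1 2 2 0).2, (c 0 2 1 0 2 1).2, (c 0 2 1 1 2 0).1]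

omit hh in
lemma vol_sub_le (x : Space) : |𝔳 h x - 1| ≤ 10 * (κ x / bracket x) := by
  have h1 := hf.det_sub_le x; have h2 := hf.div_le x; have hpos : 0 ≤ (h x).det := by linarith [(abs_le.1 h1).1]
  have h3 : (𝔳 h x - 1) * (𝔳 h x + 1) = (h x).det - 1 := by have : 𝔳 h x * 𝔳 h x = (h x).det := Real.mul_self_sqrt hpos; linarith
  have h4 : 0 ≤ 𝔳 h x := Real.sqrt_nonneg _; refine le_trans ?_ h1
  rw [← h3, abs_mul, abs_of_nonneg (by linarith : 0 ≤ 𝔳 h x + 1)]; nlinarith [abs_nonneg (𝔳 h x - 1)]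

omit hh in
lemma vol_le (x : Space) : 𝔳 h x ≤ 2 := by have := (abs_le.1 (hf.vol_sub_le x)).2; linarith [hf.div_le x]

omit hh in
lemma le_vol (x : Space) : 1 / 2 ≤ 𝔳 h x := by have := (abs_le.1 (hf.vol_sub_le x)).1; linarith [hf.div_le x]

lemma pd_vol_le (k : Fin 3) (x : Space) : |pd k (𝔳 h) x| ≤ 54 * (κ x / bracket x ^ 2) := by
  rw [hh.pd_vol]; have h1 : |𝔳 h x| ≤ 2 := by rw [abs_of_pos (hh.volDensity_pos x)]; exact hf.vol_le x
  exact (abs_mul_le' h1 (abs_sum3_le fun i => hf.christoffel_le hh _ _ _ x)).trans (by linarith)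

end NearFlat

section
section

/-- A smooth square root near the identity of a Banach star algebra, preserving self-adjointness. -/
lemma exists_local_sqrt (A : Type*) [NormedRing A] [NormedAlgebra ℝ A] [CompleteSpace A] [StarRing A]
    [ContinuousStar A] : ∃ (g : A → A) (K r : ℝ),
    0 < r ∧ 0 ≤ K ∧ ∀ M, ‖M - 1‖ < r → g M * g M = M ∧ ContDiffAt ℝ ∞ g M ∧
      ‖fderiv ℝ g M‖ ≤ K ∧ (IsSelfAdjoint M → IsSelfAdjoint (g M)) ∧ ‖g M - 1‖ < 1 / 10 := by
  let f : A → A := fun a => a * a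
  have hf : 𝒞 ω f := contDiff_id.mul contDiff_id
  let L : A ≃L[ℝ] A := ContinuousLinearEquiv.smulLeft (Units.mk0 (2 : ℝ) two_ne_zero)
  have hL : HasFDerivAt f (L : A →L[ℝ] A) 1 := by
    have := (hasFDerivAt_id (𝕜 := ℝ) (1 : A)).mul' (hasFDerivAt_id 1); refine this.congr_fderiv ?_
    ext1 a
    have : L a = (2 : ℝ) • a := rfl; simp [this, two_smul]
  have hω : (ω : WithTop ℕ∞) ≠ 0 := by simp
  have hfa : ContDiffAt ℝ ω f 1 := hf.contDiffAt
  let Φ := hfa.toOpenPartialHomeomorph f hL hω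
  let g := hfa.localInverse hL hω
  have f1 : f 1 = 1 := by simp [f]
  have hg1 : g 1 = 1 := by
    have := hfa.localInverse_apply_image hL hω
    rwa [f1] at this
  have hgc : ContDiffAt ℝ ω g 1 := by
    have := hfa.to_localInverse hL hω
    rwa [f1] at this
  have e1 : ∀ᶠ M in 𝓝 (1 : A), f (g M) = M := by
    have := (hfa.hasStrictFDerivAt' hL hω).eventually_right_inverse
    rwa [f1] at this
  have hsrc : Φ.source ∈ 𝓝 (1 : A) := Φ.open_source.mem_nhds (hfa.mem_toOpenPartialHomeomorph_source hL hω)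
  have hcont : Tendsto g (𝓝 1) (𝓝 1) := by simpa [ContinuousAt, hg1] using hgc.continuousAt
  have e2 : ∀ᶠ M in 𝓝 (1 : A), g M ∈ Φ.source := hcont hsrc
  have hT : Tendsto (fun a : A => star a) (𝓝 1) (𝓝 1) := by
    simpa [ContinuousAt] using (continuous_star (R := A)).continuousAt (x := (1 : A))
  have e3 : ∀ᶠ M in 𝓝 (1 : A), star (g M) ∈ Φ.source := (hT.comp hcont) hsrc
  have e4 : ∀ᶠ M in 𝓝 (1 : A), ContDiffAt ℝ ω g M := hgc.eventually (by simp)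
  have e5 : ∀ᶠ M in 𝓝 (1 : A), ‖fderiv ℝ g M‖ < ‖fderiv ℝ g 1‖ + 1 := by
    have h1 : ContinuousAt (fderiv ℝ g) 1 := (hgc.fderiv_right (m := 0) (by simp)).continuousAt
    exact h1.norm.eventually_lt continuousAt_const (by simp)
  have e6 : ∀ᶠ M in 𝓝 (1 : A), ‖g M - 1‖ < 1 / 10 := by
    have := hcont (Metric.ball_mem_nhds 1 (by norm_num : (0 : ℝ) < 1 / 10)); filter_upwards [this] with M hM; simpa [dist_eq_norm] using hM
  obtain ⟨r, hr, hb⟩ := Metric.eventually_nhds_iff_ball.1 (e1.and (e2.and (e3.and (e4.and (e5.and e6)))))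
  refine ⟨g, ‖fderiv ℝ g 1‖ + 1, r, hr, by positivity, fun M hM => ?_⟩
  obtain ⟨h1, h2, h3, h4, h5, h6⟩ := hb M (by simpa [dist_eq_norm] using hM)
  refine ⟨h1, h4.of_le le_top, h5.le, fun hs => ?_, h6⟩; refine Φ.injOn h3 h2 ?_; change star (g M) * star (g M) = g M * g M
  have h1' : g M * g M = M := h1; rw [← star_mul, h1', hs.star_eq]

end

open Matrix in
/-- Pointwise properties and derivative bounds of the symmetric dreibein. -/
lemma exists_symmetric_dreibein : ∃ (ε K : ℝ), 0 < ε ∧ 0 ≤ K ∧ ∀ (h : MatField) (κ : Space → ℝ), IsMetric h → NearFlat h κ →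
      (∀ x, κ x ≤ ε) → ∃ e : MatField, IsDreibein h e ∧ (∀ x, (e x).PosDef) ∧ (∀ i a x, |e x i a| ≤ 2) ∧
        ∀ j i a x, |pd j (fun y => e y i a) x| ≤ K * (κ x / bracket x ^ 2) := by
  obtain ⟨g, K, r, hr, hK, hg⟩ := exists_local_sqrt (Space →L[ℝ] Space)
  let P : Matrix (Fin 3) (Fin 3) ℝ ≃⋆ₐ[ℝ] (Space →L[ℝ] Space) := toEuclideanCLM (n := Fin 3) (𝕜 := ℝ)
  let E : Fin 3 → Fin 3 → (Space →L[ℝ] Space) := fun i j => P (Matrix.single i j 1)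
  let S : ℝ := ∑ i, ∑ j, ‖E i j‖
  have hS : 0 ≤ S := sum_nonneg fun i _ => sum_nonneg fun j _ => norm_nonneg _
  have hE : ∀ M : Matrix (Fin 3) (Fin 3) ℝ, P M = ∑ i, ∑ j, M i j • E i j := by
    intro M
    conv_lhs => rw [Matrix.matrix_eq_sum_single M]
    simp only [map_sum, E]; refine sum_ext fun i => sum_ext fun j => ?_; rw [← map_smul]; simp
  have hSb : ∀ (c : Fin 3 → Fin 3 → ℝ) (t : ℝ), (∀ i j, |c i j| ≤ t) → ‖∑ i, ∑ j, c i j • E i j‖ ≤ t * S := by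
    intro c t hc; refine (norm_sum_le _ _).trans ?_; simp only [S, mul_sum]
    refine sum_le_sum fun i _ => (norm_sum_le _ _).trans (sum_le_sum fun j _ => ?_); rw [norm_smul]
    exact mul_le_mul_of_nonneg_right (hc i j) (norm_nonneg _)
  refine ⟨r / (12 * (S + 1)), K * (36 * S), by positivity, by positivity, fun h κ hh hf hκ => ?_⟩
  let M : Space → (Space →L[ℝ] Space) := fun x => ∑ i, ∑ j, hInv h i j x • E i j
  have hMP : ∀ x, M x = P (h x)⁻¹ := fun x => (hE _).symm
  have hM1 : ∀ x, ‖M x - 1‖ < r := by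
    intro x
    have e1 : M x - 1 = ∑ i, ∑ j, (hInv h i j x - if i = j then 1 else 0) • E i j := by
      rw [hMP, ← map_one P, ← map_sub, hE]; simp [hInv, Matrix.one_apply]
    rw [e1]; refine (hSb _ _ fun i j => hf.hInv_sub_le hh i j x).trans_lt ?_
    have h1 : κ x / bracket x ≤ r / (12 * (S + 1)) := (div_le_self (hf.nonneg x) (one_le_bracket x)).trans (hκ x)
    calc 6 * (κ x / bracket x) * S ≤ 6 * (r / (12 * (S + 1))) * S := by gcongr
      _ = r * (S / (2 * (S + 1))) := by field_simp; ring
      _ < r * 1 := by refine mul_lt_mul_of_pos_left ?_ hr; rw [div_lt_one (by positivity)]; linarith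
      _ = r := mul_one r
  have hMsm : 𝒞 ∞ M := ContDiff.sum fun i _ => ContDiff.sum fun j _ => (hh.contDiff_hInv i j).smul contDiff_const
  have hMsa : ∀ x, IsSelfAdjoint (M x) := by
    intro x; rw [hMP, IsSelfAdjoint, ← map_star]; congr 1; ext i j; simp only [Matrix.star_apply, star_trivial]; exact hh.hInv_symm j i x
  let G : Space → (Space →L[ℝ] Space) := fun x => g (M x)
  have hGsm : 𝒞 ∞ G := contDiff_iff_contDiffAt.2 fun x => (hg _ (hM1 x)).2.1.comp x hMsm.contDiffAt
  let e : MatField := fun x => P.symm (G x)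
  let ev : Fin 3 → Fin 3 → (Space →L[ℝ] Space) →L[ℝ] ℝ := fun i a =>
    (EuclideanSpace.proj i).comp (ContinuousLinearMap.apply ℝ Space (single a (1 : ℝ)))
  have hev : ∀ i a T, ev i a T = P.symm T i a := by
    intro i a T; obtain ⟨A, rfl⟩ : ∃ A, P A = T := ⟨P.symm T, P.apply_symm_apply T⟩; rw [StarAlgEquiv.symm_apply_apply]
    change (toEuclideanCLM (n := Fin 3) (𝕜 := ℝ) A (single a (1 : ℝ))) i = A i a; rw [Matrix.ofLp_toEuclideanCLM]; simp
  have hevn : ∀ i a T, |ev i a T| ≤ ‖T‖ := by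
    intro i a T; have h1 : |(T (single a (1 : ℝ))) i| ≤ ‖T (single a (1 : ℝ))‖ := PiLp.norm_apply_le (p := 2) (T (single a (1 : ℝ))) i
    have h2 := T.le_opNorm (single a (1 : ℝ)); have h3 : ‖(single a (1 : ℝ) : Space)‖ = 1 := by simp
    rw [h3, mul_one] at h2; exact h1.trans h2
  have hee : ∀ i a, (fun x => e x i a) = fun x => ev i a (G x) := fun i a => by funext x; exact (hev i a (G x)).symm
  have hesa : ∀ x, (e x).IsSymm := by
    intro x
    have h1 : star (e x) = e x := by change star (P.symm (G x)) = P.symm (G x); rw [← map_star, ((hg _ (hM1 x)).2.2.2.1 (hMsa x)).star_eq]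
    ext i j; have := congrFun (congrFun h1 i) j; simpa using this
  refine ⟨e, ⟨fun i a => ?_, fun x i j => ?_⟩, fun x => ?_, fun i a x => ?_, fun j i a x => ?_⟩
  · rw [hee]; exact (ev i a).contDiff.comp hGsm
  · have h1 : e x * e x = (h x)⁻¹ := by
      change P.symm (G x) * P.symm (G x) = _; rw [← map_mul, (hg _ (hM1 x)).1, hMP, StarAlgEquiv.symm_apply_apply]
    rw [hInv, ← h1, Matrix.mul_apply]; exact sum_ext fun a => by rw [(hesa x).apply j a]
  · refine Matrix.PosDef.of_dotProduct_mulVec_pos (by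
      rw [Matrix.IsHermitian, Matrix.conjTranspose_eq_transpose_of_trivial]; exact hesa x) fun v hv => ?_
    have h1 : star v ⬝ᵥ (e x *ᵥ v) = ⟪(WithLp.toLp 2 v : Space), G x (WithLp.toLp 2 v)⟫ := by
      have : G x = P (e x) := (P.apply_symm_apply _).symm; rw [this]
      change _ = ⟪(WithLp.toLp 2 v : Space), toEuclideanCLM (n := Fin 3) (𝕜 := ℝ) (e x) (WithLp.toLp 2 v)⟫
      rw [Matrix.toEuclideanCLM_toLp, EuclideanSpace.inner_toLp_toLp, dotProduct_comm]
    rw [h1]; set w : Space := WithLp.toLp 2 v; have hw : 0 < ‖w‖ := by rw [norm_pos_iff]; intro h0; exact hv ((WithLp.toLp_eq_zero 2).1 h0)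
    have h2 : ⟪w, G x w⟫ = ‖w‖ ^ 2 + ⟪w, (G x - 1) w⟫ := by rw [← real_inner_self_eq_norm_sq, ← inner_add_right]; simp
    have h3 := abs_le.1 (abs_real_inner_le_norm w ((G x - 1) w))
    have h4 : ‖(G x - 1) w‖ ≤ 1 / 10 * ‖w‖ := (G x - 1).le_of_opNorm_le (hg _ (hM1 x)).2.2.2.2.le w; rw [h2]
    nlinarith [mul_le_mul_of_nonneg_left h4 hw.le]
  · have h0 : |ev i a (G x - 1)| ≤ 1 / 10 := (hevn _ _ _).trans (hg _ (hM1 x)).2.2.2.2.le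
    have h1 : |ev i a 1| ≤ 1 := (hevn _ _ _).trans (by simp)
    have h2 : e x i a = ev i a (G x - 1) + ev i a 1 := by rw [map_sub, sub_add_cancel]; exact congrFun (hee i a) x
    rw [h2]; exact (abs_add_le _ _).trans (by linarith)
  · rw [hee, pd_const_clm _ (hGsm.diff x)]; refine (hevn _ _ _).trans ?_
    have h1 : pd j G x = fderiv ℝ g (M x) (pd j M x) := by
      have hd := (hg _ (hM1 x)).2.1.differentiableAt (by simp); have := (hd.hasFDerivAt.comp x (hMsm.diff x).hasFDerivAt).fderiv
      rw [pd, show G = g ∘ M from rfl, this]; rfl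
    have h2 : pd j M x = ∑ i, ∑ k, pd j (hInv h i k) x • E i k := by
      rw [pd_sum fun i _ => ?_]
      · refine sum_ext fun i => ?_; rw [pd_sum fun i _ => ?_]
        · exact sum_ext fun k => pd_smul_const (hh.diff_hInv _ _ _) _ _
        · exact (hh.diff_hInv _ _ _).smul_const _
      · exact DifferentiableAt.fun_sum fun k _ => (hh.diff_hInv _ _ _).smul_const _
    rw [h1]; refine ((fderiv ℝ g (M x)).le_of_opNorm_le (hg _ (hM1 x)).2.2.1 _).trans ?_; rw [mul_assoc]
    refine mul_le_mul_of_nonneg_left ?_ hK; rw [h2]; exact (hSb _ _ fun i k => hf.pd_hInv_le hh j i k x).trans (by linarith)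

lemma norm_spinB_le : ∃ G : ℝ, 0 ≤ G ∧ ∀ (h e : MatField) (j : Fin 3) (x : Space)
    (t : ℝ), (∀ a b, |spinConnection h e j a b x| ≤ t) → ∀ k l, ‖spinB h e j x k l‖ ≤ G * t := by
  let N : Fin 4 → Fin 4 → ℝ := fun k l => ∑ a, ∑ b, ‖(gammaDown a * gammaDown b - gammaDown b * gammaDown a) k l‖
  have hN : ∀ k l, 0 ≤ N k l := fun k l => sum_nonneg fun a _ => sum_nonneg fun b _ => norm_nonneg _
  refine ⟨∑ k, ∑ l, N k l, sum_nonneg fun k _ => sum_nonneg fun l _ => hN k l, fun h e j x t ht k l => ?_⟩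
  have ht0 : 0 ≤ t := (abs_nonneg _).trans (ht 0 0)
  have h1 : ‖spinB h e j x k l‖ ≤ N k l * t := by
    simp only [spinB, Matrix.smul_apply, Matrix.sum_apply, N, sum_mul]; rw [norm_smul]
    refine (mul_le_mul (b := 1) (by norm_num : ‖(1 / 8 : ℂ)‖ ≤ 1) le_rfl (norm_nonneg _) zero_le_one).trans ?_; rw [one_mul]
    refine (norm_sum_le _ _).trans (sum_le_sum fun a _ => (norm_sum_le _ _).trans (sum_le_sum fun b _ => ?_))
    rw [norm_smul, mul_comm]; refine mul_le_mul_of_nonneg_left ?_ (norm_nonneg _); simpa using ht a b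
  refine h1.trans (mul_le_mul_of_nonneg_right ?_ ht0)
  exact (single_le_sum (f := fun l => N k l) (fun l _ => hN k l) (Finset.mem_univ l)).trans
    (single_le_sum (f := fun k => ∑ l, N k l) (fun k _ => sum_nonneg fun l _ => hN k l) (Finset.mem_univ k))

/-- Asymptotically flat metrics have symmetric dreibeins with decaying spin connection. -/
lemma exists_dreibein_spinB_le : ∃ ε CB : ℝ, 0 < ε ∧ 0 < CB ∧ ∀ (σ : ℝ) (h : MatField) (Ch : ℝ), 0 < σ →
      IsMetric h → AsymptoticallyFlat h Ch σ → Ch ≤ ε → ∃ e : MatField, IsDreibein h e ∧ (∀ x, (e x).PosDef) ∧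
          ∀ (j : Fin 3) (x : Space) (k l : Fin 4), ‖spinB h e j x k l‖ ≤ CB * Ch * bracket x ^ (-2 - σ) := by
  obtain ⟨ε, K, hε, hK, hd⟩ := exists_symmetric_dreibein; obtain ⟨G, hG, hspin⟩ := norm_spinB_le
  refine ⟨min ε (1 / 100), G * (36 * K + 1944) + 1, by positivity, by positivity,
    fun σ h Ch hσ hh hf hC => ?_⟩
  have hn := hf.nearFlat hh hσ (hC.trans (min_le_right _ _)); have hC0 := hf.nonneg
  obtain ⟨e, he, hpos, h2, h3⟩ := hd h _ hh hn fun x => by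
    refine le_trans ?_ (hC.trans (min_le_left _ _))
    exact mul_le_of_le_one_right hC0 (Real.rpow_le_one_of_one_le_of_nonpos (one_le_bracket x) (by linarith))
  refine ⟨e, he, hpos, fun j x k l => ?_⟩; set t := Ch * bracket x ^ (-σ) / bracket x ^ 2 with ht; have ht0 : 0 ≤ t := hn.div_nonneg 2 x
  have ht' : t = Ch * bracket x ^ (-2 - σ) := by
    rw [ht, mul_div_assoc, ← Real.rpow_natCast, ← Real.rpow_sub (bracket_pos x)]; congr 2; push_cast; ring
  have hhb : ∀ i j, |h x i j| ≤ 2 := by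
    intro i j; have h0 := (hn.zeroth i j x).trans (hn.div_le x); have := abs_le.1 h0; rw [abs_le]
    split_ifs at this <;> constructor <;> linarith
  have hco : ∀ i a, |coframe e i a x| ≤ 12 := by
    intro i a; rw [he.coframe_eq hh]; exact (abs_sum3_le fun j => abs_mul_le' (h2 j a x) (hhb j i)).trans (by norm_num)
  have hω : ∀ a b, |spinConnection h e j a b x| ≤ (36 * K + 1944) * t := by
    intro a b; rw [IsDreibein.spinConnection_eq, abs_neg]
    have h5 : ∀ i, |pd j (fun y => e y i b) x + ∑ k, Γ h i j k x * e x k b| ≤ K * t + 3 * (9 * t * 2) := fun i =>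
      (abs_add_le _ _).trans (add_le_add (h3 j i b x) (abs_sum3_le fun k => abs_mul_le' (hn.christoffel_le hh i j k x) (h2 k b x)))
    exact (abs_sum3_le fun i => abs_mul_le' (hco i a) (h5 i)).trans (by linarith)
  refine (hspin h e j x _ hω k l).trans ?_; rw [mul_assoc, ← ht', ← mul_assoc]; exact mul_le_mul_of_nonneg_right (by linarith) ht0
end

variable (hf : NearFlat h fun _ => κ)

/-! ### Integration by parts on `ℝ³` -/

lemma integral_fderiv_eq_zero {E : Type*} [NormedAddCommGroup E] [NormedSpace ℝ E]
    [FiniteDimensional ℝ E] [MeasurableSpace E] [BorelSpace E] (μ : Measure E) [μ.IsAddHaarMeasure]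
    {f : E → ℝ} (hf : 𝒞 1 f) (hc : HasCompactSupport f) (v : E) :
    ∫ x, fderiv ℝ f x v ∂μ = 0 := by
  have hd : Continuous fun x => fderiv ℝ f x v := (hf.continuous_fderiv (by simp)).clm_apply continuous_const
  have hdc : HasCompactSupport fun x => fderiv ℝ f x v := .intro hc fun x hx => by simp [fderiv_of_notMem_tsupport ℝ hx]
  have h := integral_mul_fderiv_eq_neg_fderiv_mul_of_integrable (μ := μ) (f := fun _ : E => (1 : ℝ)) (g := f)
    (v := v) (by simp) (by simpa using hd.integrable_of_hasCompactSupport hdc)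
    (by simpa using hf.continuous.integrable_of_hasCompactSupport hc)
    (fun x _ => differentiableAt_const _) (fun x _ => (hf.diff).differentiableAt)
  simpa using h

lemma integral_pd_eq_zero {f : Space → ℝ} (hf : 𝒞 1 f) (hc : HasCompactSupport f) (i : Fin 3) : ∫ x, pd i f x = 0 :=
  integral_fderiv_eq_zero volume hf hc _

lemma integrable_pd {f : Space → ℝ} (hf : 𝒞 1 f) (hc : HasCompactSupport f) (i : Fin 3) : Integrable (pd i f) :=
  (ContDiff.pd (m := 0) hf (by simp) i).continuous.integrable_of_hasCompactSupport
    (.intro hc fun x hx => by simp [pd, fderiv_of_notMem_tsupport ℝ hx])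

lemma integral_le_of_le_add_div {f g : Space → ℝ} {Q : Fin 3 → Space → ℝ} (hf : Integrable f)
    (hg : Integrable g) (hQ : ∀ i, 𝒞 1 (Q i)) (hQc : ∀ i, HasCompactSupport (Q i))
    (h : ∀ x, f x ≤ g x + ∑ i, pd i (Q i) x) : ∫ x, f x ≤ ∫ x, g x := by
  have h1 : Integrable fun x => ∑ i, pd i (Q i) x := integrable_finsetSum _ fun i _ => integrable_pd (hQ i) (hQc i) i
  refine (integral_mono hf (hg.add h1) h).trans (le_of_eq ?_); simp only [Pi.add_apply]
  rw [integral_add hg h1, integral_finsetSum _ fun i _ => integrable_pd (hQ i) (hQc i) i]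
  simp [fun i => integral_pd_eq_zero (hQ i) (hQc i) i]

lemma integral_eq_of_eq_add_div {f g : Space → ℝ} {Q : Fin 3 → Space → ℝ} (hf : Integrable f)
    (hg : Integrable g) (hQ : ∀ i, 𝒞 1 (Q i)) (hQc : ∀ i, HasCompactSupport (Q i))
    (h : ∀ x, f x = g x + ∑ i, pd i (Q i) x) : ∫ x, f x = ∫ x, g x := by
  refine le_antisymm (integral_le_of_le_add_div hf hg hQ hQc fun x => (h x).le) ?_
  refine integral_le_of_le_add_div (Q := fun i x => -Q i x) hg hf (fun i => (hQ i).neg) (fun i => (hQc i).neg) fun x => ?_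
  simp only [pd_neg, sum_neg_distrib, h x]; linarith

lemma integrable_of_eq_zero {f : Space → ℝ} {G : Type*} [NormedAddCommGroup G] {φ : Space → G}
    (hf : Continuous f) (hc : HasCompactSupport φ) (h : ∀ x, x ∉ tsupport φ → f x = 0) :
    Integrable f :=
  hf.integrable_of_hasCompactSupport (.intro hc h)

lemma abs_sum_inner_le {F : Type*} [NormedAddCommGroup F] [InnerProductSpace ℝ F]
    {a : Fin 3 → Fin 3 → ℝ} {t : ℝ} (ha : ∀ i j, |a i j| ≤ t) (v w : Fin 3 → F) :
    |∑ i, ∑ j, a i j * ⟪v i, w j⟫| ≤ t * (3 / 2 * (∑ i, ‖v i‖ ^ 2 + ∑ i, ‖w i‖ ^ 2)) := by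
  have ht : 0 ≤ t := (abs_nonneg _).trans (ha 0 0)
  have h1 : ∀ i j, |a i j * ⟪v i, w j⟫| ≤ t * (1 / 2 * (‖v i‖ ^ 2 + ‖w j‖ ^ 2)) := by
    intro i j; refine abs_mul_le' (ha i j) ((abs_real_inner_le_norm _ _).trans ?_); nlinarith [sq_nonneg (‖v i‖ - ‖w j‖)]
  refine (Finset.abs_sum_le_sum_abs _ _).trans ((sum_le_sum fun i _ =>
    (Finset.abs_sum_le_sum_abs _ _).trans (sum_le_sum fun j _ => h1 i j)).trans (le_of_eq ?_))
  simp only [Fin.sum_univ_three]; ring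

namespace CliffordRep

lemma inner_B (j : Fin 3) (x : Space) (v w : F) : ⟪c.B h e j x v, w⟫ = - ⟪v, c.B h e j x w⟫ := by
  simp only [B, sum_apply, smul_apply, sum_inner, inner_sum, inner_smul_left, inner_smul_right, c.inner_sgen]; simp

lemma inner_A (j : Fin 3) (x : Space) (v w : F) : ⟪c.A e j x v, w⟫ = ⟪v, c.A e j x w⟫ := by
  simp only [A, sum_apply, smul_apply, sum_inner, inner_sum, inner_smul_left, inner_smul_right, c.inner_al]; simp

lemma norm_al (a : Fin 3) (v : F) : ‖c.al a v‖ = ‖v‖ := by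
  have h1 : c.al a (c.al a v) = v := congrArg (fun T : F →L[ℝ] F => T v) (c.al_sq a)
  have h2 : ‖c.al a v‖ ^ 2 = ‖v‖ ^ 2 := by rw [← real_inner_self_eq_norm_sq, c.inner_al, h1, real_inner_self_eq_norm_sq]
  exact (pow_left_inj₀ (norm_nonneg _) (norm_nonneg _) two_ne_zero).1 h2

lemma norm_J (v : F) : ‖c.J v‖ = ‖v‖ := by
  have h2 : ‖c.J v‖ ^ 2 = ‖v‖ ^ 2 := by
    rw [← real_inner_self_eq_norm_sq, c.inner_J, c.J_J, inner_neg_right, neg_neg, real_inner_self_eq_norm_sq]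
  exact (pow_left_inj₀ (norm_nonneg _) (norm_nonneg _) two_ne_zero).1 h2

lemma pd_inner_D {x : Space} (hφ : DiffAt φ x) (hψ : DiffAt ψ x) (k : Fin 3) : pd k (fun y => ⟪φ y, ψ y⟫) x
      = ⟪c.D h e k φ x, ψ x⟫ + ⟪φ x, c.D h e k ψ x⟫ := by
  rw [pd_inner hφ hψ, D, D, inner_add_left, inner_add_right, c.inner_B]; ring

lemma D_smul {f : Space → ℝ} {x : Space} (hf : DiffAt f x) (hφ : DiffAt φ x) (k : Fin 3) :
    c.D h e k (fun y => f y • φ y) x = pd k f x • φ x + f x • c.D h e k φ x := by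
  rw [D, D, pd_smul hf hφ, map_smul, smul_add, add_assoc]

lemma D_add {x : Space} (hφ : DiffAt φ x) (hψ : DiffAt ψ x) (k : Fin 3) :
    c.D h e k (fun y => φ y + ψ y) x = c.D h e k φ x + c.D h e k ψ x := by
  rw [D, D, D, pd_add hφ hψ, map_add]; abel

lemma D_sum {ι : Type*} {s : Finset ι} {φ : ι → Space → F} {x : Space} (hφ : ∀ i ∈ s, DiffAt (φ i) x) (k : Fin 3) :
    c.D h e k (fun y => ∑ i ∈ s, φ i y) x = ∑ i ∈ s, c.D h e k (φ i) x := by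
  simp only [D, pd_sum hφ, map_sum, sum_add_distrib]

lemma D_J {x : Space} (hφ : DiffAt φ x) (k : Fin 3) : c.D h e k (fun y => c.J (φ y)) x = c.J (c.D h e k φ x) := by
  rw [D, D, pd_const_clm c.J hφ, c.B_J, map_add]

include hh he

lemma D_A {x : Space} (hφ : DiffAt φ x) (i k : Fin 3) : c.D h e i (fun y => c.A e k y (φ y)) x
      = c.A e k x (c.D h e i φ x) - ∑ l, Γ h k i l x • c.A e l x (φ x) := by
  rw [D, D, pd_clm_apply (c.diff_A he k x) hφ, c.pd_A hh he]; simp only [sub_apply, mul_apply_eq_comp, sum_apply, smul_apply, map_add]; abel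

lemma sum_D_A {x : Space} (hφ : DiffAt φ x) : ∑ i, c.D h e i (fun y => 𝔳 h y • c.A e i y (φ y)) x = 𝔳 h x • c.H0 h e φ x := by
  have h1 : ∀ i, c.D h e i (fun y => 𝔳 h y • c.A e i y (φ y)) x = (𝔳 h x * ∑ l, Γ h l l i x) • c.A e i x (φ x)
        + 𝔳 h x • (c.A e i x (c.D h e i φ x) - ∑ l, Γ h i i l x • c.A e l x (φ x)) := by
    intro i; rw [c.D_smul (hh.diff_vol x) ((c.diff_A he i x).clm_apply hφ), hh.pd_vol, c.D_A hh he hφ]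
  simp only [h1, H0, smul_sub, sum_add_distrib, sum_sub_distrib, smul_sum]
  have h2 : ∑ i, ∑ l, 𝔳 h x • Γ h i i l x • c.A e l x (φ x) = ∑ i, (𝔳 h x * ∑ l, Γ h l l i x) • c.A e i x (φ x) := by
    rw [sum_comm]; refine sum_ext fun i => ?_; simp only [mul_sum, sum_smul, smul_smul]
  rw [h2]; abel

/-- The Dirac operator is formally self-adjoint. -/
lemma inner_H_sub (m : ℝ) {x : Space} (hφ : DiffAt φ x) (hψ : DiffAt ψ x) : 𝔳 h x * ⟪c.H h e m φ x, ψ x⟫ = 𝔳 h x * ⟪φ x, c.H h e m ψ x⟫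
      + ∑ i, pd i (fun y => -⟪c.J (𝔳 h y • c.A e i y (φ y)), ψ y⟫) x := by
  have hd : ∀ i, DiffAt (fun y => 𝔳 h y • c.A e i y (φ y)) x := fun i => (hh.diff_vol x).smul ((c.diff_A he i x).clm_apply hφ)
  have h1 : ∀ i, pd i (fun y => -⟪c.J (𝔳 h y • c.A e i y (φ y)), ψ y⟫) x
      = -(⟪c.J (c.D h e i (fun y => 𝔳 h y • c.A e i y (φ y)) x), ψ x⟫ - 𝔳 h x * ⟪φ x, c.J (c.A e i x (c.D h e i ψ x))⟫) := by
    intro i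
    have h2 : ⟪c.J (c.A e i x (φ x)), c.D h e i ψ x⟫ = -⟪φ x, c.J (c.A e i x (c.D h e i ψ x))⟫ := by rw [c.inner_J, c.inner_A, c.A_J]
    rw [pd_neg, c.pd_inner_D (h := h) (e := e)
      (φ := fun y => c.J (𝔳 h y • c.A e i y (φ y))) (c.J.differentiableAt.comp x (hd i)) hψ, c.D_J (hd i), map_smul, real_inner_smul_left, h2]
    ring
  simp only [h1, sum_neg_distrib, sum_sub_distrib]; rw [← sum_inner, ← map_sum, c.sum_D_A hh he hφ, ← mul_sum, ← inner_sum, ← map_sum]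
  simp only [H, inner_sub_left, inner_sub_right, inner_neg_left, inner_neg_right, map_smul,
    real_inner_smul_left, real_inner_smul_right, c.inner_bt, H0]
  ring

lemma integral_inner_H (m : ℝ) (hφ : 𝒞 1 φ) (hψ : 𝒞 1 ψ) (hc : HasCompactSupport φ) :
    ∫ x, 𝔳 h x * ⟪c.H h e m φ x, ψ x⟫ = ∫ x, 𝔳 h x * ⟪φ x, c.H h e m ψ x⟫ := by
  have hD : ∀ {φ : Space → F}, 𝒞 1 φ → ∀ j, Continuous (c.D h e j φ) := fun hφ j =>
    (c.contDiff_D hh he (k := 0) hφ (by simp) (by simp) j).continuous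
  have hH : ∀ {φ : Space → F}, 𝒞 1 φ → Continuous (c.H h e m φ) := fun {φ} hφ => by
    have h1 : Continuous (c.H0 h e φ) := continuous_finsetSum _ fun j _ => (c.contDiff_A he j).continuous.clm_apply (hD hφ j)
    exact (c.J.continuous.comp h1).neg.sub ((c.bt.continuous.comp hφ.continuous).const_smul m)
  have hvol := hh.contDiff_volDensity
  refine integral_eq_of_eq_add_div (integrable_of_eq_zero (hvol.continuous.mul ((hH hφ).inner hψ.continuous)) hc fun x hx => ?_)
    (integrable_of_eq_zero (hvol.continuous.mul (hφ.continuous.inner (hH hψ))) hc fun x hx => ?_)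
    (Q := fun i y => -⟪c.J (𝔳 h y • c.A e i y (φ y)), ψ y⟫)
    (fun i => ?_) (fun i => ?_)
    fun x => c.inner_H_sub hh he m (hφ.diff x) (hψ.diff x)
  · simp [H, H0, D, pd, fderiv_of_notMem_tsupport ℝ hx, off_tsupport hx]
  · simp [off_tsupport hx]
  · exact ((c.J.contDiff.comp ((hvol.of_le (by simp)).smul (((c.contDiff_A he i).of_le (by simp)).clm_apply hφ))).inner ℝ hψ).neg
  · exact .intro hc fun x hx => by simp [off_tsupport hx]

end CliffordRep

lemma contDiff_bracket : 𝒞 ∞ bracket := by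
  have h1 : 𝒞 ∞ fun x : Space => 1 + ‖x‖ ^ 2 := contDiff_const.add (contDiff_norm_sq ℝ); exact h1.sqrt fun x => by positivity

lemma sum_coord_sq (x : Space) : ∑ i, x i ^ 2 = ‖x‖ ^ 2 := (EuclideanSpace.real_norm_sq_eq x).symm

lemma pd_coord (i j : Fin 3) (x : Space) : pd i (fun y : Space => y j) x = if i = j then 1 else 0 := by
  have h1 : (fun y : Space => y j) = fun y => (EuclideanSpace.proj j : Space →L[ℝ] ℝ) y := rfl
  rw [h1, pd, ContinuousLinearMap.fderiv]; simp [eq_comm]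

lemma contDiff_coord (j : Fin 3) : 𝒞 ∞ (fun y : Space => y j) := (EuclideanSpace.proj j : Space →L[ℝ] ℝ).contDiff

/-- The derivative of a function of `s² + |x|²`. -/
lemma pd_comp_norm_sq {f f' : ℝ → ℝ} {x : Space} (hf : HasDerivAt f (f' (s ^ 2 + ‖x‖ ^ 2)) (s ^ 2 + ‖x‖ ^ 2)) (i : Fin 3) :
    pd i (fun y : Space => f (s ^ 2 + ‖y‖ ^ 2)) x = 2 * x i * f' (s ^ 2 + ‖x‖ ^ 2) := by
  have h1 : HasFDerivAt (fun y : Space => s ^ 2 + ‖y‖ ^ 2) (2 • innerSL ℝ x) x := (hasStrictFDerivAt_norm_sq x).hasFDerivAt.const_add _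
  have h2 := hf.comp_hasFDerivAt x h1; rw [pd]; change fderiv ℝ (f ∘ fun y : Space => s ^ 2 + ‖y‖ ^ 2) x _ = _; rw [h2.fderiv]
  simp [EuclideanSpace.inner_single_right]; ring

lemma integrable_inv_bracket_sq_mul (hφ : Continuous φ) (hc : HasCompactSupport φ) : Integrable fun x => (bracket x ^ 2)⁻¹ * ‖φ x‖ ^ 2 :=
  integrable_of_eq_zero (((contDiff_bracket.continuous.pow 2).inv₀ fun x => (pow_pos (bracket_pos x) 2).ne').mul
    (hφ.norm.pow 2)) hc fun x hx => by simp [off_tsupport hx]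

namespace CliffordRep

/-- The flat squared length of the covariant gradient. -/
def gradSq (h e : MatField) (φ : Space → F) (x : Space) : ℝ := ∑ k, ‖c.D h e k φ x‖ ^ 2

lemma gradSq_nonneg (φ : Space → F) (x : Space) : 0 ≤ c.gradSq h e φ x := sum_nonneg fun _ _ => sq_nonneg _

lemma D_eq_zero {x : Space} (hx : x ∉ tsupport φ) (k : Fin 3) : c.D h e k φ x = 0 := by
  simp [D, pd, fderiv_of_notMem_tsupport ℝ hx, off_tsupport hx]

lemma gradSq_eq_zero {x : Space} (hx : x ∉ tsupport φ) : c.gradSq h e φ x = 0 := by simp [gradSq, c.D_eq_zero hx]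

lemma H_eq_zero (m : ℝ) {x : Space} (hx : x ∉ tsupport φ) : c.H h e m φ x = 0 := by simp [H, H0, c.D_eq_zero hx, off_tsupport hx]

/-- The covariant flux `√h h^{kj} D_j φ`. -/
def flux (h e : MatField) (k : Fin 3) (φ : Space → F) (x : Space) : F := ∑ j, (𝔳 h x * hInv h k j x) • c.D h e j φ x

lemma flux_eq_zero {x : Space} (hx : x ∉ tsupport φ) (k : Fin 3) : c.flux h e k φ x = 0 := by simp [flux, c.D_eq_zero hx]

include hh he

lemma continuous_D (hφ : 𝒞 1 φ) (j : Fin 3) : Continuous (c.D h e j φ) := (c.contDiff_D hh he (k := 0) hφ (by simp) (by simp) j).continuous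

lemma contDiff_H (m : ℝ) {n : WithTop ℕ∞} (hφ : 𝒞 (n + 1) φ) (hn : n ≤ (⊤ : ℕ∞)) : 𝒞 n (c.H h e m φ) := by
  have h1 : 𝒞 n (c.H0 h e φ) := ContDiff.sum fun j _ => ((c.contDiff_A he j).of_le hn).clm_apply (c.contDiff_D hh he hφ le_rfl hn j)
  exact (c.J.contDiff.comp h1).neg.sub ((c.bt.contDiff.comp (hφ.of_le (by simp))).const_smul m)

lemma continuous_gradSq (hφ : 𝒞 1 φ) : Continuous (c.gradSq h e φ) :=
  continuous_finsetSum _ fun k _ => (c.continuous_D hh he hφ k).norm.pow 2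

lemma integrable_gradSq (hφ : 𝒞 1 φ) (hc : HasCompactSupport φ) : Integrable (c.gradSq h e φ) :=
  integrable_of_eq_zero (c.continuous_gradSq hh he hφ) hc fun x hx => c.gradSq_eq_zero hx

lemma contDiff_flux {n : WithTop ℕ∞} (hφ : 𝒞 (n + 1) φ) (hn : n ≤ (⊤ : ℕ∞)) (k : Fin 3) : 𝒞 n (c.flux h e k φ) :=
  ContDiff.sum fun j _ => ((hh.contDiff_volDensity.of_le hn).mul ((hh.contDiff_hInv k j).of_le hn)).smul (c.contDiff_D hh he hφ le_rfl hn j)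

lemma sum_D_flux (hφ : 𝒞 2 φ) (x : Space) : ∑ k, c.D h e k (c.flux h e k φ) x = 𝔳 h x • c.lap h e φ x := by
  have hD := fun k => c.diff_D hh he hφ k x
  have hw : ∀ k j, DiffAt (fun y => 𝔳 h y * hInv h k j y) x := fun k j => (hh.diff_vol x).mul (hh.diff_hInv k j x)
  have h1 : ∀ k, c.D h e k (c.flux h e k φ) x = ∑ j, pd k (fun y => 𝔳 h y * hInv h k j y) x • c.D h e j φ x
      + ∑ j, (𝔳 h x * hInv h k j x) • c.D h e k (c.D h e j φ) x := by
    intro k; have : c.flux h e k φ = fun y => ∑ j, (𝔳 h y * hInv h k j y) • c.D h e j φ y := rfl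
    rw [this, c.D_sum (fun j _ => (hw k j).fun_smul (hD j)), ← sum_add_distrib]; exact sum_ext fun j => c.D_smul (hw k j) (hD j) k
  have h2 : ∑ k, ∑ j, pd k (fun y => 𝔳 h y * hInv h k j y) x • c.D h e j φ x
      = - ∑ j, (𝔳 h x * ∑ i, ∑ k, hInv h i k x * Γ h j i k x) • c.D h e j φ x := by
    rw [sum_comm, ← sum_neg_distrib]; refine sum_ext fun j => ?_; rw [← sum_smul, hh.sum_pd_vol_hInv, neg_mul, neg_smul]
  simp only [h1, sum_add_distrib, h2, lap, D2, smul_sub, sum_sub_distrib, smul_sum, smul_smul]; rw [neg_add_eq_sub]; congr 1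
  · rw [sum_comm]; refine sum_ext fun i => sum_ext fun j => ?_; rw [hh.hInv_symm j i]; rfl
  · simp only [mul_sum, sum_smul]; rw [sum_comm]; refine sum_ext fun i => ?_; rw [sum_comm]
    refine sum_ext fun j => sum_ext fun l => ?_; rw [hh.christoffel_symm l i j]

lemma inner_lap (hφ : 𝒞 2 φ) {x : Space} (hψ : DiffAt ψ x) : -(𝔳 h x * ⟪c.lap h e φ x, ψ x⟫) = ∑ k, ⟪c.flux h e k φ x, c.D h e k ψ x⟫
      + ∑ k, pd k (fun y => -⟪c.flux h e k φ y, ψ y⟫) x := by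
  have hd : ∀ k, DiffAt (c.flux h e k φ) x := fun k => (c.contDiff_flux hh he (n := 1) hφ (by norm_cast) k).diff x
  simp only [pd_neg, fun k => c.pd_inner_D (h := h) (e := e) (hd k) hψ k, sum_neg_distrib,
    sum_add_distrib, ← sum_inner, c.sum_D_flux hh he hφ x, real_inner_smul_left]
  ring

end CliffordRep

lemma NearFlat.const_div_le (hf : NearFlat h fun _ => κ) (x : Space) : κ / bracket x ≤ κ := div_le_self (hf.nonneg 0) (one_le_bracket x)

lemma NearFlat.vol_mul_hInv_sub_le (hh : IsMetric h) (hf : NearFlat h fun _ => κ) (i j : Fin 3) (x : Space) :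
    |𝔳 h x * hInv h i j x - if i = j then 1 else 0| ≤ 32 * (κ / bracket x) := by
  have h1 := hf.vol_sub_le x; have h2 := hf.hInv_sub_le hh i j x; have h3 := hf.hInv_le hh i j x
  have e1 : 𝔳 h x * hInv h i j x - (if i = j then 1 else 0)
      = (𝔳 h x - 1) * hInv h i j x + (hInv h i j x - if i = j then 1 else 0) := by ring
  rw [e1]; refine (abs_add_le _ _).trans ((add_le_add (abs_mul_le' h1 h3) h2).trans ?_); have := hf.div_nonneg 1 x
  simp only [pow_one] at this; linarith

namespace CliffordRep

/-- Comparison of the flux pairing with its flat counterpart. -/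
lemma sum_inner_flux_sub (hh : IsMetric h) (hf : NearFlat h fun _ => κ) (φ : Space → F) (ψ : Fin 3 → F) (x : Space) :
    |∑ k, ⟪c.flux h e k φ x, ψ k⟫ - ∑ k, ⟪c.D h e k φ x, ψ k⟫| ≤ 48 * (κ / bracket x) * (c.gradSq h e φ x + ∑ k, ‖ψ k‖ ^ 2) := by
  have e1 : ∑ k, ⟪c.flux h e k φ x, ψ k⟫ - ∑ k, ⟪c.D h e k φ x, ψ k⟫
      = ∑ j, ∑ k, (𝔳 h x * hInv h k j x - if k = j then 1 else 0) * ⟪c.D h e j φ x, ψ k⟫ := by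
    simp only [flux, sum_inner, real_inner_smul_left, sub_mul, sum_sub_distrib]; congr 1
    · rw [sum_comm]
    · simp
  rw [e1]; refine (abs_sum_inner_le (fun j k => hf.vol_mul_hInv_sub_le hh k j x) _ _).trans (le_of_eq ?_); rw [gradSq]; ring

include hh he in
/-- The Hardy inequality. -/
lemma integral_hardy (hφ : 𝒞 1 φ) (hc : HasCompactSupport φ) : ∫ x, (bracket x ^ 2)⁻¹ * ‖φ x‖ ^ 2 ≤ 4 * ∫ x, c.gradSq h e φ x := by
  have hbs : 𝒞 ∞ fun x : Space => (1 + ‖x‖ ^ 2)⁻¹ := (contDiff_const.add (contDiff_norm_sq ℝ)).inv fun x => by positivity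
  have i1 := integrable_inv_bracket_sq_mul hφ.continuous hc; have i2 := c.integrable_gradSq hh he hφ hc; rw [← integral_const_mul]
  refine integral_le_of_le_add_div (Q := fun i x => (2 * (x i * (1 + ‖x‖ ^ 2)⁻¹)) * ⟪φ x, φ x⟫) i1 (i2.const_mul 4)
    (fun i => ?_) (fun i => ?_) fun x => ?_
  · exact (contDiff_const.mul (((contDiff_coord i).mul hbs).of_le (by simp))).mul (hφ.inner ℝ hφ)
  · exact .intro hc fun x hx => by simp [off_tsupport hx]
  · have hd := hφ.diff x; set B := (1 + ‖x‖ ^ 2)⁻¹ with hB; have hpos : 0 < 1 + ‖x‖ ^ 2 := by positivity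
    have hBpos : 0 < B := by positivity
    have hBx : B * (1 + ‖x‖ ^ 2) = 1 := inv_mul_cancel₀ hpos.ne'
    have d1 : ∀ i, pd i (fun y : Space => (1 + ‖y‖ ^ 2)⁻¹) x = -(2 * x i * B ^ 2) := by
      intro i; have := pd_comp_norm_sq (f := fun r => r⁻¹) (f' := fun r => -(r ^ 2)⁻¹) (s := 1) (x := x) (hasDerivAt_inv (by positivity)) i
      simp only [one_pow] at this; rw [this, hB, inv_pow]; ring
    have hcd : ∀ i : Fin 3, DiffAt (fun y : Space => y i) x := fun i => (contDiff_coord i).diff x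
    have hBd : DiffAt (fun y : Space => (1 + ‖y‖ ^ 2)⁻¹) x := hbs.diff x
    have d2 : ∀ i, pd i (fun y : Space => (2 * (y i * (1 + ‖y‖ ^ 2)⁻¹)) * ⟪φ y, φ y⟫) x
        = 2 * (B - 2 * x i ^ 2 * B ^ 2) * ‖φ x‖ ^ 2 + 4 * x i * B * ⟪c.D h e i φ x, φ x⟫ := by
      intro i
      rw [pd_mul (((hcd i).fun_mul hBd).const_mul 2) (hd.inner ℝ hd), pd_const_mul _ ((hcd i).fun_mul hBd),
        pd_mul (hcd i) hBd, pd_coord, d1, c.pd_inner_D (h := h) (e := e) hd hd, real_inner_self_eq_norm_sq,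
        real_inner_comm (c.D h e i φ x) (φ x)]
      simp only [if_true]; ring
    rw [bracket_sq, ← hB]; simp only [d2, sum_add_distrib]
    have h3 : ∑ i : Fin 3, 2 * (B - 2 * x i ^ 2 * B ^ 2) * ‖φ x‖ ^ 2 = (6 * B - 4 * ‖x‖ ^ 2 * B ^ 2) * ‖φ x‖ ^ 2 := by
      rw [← sum_coord_sq x]; simp only [Fin.sum_univ_three]; ring
    have h4 : ∀ i : Fin 3, -(4 * x i * B * ⟪c.D h e i φ x, φ x⟫) ≤ 4 * ‖c.D h e i φ x‖ ^ 2 + x i ^ 2 * B ^ 2 * ‖φ x‖ ^ 2 := by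
      intro i; have h5 := abs_le.1 (abs_real_inner_le_norm (c.D h e i φ x) (φ x))
      have h6 : |x i * B * ⟪c.D h e i φ x, φ x⟫| ≤ |x i * B| * (‖c.D h e i φ x‖ * ‖φ x‖) := by
        rw [abs_mul]; exact mul_le_mul_of_nonneg_left (abs_real_inner_le_norm _ _) (abs_nonneg _)
      have h7 := abs_le.1 h6; have h8 : |x i * B| ^ 2 = x i ^ 2 * B ^ 2 := by rw [sq_abs]; ring
      nlinarith [sq_nonneg (2 * ‖c.D h e i φ x‖ - |x i * B| * ‖φ x‖)]
    have h5 : -(∑ i, 4 * x i * B * ⟪c.D h e i φ x, φ x⟫) ≤ 4 * c.gradSq h e φ x + ‖x‖ ^ 2 * B ^ 2 * ‖φ x‖ ^ 2 := by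
      rw [← sum_neg_distrib]; refine (sum_le_sum fun i _ => h4 i).trans (le_of_eq ?_)
      rw [sum_add_distrib, ← mul_sum, ← sum_mul, ← sum_mul, sum_coord_sq, gradSq]
    rw [h3]; have h6 : ‖x‖ ^ 2 * B ^ 2 = B - B ^ 2 := by linear_combination B * hBx
    nlinarith [mul_nonneg (sq_nonneg B) (sq_nonneg ‖φ x‖), mul_nonneg hBpos.le (sq_nonneg ‖φ x‖), congrArg (fun t => t * ‖φ x‖ ^ 2) h6]

include hh he hf in
/-- The Dirac operator controls the covariant gradient. -/
lemma integral_gradSq_le [Nontrivial F] (hκ : κ ≤ 1 / 10 ^ 6) (m : ℝ) (hφ : 𝒞 2 φ) (hc : HasCompactSupport φ) :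
    ∫ x, c.gradSq h e φ x ≤ 2 * ∫ x, 𝔳 h x * ‖c.H h e m φ x‖ ^ 2 := by
  have hφ1 : 𝒞 1 φ := hφ.of_le (by norm_num); have hH : 𝒞 1 (c.H h e m φ) := c.contDiff_H hh he m hφ (by norm_cast)
  have hκ0 := hf.nonneg 0; have hhardy := c.integral_hardy hh he hφ1 hc; have i1 := integrable_inv_bracket_sq_mul hφ.continuous hc
  have i2 := c.integrable_gradSq hh he hφ1 hc
  have i3 : Integrable fun x => 𝔳 h x * ⟪c.H h e m (c.H h e m φ) x, φ x⟫ := integrable_of_eq_zero (hh.contDiff_volDensity.continuous.mul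
      ((c.contDiff_H hh he m (n := 0) hH (by simp)).continuous.inner hφ.continuous)) hc fun x hx => by
      simp [off_tsupport hx]
  have e1 : ∫ x, 𝔳 h x * ‖c.H h e m φ x‖ ^ 2 = ∫ x, 𝔳 h x * ⟪c.H h e m (c.H h e m φ) x, φ x⟫ := by
    rw [c.integral_inner_H hh he m hH hφ1 (.intro hc fun x hx => c.H_eq_zero m hx)]; simp only [real_inner_self_eq_norm_sq]
  have key : ∫ x, (1 / 2 + 1 / 4) * c.gradSq h e φ x ≤
      ∫ x, (𝔳 h x * ⟪c.H h e m (c.H h e m φ) x, φ x⟫ + 1 / 40 * ((bracket x ^ 2)⁻¹ * ‖φ x‖ ^ 2)) := by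
    refine integral_le_of_le_add_div (i2.const_mul _) (i3.add (i1.const_mul _))
      (Q := fun k y => ⟪c.flux h e k φ y, φ y⟫) (fun k => ?_) (fun k => ?_) fun x => ?_
    · exact (c.contDiff_flux hh he (n := 1) hφ (by norm_cast) k).inner ℝ hφ1
    · exact .intro hc fun x hx => by simp [off_tsupport hx]
    · have h1 := c.inner_lap hh he hφ (hφ1.diff x); have h2 := abs_le.1 (c.sum_inner_flux_sub (e := e) hh hf φ (fun k => c.D h e k φ x) x)
      have h3 : ∑ k, ⟪c.D h e k φ x, c.D h e k φ x⟫ = c.gradSq h e φ x := by simp only [real_inner_self_eq_norm_sq, gradSq]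
      rw [h3, show ∑ k, ‖c.D h e k φ x‖ ^ 2 = c.gradSq h e φ x from rfl] at h2; have h4 := c.H_H hh he m hφ x
      have h5 : ⟪c.H h e m (c.H h e m φ) x, φ x⟫ = m ^ 2 * ‖φ x‖ ^ 2 - ⟪c.lap h e φ x, φ x⟫ + 1 / 4 * scalarCurvature h x * ‖φ x‖ ^ 2 := by
        rw [h4, inner_add_left, inner_sub_left, real_inner_smul_left, real_inner_smul_left, real_inner_self_eq_norm_sq]
      have hv := hh.volDensity_pos x
      have h6 : |𝔳 h x * (1 / 4 * scalarCurvature h x)| ≤ 1 / 40 * (bracket x ^ 2)⁻¹ := by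
        have a1 : |𝔳 h x| ≤ 2 := by rw [abs_of_pos hv]; exact hf.vol_le x
        have a2 : |1 / 4 * scalarCurvature h x| ≤ 1 / 4 * (30000 * (κ / bracket x ^ 3)) :=
          abs_mul_le' (by norm_num) (hf.scalarCurvature_le hh x)
        refine (abs_mul_le' a1 a2).trans ?_
        have a3 : κ / bracket x ^ 3 ≤ κ * (bracket x ^ 2)⁻¹ := by
          simpa [div_eq_mul_inv] using hf.div_pow_le (n := 2) (m := 3) (by norm_num) x
        have a4 : 0 ≤ (bracket x ^ 2)⁻¹ := inv_nonneg.2 (pow_nonneg (bracket_pos x).le 2); nlinarith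
      have h7 := (abs_le.1 h6).1; have h8 : 0 ≤ c.gradSq h e φ x := c.gradSq_nonneg φ x; have h9 := hf.const_div_le x
      have h10 : 48 * (κ / bracket x) * (c.gradSq h e φ x + c.gradSq h e φ x) ≤ 1 / 4 * c.gradSq h e φ x := by nlinarith
      have h11 : 0 ≤ 𝔳 h x * (m ^ 2 * ‖φ x‖ ^ 2) := by positivity
      have h12 := mul_le_mul_of_nonneg_right h7 (sq_nonneg ‖φ x‖); simp only [pd_neg, sum_neg_distrib] at h1; rw [h5]; nlinarith
  rw [integral_const_mul, integral_add i3 (i1.const_mul _), integral_const_mul] at key; rw [e1]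
  have : 0 ≤ ∫ x, c.gradSq h e φ x := integral_nonneg fun x => c.gradSq_nonneg φ x; linarith

end CliffordRep

lemma pd_pow {f : Space → ℝ} {x : Space} (hf : DiffAt f x) (n : ℕ) (i : Fin 3) :
    pd i (fun y => f y ^ n) x = n * f x ^ (n - 1) * pd i f x := by
  rw [pd, fderiv_fun_pow n hf]; simp [pd]

/-- The weight `(s² + |x|²)^{-1/2}`. -/
def wgt (s : ℝ) (x : Space) : ℝ := (√(s ^ 2 + ‖x‖ ^ 2))⁻¹

section wgt

include hs

lemma radicand_pos (x : Space) : 0 < s ^ 2 + ‖x‖ ^ 2 := by positivity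

lemma wgt_pos (x : Space) : 0 < wgt s x := inv_pos.2 (Real.sqrt_pos.2 (radicand_pos hs x))

lemma wgt_sq_mul (x : Space) : wgt s x ^ 2 * (s ^ 2 + ‖x‖ ^ 2) = 1 := by
  rw [wgt, inv_pow, Real.sq_sqrt (radicand_pos hs x).le]; exact inv_mul_cancel₀ (radicand_pos hs x).ne'

lemma wgt_le (x : Space) : wgt s x ≤ (bracket x)⁻¹ := by refine inv_anti₀ (bracket_pos x) (Real.sqrt_le_sqrt ?_); nlinarith

lemma mul_wgt_le_one (x : Space) : s * wgt s x ≤ 1 := by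
  have h1 := wgt_sq_mul hs x; have h2 := wgt_pos hs x
  have h3 : (s * wgt s x) ^ 2 ≤ 1 := by nlinarith [mul_nonneg (sq_nonneg (wgt s x)) (sq_nonneg ‖x‖)]
  exact (abs_le_of_sq_le_sq' (by simpa using h3) zero_le_one).2

lemma coord_mul_wgt_le (x : Space) (i : Fin 3) : |x i * wgt s x| ≤ 1 := by
  have h1 := wgt_sq_mul hs x; have h0 : |x i| ≤ ‖x‖ := PiLp.norm_apply_le x i
  have h3 : (x i * wgt s x) ^ 2 ≤ 1 ^ 2 := by
    have : x i ^ 2 ≤ ‖x‖ ^ 2 := by rw [← sq_abs]; exact pow_le_pow_left₀ (abs_nonneg _) h0 2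
    nlinarith [mul_le_mul_of_nonneg_left this (sq_nonneg (wgt s x)), mul_nonneg (sq_nonneg (wgt s x)) (sq_nonneg s)]
  exact abs_le_of_sq_le_sq h3 zero_le_one

lemma contDiff_wgt : 𝒞 ∞ (wgt s) := by
  have h1 : 𝒞 ∞ fun x : Space => s ^ 2 + ‖x‖ ^ 2 := contDiff_const.add (contDiff_norm_sq ℝ)
  exact (h1.sqrt fun x => (radicand_pos hs x).ne').inv fun x => (Real.sqrt_pos.2 (radicand_pos hs x)).ne'

lemma diff_wgt : Diff (wgt s) := (contDiff_wgt hs).diff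

lemma pd_wgt (i : Fin 3) (x : Space) : pd i (wgt s) x = -(x i * wgt s x ^ 3) := by
  have h0 := radicand_pos hs x
  have h1 := pd_comp_norm_sq (f := fun r => (√r)⁻¹) (f' := fun r => -(1 / (2 * √r)) / √r ^ 2) (s := s) (x := x)
    ((Real.hasDerivAt_sqrt h0.ne').inv (Real.sqrt_pos.2 h0).ne') i
  have h2 : (fun y : Space => (√(s ^ 2 + ‖y‖ ^ 2))⁻¹) = wgt s := rfl; rw [h2] at h1; rw [h1, wgt]
  have := (Real.sqrt_pos.2 h0).ne'; field_simp

/-- The components `x_i (s² + |x|²)^{-1/2}` of the radial field. -/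
lemma contDiff_radialCoord (i : Fin 3) : 𝒞 ∞ fun y : Space => y i * wgt s y := (contDiff_coord i).mul (contDiff_wgt hs)

lemma diff_radialCoord (i : Fin 3) : Diff fun y : Space => y i * wgt s y := (contDiff_radialCoord hs i).diff

lemma pd_radialCoord (k i : Fin 3) (x : Space) :
    pd k (fun y : Space => y i * wgt s y) x = (if k = i then 1 else 0) * wgt s x - x i * x k * wgt s x ^ 3 := by
  rw [pd_mul ((contDiff_coord i).diff x) (diff_wgt hs x), pd_coord, pd_wgt hs]; ring

lemma abs_pd_radialCoord_le (k i : Fin 3) (x : Space) :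
    |pd k (fun y : Space => y i * wgt s y) x| ≤ 2 * (bracket x)⁻¹ := by
  have h1 := coord_mul_wgt_le hs x i; have h2 := coord_mul_wgt_le hs x k; have h3 := wgt_pos hs x; have h4 := wgt_le hs x
  have e1 : pd k (fun y : Space => y i * wgt s y) x = ((if k = i then 1 else 0) - (x i * wgt s x) * (x k * wgt s x)) * wgt s x := by
    rw [pd_radialCoord hs]; ring
  have h5 : |(if k = i then (1:ℝ) else 0) - (x i * wgt s x) * (x k * wgt s x)| ≤ 2 := by
    have h6 : |if k = i then (1:ℝ) else 0| ≤ 1 := by split_ifs <;> simp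
    exact (abs_sub _ _).trans ((add_le_add h6 (abs_mul_le' h1 h2)).trans (by norm_num))
  rw [e1]; exact abs_mul_le' h5 (by rwa [abs_of_pos h3])

omit hs in
/-- The Euclidean divergence of the radial field. -/
def gZero (s : ℝ) (x : Space) : ℝ := 2 * wgt s x + s ^ 2 * wgt s x ^ 3

lemma contDiff_gZero : 𝒞 ∞ (gZero s) := (contDiff_const.mul (contDiff_wgt hs)).add (contDiff_const.mul ((contDiff_wgt hs).pow 3))

lemma diff_gZero : Diff (gZero s) := (contDiff_gZero hs).diff

lemma sum_pd_radialCoord (x : Space) : ∑ i, pd i (fun y : Space => y i * wgt s y) x = gZero s x := by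
  have h1 := wgt_sq_mul hs x; rw [← sum_coord_sq] at h1; simp only [pd_radialCoord hs, gZero, Fin.sum_univ_three, if_true] at h1 ⊢
  linear_combination -(wgt s x) * h1

lemma pd_gZero (k : Fin 3) (x : Space) : pd k (gZero s) x = x k * (-2 * wgt s x ^ 3 - 3 * s ^ 2 * wgt s x ^ 5) := by
  have hw := diff_wgt hs x; have e1 : gZero s = fun y => 2 * wgt s y + s ^ 2 * wgt s y ^ 3 := rfl
  rw [e1, pd_add (hw.const_mul 2) ((hw.fun_pow 3).const_mul _), pd_const_mul _ hw, pd_const_mul _ (hw.fun_pow 3), pd_pow hw, pd_wgt hs]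
  push_cast; ring

lemma abs_pd_gZero_le (k : Fin 3) (x : Space) : |pd k (gZero s) x| ≤ 5 * ((bracket x)⁻¹ * (bracket x)⁻¹) := by
  have h3 := wgt_pos hs x; have h5 : |wgt s x| ≤ (bracket x)⁻¹ := by rw [abs_of_pos h3]; exact wgt_le hs x
  have h6 : |s * wgt s x| ≤ 1 := by rw [abs_of_nonneg (by positivity)]; exact mul_wgt_le_one hs x
  have h7 := coord_mul_wgt_le hs x k
  have e1 : pd k (gZero s) x = (-2 * (x k * wgt s x) - 3 * ((s * wgt s x) * (s * wgt s x) * (x k * wgt s x)))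
      * (wgt s x * wgt s x) := by rw [pd_gZero hs]; ring
  rw [e1]; refine abs_mul_le' ?_ (abs_mul_le' h5 h5)
  refine (abs_sub _ _).trans ((add_le_add (abs_mul_le' (A := 2) (by norm_num) h7)
    (abs_mul_le' (A := 3) (by norm_num) (abs_mul_le' (abs_mul_le' h6 h6) h7))).trans (by norm_num))

lemma sum_pd_pd_gZero (x : Space) : ∑ k, pd k (pd k (gZero s)) x = -15 * s ^ 4 * wgt s x ^ 7 := by
  have hw := diff_wgt hs x; have h1 := wgt_sq_mul hs x; rw [← sum_coord_sq] at h1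
  have h2 : ∀ k, pd k (pd k (gZero s)) x = (-2 * wgt s x ^ 3 - 3 * s ^ 2 * wgt s x ^ 5)
      + x k ^ 2 * (6 * wgt s x ^ 5 + 15 * s ^ 2 * wgt s x ^ 7) := by
    intro k; have e1 : pd k (gZero s) = fun y => y k * (-2 * wgt s y ^ 3 - 3 * s ^ 2 * wgt s y ^ 5) := by funext y; exact pd_gZero hs k y
    have d3 := (hw.fun_pow 3).const_mul (-2); have d5 := (hw.fun_pow 5).const_mul (3 * s ^ 2)
    rw [e1, pd_mul ((contDiff_coord k).diff x) (d3.fun_sub d5), pd_coord, pd_sub d3 d5,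
      pd_const_mul _ (hw.fun_pow 3), pd_const_mul _ (hw.fun_pow 5), pd_pow hw, pd_pow hw, pd_wgt hs]
    push_cast; simp only [if_true]; ring
  simp only [h2, Fin.sum_univ_three] at h1 ⊢
  linear_combination (6 * wgt s x ^ 3 + 15 * s ^ 2 * wgt s x ^ 5) * h1

end wgt

/-- The metric correction to the divergence of the radial field. -/
def gOne (h : MatField) (s : ℝ) (x : Space) : ℝ := ∑ i, (x i * wgt s x) * ∑ l, Γ h l l i x

section gOne

include hh hs

lemma contDiff_gOne : 𝒞 ∞ (gOne h s) := ContDiff.sum fun i _ => (contDiff_radialCoord hs i).mul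
    (ContDiff.sum fun l _ => hh.contDiff_christoffel l l i)

lemma diff_gOne : Diff (gOne h s) := (contDiff_gOne hh hs).diff

lemma sum_pd_vol_radialCoord (x : Space) : ∑ i, pd i (fun y => 𝔳 h y * (y i * wgt s y)) x = 𝔳 h x * (gZero s x + gOne h s x) := by
  simp only [fun i => pd_mul (hh.diff_vol x) (diff_radialCoord hs i x) i, hh.pd_vol, sum_add_distrib,
    ← mul_sum, sum_pd_radialCoord hs, gOne]
  rw [mul_add, add_comm]; congr 1; rw [mul_sum]; exact sum_ext fun i => by ring

include hf

lemma abs_gOne_le (x : Space) : |gOne h s x| ≤ 81 * (κ / bracket x ^ 2) := (abs_sum3_le fun i => abs_mul_le' (coord_mul_wgt_le hs x i)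
    (abs_sum3_le fun l => hf.christoffel_le hh l l i x)).trans (by linarith)

lemma abs_pd_gOne_le (k : Fin 3) (x : Space) : |pd k (gOne h s) x| ≤ 2000 * (κ / bracket x ^ 3) := by
  have hd : ∀ i, DiffAt (fun y => ∑ l, Γ h l l i y) x := fun i => DifferentiableAt.fun_sum fun l _ => hh.diff_christoffel l l i x
  have e1 : pd k (gOne h s) x = ∑ i, (pd k (fun y : Space => y i * wgt s y) x * ∑ l, Γ h l l i x
      + (x i * wgt s x) * ∑ l, pd k (Γ h l l i) x) := by
    have : gOne h s = fun y => ∑ i, (y i * wgt s y) * ∑ l, Γ h l l i y := rfl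
    rw [this, pd_sum fun i _ => (diff_radialCoord hs i x).fun_mul (hd i)]; refine sum_ext fun i => ?_
    rw [pd_mul (diff_radialCoord hs i x) (hd i), pd_sum fun l _ => hh.diff_christoffel l l i x]
  have e2 : (bracket x)⁻¹ * (κ / bracket x ^ 2) = κ / bracket x ^ 3 := by have := (bracket_pos x).ne'; field_simp
  have h0 := hf.div_nonneg 3 x; rw [e1]
  refine (abs_sum3_le fun i => (abs_add_le _ _).trans (add_le_add
    (abs_mul_le' (abs_pd_radialCoord_le hs k i x) (abs_sum3_le fun l => hf.christoffel_le hh l l i x))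
    (abs_mul_le' (coord_mul_wgt_le hs x i) (abs_sum3_le fun l => hf.pd_christoffel_le hh k l l i x)))).trans ?_
  have : 2 * (bracket x)⁻¹ * (3 * (9 * (κ / bracket x ^ 2))) = 54 * (κ / bracket x ^ 3) := by rw [← e2]; ring
  rw [this]; linarith

end gOne

namespace CliffordRep

/-- The antisymmetrized radial derivative. -/
def radial (h e : MatField) (s : ℝ) (φ : Space → F) (x : Space) : F :=
  ∑ i, (x i * wgt s x) • c.D h e i φ x + (1 / 2 * (gZero s x + gOne h s x)) • φ x

lemma radial_eq_zero {x : Space} (hx : x ∉ tsupport φ) : c.radial h e s φ x = 0 := by simp [radial, c.D_eq_zero hx, off_tsupport hx]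

include hh he hs

lemma contDiff_radial {n : WithTop ℕ∞} (hφ : 𝒞 (n + 1) φ) (hn : n ≤ (⊤ : ℕ∞)) : 𝒞 n (c.radial h e s φ) :=
  (ContDiff.sum fun i _ => ((contDiff_radialCoord hs i).of_le hn).smul (c.contDiff_D hh he hφ le_rfl hn i)).add
    ((contDiff_const.mul (((contDiff_gZero hs).add (contDiff_gOne hh hs)).of_le hn)).smul (hφ.of_le (by simp)))

omit he in
lemma inner_radial_add {x : Space} (hφ : DiffAt φ x) (hψ : DiffAt ψ x) :
    𝔳 h x * ⟪c.radial h e s φ x, ψ x⟫ = -(𝔳 h x * ⟪φ x, c.radial h e s ψ x⟫)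
      + ∑ i, pd i (fun y => (𝔳 h y * (y i * wgt s y)) * ⟪φ y, ψ y⟫) x := by
  have hd : ∀ i, DiffAt (fun y => 𝔳 h y * (y i * wgt s y)) x := fun i => (hh.diff_vol x).fun_mul (diff_radialCoord hs i x)
  simp only [fun i => pd_mul (hd i) (hφ.inner ℝ hψ) i, sum_add_distrib, ← sum_mul,
    sum_pd_vol_radialCoord hh hs, c.pd_inner_D (h := h) (e := e) hφ hψ, radial, inner_add_left, inner_add_right,
    real_inner_smul_left, real_inner_smul_right, sum_inner, inner_sum, mul_sum, mul_add]
  have h1 : ∀ (w : Fin 3 → ℝ), ∑ i, 𝔳 h x * (x i * wgt s x * w i) = ∑ i, 𝔳 h x * (x i * wgt s x) * w i := fun w => sum_ext fun i => by ring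
  rw [h1, h1]; ring

/-- The density `√h h^{kj} ⟨D_j φ, D_k φ⟩`. -/
def energyDensity (h e : MatField) (φ : Space → F) (x : Space) : ℝ := ∑ k, ⟪c.flux h e k φ x, c.D h e k φ x⟫

omit hs

lemma contDiff_energyDensity (hφ : 𝒞 2 φ) : 𝒞 1 (c.energyDensity h e φ) :=
  ContDiff.sum fun k _ => (c.contDiff_flux hh he (n := 1) hφ (by norm_cast) k).inner ℝ
    (c.contDiff_D hh he (k := 1) hφ (by norm_num) (mod_cast le_top) k)

omit he in
lemma sum_inner_flux_comm (φ : Space → F) (ψ : Fin 3 → F) (x : Space) : ∑ k, ∑ j, 𝔳 h x * hInv h k j x * ⟪ψ j, c.D h e k φ x⟫ =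
    ∑ k, ⟪c.flux h e k φ x, ψ k⟫ := by
  simp only [flux, sum_inner, real_inner_smul_left]; rw [sum_comm]; refine sum_ext fun k => sum_ext fun j => ?_
  rw [hh.hInv_symm j k, real_inner_comm]

lemma pd_energyDensity (hφ : 𝒞 2 φ) (i : Fin 3) (x : Space) : pd i (c.energyDensity h e φ) x
      = ∑ k, ∑ j, pd i (fun y => 𝔳 h y * hInv h k j y) x * ⟪c.D h e j φ x, c.D h e k φ x⟫
        + 2 * ∑ k, ⟪c.flux h e k φ x, c.D h e i (c.D h e k φ) x⟫ := by
  have hD := fun k => c.diff_D hh he hφ k x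
  have hw : ∀ k j, DiffAt (fun y => 𝔳 h y * hInv h k j y) x := fun k j => (hh.diff_vol x).mul (hh.diff_hInv k j x)
  have e1 : c.energyDensity h e φ = fun y => ∑ k, ∑ j, (𝔳 h y * hInv h k j y) * ⟪c.D h e j φ y, c.D h e k φ y⟫ := by
    funext y; simp only [energyDensity, flux, sum_inner, real_inner_smul_left]
  rw [e1, pd_sum fun k _ => DifferentiableAt.fun_sum fun j _ => (hw k j).fun_mul ((hD j).inner ℝ (hD k))]
  simp only [fun k => pd_sum (fun j (_ : j ∈ Finset.univ) => (hw k j).fun_mul ((hD j).inner ℝ (hD k))) i,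
    fun k j => pd_mul (hw k j) ((hD j).inner ℝ (hD k)) i, sum_add_distrib,
    c.pd_inner_D (h := h) (e := e) (hD _) (hD _), mul_add]
  rw [c.sum_inner_flux_comm hh φ (fun j => c.D h e i (c.D h e j φ) x) x, two_mul]; congr 2
  simp only [flux, sum_inner, real_inner_smul_left]

include hs

lemma D_radial (hφ : 𝒞 2 φ) (k : Fin 3) (x : Space) : c.D h e k (c.radial h e s φ) x = ∑ i, (pd k (fun y => y i * wgt s y) x • c.D h e i φ x
        + (x i * wgt s x) • (c.D h e i (c.D h e k φ) x + c.curv h e k i x (φ x)))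
      + ((1 / 2 * (pd k (gZero s) x + pd k (gOne h s) x)) • φ x + (1 / 2 * (gZero s x + gOne h s x)) • c.D h e k φ x) := by
  have hD := fun k => c.diff_D hh he hφ k x; have hφ1 : DiffAt φ x := hφ.diff x
  have hg : DiffAt (fun y => gZero s y + gOne h s y) x := (diff_gZero hs x).fun_add (diff_gOne hh hs x)
  have hr := fun i => diff_radialCoord hs i x
  have hcomm : ∀ i, c.D h e k (c.D h e i φ) x = c.D h e i (c.D h e k φ) x + c.curv h e k i x (φ x) := by
    intro i; rw [← c.D_comm hh he hφ k i x]; simp only [D2, hh.christoffel_symm _ k i]; simp only [D]; abel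
  have e1 : c.radial h e s φ = fun y => ∑ i, (y i * wgt s y) • c.D h e i φ y + (1 / 2 * (gZero s y + gOne h s y)) • φ y := rfl
  rw [e1, c.D_add (DifferentiableAt.fun_sum fun i _ => (hr i).fun_smul (hD i)) ((hg.const_mul _).fun_smul hφ1),
    c.D_sum (fun i _ => (hr i).fun_smul (hD i)), c.D_smul (hg.const_mul _) hφ1, pd_const_mul _ hg,
    pd_add (diff_gZero hs x) (diff_gOne hh hs x)]
  congr 1; refine sum_ext fun i => ?_; rw [c.D_smul (hr i) (hD i), hcomm]

lemma virial_identity (hφ : 𝒞 3 φ) (x : Space) : -(𝔳 h x * ⟪c.lap h e φ x, c.radial h e s φ x⟫) =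
      ∑ k, ⟪c.flux h e k φ x, (∑ i, pd k (fun y => y i * wgt s y) x • c.D h e i φ x)⟫
      + ∑ k, ∑ i, (x i * wgt s x) * ⟪c.flux h e k φ x, c.curv h e k i x (φ x)⟫
      + 1 / 2 * gOne h s x * c.energyDensity h e φ x
      - 1 / 2 * ∑ i, (x i * wgt s x) * ∑ k, ∑ j, pd i (fun y => 𝔳 h y * hInv h k j y) x * ⟪c.D h e j φ x, c.D h e k φ x⟫
      + 1 / 2 * ∑ k, (pd k (gZero s) x + pd k (gOne h s) x) * ⟪c.flux h e k φ x, φ x⟫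
      + ∑ i, pd i (fun y => -⟪c.flux h e i φ y, c.radial h e s φ y⟫ + 1 / 2 * ((y i * wgt s y) * c.energyDensity h e φ y)) x := by
  have hφ2 : 𝒞 2 φ := hφ.of_le (by norm_num)
  have hR : DiffAt (c.radial h e s φ) x := (c.contDiff_radial hh he hs (n := 1) hφ2 (by norm_cast)).diff x
  have hfl : ∀ i, DiffAt (c.flux h e i φ) x := fun i => (c.contDiff_flux hh he (n := 1) hφ2 (by norm_cast) i).diff x
  have hE : DiffAt (c.energyDensity h e φ) x := (c.contDiff_energyDensity hh he hφ2).diff x; have hr := fun i => diff_radialCoord hs i x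
  have e1 : ∀ i, pd i (fun y => -⟪c.flux h e i φ y, c.radial h e s φ y⟫ + 1 / 2 * ((y i * wgt s y) * c.energyDensity h e φ y)) x
      = pd i (fun y => -⟪c.flux h e i φ y, c.radial h e s φ y⟫) x + 1 / 2 * (pd i (fun y => y i * wgt s y) x * c.energyDensity h e φ x
          + (x i * wgt s x) * pd i (c.energyDensity h e φ) x) := by
    intro i
    rw [pd_add ((hfl i).inner ℝ hR).fun_neg (((hr i).fun_mul hE).const_mul _), pd_const_mul _ ((hr i).fun_mul hE), pd_mul (hr i) hE]
  rw [c.inner_lap hh he hφ2 hR]; simp only [e1, sum_add_distrib, ← mul_sum, ← sum_mul, sum_pd_radialCoord hs]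
  have e2 : ∑ k, ⟪c.flux h e k φ x, c.D h e k (c.radial h e s φ) x⟫
      = ∑ k, ⟪c.flux h e k φ x, (∑ i, pd k (fun y => y i * wgt s y) x • c.D h e i φ x)⟫
        + ∑ i, (x i * wgt s x) * ∑ k, ⟪c.flux h e k φ x, c.D h e i (c.D h e k φ) x⟫
        + ∑ k, ∑ i, (x i * wgt s x) * ⟪c.flux h e k φ x, c.curv h e k i x (φ x)⟫
        + 1 / 2 * ∑ k, (pd k (gZero s) x + pd k (gOne h s) x) * ⟪c.flux h e k φ x, φ x⟫
        + 1 / 2 * (gZero s x + gOne h s x) * c.energyDensity h e φ x := by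
    rw [show ∑ i, (x i * wgt s x) * ∑ k, ⟪c.flux h e k φ x, c.D h e i (c.D h e k φ) x⟫
        = ∑ k, ∑ i, (x i * wgt s x) * ⟪c.flux h e k φ x, c.D h e i (c.D h e k φ) x⟫ from by
      simp only [mul_sum]; exact sum_comm]
    simp only [c.D_radial hh he hs hφ2, inner_add_right, inner_sum, real_inner_smul_right, sum_add_distrib,
      energyDensity, mul_add, smul_add]
    simp only [Fin.sum_univ_three]; ring
  rw [e2]; simp only [c.pd_energyDensity hh he hφ2, mul_add, sum_add_distrib]; simp only [← mul_assoc, mul_comm _ (2:ℝ)]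
  simp only [mul_assoc, ← mul_sum]; ring

end CliffordRep

section bounds

include hf

lemma NearFlat.abs_metric_le (i j : Fin 3) (x : Space) : |h x i j| ≤ 2 := by
  have := abs_le.1 ((hf.zeroth i j x).trans (hf.div_le x)); rw [abs_le]
  split_ifs at this <;> constructor <;> linarith

include hh he

lemma NearFlat.abs_frame_le (i a : Fin 3) (x : Space) : |e x i a| ≤ 2 := by
  have h1 := (abs_le.1 (hf.hInv_le hh i i x)).2; rw [he.frame] at h1
  have h2 := single_le_sum (f := fun a => e x i a * e x i a) (fun a _ => mul_self_nonneg _) (Finset.mem_univ a)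
  exact abs_le_of_sq_le_sq (by nlinarith) (by norm_num)

lemma NearFlat.abs_coframe_le (i a : Fin 3) (x : Space) : |coframe e i a x| ≤ 12 := by
  rw [he.coframe_eq hh]; exact (abs_sum3_le fun j => abs_mul_le' (hf.abs_frame_le hh he j a x) (hf.abs_metric_le j i x)).trans (by norm_num)

lemma NearFlat.abs_riemFrame_le (a b l i : Fin 3) (x : Space) :
    |riemFrame h e a b l i x| ≤ 108000 * (κ / bracket x ^ 3) :=
  (abs_sum3_le fun k => abs_sum3_le fun m => abs_mul_le' (abs_mul_le' (hf.abs_coframe_le hh he k a x)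
    (hf.abs_frame_le hh he m b x)) (hf.riem_le hh k m l i x)).trans (by linarith)

omit he in
lemma NearFlat.abs_vol_hInv_le (k j : Fin 3) (x : Space) : |𝔳 h x * hInv h k j x| ≤ 4 :=
  (abs_mul_le' (A := 2) (by rw [abs_of_pos (hh.volDensity_pos x)]; exact hf.vol_le x) (hf.hInv_le hh k j x)).trans
    (by norm_num)

omit he in
lemma NearFlat.abs_pd_vol_hInv_le (i k j : Fin 3) (x : Space) :
    |pd i (fun y => 𝔳 h y * hInv h k j y) x| ≤ 180 * (κ / bracket x ^ 2) := by
  rw [pd_mul (hh.diff_vol x) (hh.diff_hInv k j x)]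
  refine (abs_add_le _ _).trans ((add_le_add (abs_mul_le' (hf.pd_vol_le hh i x) (hf.hInv_le hh k j x))
    (abs_mul_le' (A := 2) (by rw [abs_of_pos (hh.volDensity_pos x)]; exact hf.vol_le x) (hf.pd_hInv_le hh i k j x))).trans ?_)
  linarith

end bounds

namespace CliffordRep

/-- The density `⟨x⟩^{-2} |Dφ|² + ⟨x⟩^{-4} |φ|²`. -/
def lowDensity (h e : MatField) (φ : Space → F) (x : Space) : ℝ := (bracket x)⁻¹ ^ 2 * c.gradSq h e φ x + (bracket x)⁻¹ ^ 4 * ‖φ x‖ ^ 2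

lemma lowDensity_nonneg (φ : Space → F) (x : Space) : 0 ≤ c.lowDensity h e φ x := by
  have := c.gradSq_nonneg (h := h) (e := e) φ x; unfold lowDensity; positivity

lemma sum_norm_D_mul_le (φ : Space → F) (x : Space) :
    (bracket x)⁻¹ ^ 3 * ((∑ j, ‖c.D h e j φ x‖) * ‖φ x‖) ≤ 3 / 2 * c.lowDensity h e φ x := by
  have h1 : ∀ j, (bracket x)⁻¹ ^ 3 * (‖c.D h e j φ x‖ * ‖φ x‖)
      ≤ 1 / 2 * ((bracket x)⁻¹ ^ 2 * ‖c.D h e j φ x‖ ^ 2 + (bracket x)⁻¹ ^ 4 * ‖φ x‖ ^ 2) := fun j => by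
    nlinarith [sq_nonneg ((bracket x)⁻¹ * ‖c.D h e j φ x‖ - (bracket x)⁻¹ ^ 2 * ‖φ x‖)]
  rw [sum_mul, mul_sum]; refine (sum_le_sum fun j _ => h1 j).trans ?_; rw [← mul_sum, sum_add_distrib, ← mul_sum, lowDensity, gradSq]
  simp only [Finset.sum_const, Finset.card_univ, Fintype.card_fin, nsmul_eq_mul]
  have : 0 ≤ (bracket x)⁻¹ ^ 2 * ∑ k, ‖c.D h e k φ x‖ ^ 2 := mul_nonneg (sq_nonneg _) (sum_nonneg fun _ _ => sq_nonneg _)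
  push_cast; linarith

include hh he hf

lemma norm_curv_le (l i : Fin 3) (x : Space) (v : F) : ‖c.curv h e l i x v‖ ≤ 300000 * (κ / bracket x ^ 3) * ‖v‖ := by
  rw [c.curv_eq hh he]; simp only [smul_apply, sum_apply, mul_apply_eq_comp]
  have h1 : ∀ a b, ‖riemFrame h e a b l i x • c.al a (c.al b v)‖ ≤ 108000 * (κ / bracket x ^ 3) * ‖v‖ := by
    intro a b; rw [norm_smul, c.norm_al, c.norm_al]; exact mul_le_mul_of_nonneg_right (hf.abs_riemFrame_le hh he a b l i x) (norm_nonneg _)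
  have h2 : ‖∑ a, ∑ b, riemFrame h e a b l i x • c.al a (c.al b v)‖ ≤ 9 * (108000 * (κ / bracket x ^ 3) * ‖v‖) := by
    refine (norm_sum_le_of_le _ fun a _ => norm_sum_le_of_le _ fun b _ => h1 a b).trans (le_of_eq ?_); simp; ring
  rw [norm_smul]; have := mul_nonneg (hf.div_nonneg 3 x) (norm_nonneg v); norm_num; nlinarith

omit he

lemma norm_flux_le (φ : Space → F) (k : Fin 3) (x : Space) : ‖c.flux h e k φ x‖ ≤ 4 * ∑ j, ‖c.D h e j φ x‖ := by
  rw [mul_sum]; refine norm_sum_le_of_le _ fun j _ => ?_; rw [norm_smul]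
  exact mul_le_mul_of_nonneg_right (hf.abs_vol_hInv_le hh k j x) (norm_nonneg _)

lemma norm_flux_sub_le (φ : Space → F) (k : Fin 3) (x : Space) :
    ‖c.flux h e k φ x - c.D h e k φ x‖ ≤ 32 * (κ / bracket x) * ∑ j, ‖c.D h e j φ x‖ := by
  have e1 : c.flux h e k φ x - c.D h e k φ x = ∑ j, (𝔳 h x * hInv h k j x - if k = j then 1 else 0) • c.D h e j φ x := by
    simp [flux, sub_smul, sum_sub_distrib]
  rw [e1, mul_sum]; refine norm_sum_le_of_le _ fun j _ => ?_; rw [norm_smul]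
  exact mul_le_mul_of_nonneg_right (hf.vol_mul_hInv_sub_le hh k j x) (norm_nonneg _)

lemma energyDensity_le (φ : Space → F) (x : Space) :
    |c.energyDensity h e φ x| ≤ 2 * c.gradSq h e φ x := by
  have h1 := abs_le.1 (c.sum_inner_flux_sub (e := e) hh hf φ (fun k => c.D h e k φ x) x)
  have h3 : ∑ k, ⟪c.D h e k φ x, c.D h e k φ x⟫ = c.gradSq h e φ x := by simp only [real_inner_self_eq_norm_sq, gradSq]
  rw [h3, show ∑ k, ‖c.D h e k φ x‖ ^ 2 = c.gradSq h e φ x from rfl] at h1; have h4 := c.gradSq_nonneg (h := h) (e := e) φ x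
  have h5 : κ / bracket x ≤ 1 / 100 := hf.div_le x; change _ ≤ c.energyDensity h e φ x - _ ∧ c.energyDensity h e φ x - _ ≤ _ at h1
  rw [abs_le]; constructor <;> nlinarith

include hs

lemma norm_radial_le (φ : Space → F) (x : Space) : ‖c.radial h e s φ x‖ ≤ ∑ j, ‖c.D h e j φ x‖ + 2 * (bracket x)⁻¹ * ‖φ x‖ := by
  have hp : 0 < (bracket x)⁻¹ := inv_pos.2 (bracket_pos x)
  have h1 : |gZero s x| ≤ 3 * (bracket x)⁻¹ := by
    have h3 := wgt_pos hs x; have h4 := wgt_le hs x; have h6 := mul_wgt_le_one hs x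
    have h7 : (s * wgt s x) ^ 2 ≤ 1 := pow_le_one₀ (by positivity) h6; rw [gZero, abs_of_nonneg (by positivity)]; nlinarith
  have h2 : |gOne h s x| ≤ (bracket x)⁻¹ := by
    refine (abs_gOne_le hh hs hf x).trans ?_; have h3 : κ / bracket x ^ 2 ≤ κ / bracket x ^ 1 := hf.div_pow_le (by norm_num) x
    have h4 : κ ≤ 1 / 100 := hf.le x; rw [pow_one, div_eq_mul_inv κ (bracket x)] at h3; nlinarith
  refine (norm_add_le _ _).trans (add_le_add (norm_sum_le_of_le _ fun i _ => ?_) ?_)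
  · rw [norm_smul]; exact mul_le_of_le_one_left (norm_nonneg _) (coord_mul_wgt_le hs x i)
  · rw [norm_smul]; refine mul_le_mul_of_nonneg_right ?_ (norm_nonneg _)
    refine (abs_mul_le' (A := 1 / 2) (B := 4 * (bracket x)⁻¹) (by norm_num) ?_).trans (by linarith)
    exact (abs_add_le _ _).trans (by linarith)

omit hh hf in
lemma radial_hessian_flat (φ : Space → F) (x : Space) : s ^ 2 * wgt s x ^ 3 * c.gradSq h e φ x ≤
      ∑ j, ∑ i, pd j (fun y => y i * wgt s y) x * ⟪c.D h e j φ x, c.D h e i φ x⟫ := by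
  have h1 : ∑ j, ∑ i, pd j (fun y => y i * wgt s y) x * ⟪c.D h e j φ x, c.D h e i φ x⟫
      = wgt s x * c.gradSq h e φ x - wgt s x ^ 3 * ‖∑ i, x i • c.D h e i φ x‖ ^ 2 := by
    simp only [pd_radialCoord hs, sub_mul, sum_sub_distrib, ← real_inner_self_eq_norm_sq, gradSq, inner_sum,
      sum_inner, real_inner_smul_left, real_inner_smul_right, mul_sum]
    congr 1
    · refine sum_ext fun j => ?_; simp
    · rw [sum_comm]; refine sum_ext fun j => sum_ext fun i => by ring
  have h2 : ‖∑ i, x i • c.D h e i φ x‖ ^ 2 ≤ ‖x‖ ^ 2 * c.gradSq h e φ x := by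
    have h3 : ‖∑ i, x i • c.D h e i φ x‖ ≤ ∑ i, |x i| * ‖c.D h e i φ x‖ := norm_sum_le_of_le _ fun i _ => by rw [norm_smul]; rfl
    have h4 := Finset.sum_mul_sq_le_sq_mul_sq Finset.univ (fun i => |x i|) (fun i => ‖c.D h e i φ x‖)
    simp only [sq_abs, sum_coord_sq] at h4; exact (pow_le_pow_left₀ (norm_nonneg _) h3 2).trans h4
  have h5 := wgt_sq_mul hs x; have h6 := wgt_pos hs x; have h7 := mul_le_mul_of_nonneg_left h2 (pow_pos h6 3).le; rw [h1]
  have h8 : s ^ 2 * wgt s x ^ 3 = wgt s x - wgt s x ^ 3 * ‖x‖ ^ 2 := by linear_combination wgt s x * h5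
  rw [h8]; linarith

include he

/-- The pointwise virial inequality. -/
lemma virial_pointwise [Nontrivial F] (m : ℝ) (hφ : 𝒞 3 φ) (x : Space) :
    s ^ 2 * wgt s x ^ 3 * c.gradSq h e φ x + 15 / 4 * (s ^ 4 * wgt s x ^ 7) * ‖φ x‖ ^ 2 ≤
      (𝔳 h x * ⟪c.H h e m (c.H h e m φ) x, c.radial h e s φ x⟫ + 2 * 10 ^ 7 * κ * c.lowDensity h e φ x)
      + ∑ i, pd i (fun y => ⟪c.flux h e i φ y, c.radial h e s φ y⟫ - 1 / 2 * ((y i * wgt s y) * c.energyDensity h e φ y)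
          - 1 / 4 * (pd i (gZero s) y * ⟪φ y, φ y⟫)
          - m ^ 2 / 2 * ((𝔳 h y * (y i * wgt s y)) * ⟪φ y, φ y⟫)) x := by
  have hφ2 : 𝒞 2 φ := hφ.of_le (by norm_num); have hd : DiffAt φ x := hφ.diff x
  have hR : DiffAt (c.radial h e s φ) x := (c.contDiff_radial hh he hs (n := 1) hφ2 (by norm_cast)).diff x
  have hfl : ∀ i, DiffAt (c.flux h e i φ) x := fun i => (c.contDiff_flux hh he (n := 1) hφ2 (by norm_cast) i).diff x
  have hE : DiffAt (c.energyDensity h e φ) x := (c.contDiff_energyDensity hh he hφ2).diff x; have hr := fun i => diff_radialCoord hs i x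
  have hg : ∀ i, DiffAt (pd i (gZero s)) x := fun i => (ContDiff.pd_infty (contDiff_gZero hs) i).diff x
  have hin : DiffAt (fun y => ⟪φ y, φ y⟫) x := hd.inner ℝ hd
  have hv : ∀ i, DiffAt (fun y => 𝔳 h y * (y i * wgt s y)) x := fun i => (hh.diff_vol x).fun_mul (hr i)
  -- the divergence terms
  have e1 : ∀ i, pd i (fun y => ⟪c.flux h e i φ y, c.radial h e s φ y⟫ - 1 / 2 * ((y i * wgt s y) * c.energyDensity h e φ y)
          - 1 / 4 * (pd i (gZero s) y * ⟪φ y, φ y⟫)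
          - m ^ 2 / 2 * ((𝔳 h y * (y i * wgt s y)) * ⟪φ y, φ y⟫)) x
      = -(pd i (fun y => -⟪c.flux h e i φ y, c.radial h e s φ y⟫ + 1 / 2 * ((y i * wgt s y) * c.energyDensity h e φ y)) x)
        - 1 / 4 * (pd i (pd i (gZero s)) x * ‖φ x‖ ^ 2 + pd i (gZero s) x * (2 * ⟪c.D h e i φ x, φ x⟫))
        - m ^ 2 / 2 * pd i (fun y => (𝔳 h y * (y i * wgt s y)) * ⟪φ y, φ y⟫) x := by
    intro i; have a1 : DiffAt (fun y => ⟪c.flux h e i φ y, c.radial h e s φ y⟫) x := (hfl i).inner ℝ hR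
    have a2 : DiffAt (fun y => (y i * wgt s y) * c.energyDensity h e φ y) x := (hr i).fun_mul hE
    have a3 : DiffAt (fun y => pd i (gZero s) y * ⟪φ y, φ y⟫) x := (hg i).fun_mul hin
    have a4 : DiffAt (fun y => (𝔳 h y * (y i * wgt s y)) * ⟪φ y, φ y⟫) x := (hv i).fun_mul hin
    rw [pd_sub ((a1.fun_sub (a2.const_mul _)).fun_sub (a3.const_mul _)) (a4.const_mul _),
      pd_sub (a1.fun_sub (a2.const_mul _)) (a3.const_mul _), pd_sub a1 (a2.const_mul _),
      pd_add a1.fun_neg (a2.const_mul _), pd_neg, pd_const_mul _ a2, pd_const_mul _ a3, pd_const_mul _ a4,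
      pd_mul (hg i) hin, c.pd_inner_D (h := h) (e := e) hd hd, real_inner_self_eq_norm_sq,
      real_inner_comm (c.D h e i φ x) (φ x)]
    ring
  have e2 := c.virial_identity hh he hs hφ x; have e3 := c.inner_radial_add (h := h) (e := e) hh hs hd hd
  rw [real_inner_comm (φ x) (c.radial h e s φ x)] at e3; have e4 := sum_pd_pd_gZero hs x
  have e5 : ⟪c.H h e m (c.H h e m φ) x, c.radial h e s φ x⟫ = m ^ 2 * ⟪φ x, c.radial h e s φ x⟫ - ⟪c.lap h e φ x, c.radial h e s φ x⟫
        + 1 / 4 * scalarCurvature h x * ⟪φ x, c.radial h e s φ x⟫ := by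
    rw [c.H_H hh he m hφ2, inner_add_left, inner_sub_left, real_inner_smul_left, real_inner_smul_left]
  simp only [e1, sum_sub_distrib, ← mul_sum, sum_add_distrib, sum_neg_distrib, ← sum_mul, e4]; rw [e5]
  -- notation for the error terms
  set G := c.gradSq h e φ x with hG; set N := c.lowDensity h e φ x with hN; set S := ∑ j, ‖c.D h e j φ x‖ with hS
  have hG0 : 0 ≤ G := c.gradSq_nonneg φ x; have hN0 : 0 ≤ N := c.lowDensity_nonneg φ x; have hκ0 : 0 ≤ κ := hf.nonneg x
  set p := (bracket x)⁻¹ with hp; have hp0 : 0 < p := inv_pos.2 (bracket_pos x)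
  have hp1 : p ≤ 1 := inv_le_one_of_one_le₀ (one_le_bracket x); have hSN : p ^ 3 * (S * ‖φ x‖) ≤ 3 / 2 * N := c.sum_norm_D_mul_le φ x
  have hGN : p ^ 2 * G ≤ N := by rw [hN, lowDensity]; exact le_add_of_nonneg_right (by positivity)
  have hφN : p ^ 4 * ‖φ x‖ ^ 2 ≤ N := by rw [hN, lowDensity]; exact le_add_of_nonneg_left (by positivity)
  have hdiv : ∀ n : ℕ, κ / bracket x ^ n = κ * p ^ n := fun n => by rw [div_eq_mul_inv, hp, inv_pow]
  have hdiv1 : κ / bracket x = κ * p := by rw [div_eq_mul_inv]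
  have hSN' := mul_le_mul_of_nonneg_left hSN hκ0; have hGN' := mul_le_mul_of_nonneg_left hGN hκ0
  have hφN' := mul_le_mul_of_nonneg_left hφN hκ0; have hS0 : 0 ≤ S := sum_nonneg fun _ _ => norm_nonneg _
  -- the Hessian term
  have t1 : s ^ 2 * wgt s x ^ 3 * G - 576 * κ * N ≤ ∑ k, ⟪c.flux h e k φ x, (∑ i, pd k (fun y => y i * wgt s y) x • c.D h e i φ x)⟫ := by
    have b1 : ∑ k, ⟪c.flux h e k φ x, (∑ i, pd k (fun y => y i * wgt s y) x • c.D h e i φ x)⟫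
        = ∑ j, ∑ i, (∑ k, (𝔳 h x * hInv h k j x - if k = j then 1 else 0)
            * pd k (fun y => y i * wgt s y) x) * ⟪c.D h e j φ x, c.D h e i φ x⟫
          + ∑ j, ∑ i, pd j (fun y => y i * wgt s y) x * ⟪c.D h e j φ x, c.D h e i φ x⟫ := by
      simp only [flux, sum_inner, inner_sum, real_inner_smul_left, real_inner_smul_right]; simp only [Fin.sum_univ_three]; simp; ring
    have b2 := abs_le.1 (abs_sum_inner_le (a := fun j i => ∑ k, (𝔳 h x * hInv h k j x - if k = j then 1 else 0)
            * pd k (fun y => y i * wgt s y) x) (t := 192 * κ * p ^ 2) (fun j i => by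
        refine (abs_sum3_le fun k => abs_mul_le' (hf.vol_mul_hInv_sub_le hh k j x) (abs_pd_radialCoord_le hs k i x)).trans (le_of_eq ?_)
        rw [hdiv1]; ring) (fun j => c.D h e j φ x) (fun i => c.D h e i φ x))
    rw [show ∑ k, ‖c.D h e k φ x‖ ^ 2 = G from rfl] at b2; have b3 := c.radial_hessian_flat (h := h) (e := e) hs φ x
    have b4 : 192 * κ * p ^ 2 * (3 / 2 * (G + G)) = 576 * (κ * (p ^ 2 * G)) := by ring
    rw [b4] at b2; rw [b1]; linarith [b2.1]
  -- the curvature term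
  have t2 : |∑ k, ∑ i, (x i * wgt s x) * ⟪c.flux h e k φ x, c.curv h e k i x (φ x)⟫| ≤ 16200000 * κ * N := by
    refine (abs_sum3_le fun k => abs_sum3_le fun i => abs_mul_le' (coord_mul_wgt_le hs x i)
      ((abs_real_inner_le_norm _ _).trans (mul_le_mul (c.norm_flux_le hh hf φ k x)
        (c.norm_curv_le hh he hf k i x (φ x)) (norm_nonneg _) (by positivity)))).trans ?_
    rw [hdiv]
    calc _ = 10800000 * (κ * (p ^ 3 * (S * ‖φ x‖))) := by ring
      _ ≤ _ := by linarith
  have t3 : |1 / 2 * gOne h s x * c.energyDensity h e φ x| ≤ 81 * κ * N := by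
    refine (abs_mul_le' (abs_mul_le' (A := 1 / 2) (by norm_num) (abs_gOne_le hh hs hf x)) (c.energyDensity_le hh hf φ x)).trans ?_
    rw [hdiv]
    calc _ = 81 * (κ * (p ^ 2 * G)) := by ring
      _ ≤ _ := by linarith
  have t4 : |∑ i, (x i * wgt s x) * ∑ k, ∑ j, pd i (fun y => 𝔳 h y * hInv h k j y) x * ⟪c.D h e j φ x, c.D h e k φ x⟫| ≤ 1620 * κ * N := by
    have b1 : ∀ i, |∑ k, ∑ j, pd i (fun y => 𝔳 h y * hInv h k j y) x
          * ⟪c.D h e j φ x, c.D h e k φ x⟫| ≤ 180 * (κ / bracket x ^ 2) * (3 / 2 * (G + G)) := by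
      intro i; rw [sum_comm]
      exact abs_sum_inner_le (a := fun j k => pd i (fun y => 𝔳 h y * hInv h k j y) x)
        (fun j k => hf.abs_pd_vol_hInv_le hh i k j x) (fun j => c.D h e j φ x) (fun j => c.D h e j φ x)
    refine (abs_sum3_le fun i => abs_mul_le' (coord_mul_wgt_le hs x i) (b1 i)).trans ?_; rw [hdiv]
    calc _ = 1620 * (κ * (p ^ 2 * G)) := by ring
      _ ≤ _ := by linarith
  have t5 : |∑ k, pd k (gOne h s) x * ⟪c.flux h e k φ x, φ x⟫| ≤ 36000 * κ * N := by
    refine (abs_sum3_le fun k => abs_mul_le' (abs_pd_gOne_le hh hs hf k x)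
      ((abs_real_inner_le_norm _ _).trans (mul_le_mul_of_nonneg_right (c.norm_flux_le hh hf φ k x) (norm_nonneg _)))).trans ?_
    rw [hdiv]
    calc _ = 24000 * (κ * (p ^ 3 * (S * ‖φ x‖))) := by ring
      _ ≤ _ := by linarith
  have t6 : |∑ k, pd k (gZero s) x * ⟪c.flux h e k φ x, φ x⟫ - ∑ k, pd k (gZero s) x * ⟪c.D h e k φ x, φ x⟫| ≤ 720 * κ * N := by
    rw [← sum_sub_distrib]; simp only [← mul_sub, ← inner_sub_left]
    refine (abs_sum3_le fun k => abs_mul_le' (abs_pd_gZero_le hs k x)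
      ((abs_real_inner_le_norm _ _).trans (mul_le_mul_of_nonneg_right (c.norm_flux_sub_le hh hf φ k x) (norm_nonneg _)))).trans ?_
    rw [hdiv1]
    calc _ = 480 * (κ * (p ^ 3 * (S * ‖φ x‖))) := by ring
      _ ≤ _ := by linarith
  have t7 : |𝔳 h x * (1 / 4 * scalarCurvature h x * ⟪φ x, c.radial h e s φ x⟫)| ≤ 52500 * κ * N := by
    refine (abs_mul_le' (A := 2) (by rw [abs_of_pos (hh.volDensity_pos x)]; exact hf.vol_le x)
      (abs_mul_le' (abs_mul_le' (A := 1 / 4) (by norm_num) (hf.scalarCurvature_le hh x))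
        ((abs_real_inner_le_norm _ _).trans (mul_le_mul_of_nonneg_left (c.norm_radial_le hh hs hf φ x) (norm_nonneg _))))).trans ?_
    rw [hdiv]
    calc _ = 15000 * (κ * (p ^ 3 * (S * ‖φ x‖))) + 30000 * (κ * (p ^ 4 * ‖φ x‖ ^ 2)) := by ring
      _ ≤ _ := by linarith
  have b2 := abs_le.1 t2; have b3 := abs_le.1 t3; have b4 := abs_le.1 t4; have b5 := abs_le.1 t5; have b6 := abs_le.1 t6
  have b7 := abs_le.1 t7
  have b8 : ∑ k, (pd k (gZero s) x + pd k (gOne h s) x) * ⟪c.flux h e k φ x, φ x⟫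
      = ∑ k, pd k (gZero s) x * ⟪c.flux h e k φ x, φ x⟫ + ∑ k, pd k (gOne h s) x * ⟪c.flux h e k φ x, φ x⟫ := by
    rw [← sum_add_distrib]; exact sum_ext fun k => by ring
  rw [b8] at e2
  have b9 : ∑ k, pd k (gZero s) x * (2 * ⟪c.D h e k φ x, φ x⟫) = 2 * ∑ k, pd k (gZero s) x * ⟪c.D h e k φ x, φ x⟫ := by
    rw [mul_sum]; exact sum_ext fun k => by ring
  rw [b9]; have hκN : 0 ≤ κ * N := mul_nonneg hκ0 hN0
  have e3' : m ^ 2 / 2 * ∑ i, pd i (fun y => (𝔳 h y * (y i * wgt s y)) * ⟪φ y, φ y⟫) x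
      = m ^ 2 * (𝔳 h x * ⟪φ x, c.radial h e s φ x⟫) := by linear_combination (-(m ^ 2) / 2) * e3
  rw [e3']; linarith

end CliffordRep

/-! ### Weighted norms of test fields -/

section volSq

/-- The squared norm in `L²(M_h)`. -/
def volSq (h : MatField) (f : Space → F) : ℝ := ∫ x, 𝔳 h x * ‖f x‖ ^ 2

/-- The inner product in `L²(M_h)`. -/
def volInner (h : MatField) (f g : Space → F) : ℝ := ∫ x, 𝔳 h x * ⟪f x, g x⟫

include hh

lemma integrable_volInner {f g : Space → F} (hf : Continuous f) (hg : Continuous g) (hc : HasCompactSupport f) :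
    Integrable fun x => 𝔳 h x * ⟪f x, g x⟫ :=
  integrable_of_eq_zero (hh.contDiff_volDensity.continuous.mul (hf.inner hg)) hc fun x hx => by simp [off_tsupport hx]

omit hh in
lemma volInner_self (f : Space → F) : volInner h f f = volSq h f := by simp only [volInner, volSq, real_inner_self_eq_norm_sq]

end volSq

/-! ### Static estimates -/

namespace CliffordRep

/-- The positive density produced by the radial multiplier. -/
def virialDensity (h e : MatField) (s : ℝ) (φ : Space → F) (x : Space) : ℝ :=
  s ^ 2 * wgt s x ^ 3 * c.gradSq h e φ x + 15 / 4 * (s ^ 4 * wgt s x ^ 7) * ‖φ x‖ ^ 2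

include hh he hs

lemma integrable_virialDensity (hφ : 𝒞 1 φ) (hc : HasCompactSupport φ) : Integrable (c.virialDensity h e s φ) := by
  have hw := (contDiff_wgt hs).continuous; refine integrable_of_eq_zero (φ := φ) ?_ hc fun x hx => ?_
  · exact ((continuous_const.mul (hw.pow 3)).mul (c.continuous_gradSq hh he hφ)).add
      ((continuous_const.mul (continuous_const.mul (hw.pow 7))).mul (hφ.continuous.norm.pow 2))
  · simp [virialDensity, c.gradSq_eq_zero hx, off_tsupport hx]

omit hs in
lemma integrable_lowDensity (hφ : 𝒞 1 φ) (hc : HasCompactSupport φ) : Integrable (c.lowDensity h e φ) := by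
  have hb : Continuous fun x : Space => (bracket x)⁻¹ := contDiff_bracket.continuous.inv₀ fun x => (bracket_pos x).ne'
  refine integrable_of_eq_zero (φ := φ) ?_ hc fun x hx => ?_
  · exact ((hb.pow 2).mul (c.continuous_gradSq hh he hφ)).add ((hb.pow 4).mul (hφ.continuous.norm.pow 2))
  · simp [lowDensity, c.gradSq_eq_zero hx, off_tsupport hx]

include hf

lemma integral_virialDensity_le [Nontrivial F] (m : ℝ) (hφ : 𝒞 3 φ) (hc : HasCompactSupport φ) :
    ∫ x, c.virialDensity h e s φ x ≤ volInner h (c.H h e m (c.H h e m φ)) (c.radial h e s φ)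
      + 2 * 10 ^ 7 * κ * ∫ x, c.lowDensity h e φ x := by
  have hφ1 : 𝒞 1 φ := hφ.of_le (by norm_num); have hφ2 : 𝒞 2 φ := hφ.of_le (by norm_num)
  have hH : 𝒞 1 (c.H h e m φ) := c.contDiff_H hh he m hφ2 (by norm_cast)
  have hR : 𝒞 1 (c.radial h e s φ) := c.contDiff_radial hh he hs hφ2 (by norm_cast); have i1 := c.integrable_lowDensity hh he hφ1 hc
  have i2 : Integrable fun x => 𝔳 h x * ⟪c.H h e m (c.H h e m φ) x, c.radial h e s φ x⟫ :=
    integrable_of_eq_zero (hh.contDiff_volDensity.continuous.mul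
      ((c.contDiff_H hh he m (n := 0) hH (by simp)).continuous.inner hR.continuous)) hc fun x hx => by
      simp [c.radial_eq_zero hx]
  have hvol1 : 𝒞 1 (𝔳 h) := hh.contDiff_volDensity.of_le (by simp)
  have hr1 : ∀ i, 𝒞 1 fun y : Space => y i * wgt s y := fun i => (contDiff_radialCoord hs i).of_le (by simp)
  rw [volInner, ← integral_const_mul, ← integral_add i2 (i1.const_mul _)]
  refine integral_le_of_le_add_div (c.integrable_virialDensity hh he hs hφ1 hc) (i2.add (i1.const_mul _))
    (fun i => ?_) (fun i => ?_) (c.virial_pointwise hh he hs hf m hφ)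
  · exact (((((c.contDiff_flux hh he (n := 1) hφ2 (by norm_cast) i).inner ℝ hR).sub
      (contDiff_const.mul ((hr1 i).mul (c.contDiff_energyDensity hh he hφ2)))).sub
      (contDiff_const.mul (((ContDiff.pd_infty (contDiff_gZero hs) i).of_le (by simp)).mul (hφ1.inner ℝ hφ1)))).sub
      (contDiff_const.mul ((hvol1.mul (hr1 i)).mul (hφ1.inner ℝ hφ1))))
  · refine .intro hc fun x hx => ?_; simp [c.radial_eq_zero hx, energyDensity, c.flux_eq_zero hx, off_tsupport hx]

lemma volSq_radial_le [Nontrivial F] (hκ : κ ≤ 1 / 10 ^ 6) (m : ℝ) (hφ : 𝒞 2 φ)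
    (hc : HasCompactSupport φ) : volSq h (c.radial h e s φ) ≤ 152 * volSq h (c.H h e m φ) := by
  have hφ1 : 𝒞 1 φ := hφ.of_le (by norm_num); have h1 := c.integral_gradSq_le hh he hf hκ m hφ hc; have h2 := c.integral_hardy hh he hφ1 hc
  have i1 := integrable_inv_bracket_sq_mul hφ.continuous hc; have i2 := c.integrable_gradSq hh he hφ1 hc
  have hR : 𝒞 1 (c.radial h e s φ) := c.contDiff_radial hh he hs hφ (by norm_cast)
  have i3 : Integrable fun x => 𝔳 h x * ‖c.radial h e s φ x‖ ^ 2 :=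
    integrable_of_eq_zero (hh.contDiff_volDensity.continuous.mul (hR.continuous.norm.pow 2)) hc fun x hx => by simp [c.radial_eq_zero hx]
  have h3 : volSq h (c.radial h e s φ) ≤ ∫ x, (12 * c.gradSq h e φ x + 16 * ((bracket x ^ 2)⁻¹ * ‖φ x‖ ^ 2)) := by
    refine integral_mono i3 ((i2.const_mul _).add (i1.const_mul _)) fun x => ?_; have h4 := c.norm_radial_le (h := h) (e := e) hh hs hf φ x
    have h5 : (∑ j, ‖c.D h e j φ x‖) ^ 2 ≤ 3 * c.gradSq h e φ x := by
      have := sq_sum_le_card_mul_sum_sq (s := (Finset.univ : Finset (Fin 3))) (f := fun j => ‖c.D h e j φ x‖); simpa [gradSq] using this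
    have h6 : ‖c.radial h e s φ x‖ ^ 2 ≤ 6 * c.gradSq h e φ x + 8 * ((bracket x ^ 2)⁻¹ * ‖φ x‖ ^ 2) := by
      have h7 := pow_le_pow_left₀ (norm_nonneg _) h4 2
      have h8 : (bracket x ^ 2)⁻¹ * ‖φ x‖ ^ 2 = ((bracket x)⁻¹ * ‖φ x‖) ^ 2 := by rw [mul_pow, inv_pow]
      rw [h8]; nlinarith [sq_nonneg (∑ j, ‖c.D h e j φ x‖ - 2 * (bracket x)⁻¹ * ‖φ x‖)]
    calc 𝔳 h x * ‖c.radial h e s φ x‖ ^ 2 ≤ 2 * (6 * c.gradSq h e φ x + 8 * ((bracket x ^ 2)⁻¹ * ‖φ x‖ ^ 2)) :=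
          mul_le_mul (hf.vol_le x) h6 (sq_nonneg _) (by norm_num)
      _ = _ := by ring
  rw [integral_add (i2.const_mul _) (i1.const_mul _), integral_const_mul, integral_const_mul] at h3
  change _ ≤ 2 * volSq h (c.H h e m φ) at h1; linarith

end CliffordRep

/-- An energy inequality for functions of time. -/
lemma energy_growth_le {E E' g : ℝ → ℝ} {a b : ℝ} (hE : ∀ t, HasDerivAt E (E' t) t)
    (hE' : Continuous E') (hg : Continuous g) (hg0 : ∀ t, 0 ≤ g t) (h0 : ∀ t, 0 ≤ E t)
    (h : ∀ t, |E' t| ≤ 2 * (g t * √(E t))) {t t₀ : ℝ} (ht : t ∈ Icc a b) (ht₀ : t₀ ∈ Icc a b) :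
    E t ≤ 2 * E t₀ + 4 * (∫ r in a..b, g r) ^ 2 := by
  have hab : a ≤ b := ht.1.trans ht.2; have hEc : Continuous E := continuous_iff_continuousAt.2 fun t => (hE t).continuousAt
  obtain ⟨r, hr, hmax⟩ := isCompact_Icc.exists_isMaxOn (⟨t, ht⟩ : (Icc a b).Nonempty) hEc.continuousOn; set M := √(E r) with hM
  set J := ∫ r in a..b, g r with hJ; have hM2 : M ^ 2 = E r := Real.sq_sqrt (h0 r)
  have hgi : ∀ C a b, IntervalIntegrable (fun q => C * g q) volume a b := fun C a b =>
    Continuous.intervalIntegrable (continuous_const.mul hg) a b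
  have hi : ∀ a b, IntervalIntegrable E' volume a b := fun a b => hE'.intervalIntegrable a b
  have h1 : E r - E t₀ = ∫ q in t₀..r, E' q := (intervalIntegral.integral_eq_sub_of_hasDerivAt (fun q _ => hE q) (hi _ _)).symm
  have h2 : |∫ q in t₀..r, E' q| ≤ ∫ q in a..b, 2 * M * g q := by
    have h3 : ‖∫ q in t₀..r, E' q‖ ≤ |∫ q in t₀..r, 2 * M * g q| := by
      refine intervalIntegral.norm_integral_le_abs_of_norm_le (ae_restrict_of_forall_mem measurableSet_uIoc fun q hq => ?_) (hgi _ _ _)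
      have hq' : q ∈ Icc a b := by
        rcases le_total t₀ r with h4 | h4
        · rw [uIoc_of_le h4] at hq; exact ⟨ht₀.1.trans hq.1.le, hq.2.trans hr.2⟩
        · rw [uIoc_of_ge h4] at hq; exact ⟨hr.1.trans hq.1.le, hq.2.trans ht₀.2⟩
      refine (h q).trans ?_; have h5 : √(E q) ≤ M := Real.sqrt_le_sqrt (hmax hq'); nlinarith [mul_le_mul_of_nonneg_left h5 (hg0 q)]
    refine h3.trans ?_
    refine (intervalIntegral.abs_integral_mono_interval ?_ (.of_forall fun q => ?_) (hgi _ _ _)).trans (le_of_eq (abs_of_nonneg ?_))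
    · rw [uIoc_of_le hab]; rcases le_total t₀ r with h4 | h4
      · rw [uIoc_of_le h4]; exact Ioc_subset_Ioc ht₀.1 hr.2
      · rw [uIoc_of_ge h4]; exact Ioc_subset_Ioc hr.1 ht₀.2
    · exact mul_nonneg (mul_nonneg zero_le_two (Real.sqrt_nonneg _)) (hg0 q)
    · exact intervalIntegral.integral_nonneg hab fun q _ => mul_nonneg (mul_nonneg zero_le_two (Real.sqrt_nonneg _)) (hg0 q)
  rw [intervalIntegral.integral_const_mul] at h2; have h6 : E t ≤ E r := hmax ht; have h7 := (abs_le.1 h2).2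
  nlinarith [sq_nonneg (M - 2 * J)]

namespace CliffordRep

/-! ### The commutator of the Dirac operator with the radial multiplier -/

lemma D_bt {x : Space} (hφ : DiffAt φ x) (k : Fin 3) : c.D h e k (fun y => c.bt (φ y)) x = c.bt (c.D h e k φ x) := by
  rw [D, D, pd_const_clm c.bt hφ, c.B_bt, map_add]

include hh he hs in
lemma H0_radial_sub (hφ : 𝒞 2 φ) (x : Space) : c.H0 h e (c.radial h e s φ) x - c.radial h e s (c.H0 h e φ) x
      = ∑ j, ∑ i, (pd j (fun y => y i * wgt s y) x • c.A e j x (c.D h e i φ x) + (x i * wgt s x) • c.A e j x (c.curv h e j i x (φ x))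
          + (x i * wgt s x) • ∑ l, Γ h j i l x • c.A e l x (c.D h e j φ x))
        + ∑ j, (1 / 2 * (pd j (gZero s) x + pd j (gOne h s) x)) • c.A e j x (φ x) := by
  have hD := fun j => c.diff_D hh he hφ j x
  have e2 : ∀ i, c.D h e i (c.H0 h e φ) x
      = ∑ j, (c.A e j x (c.D h e i (c.D h e j φ) x) - ∑ l, Γ h j i l x • c.A e l x (c.D h e j φ x)) := by
    intro i; have : c.H0 h e φ = fun y => ∑ j, c.A e j y (c.D h e j φ y) := rfl
    rw [this, c.D_sum fun j _ => (c.diff_A he j x).clm_apply (hD j)]; exact sum_ext fun j => c.D_A hh he (hD j) i j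
  have e4 : c.radial h e s (c.H0 h e φ) x = ∑ i, (x i * wgt s x) • c.D h e i (c.H0 h e φ) x
      + (1 / 2 * (gZero s x + gOne h s x)) • ∑ j, c.A e j x (c.D h e j φ x) := rfl
  rw [e4, H0]; simp only [c.D_radial hh he hs hφ, e2]
  simp only [map_add, map_sum, map_smul, smul_add, sum_add_distrib, smul_sum, smul_sub, sum_sub_distrib]
  rw [sum_comm (f := fun i j => (x i * wgt s x) • c.A e j x (c.D h e i (c.D h e j φ) x)),
    sum_comm (f := fun i j => ∑ l, (x i * wgt s x) • Γ h j i l x • c.A e l x (c.D h e j φ x))]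
  abel

include hh he in
lemma H_radial_sub (m : ℝ) (hφ : 𝒞 2 φ) (x : Space) : c.H h e m (c.radial h e s φ) x - c.radial h e s (c.H h e m φ) x
      = -c.J (c.H0 h e (c.radial h e s φ) x - c.radial h e s (c.H0 h e φ) x) := by
  have hφ1 : DiffAt φ x := hφ.diff x; have hbt : DiffAt (fun y => c.bt (φ y)) x := c.bt.differentiableAt.comp x hφ1
  have hH0 : DiffAt (c.H0 h e φ) x := by
    refine DifferentiableAt.fun_sum fun j _ => (c.diff_A he j x).clm_apply ?_; exact c.diff_D hh he hφ j x
  have hJ : DiffAt (fun y => c.J (c.H0 h e φ y)) x := c.J.differentiableAt.comp x hH0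
  have e0 : c.H h e m φ = fun y => (-1 : ℝ) • c.J (c.H0 h e φ y) + (-m) • c.bt (φ y) := by funext y; simp [H, sub_eq_add_neg]
  have e1 : ∀ k, c.D h e k (c.H h e m φ) x = (-1 : ℝ) • c.J (c.D h e k (c.H0 h e φ) x) + (-m) • c.bt (c.D h e k φ x) := by
    intro k
    rw [e0, c.D_add (hJ.fun_const_smul _) (hbt.fun_const_smul _), c.D_smul (differentiableAt_const _) hJ,
      c.D_smul (differentiableAt_const _) hbt, c.D_J hH0, c.D_bt hφ1, pd_const, pd_const]
    simp
  have e2 : c.radial h e s (c.H h e m φ) x = (-1 : ℝ) • c.J (c.radial h e s (c.H0 h e φ) x) + (-m) • c.bt (c.radial h e s φ x) := by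
    simp only [radial, e1, map_add, map_sum, map_smul, smul_add, sum_add_distrib, smul_sum]
    simp only [e0, smul_add, smul_comm (-1 : ℝ), smul_comm (-m)]; abel
  rw [e2, H, map_sub]; module

include hh he hf in
lemma norm_A_le (j : Fin 3) (x : Space) (v : F) : ‖c.A e j x v‖ ≤ 6 * ‖v‖ := by
  simp only [A, sum_apply, smul_apply]
  refine (norm_sum_le_of_le _ (fun a _ => ?_ : ∀ a ∈ Finset.univ, _ ≤ 2 * ‖v‖)).trans (by simp; linarith)
  rw [norm_smul, Real.norm_eq_abs, c.norm_al]; exact mul_le_mul_of_nonneg_right (hf.abs_frame_le hh he j a x) (norm_nonneg v)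

include hh he hs hf in
lemma norm_H_radial_sub_le (m : ℝ) (hφ : 𝒞 2 φ) (x : Space) :
    ‖c.H h e m (c.radial h e s φ) x - c.radial h e s (c.H h e m φ) x‖ ≤ 10 ^ 6 * (∑ j, ‖c.D h e j φ x‖ + ‖φ x‖) := by
  rw [c.H_radial_sub hh he m hφ, norm_neg, c.norm_J, c.H0_radial_sub hh he hs hφ]; have hb := one_le_bracket x
  have hbp : (bracket x)⁻¹ ≤ 1 := inv_le_one_of_one_le₀ hb; have hκ0 : 0 ≤ κ := hf.nonneg 0; have hκ1 : κ ≤ 1 / 100 := hf.le 0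
  have hd : ∀ n : ℕ, κ / bracket x ^ n ≤ 1 / 100 := fun n => (div_le_self hκ0 (one_le_pow₀ hb)).trans hκ1
  set S := ∑ j, ‖c.D h e j φ x‖ with hS
  have hSj : ∀ j, ‖c.D h e j φ x‖ ≤ S := fun j =>
    single_le_sum (f := fun j => ‖c.D h e j φ x‖) (fun _ _ => norm_nonneg _) (Finset.mem_univ j)
  have hφ0 := norm_nonneg (φ x); have hS0 : 0 ≤ S := (norm_nonneg _).trans (hSj 0)
  have key : ∀ (a b : ℝ) (v : F), |a| ≤ b → ∀ t, ‖v‖ ≤ t → ‖a • v‖ ≤ b * t := fun a b v ha t hv => by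
    rw [norm_smul]; exact mul_le_mul ha hv (norm_nonneg _) ((abs_nonneg _).trans ha)
  have hA : ∀ j (v : F) t, ‖v‖ ≤ t → ‖c.A e j x v‖ ≤ 6 * t := fun j v t hv => (c.norm_A_le hh he hf j x v).trans (by linarith)
  have b1 : ∀ j i, ‖pd j (fun y : Space => y i * wgt s y) x • c.A e j x (c.D h e i φ x)‖ ≤ 2 * (6 * S) := fun j i =>
    key _ _ _ ((abs_pd_radialCoord_le hs j i x).trans (by linarith)) _ (hA j _ _ (hSj i))
  have b2 : ∀ j i, ‖(x i * wgt s x) • c.A e j x (c.curv h e j i x (φ x))‖ ≤ 1 * (6 * (3000 * ‖φ x‖)) := fun j i =>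
    key _ _ _ (coord_mul_wgt_le hs x i) _ (hA j _ _ ((c.norm_curv_le hh he hf j i x (φ x)).trans
      (mul_le_mul_of_nonneg_right (by linarith [hd 3]) hφ0)))
  have b3 : ∀ j i, ‖(x i * wgt s x) • ∑ l, Γ h j i l x • c.A e l x (c.D h e j φ x)‖ ≤ 1 * (∑ l : Fin 3, 1 * (6 * S)) := fun j i =>
    key _ _ _ (coord_mul_wgt_le hs x i) _ (norm_sum_le_of_le _ fun l _ =>
      key _ _ _ ((hf.christoffel_le hh j i l x).trans (by linarith [hd 2])) _ (hA l _ _ (hSj j)))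
  have b4 : ∀ j, ‖(1 / 2 * (pd j (gZero s) x + pd j (gOne h s) x)) • c.A e j x (φ x)‖ ≤ 13 * (6 * ‖φ x‖) := fun j => by
    refine key _ _ _ ?_ _ (hA j _ _ le_rfl); rw [abs_mul]; have h1 := abs_pd_gZero_le hs j x; have h2 := abs_pd_gOne_le hh hs hf j x
    have h3 : (bracket x)⁻¹ * (bracket x)⁻¹ ≤ 1 := mul_le_one₀ hbp (inv_nonneg.2 (bracket_pos x).le) hbp
    have h4 := abs_add_le (pd j (gZero s) x) (pd j (gOne h s) x); rw [abs_of_pos (by norm_num : (0 : ℝ) < 1 / 2)]; linarith [hd 3]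
  refine (norm_add_le _ _).trans ((add_le_add (norm_sum_le_of_le _ fun j _ => norm_sum_le_of_le _ fun i _ =>
    (norm_add₃_le).trans (add_le_add (add_le_add (b1 j i) (b2 j i)) (b3 j i))) (norm_sum_le_of_le _ fun j _ => b4 j)).trans ?_)
  simp only [Finset.sum_const, Finset.card_univ, Fintype.card_fin, nsmul_eq_mul]; push_cast; linarith

/-! ### Summation over dyadic scales -/

/-- The density `⟨x⟩^{-1-2η} |Dφ|² + ⟨x⟩^{-3-2η} |φ|²`. -/
def smoothingDensity (h e : MatField) (η : ℝ) (φ : Space → F) (x : Space) : ℝ :=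
  bracket x ^ (-1 - 2 * η) * c.gradSq h e φ x + bracket x ^ (-3 - 2 * η) * ‖φ x‖ ^ 2

lemma lowDensity_eq (φ : Space → F) (x : Space) : c.lowDensity h e φ x = c.smoothingDensity h e (1 / 2) φ x := by
  have h1 : ∀ n : ℕ, bracket x ^ (-(n : ℝ)) = (bracket x)⁻¹ ^ n := fun n => by
    rw [Real.rpow_neg (bracket_pos x).le, Real.rpow_natCast, inv_pow]
  rw [lowDensity, smoothingDensity, ← h1 2, ← h1 4]; norm_num

lemma smoothingDensity_le_virialDensity {η : ℝ} (hη : 0 < η) (k : ℕ) (φ : Space → F) {x : Space}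
    (h1 : (2 : ℝ) ^ k ≤ bracket x) (h2 : bracket x < 2 ^ (k + 1)) :
    c.smoothingDensity h e η φ x ≤ 50 * (((2 : ℝ) ^ (-2 * η)) ^ k * c.virialDensity h e (2 ^ k) φ x) := by
  have hb := bracket_pos x; have hs : (1 : ℝ) ≤ 2 ^ k := one_le_pow₀ (by norm_num)
  have hG := c.gradSq_nonneg (h := h) (e := e) φ x; set s : ℝ := 2 ^ k with hsd; set b := bracket x with hbd
  have hw := wgt_sq_mul hs x; have hw0 := wgt_pos hs x; set w := wgt s x; have h3 : b ^ 2 = 1 + ‖x‖ ^ 2 := bracket_sq x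
  have h4 : 1 ≤ 2 * (w * b) ^ 2 := by have : s ^ 2 ≤ b ^ 2 := pow_le_pow_left₀ (by linarith) h1 2; rw [mul_pow]; nlinarith [sq_nonneg w]
  have h5 : b ≤ 2 * s := by rw [pow_succ] at h2; linarith
  have hwb : 707 / 1000 ≤ w * b := by by_contra! hlt; nlinarith [mul_pos hw0 hb]
  have hq : b ^ (-2 * η) ≤ ((2 : ℝ) ^ (-2 * η)) ^ k := by
    rw [← Real.rpow_natCast ((2 : ℝ) ^ (-2 * η)), ← Real.rpow_mul (by norm_num), mul_comm (-2 * η) (k : ℝ),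
      Real.rpow_mul (by norm_num : (0 : ℝ) ≤ 2) (k : ℝ), Real.rpow_natCast]
    exact Real.rpow_le_rpow_of_nonpos (by linarith) h1 (by linarith)
  have e1 : b ^ (-1 - 2 * η) = b ^ (-2 * η) * b⁻¹ := by rw [← Real.rpow_neg_one b, ← Real.rpow_add hb]; ring_nf
  have e3 : b ^ (-3 - 2 * η) = b ^ (-2 * η) * (b⁻¹) ^ 3 := by
    rw [inv_pow, ← Real.rpow_natCast, ← Real.rpow_neg hb.le, ← Real.rpow_add hb]; congr 1; push_cast; ring
  have hsb : 1 / 2 ≤ s * b⁻¹ := by rw [← div_eq_mul_inv, le_div_iff₀ hb]; linarith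
  have hwb3 : 353 / 1000 ≤ (w * b) ^ 3 := by have := pow_le_pow_left₀ (by norm_num) hwb 3; norm_num at this; linarith
  have hwb7 : 882 / 10000 ≤ (w * b) ^ 7 := by have := pow_le_pow_left₀ (by norm_num) hwb 7; norm_num at this; linarith
  have hsb2 : 1 / 4 ≤ (s * b⁻¹) ^ 2 := by have := pow_le_pow_left₀ (by norm_num) hsb 2; norm_num at this; linarith
  have hsb4 : 1 / 16 ≤ (s * b⁻¹) ^ 4 := by have := pow_le_pow_left₀ (by norm_num) hsb 4; norm_num at this; linarith
  have c1 : b⁻¹ ≤ 50 * (s ^ 2 * w ^ 3) := by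
    have e : s ^ 2 * w ^ 3 = ((s * b⁻¹) ^ 2 * (w * b) ^ 3) * b⁻¹ := by field_simp
    rw [e]; have := mul_le_mul hsb2 hwb3 (by norm_num) (by positivity); nlinarith [inv_pos.2 hb]
  have c2 : (b⁻¹) ^ 3 ≤ 50 * (15 / 4 * (s ^ 4 * w ^ 7)) := by
    have e : s ^ 4 * w ^ 7 = ((s * b⁻¹) ^ 4 * (w * b) ^ 7) * (b⁻¹) ^ 3 := by field_simp
    rw [e]; have := mul_le_mul hsb4 hwb7 (by norm_num) (by positivity); nlinarith [pow_pos (inv_pos.2 hb) 3]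
  have c3 : c.smoothingDensity h e η φ x = b ^ (-2 * η) * (b⁻¹ * c.gradSq h e φ x + (b⁻¹) ^ 3 * ‖φ x‖ ^ 2) := by
    rw [smoothingDensity, e1, e3]; ring
  have c4 : b⁻¹ * c.gradSq h e φ x + (b⁻¹) ^ 3 * ‖φ x‖ ^ 2 ≤ 50 * c.virialDensity h e s φ x := by
    have := mul_le_mul_of_nonneg_right c1 hG; have := mul_le_mul_of_nonneg_right c2 (sq_nonneg ‖φ x‖); rw [virialDensity]; linarith
  rw [c3]
  calc _ ≤ ((2 : ℝ) ^ (-2 * η)) ^ k * (50 * c.virialDensity h e s φ x) := mul_le_mul hq c4 (by positivity) (by positivity)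
    _ = _ := by ring

lemma virialDensity_nonneg (hs : 1 ≤ s) (φ : Space → F) (x : Space) : 0 ≤ c.virialDensity h e s φ x := by
  have := c.gradSq_nonneg (h := h) (e := e) φ x; have := wgt_pos hs x; unfold virialDensity; positivity

lemma smoothingDensity_le_sum {η : ℝ} (hη : 0 < η) (K : ℕ) (φ : Space → F) (x : Space) :
    c.smoothingDensity h e η φ x ≤ 50 * ∑ k ∈ Finset.range K, ((2 : ℝ) ^ (-2 * η)) ^ k * c.virialDensity h e (2 ^ k) φ x
      + (1 / 2) ^ K * (c.gradSq h e φ x + ‖φ x‖ ^ 2) := by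
  have hG := c.gradSq_nonneg (h := h) (e := e) φ x; have hb := one_le_bracket x
  have hV : ∀ k : ℕ, 0 ≤ ((2 : ℝ) ^ (-2 * η)) ^ k * c.virialDensity h e (2 ^ k) φ x := fun k =>
    mul_nonneg (by positivity) (c.virialDensity_nonneg (one_le_pow₀ (by norm_num)) φ x)
  obtain ⟨k, h1, h2⟩ := exists_nat_pow_near hb (by norm_num : (1 : ℝ) < 2); rcases lt_or_ge k K with hk | hk
  · refine (c.smoothingDensity_le_virialDensity hη k φ h1 h2).trans ?_; have := single_le_sum (fun k _ => hV k) (Finset.mem_range.2 hk)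
    have : 0 ≤ (1 / 2 : ℝ) ^ K * (c.gradSq h e φ x + ‖φ x‖ ^ 2) := by positivity
    linarith
  · have h3 : (2 : ℝ) ^ K ≤ bracket x := (pow_le_pow_right₀ (by norm_num) hk).trans h1
    have h4 : ∀ a : ℝ, a ≤ -1 → bracket x ^ a ≤ (1 / 2) ^ K := fun a ha => by
      refine (Real.rpow_le_rpow_of_exponent_le hb ha).trans ?_; rw [Real.rpow_neg_one, one_div, inv_pow]; exact inv_anti₀ (by positivity) h3
    have h5 : 0 ≤ ∑ k ∈ Finset.range K, ((2 : ℝ) ^ (-2 * η)) ^ k * c.virialDensity h e (2 ^ k) φ x := sum_nonneg fun k _ => hV k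
    have h6 := mul_le_mul_of_nonneg_right (h4 (-1 - 2 * η) (by linarith)) hG
    have h7 := mul_le_mul_of_nonneg_right (h4 (-3 - 2 * η) (by linarith)) (sq_nonneg ‖φ x‖); rw [smoothingDensity]; linarith

end CliffordRep

/-! ### Functions as elements of `L²` -/

section L2

variable {α F : Type*} [MeasurableSpace α] [NormedAddCommGroup F] [InnerProductSpace ℝ F] {μ : Measure α}

/-- The class in `L²` of a function (zero if the function is not square integrable). -/
def lp (μ : Measure α) (f : α → F) : Lp F 2 μ := open Classical in if h : MemLp f 2 μ then h.toLp f else 0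

lemma lp_eq {f : α → F} (hf : MemLp f 2 μ) : lp μ f = hf.toLp f := by rw [lp, dif_pos hf]

lemma coeFn_lp {f : α → F} (hf : MemLp f 2 μ) : lp μ f =ᵐ[μ] f := by rw [lp_eq hf]; exact hf.coeFn_toLp

lemma lp_coeFn (f : Lp F 2 μ) : lp μ f = f := by rw [lp_eq (Lp.memLp f), Lp.toLp_coeFn]

lemma lp_add {f g : α → F} (hf : MemLp f 2 μ) (hg : MemLp g 2 μ) : lp μ (fun x => f x + g x) = lp μ f + lp μ g := by
  rw [lp_eq hf, lp_eq hg, lp_eq (f := fun x => f x + g x) (hf.add hg)]; rfl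

lemma lp_sub {f g : α → F} (hf : MemLp f 2 μ) (hg : MemLp g 2 μ) : lp μ (fun x => f x - g x) = lp μ f - lp μ g := by
  rw [lp_eq hf, lp_eq hg, lp_eq (f := fun x => f x - g x) (hf.sub hg)]; rfl

lemma lp_const_smul {f : α → F} (hf : MemLp f 2 μ) (a : ℝ) : lp μ (fun x => a • f x) = a • lp μ f := by
  rw [lp_eq hf, lp_eq (f := fun x => a • f x) (hf.const_smul a)]; rfl

lemma lp_sum {ι : Type*} (s : Finset ι) {f : ι → α → F} (hf : ∀ i, MemLp (f i) 2 μ) :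
    lp μ (fun x => ∑ i ∈ s, f i x) = ∑ i ∈ s, lp μ (f i) := by
  classical
  induction s using Finset.induction_on with
  | empty =>
    simp only [Finset.sum_empty]; exact (lp_eq (f := fun _ : α => (0 : F)) MemLp.zero').trans (MemLp.toLp_zero _)
  | insert i s hi ih =>
    simp only [Finset.sum_insert hi]; rw [lp_add (hf i) (memLp_finsetSum s fun i _ => hf i), ih]

lemma lp_congr {f g : α → F} (h : f =ᵐ[μ] g) : lp μ f = lp μ g := by
  by_cases hf : MemLp f 2 μ
  · have hg : MemLp g 2 μ := (memLp_congr_ae h).1 hf; rw [lp_eq hf, lp_eq hg]; exact (MemLp.toLp_eq_toLp_iff _ _).2 h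
  · have hg : ¬MemLp g 2 μ := fun hg => hf ((memLp_congr_ae h).2 hg); rw [lp, lp, dif_neg hf, dif_neg hg]

lemma inner_lp {f g : α → F} (hf : MemLp f 2 μ) (hg : MemLp g 2 μ) : ⟪lp μ f, lp μ g⟫ = ∫ x, ⟪f x, g x⟫ ∂μ := by
  rw [L2.inner_def]; refine integral_congr_ae ?_; filter_upwards [coeFn_lp hf, coeFn_lp hg] with x h1 h2; rw [h1, h2]

lemma inner_lp_left {f : α → F} (hf : MemLp f 2 μ) (g : Lp F 2 μ) : ⟪lp μ f, g⟫ = ∫ x, ⟪f x, g x⟫ ∂μ := by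
  conv_lhs => rw [← lp_coeFn g]
  exact inner_lp hf (Lp.memLp g)

lemma norm_lp_sq {f : α → F} (hf : MemLp f 2 μ) : ‖lp μ f‖ ^ 2 = ∫ x, ‖f x‖ ^ 2 ∂μ := by
  rw [← real_inner_self_eq_norm_sq, inner_lp hf hf]; simp only [real_inner_self_eq_norm_sq]

lemma enorm_lp {f : α → F} (hf : MemLp f 2 μ) : ‖lp μ f‖ₑ = eLpNorm f 2 μ := by rw [lp_eq hf, Lp.enorm_toLp]

lemma norm_lp_norm {f : α → F} (hf : MemLp f 2 μ) : ‖lp μ fun x => ‖f x‖‖ = ‖lp μ f‖ := by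
  refine (pow_left_inj₀ (norm_nonneg _) (norm_nonneg _) two_ne_zero).1 ?_; rw [norm_lp_sq hf, norm_lp_sq hf.norm]; simp

lemma norm_lp_le {f : α → F} {g : α → ℝ} (hf : MemLp f 2 μ) (hg : MemLp g 2 μ) (h : ∀ x, ‖f x‖ ≤ g x) : ‖lp μ f‖ ≤ ‖lp μ g‖ := by
  refine Lp.norm_le_norm_of_ae_le ?_; filter_upwards [coeFn_lp hf, coeFn_lp hg] with x h1 h2; rw [h1, h2]; exact (h x).trans (le_abs_self _)

lemma norm_lp_le_sum {f g : α → F} {k : Fin 3 → α → F} {C : ℝ} (hC : 0 ≤ C) (hf : MemLp f 2 μ) (hg : MemLp g 2 μ)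
    (hk : ∀ j, MemLp (k j) 2 μ) (h : ∀ x, ‖f x‖ ≤ C * (∑ j, ‖k j x‖ + ‖g x‖)) :
    ‖lp μ f‖ ≤ C * (∑ j, ‖lp μ (k j)‖ + ‖lp μ g‖) := by
  have h1 : MemLp (fun x => ∑ j, ‖k j x‖) 2 μ := memLp_finsetSum _ fun j _ => (hk j).norm
  have h2 : MemLp (fun x => ∑ j, ‖k j x‖ + ‖g x‖) 2 μ := h1.add hg.norm
  refine (norm_lp_le (g := fun x => C • (∑ j, ‖k j x‖ + ‖g x‖)) hf (h2.const_smul C) h).trans ?_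
  rw [lp_const_smul h2, lp_add h1 hg.norm, lp_sum _ fun j => (hk j).norm, norm_smul, Real.norm_of_nonneg hC]
  refine mul_le_mul_of_nonneg_left ((norm_add_le _ _).trans (add_le_add ((norm_sum_le _ _).trans ?_) ?_)) hC
  · exact sum_le_sum fun j _ => (norm_lp_norm (hk j)).le
  · exact (norm_lp_norm hg).le

/-- Multiplication by a bounded field of operators. -/
def opL (μ : Measure α) (T : α → F →L[ℝ] F) : Lp F 2 μ →L[ℝ] Lp F 2 μ := open Classical in if h : MemLp T ∞ μ then
    (ContinuousLinearMap.id ℝ (F →L[ℝ] F)).holderL μ ∞ 2 2 (h.toLp T) else 0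

lemma coeFn_opL {T : α → F →L[ℝ] F} (hT : MemLp T ∞ μ) (f : Lp F 2 μ) : opL μ T f =ᵐ[μ] fun x => T x (f x) := by
  rw [opL, dif_pos hT]; have h1 := (ContinuousLinearMap.id ℝ (F →L[ℝ] F)).coeFn_holder (r := 2) (hT.toLp T) f
  refine Filter.EventuallyEq.trans h1 ?_; filter_upwards [hT.coeFn_toLp] with x hx; rw [hx]; rfl

lemma memLp_clm_apply {T : α → F →L[ℝ] F} (hT : MemLp T ∞ μ) {f : α → F} (hf : MemLp f 2 μ) : MemLp (fun x => T x (f x)) 2 μ :=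
  (ContinuousLinearMap.id ℝ (F →L[ℝ] F)).memLp_of_bilin 2 hT hf

lemma opL_lp {T : α → F →L[ℝ] F} (hT : MemLp T ∞ μ) {f : α → F} (hf : MemLp f 2 μ) : opL μ T (lp μ f) = lp μ fun x => T x (f x) := by
  refine Lp.ext ?_; filter_upwards [coeFn_opL hT (lp μ f), coeFn_lp hf, coeFn_lp (memLp_clm_apply hT hf)] with x h1 h2 h3; rw [h1, h2, h3]

lemma inner_opL_comm {T T' : α → F →L[ℝ] F} (hT : MemLp T ∞ μ) (hT' : MemLp T' ∞ μ)
    (h : ∀ x v w, ⟪T x v, w⟫ = ⟪v, T' x w⟫) (f g : Lp F 2 μ) :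
    ⟪opL μ T f, g⟫ = ⟪f, opL μ T' g⟫ := by
  rw [L2.inner_def, L2.inner_def]; refine integral_congr_ae ?_; filter_upwards [coeFn_opL hT f, coeFn_opL hT' g] with x h1 h2
  rw [h1, h2, h]

/-- Multiplication by a bounded function. -/
def mulL (μ : Measure α) (f : α → ℝ) : Lp F 2 μ →L[ℝ] Lp F 2 μ := opL μ fun x => f x • (1 : F →L[ℝ] F)

lemma memLp_smul_one {f : α → ℝ} (hf : MemLp f ∞ μ) : MemLp (fun x => f x • (1 : F →L[ℝ] F)) ∞ μ :=
  ((1 : ℝ →L[ℝ] ℝ).smulRight (1 : F →L[ℝ] F)).comp_memLp' hf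

lemma memLp_smul_fun {f : α → ℝ} (hf : MemLp f ∞ μ) {g : α → F} (hg : MemLp g 2 μ) : MemLp (fun x => f x • g x) 2 μ :=
  memLp_clm_apply (memLp_smul_one hf) hg

lemma mulL_lp {f : α → ℝ} (hf : MemLp f ∞ μ) {g : α → F} (hg : MemLp g 2 μ) : mulL μ f (lp μ g) = lp μ fun x => f x • g x := by
  rw [mulL, opL_lp (memLp_smul_one hf) hg]; rfl

end L2

lemma memLp_of_continuous_bound {α G : Type*} [TopologicalSpace α] [MeasurableSpace α] [OpensMeasurableSpace α]
    [SecondCountableTopology α] [NormedAddCommGroup G] {μ : Measure α} {f : α → G} (hf : Continuous f) {C : ℝ}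
    (hC : ∀ x, ‖f x‖ ≤ C) : MemLp f ∞ μ :=
  memLp_top_of_bound hf.aestronglyMeasurable C (.of_forall hC)

/-! ### The Riemannian measure -/

lemma IsMetric.integral_riemVol (hh : IsMetric h) (f : Space → ℝ) : ∫ x, f x ∂𝔯 h = ∫ x, 𝔳 h x * f x := by
  have h1 : Measurable fun x => Real.toNNReal (𝔳 h x) := hh.contDiff_volDensity.continuous.measurable.real_toNNReal
  have h2 : 𝔯 h = (volume : Measure Space).withDensity fun x => ((Real.toNNReal (𝔳 h x) : ℝ≥0) : ℝ≥0∞) := rfl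
  rw [h2, integral_withDensity_eq_integral_smul h1]; refine integral_congr_ae (.of_forall fun x => ?_)
  change (Real.toNNReal (𝔳 h x) : ℝ) * f x = _; rw [Real.coe_toNNReal _ (hh.volDensity_pos x).le]

/-- A smooth compactly supported field. -/
structure IsTest {X : Type*} [NormedAddCommGroup X] [NormedSpace ℝ X] (φ : X → F) : Prop where
  smooth : 𝒞 ∞ φ
  compact : HasCompactSupport φ

section

variable {X : Type*} [NormedAddCommGroup X] [NormedSpace ℝ X] {φ : X → F} (hφ : IsTest φ)
include hφ

lemma IsTest.cont : Continuous φ := hφ.smooth.continuous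

lemma IsTest.diff : Diff φ := hφ.smooth.diff

end

section test

include hh

lemma IsMetric.memLp (hφ : Continuous φ) (hc : HasCompactSupport φ) : MemLp φ 2 𝔯 h := haveI := isLocallyFinite_riemVol hh
  hφ.memLp_of_hasCompactSupport hc

lemma IsTest.memLp (hφ : IsTest φ) : MemLp φ 2 𝔯 h := hh.memLp hφ.smooth.continuous hφ.compact

lemma volInner_eq (hφ : IsTest φ) (hψ : IsTest ψ) : volInner h φ ψ = ⟪lp 𝔯 h φ, lp 𝔯 h ψ⟫ := by
  rw [inner_lp (hφ.memLp hh) (hψ.memLp hh), hh.integral_riemVol]; rfl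

lemma volSq_eq (hφ : IsTest φ) : volSq h φ = ‖lp 𝔯 h φ‖ ^ 2 := by rw [← volInner_self, volInner_eq hh hφ hφ, real_inner_self_eq_norm_sq]

omit hh

lemma IsTest.add (hφ : IsTest φ) (hψ : IsTest ψ) : IsTest fun x => φ x + ψ x := ⟨hφ.smooth.add hψ.smooth, hφ.compact.add hψ.compact⟩

lemma IsTest.const_smul (hφ : IsTest φ) (a : ℝ) : IsTest fun x => a • φ x :=
  ⟨contDiff_const.smul hφ.smooth, hφ.compact.smul_left (f := fun _ => a)⟩

lemma IsTest.sub (hφ : IsTest φ) (hψ : IsTest ψ) : IsTest fun x => φ x - ψ x := by simpa [sub_eq_add_neg] using hφ.add (hψ.const_smul (-1))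

lemma IsTest.clm (hφ : IsTest φ) (T : F →L[ℝ] F) : IsTest fun x => T (φ x) := ⟨T.contDiff.comp hφ.smooth, hφ.compact.comp_left (map_zero T)⟩

include hh he

lemma IsTest.D (hφ : IsTest φ) (k : Fin 3) : IsTest (c.D h e k φ) :=
  ⟨c.contDiff_D hh he hφ.smooth (by simp) le_rfl k, .intro hφ.compact fun x hx => c.D_eq_zero hx k⟩

lemma IsTest.H (hφ : IsTest φ) (m : ℝ) : IsTest (c.H h e m φ) :=
  ⟨c.contDiff_H hh he m hφ.smooth (by simp), .intro hφ.compact fun x hx => c.H_eq_zero m hx⟩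

lemma IsTest.radial (hφ : IsTest φ) (hs : 1 ≤ s) : IsTest (c.radial h e s φ) :=
  ⟨c.contDiff_radial hh he hs hφ.smooth (by simp), .intro hφ.compact fun x hx => c.radial_eq_zero hx⟩

end test

namespace CliffordRep

/-- `(u, k, d)` is a limit of triples `(φ, Hφ, Dφ)` with test fields `φ`. -/
def InGraph (h e : MatField) (m : ℝ) (u k : Lp F 2 𝔯 h) (d : Fin 3 → Lp F 2 𝔯 h) : Prop :=
  ∃ φ : ℕ → Space → F, (∀ n, IsTest (φ n)) ∧ Tendsto (fun n => lp 𝔯 h (φ n)) atTop (𝓝 u) ∧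
    Tendsto (fun n => lp 𝔯 h (c.H h e m (φ n))) atTop (𝓝 k) ∧
    ∀ j, Tendsto (fun n => lp 𝔯 h (c.D h e j (φ n))) atTop (𝓝 (d j))

/-- The complex structure on `L²`. -/
def JL (μ : Measure Space) : Lp F 2 μ →L[ℝ] Lp F 2 μ := opL μ fun _ => c.J

lemma memLp_J (μ : Measure Space) : MemLp (fun _ : Space => c.J) ∞ μ := memLp_of_continuous_bound continuous_const fun _ => le_rfl

lemma JL_lp {μ : Measure Space} {f : Space → F} (hf : MemLp f 2 μ) : c.JL μ (lp μ f) = lp μ fun x => c.J (f x) := opL_lp (c.memLp_J μ) hf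

lemma inner_JL {μ : Measure Space} (f g : Lp F 2 μ) : ⟪c.JL μ f, g⟫ = -⟪f, c.JL μ g⟫ := by
  have h1 := inner_opL_comm (T' := fun _ => -c.J) (c.memLp_J μ) (memLp_of_continuous_bound continuous_const fun _ => le_rfl)
    (fun x v w => by rw [c.inner_J, neg_apply, inner_neg_right]) f g
  have h2 : opL μ (fun _ : Space => -c.J) g = -c.JL μ g := by
    refine Lp.ext ?_
    filter_upwards [coeFn_opL (T := fun _ : Space => -c.J) (memLp_of_continuous_bound continuous_const fun _ => le_rfl) g,
      coeFn_opL (c.memLp_J μ) g, Lp.coeFn_neg (c.JL μ g)] with x h1 h2 h3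
    rw [h1, h3, Pi.neg_apply, JL, h2]; rfl
  rw [JL, h1, h2, inner_neg_right, JL]

lemma JL_JL {μ : Measure Space} (f : Lp F 2 μ) : c.JL μ (c.JL μ f) = -f := by
  refine Lp.ext ?_; filter_upwards [coeFn_opL (c.memLp_J μ) (c.JL μ f), coeFn_opL (c.memLp_J μ) f, Lp.coeFn_neg f] with x h1 h2 h3
  change (opL μ (fun _ : Space => c.J) (c.JL μ f)) x = _; rw [h1, h3, JL, h2, c.J_J]; rfl

lemma norm_JL {μ : Measure Space} (f : Lp F 2 μ) : ‖c.JL μ f‖ = ‖f‖ := by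
  refine (pow_left_inj₀ (norm_nonneg _) (norm_nonneg _) two_ne_zero).1 ?_
  rw [← real_inner_self_eq_norm_sq, c.inner_JL, c.JL_JL, inner_neg_right, neg_neg, real_inner_self_eq_norm_sq]

lemma D_sub (hφ : IsTest φ) (hψ : IsTest ψ) (j : Fin 3) : c.D h e j (fun x => φ x - ψ x) = fun x => c.D h e j φ x - c.D h e j ψ x := by
  funext x; simp only [D, pd_sub (hφ.diff x) (hψ.diff x), map_sub]; abel

lemma D_const_smul (hφ : Diff φ) (a : ℝ) (j : Fin 3) : c.D h e j (fun x => a • φ x) = fun x => a • c.D h e j φ x := funext fun x => by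
  rw [c.D_smul (differentiableAt_const a) (hφ x), pd_const, zero_smul, zero_add]

lemma H_const_smul (m : ℝ) (hφ : Diff φ) (a : ℝ) : c.H h e m (fun x => a • φ x) = fun x => a • c.H h e m φ x := funext fun x => by
  simp only [H, H0, c.D_const_smul hφ, map_smul, ← smul_sum, smul_sub, smul_neg, smul_comm m a]

include hh he

lemma lp_D_sub (hφ : IsTest φ) (hψ : IsTest ψ) (j : Fin 3) :
    lp 𝔯 h (c.D h e j fun x => φ x - ψ x) = lp 𝔯 h (c.D h e j φ) - lp 𝔯 h (c.D h e j ψ) := by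
  rw [c.D_sub hφ hψ, lp_sub ((hφ.D hh he c j).memLp hh) ((hψ.D hh he c j).memLp hh)]

lemma lp_H_sub (hφ : IsTest φ) (hψ : IsTest ψ) : lp 𝔯 h (c.H h e m fun x => φ x - ψ x) = lp 𝔯 h (c.H h e m φ) - lp 𝔯 h (c.H h e m ψ) := by
  rw [← lp_sub ((hφ.H hh he c m).memLp hh) ((hψ.H hh he c m).memLp hh)]; congr 1; funext x
  simp only [H, H0, c.D_sub hφ hψ, map_sub, sum_sub_distrib, smul_sub]; abel

lemma InGraph.sub {u k u' k' : Lp F 2 𝔯 h} {d d' : Fin 3 → Lp F 2 𝔯 h} (h1 : c.InGraph h e m u k d) (h2 : c.InGraph h e m u' k' d') :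
    c.InGraph h e m (u - u') (k - k') (fun j => d j - d' j) := by
  obtain ⟨φ, hφ, a1, a2, a3⟩ := h1; obtain ⟨ψ, hψ, b1, b2, b3⟩ := h2
  refine ⟨fun n x => φ n x - ψ n x, fun n => (hφ n).sub (hψ n), ?_, ?_, fun j => ?_⟩
  · simp only [fun n => lp_sub ((hφ n).memLp hh) ((hψ n).memLp hh)]; exact a1.sub b1
  · simp only [fun n => c.lp_H_sub (m := m) hh he (hφ n) (hψ n)]; exact a2.sub b2
  · simp only [fun n => c.lp_D_sub hh he (hφ n) (hψ n)]; exact (a3 j).sub (b3 j)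

lemma InGraph.const_smul {u k : Lp F 2 𝔯 h} {d : Fin 3 → Lp F 2 𝔯 h} (h1 : c.InGraph h e m u k d) (a : ℝ) :
    c.InGraph h e m (a • u) (a • k) (fun j => a • d j) := by
  obtain ⟨φ, hφ, a1, a2, a3⟩ := h1; have hd := fun n => (hφ n).diff; have eD := fun n j => c.D_const_smul (h := h) (e := e) (hd n) a j
  have eH := fun n => c.H_const_smul (h := h) (e := e) m (hd n) a
  refine ⟨fun n x => a • φ n x, fun n => (hφ n).const_smul a, ?_, ?_, fun j => ?_⟩
  · simp only [fun n => lp_const_smul ((hφ n).memLp hh) a]; exact a1.const_smul a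
  · simp only [eH, fun n => lp_const_smul (((hφ n).H hh he c m).memLp hh) a]; exact a2.const_smul a
  · simp only [eD, fun n => lp_const_smul (((hφ n).D hh he c j).memLp hh) a]; exact (a3 j).const_smul a

omit hh he

/-! ### The radial multiplier and weighted norms on the graph -/

/-- The radial multiplier acting on a pair `(u, Du)`. -/
def radialL (h : MatField) (s : ℝ) (u : Lp F 2 𝔯 h) (d : Fin 3 → Lp F 2 𝔯 h) : Lp F 2 𝔯 h :=
  ∑ i, mulL 𝔯 h (fun x => x i * wgt s x) (d i) + mulL 𝔯 h (fun x => 1 / 2 * (gZero s x + gOne h s x)) u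

/-- The weighted square norm of a pair `(u, Du)` with density `⟨x⟩^{-1-2η} |Du|² + ⟨x⟩^{-3-2η} |u|²`. -/
def smoothingSq (h : MatField) (η : ℝ) (u : Lp F 2 𝔯 h) (d : Fin 3 → Lp F 2 𝔯 h) : ℝ :=
  ∑ i, ‖mulL 𝔯 h (fun x => √(bracket x ^ (-1 - 2 * η) / 𝔳 h x)) (d i)‖ ^ 2 + ‖mulL 𝔯 h (fun x => √(bracket x ^ (-3 - 2 * η) / 𝔳 h x)) u‖ ^ 2

include hs

lemma memLp_radialCoord (i : Fin 3) (μ : Measure Space) : MemLp (fun x : Space => x i * wgt s x) ∞ μ :=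
  memLp_of_continuous_bound (contDiff_radialCoord hs i).continuous fun x => coord_mul_wgt_le hs x i

lemma abs_gZero_le (x : Space) : |gZero s x| ≤ 3 * (bracket x)⁻¹ := by
  have h3 := wgt_pos hs x; have h1 := mul_wgt_le_one hs x; have h2 := wgt_le hs x
  have h4 : (s * wgt s x) ^ 2 ≤ 1 := pow_le_one₀ (by positivity) h1; rw [gZero, abs_of_pos (by positivity)]; nlinarith

include hh hf

lemma memLp_radialPotential (μ : Measure Space) : MemLp (fun x => 1 / 2 * (gZero s x + gOne h s x)) ∞ μ := by
  refine memLp_of_continuous_bound (C := 2)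
    (continuous_const.mul ((contDiff_gZero hs).continuous.add (contDiff_gOne hh hs).continuous)) fun x => ?_
  have h1 := abs_gZero_le hs x; have h2 := abs_gOne_le hh hs hf x; have h3 : (bracket x)⁻¹ ≤ 1 := inv_le_one_of_one_le₀ (one_le_bracket x)
  have h4 : κ / bracket x ^ 2 ≤ 1 / 100 := (div_le_self (hf.nonneg 0) (one_le_pow₀ (one_le_bracket x))).trans (hf.le 0)
  have h5 := abs_add_le (gZero s x) (gOne h s x); rw [Real.norm_eq_abs, abs_mul, abs_of_pos (by norm_num : (0 : ℝ) < 1 / 2)]; linarith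

omit hs

lemma memLp_smoothingWeight {a : ℝ} (ha : a ≤ 0) (μ : Measure Space) : MemLp (fun x => √(bracket x ^ a / 𝔳 h x)) ∞ μ := by
  refine memLp_of_continuous_bound (C := 2) ?_ fun x => ?_
  · exact ((contDiff_bracket.continuous.rpow_const fun x => Or.inl (bracket_pos x).ne').div
      hh.contDiff_volDensity.continuous fun x => (hh.volDensity_pos x).ne').sqrt
  · have h1 : bracket x ^ a ≤ 1 := Real.rpow_le_one_of_one_le_of_nonpos (one_le_bracket x) ha; have h2 := hf.le_vol x
    rw [Real.norm_of_nonneg (Real.sqrt_nonneg _), Real.sqrt_le_left (by norm_num), div_le_iff₀ (by linarith)]; linarith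

include he hs in
lemma radialL_lp (hφ : IsTest φ) : radialL h s (lp 𝔯 h φ) (fun j => lp 𝔯 h (c.D h e j φ)) = lp 𝔯 h (c.radial h e s φ) := by
  have hp := memLp_radialPotential hh hs hf 𝔯 h; have hD := fun i => (hφ.D hh he c i).memLp hh
  have h1 := fun i => memLp_smul_fun (memLp_radialCoord hs i 𝔯 h) (hD i); have h2 := memLp_smul_fun hp (hφ.memLp hh)
  have h3 : MemLp (fun x : Space => ∑ i, (x i * wgt s x) • c.D h e i φ x) 2 𝔯 h := memLp_finsetSum Finset.univ fun i _ => h1 i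
  have h4 : lp 𝔯 h (c.radial h e s φ) = lp 𝔯 h (fun x : Space => ∑ i, (x i * wgt s x) • c.D h e i φ x)
      + lp 𝔯 h fun x => (1 / 2 * (gZero s x + gOne h s x)) • φ x := lp_add h3 h2
  rw [h4, lp_sum Finset.univ h1, radialL, mulL_lp hp (hφ.memLp hh)]; simp only [fun i => mulL_lp (memLp_radialCoord hs i 𝔯 h) (hD i)]

lemma norm_mulL_weight_sq {a : ℝ} (ha : a ≤ 0) (hφ : IsTest φ) :
    ‖mulL 𝔯 h (fun x => √(bracket x ^ a / 𝔳 h x)) (lp 𝔯 h φ)‖ ^ 2 = ∫ x, bracket x ^ a * ‖φ x‖ ^ 2 := by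
  have hw := memLp_smoothingWeight hh hf ha 𝔯 h
  rw [mulL_lp hw (hφ.memLp hh), norm_lp_sq (memLp_smul_fun hw (hφ.memLp hh)), hh.integral_riemVol]
  refine integral_congr_ae (.of_forall fun x => ?_); have hv := hh.volDensity_pos x
  simp only [norm_smul, mul_pow, Real.norm_eq_abs, sq_abs]
  rw [Real.sq_sqrt (div_nonneg (Real.rpow_nonneg (bracket_pos x).le _) hv.le)]; field_simp

omit hh hf in
lemma integrable_rpow_mul_sq (a : ℝ) (hφ : IsTest φ) : Integrable fun x => bracket x ^ a * ‖φ x‖ ^ 2 :=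
  integrable_of_eq_zero ((contDiff_bracket.continuous.rpow_const fun x => Or.inl (bracket_pos x).ne').mul
    (hφ.cont.norm.pow 2)) hφ.compact fun x hx => by simp [off_tsupport hx]

include he

lemma smoothingSq_lp {η : ℝ} (hη : 0 < η) (hφ : IsTest φ) :
    smoothingSq h η (lp 𝔯 h φ) (fun j => lp 𝔯 h (c.D h e j φ)) = ∫ x, c.smoothingDensity h e η φ x := by
  have i1 := fun i => integrable_rpow_mul_sq (-1 - 2 * η) (hφ.D hh he c i); have i2 := integrable_rpow_mul_sq (-3 - 2 * η) hφ
  rw [smoothingSq, norm_mulL_weight_sq hh hf (by linarith) hφ]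
  simp only [fun i => norm_mulL_weight_sq hh hf (by linarith : -1 - 2 * η ≤ 0) (hφ.D hh he c i)]
  rw [← integral_finsetSum _ fun i _ => i1 i, ← integral_add (integrable_finsetSum _ fun i _ => i1 i) i2]
  simp only [smoothingDensity, gradSq, mul_sum]

/-! ### Static inequalities for test fields -/

lemma sum_norm_lp_D_sq_le [Nontrivial F] (hκ : κ ≤ 1 / 10 ^ 6) (m : ℝ) (hφ : IsTest φ) :
    ∑ j, ‖lp 𝔯 h (c.D h e j φ)‖ ^ 2 ≤ 4 * ‖lp 𝔯 h (c.H h e m φ)‖ ^ 2 := by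
  have hD := fun j => hφ.D hh he c j; have h1 := c.integral_gradSq_le hh he hf hκ m (hφ.smooth.of_le (by norm_cast)) hφ.compact
  have h2 : ∑ j, volSq h (c.D h e j φ) ≤ 2 * ∫ x, c.gradSq h e φ x := by
    have hi : ∀ j, Integrable fun x => 𝔳 h x * ‖c.D h e j φ x‖ ^ 2 := fun j =>
      integrable_of_eq_zero (hh.contDiff_volDensity.continuous.mul ((hD j).cont.norm.pow 2)) hφ.compact fun x hx => by simp [c.D_eq_zero hx]
    simp only [volSq]; rw [← integral_finsetSum _ fun j _ => hi j, ← integral_const_mul]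
    refine integral_mono (integrable_finsetSum _ fun j _ => hi j) ?_ fun x => ?_
    · exact (c.integrable_gradSq hh he (hφ.smooth.of_le (by simp)) hφ.compact).const_mul _
    · simp only [← mul_sum]; exact mul_le_mul_of_nonneg_right (hf.vol_le x) (c.gradSq_nonneg φ x)
  have h3 : ∫ x, 𝔳 h x * ‖c.H h e m φ x‖ ^ 2 = ‖lp 𝔯 h (c.H h e m φ)‖ ^ 2 := volSq_eq hh (hφ.H hh he c m)
  simp only [fun j => volSq_eq hh (hD j)] at h2; linarith

include hs

omit hf in
lemma inner_lp_radial (hφ : IsTest φ) (hψ : IsTest ψ) : ⟪lp 𝔯 h (c.radial h e s φ), lp 𝔯 h ψ⟫ = -⟪lp 𝔯 h φ, lp 𝔯 h (c.radial h e s ψ)⟫ := by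
  have hRφ := hφ.radial hh he c hs; have hRψ := hψ.radial hh he c hs
  rw [← volInner_eq hh hRφ hψ, ← volInner_eq hh hφ hRψ, volInner, volInner, ← integral_neg]
  refine integral_eq_of_eq_add_div (integrable_volInner hh hRφ.cont hψ.cont hRφ.compact)
    (integrable_volInner hh hφ.cont hRψ.cont hφ.compact).neg (fun i => ?_) (fun i => ?_)
    fun x => c.inner_radial_add hh hs (hφ.diff x) (hψ.diff x)
  · exact ((hh.contDiff_volDensity.mul (contDiff_radialCoord hs i)).mul (hφ.smooth.inner ℝ hψ.smooth)).of_le (by simp)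
  · refine .intro hφ.compact fun x hx => ?_; simp [off_tsupport hx]

omit hs hf in
lemma inner_lp_H (m : ℝ) (hφ : IsTest φ) (hψ : IsTest ψ) : ⟪lp 𝔯 h (c.H h e m φ), lp 𝔯 h ψ⟫ = ⟪lp 𝔯 h φ, lp 𝔯 h (c.H h e m ψ)⟫ := by
  rw [← volInner_eq hh (hφ.H hh he c m) hψ, ← volInner_eq hh hφ (hψ.H hh he c m)]
  exact c.integral_inner_H hh he m (hφ.smooth.of_le (by simp)) (hψ.smooth.of_le (by simp)) hφ.compact

lemma norm_lp_radial_le (hφ : IsTest φ) : ‖lp 𝔯 h (c.radial h e s φ)‖ ≤ 2 * (∑ j, ‖lp 𝔯 h (c.D h e j φ)‖ + ‖lp 𝔯 h φ‖) := by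
  refine norm_lp_le_sum (by norm_num) ((hφ.radial hh he c hs).memLp hh) (hφ.memLp hh)
    (fun j => (hφ.D hh he c j).memLp hh) fun x => (c.norm_radial_le (h := h) (e := e) hh hs hf φ x).trans ?_
  have h1 : (bracket x)⁻¹ ≤ 1 := inv_le_one_of_one_le₀ (one_le_bracket x)
  have h2 : 0 ≤ ∑ j, ‖c.D h e j φ x‖ := sum_nonneg fun _ _ => norm_nonneg _; nlinarith [mul_le_mul_of_nonneg_right h1 (norm_nonneg (φ x))]

/-- The error made by replacing `Hφ` by `Jψ`. -/
lemma volInner_H_radial_le (m : ℝ) (hφ : IsTest φ) (hψ : IsTest ψ) :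
    volInner h (c.H h e m (c.H h e m φ)) (c.radial h e s φ) ≤ ⟪c.JL 𝔯 h (lp 𝔯 h (c.H h e m ψ)), lp 𝔯 h (c.radial h e s φ)⟫
        + ‖lp 𝔯 h (c.H h e m φ) - c.JL 𝔯 h (lp 𝔯 h ψ)‖ * (10 ^ 6 * (∑ j, ‖lp 𝔯 h (c.D h e j φ)‖ + ‖lp 𝔯 h φ‖)
            + 2 * (∑ j, ‖lp 𝔯 h (c.D h e j ψ)‖ + ‖lp 𝔯 h ψ‖)) := by
  have hH := hφ.H hh he c m; have hJ := hψ.clm c.J; have hw := hH.sub hJ; have hR := hφ.radial hh he c hs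
  have eD : ∀ j, c.D h e j (fun x => c.J (ψ x)) = fun x => c.J (c.D h e j ψ x) := fun j => by funext x; exact c.D_J (hψ.diff x) j
  have eJ : ∀ {f : Space → F}, IsTest f → ‖lp 𝔯 h fun x => c.J (f x)‖ = ‖lp 𝔯 h f‖ := fun hf => by rw [← c.JL_lp (hf.memLp hh), c.norm_JL]
  have e1 : lp 𝔯 h (c.H h e m (c.H h e m φ)) = c.JL 𝔯 h (lp 𝔯 h (c.H h e m ψ)) + lp 𝔯 h (c.H h e m fun x => c.H h e m φ x - c.J (ψ x)) := by
    rw [c.JL_lp ((hψ.H hh he c m).memLp hh), ← lp_add (((hψ.H hh he c m).clm c.J).memLp hh) ((hw.H hh he c m).memLp hh)]; congr 1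
    funext x; have h1 := c.H_add (h := h) (e := e) m (hw.diff x) (hJ.diff x)
    simp only [sub_add_cancel] at h1; rw [h1, c.H_J m (hψ.diff x), add_comm]
  have e2 : lp 𝔯 h (c.H h e m (c.radial h e s φ)) = lp 𝔯 h (fun x => c.H h e m (c.radial h e s φ) x - c.radial h e s (c.H h e m φ) x)
        + lp 𝔯 h (c.radial h e s (c.H h e m φ)) := by
    rw [lp_sub ((hR.H hh he c m).memLp hh) ((hH.radial hh he c hs).memLp hh), sub_add_cancel]
  have e3 : lp 𝔯 h (c.radial h e s (c.H h e m φ)) = lp 𝔯 h (c.radial h e s fun x => c.H h e m φ x - c.J (ψ x))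
        + lp 𝔯 h (c.radial h e s fun x => c.J (ψ x)) := by
    rw [← lp_add ((hw.radial hh he c hs).memLp hh) ((hJ.radial hh he c hs).memLp hh)]; congr 1; funext x
    simp only [radial, c.D_sub hH hJ, smul_sub, sum_sub_distrib]; abel
  have e4 : inner ℝ (lp 𝔯 h fun x => c.H h e m φ x - c.J (ψ x)) (lp 𝔯 h (c.radial h e s fun x => c.H h e m φ x - c.J (ψ x))) = 0 := by
    have h1 := c.inner_lp_radial hh he hs hw hw; rw [real_inner_comm] at h1; linarith
  have hwe : lp 𝔯 h (fun x => c.H h e m φ x - c.J (ψ x)) = lp 𝔯 h (c.H h e m φ) - c.JL 𝔯 h (lp 𝔯 h ψ) := by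
    rw [lp_sub (hH.memLp hh) (hJ.memLp hh), c.JL_lp (hψ.memLp hh)]
  rw [volInner_eq hh (hH.H hh he c m) hR, e1, inner_add_left, c.inner_lp_H hh he m hw hR, e2, e3, inner_add_right,
    inner_add_right, e4, zero_add, ← hwe]
  have b1 : ‖lp 𝔯 h (fun x => c.H h e m (c.radial h e s φ) x - c.radial h e s (c.H h e m φ) x)‖
      ≤ 10 ^ 6 * (∑ j, ‖lp 𝔯 h (c.D h e j φ)‖ + ‖lp 𝔯 h φ‖) :=
    norm_lp_le_sum (by norm_num) (((hR.H hh he c m).sub (hH.radial hh he c hs)).memLp hh) (hφ.memLp hh)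
      (fun j => (hφ.D hh he c j).memLp hh) fun x => c.norm_H_radial_sub_le hh he hs hf m (hφ.smooth.of_le (by norm_cast)) x
  have b2 := c.norm_lp_radial_le hh he hs hf hJ; rw [eJ hψ] at b2; simp only [eD, fun j => eJ (hψ.D hh he c j)] at b2
  have b3 := (real_inner_le_norm (lp 𝔯 h fun x => c.H h e m φ x - c.J (ψ x))
    (lp 𝔯 h (fun x => c.H h e m (c.radial h e s φ) x - c.radial h e s (c.H h e m φ) x)))
  have b4 := (real_inner_le_norm (lp 𝔯 h fun x => c.H h e m φ x - c.J (ψ x)) (lp 𝔯 h (c.radial h e s fun x => c.J (ψ x))))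
  have b5 := mul_le_mul_of_nonneg_left (add_le_add b1 b2) (norm_nonneg (lp 𝔯 h fun x => c.H h e m φ x - c.J (ψ x)))
  rw [mul_add] at b5; linarith

end CliffordRep

namespace CliffordRep

lemma tendsto_radialL {ι : Type*} {l : Filter ι} {u : ι → Lp F 2 𝔯 h} {d : ι → Fin 3 → Lp F 2 𝔯 h}
    {u₀ : Lp F 2 𝔯 h} {d₀ : Fin 3 → Lp F 2 𝔯 h} (hu : Tendsto u l (𝓝 u₀))
    (hd : ∀ j, Tendsto (fun n => d n j) l (𝓝 (d₀ j))) (s : ℝ) :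
    Tendsto (fun n => radialL h s (u n) (d n)) l (𝓝 (radialL h s u₀ d₀)) :=
  (tendsto_finsetSum _ fun i _ => ((mulL 𝔯 h _).continuous.tendsto _).comp (hd i)).add (((mulL 𝔯 h _).continuous.tendsto _).comp hu)

lemma tendsto_smoothingSq {ι : Type*} {l : Filter ι} {u : ι → Lp F 2 𝔯 h} {d : ι → Fin 3 → Lp F 2 𝔯 h}
    {u₀ : Lp F 2 𝔯 h} {d₀ : Fin 3 → Lp F 2 𝔯 h} (hu : Tendsto u l (𝓝 u₀))
    (hd : ∀ j, Tendsto (fun n => d n j) l (𝓝 (d₀ j))) (η : ℝ) :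
    Tendsto (fun n => smoothingSq h η (u n) (d n)) l (𝓝 (smoothingSq h η u₀ d₀)) :=
  (tendsto_finsetSum _ fun i _ => (((mulL 𝔯 h _).continuous.tendsto _).comp (hd i)).norm.pow 2).add
    ((((mulL 𝔯 h _).continuous.tendsto _).comp hu).norm.pow 2)

namespace InGraph

variable {c} {u k v l : Lp F 2 𝔯 h} {d d' : Fin 3 → Lp F 2 𝔯 h}

include hh he hf

lemma sum_norm_sq_le [Nontrivial F] (hκ : κ ≤ 1 / 10 ^ 6) (h1 : c.InGraph h e m u k d) : ∑ j, ‖d j‖ ^ 2 ≤ 4 * ‖k‖ ^ 2 := by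
  obtain ⟨φ, hφ, -, a2, a3⟩ := h1
  exact le_of_tendsto_of_tendsto' (tendsto_finsetSum _ fun j _ => (a3 j).norm.pow 2) ((a2.norm.pow 2).const_mul 4)
    fun n => c.sum_norm_lp_D_sq_le hh he hf hκ m (hφ n)

include hs

lemma norm_radialL_sq_le [Nontrivial F] (hκ : κ ≤ 1 / 10 ^ 6) (h1 : c.InGraph h e m u k d) : ‖radialL h s u d‖ ^ 2 ≤ 152 * ‖k‖ ^ 2 := by
  obtain ⟨φ, hφ, a1, a2, a3⟩ := h1
  refine le_of_tendsto_of_tendsto' ((tendsto_radialL a1 a3 s).norm.pow 2) ((a2.norm.pow 2).const_mul 152) fun n => ?_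
  rw [c.radialL_lp hh he hs hf (hφ n), ← volSq_eq hh ((hφ n).radial hh he c hs), ← volSq_eq hh ((hφ n).H hh he c m)]
  exact c.volSq_radial_le hh he hs hf hκ m ((hφ n).smooth.of_le (by norm_cast)) (hφ n).compact

lemma inner_radialL (h1 : c.InGraph h e m u k d) (h2 : c.InGraph h e m v l d') : ⟪radialL h s u d, v⟫ = -⟪u, radialL h s v d'⟫ := by
  obtain ⟨φ, hφ, a1, -, a3⟩ := h1; obtain ⟨ψ, hψ, b1, -, b3⟩ := h2
  refine tendsto_nhds_unique ((tendsto_radialL a1 a3 s).inner b1) ((a1.inner (tendsto_radialL b1 b3 s)).neg.congr fun n => ?_)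
  rw [c.radialL_lp hh he hs hf (hφ n), c.radialL_lp hh he hs hf (hψ n), c.inner_lp_radial hh he hs (hφ n) (hψ n)]

lemma inner_radialL_self (h1 : c.InGraph h e m u k d) : ⟪u, radialL h s u d⟫ = 0 := by
  have h2 := h1.inner_radialL hh he hs hf h1; rw [real_inner_comm] at h2; linarith

omit hs hf

lemma inner_lp_H (h1 : c.InGraph h e m u k d) (hψ : IsTest ψ) : ⟪lp 𝔯 h (c.H h e m ψ), u⟫ = ⟪lp 𝔯 h ψ, k⟫ := by
  obtain ⟨φ, hφ, a1, a2, -⟩ := h1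
  exact tendsto_nhds_unique (tendsto_const_nhds.inner a1) ((tendsto_const_nhds.inner a2).congr fun n =>
    (c.inner_lp_H hh he m hψ (hφ n)).symm)

end InGraph

include hh he hf

lemma smoothingSq_lp_le [Nontrivial F] (m : ℝ) {η : ℝ} (hη : 0 < η) (K : ℕ) (hφ : IsTest φ) :
    ∫ x, c.smoothingDensity h e η φ x ≤ 50 * ∑ i ∈ Finset.range K, ((2 : ℝ) ^ (-2 * η)) ^ i *
        (volInner h (c.H h e m (c.H h e m φ)) (c.radial h e (2 ^ i) φ) + 2 * 10 ^ 7 * κ * ∫ x, c.smoothingDensity h e (1 / 2) φ x)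
      + (1 / 2) ^ K * (2 * (∑ j, ‖lp 𝔯 h (c.D h e j φ)‖ ^ 2 + ‖lp 𝔯 h φ‖ ^ 2)) := by
  have hφ1 : 𝒞 1 φ := hφ.smooth.of_le (by norm_cast); have hs : ∀ i : ℕ, (1 : ℝ) ≤ 2 ^ i := fun i => one_le_pow₀ (by norm_num)
  have i1 : ∀ i : ℕ, Integrable fun x => ((2 : ℝ) ^ (-2 * η)) ^ i * c.virialDensity h e (2 ^ i) φ x := fun i =>
    (c.integrable_virialDensity hh he (hs i) hφ1 hφ.compact).const_mul _
  have i2 := c.integrable_gradSq hh he hφ1 hφ.compact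
  have i3 : Integrable fun x => ‖φ x‖ ^ 2 := integrable_of_eq_zero (hφ.cont.norm.pow 2) hφ.compact fun x hx => by simp [off_tsupport hx]
  have i4 : Integrable (c.smoothingDensity h e η φ) := by
    refine Integrable.add ?_ (integrable_rpow_mul_sq _ hφ); simp only [gradSq, mul_sum]
    exact integrable_finsetSum _ fun j _ => integrable_rpow_mul_sq _ (hφ.D hh he c j)
  have i5 : Integrable fun x => ∑ i ∈ Finset.range K, ((2 : ℝ) ^ (-2 * η)) ^ i * c.virialDensity h e (2 ^ i) φ x :=
    integrable_finsetSum _ fun i _ => i1 i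
  have i6 : Integrable fun x => c.gradSq h e φ x + ‖φ x‖ ^ 2 := i2.add i3
  have h1 := integral_mono i4 ((i5.const_mul 50).add (i6.const_mul ((1 / 2) ^ K))) fun x => c.smoothingDensity_le_sum hη K φ x
  simp only [Pi.add_apply] at h1
  rw [integral_add (i5.const_mul 50) (i6.const_mul _), integral_const_mul, integral_const_mul, integral_finsetSum _ fun i _ => i1 i] at h1
  have h2 : ∀ i : ℕ, ∫ x, c.virialDensity h e (2 ^ i) φ x ≤ volInner h (c.H h e m (c.H h e m φ)) (c.radial h e (2 ^ i) φ)
          + 2 * 10 ^ 7 * κ * ∫ x, c.smoothingDensity h e (1 / 2) φ x := fun i => by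
    have := c.integral_virialDensity_le hh he (hs i) hf m (hφ.smooth.of_le (by norm_cast)) hφ.compact
    simpa only [c.lowDensity_eq] using this
  have h3 : ∫ x, (c.gradSq h e φ x + ‖φ x‖ ^ 2) ≤ 2 * (∑ j, ‖lp 𝔯 h (c.D h e j φ)‖ ^ 2 + ‖lp 𝔯 h φ‖ ^ 2) := by
    have hsq : ∀ {ψ : Space → F}, IsTest ψ → ∫ x, ‖ψ x‖ ^ 2 ≤ 2 * ‖lp 𝔯 h ψ‖ ^ 2 := fun {ψ} hψ => by
      rw [← volSq_eq hh hψ, volSq, ← integral_const_mul]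
      have h4 : ∀ f : Space → ℝ, Continuous f → Integrable fun x => f x * ‖ψ x‖ ^ 2 := fun f hf =>
        integrable_of_eq_zero (hf.mul (hψ.cont.norm.pow 2)) hψ.compact fun x hx => by simp [off_tsupport hx]
      refine integral_mono (by simpa using h4 1 continuous_const) ((h4 _ hh.contDiff_volDensity.continuous).const_mul 2)
        fun x => ?_
      have := mul_le_mul_of_nonneg_right (hf.le_vol x) (sq_nonneg ‖ψ x‖); change ‖ψ x‖ ^ 2 ≤ 2 * (𝔳 h x * ‖ψ x‖ ^ 2); linarith
    have h5 : ∀ j, Integrable fun x => ‖c.D h e j φ x‖ ^ 2 := fun j => by simpa using integrable_rpow_mul_sq 0 (hφ.D hh he c j)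
    rw [integral_add i2 i3]; simp only [gradSq]; rw [integral_finsetSum _ fun j _ => h5 j, mul_add, mul_sum]
    exact add_le_add (sum_le_sum fun j _ => hsq (hφ.D hh he c j)) (hsq hφ)
  refine h1.trans (add_le_add (mul_le_mul_of_nonneg_left (sum_le_sum fun i _ => ?_) (by norm_num))
    (mul_le_mul_of_nonneg_left h3 (by positivity)))
  rw [integral_const_mul]; exact mul_le_mul_of_nonneg_left (h2 i) (by positivity)

lemma InGraph.smoothingSq_le [Nontrivial F] {c : CliffordRep F} {u v l : Lp F 2 𝔯 h}
    {d d' : Fin 3 → Lp F 2 𝔯 h} {η : ℝ} (hη : 0 < η) (K : ℕ)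
    (h1 : c.InGraph h e m u (c.JL 𝔯 h v) d) (h2 : c.InGraph h e m v l d') :
    smoothingSq h η u d ≤ 50 * ∑ i ∈ Finset.range K, ((2 : ℝ) ^ (-2 * η)) ^ i *
        (⟪c.JL 𝔯 h l, radialL h (2 ^ i) u d⟫ + 2 * 10 ^ 7 * κ * smoothingSq h (1 / 2) u d)
      + (1 / 2) ^ K * (2 * (∑ j, ‖d j‖ ^ 2 + ‖u‖ ^ 2)) := by
  obtain ⟨φ, hφ, a1, a2, a3⟩ := h1; obtain ⟨ψ, hψ, b1, b2, b3⟩ := h2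
  have hs : ∀ i : ℕ, (1 : ℝ) ≤ 2 ^ i := fun i => one_le_pow₀ (by norm_num); set J := c.JL 𝔯 h with hJ
  have t1 : Tendsto (fun n => ‖lp 𝔯 h (c.H h e m (φ n)) - J (lp 𝔯 h (ψ n))‖ * (10 ^ 6 * (∑ j, ‖lp 𝔯 h (c.D h e j (φ n))‖ + ‖lp 𝔯 h (φ n)‖)
        + 2 * (∑ j, ‖lp 𝔯 h (c.D h e j (ψ n))‖ + ‖lp 𝔯 h (ψ n)‖))) atTop (𝓝 0) := by
    have h3 := (a2.sub ((J.continuous.tendsto _).comp b1)).norm; rw [sub_self, norm_zero] at h3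
    have h4 := ((((tendsto_finsetSum Finset.univ fun j _ => (a3 j).norm).add a1.norm).const_mul ((10 : ℝ) ^ 6)).add
      (((tendsto_finsetSum Finset.univ fun j _ => (b3 j).norm).add b1.norm).const_mul (2 : ℝ)))
    simpa using h3.mul h4
  have t2 := ((tendsto_finsetSum (Finset.range K) fun i _ =>
    (((((J.continuous.tendsto _).comp b2).inner (tendsto_radialL a1 a3 (2 ^ i))).add t1).add
      ((tendsto_smoothingSq a1 a3 (1 / 2)).const_mul (2 * 10 ^ 7 * κ))).const_mul (((2 : ℝ) ^ (-2 * η)) ^ i)).const_mul 50).add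
    ((((tendsto_finsetSum Finset.univ fun j _ => (a3 j).norm.pow 2).add (a1.norm.pow 2)).const_mul 2).const_mul ((1 / 2 : ℝ) ^ K))
  simp only [add_zero] at t2; refine le_of_tendsto_of_tendsto' (tendsto_smoothingSq a1 a3 η) t2 fun n => ?_
  rw [c.smoothingSq_lp hh he hf hη (hφ n)]; refine (c.smoothingSq_lp_le hh he hf m hη K (hφ n)).trans (add_le_add_left ?_ _)
  refine mul_le_mul_of_nonneg_left (sum_le_sum fun i _ => mul_le_mul_of_nonneg_left ?_ (by positivity)) (by norm_num)
  rw [c.smoothingSq_lp hh he hf (by norm_num : (0 : ℝ) < 1 / 2) (hφ n)]; refine add_le_add_left ?_ _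
  simp only [c.radialL_lp hh he (hs i) hf (hφ n)]; exact c.volInner_H_radial_le hh he (hs i) hf m (hφ n) (hψ n)

end CliffordRep

/-! ### Mollification -/

section mollify

variable [FiniteDimensional ℝ F]

/-- Convolution with a scalar kernel. -/
def conv {G : Type*} [NormedAddCommGroup G] [NormedSpace ℝ G] (k : Space → ℝ) (f : Space → G) : Space → G :=
  k ⋆[ContinuousLinearMap.lsmul ℝ ℝ, volume] f

lemma conv_apply {G : Type*} [NormedAddCommGroup G] [NormedSpace ℝ G] (k : Space → ℝ) (f : Space → G) (x : Space) :
    conv k f x = ∫ t, k t • f (x - t) := rfl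

lemma integrable_conv {G : Type*} [NormedAddCommGroup G] [NormedSpace ℝ G] {k : Space → ℝ} {f : Space → G}
    (hk : Continuous k) (hc : HasCompactSupport k) (hf : Continuous f) (x : Space) : Integrable fun t => k t • f (x - t) :=
  (hk.smul (hf.comp (continuous_const.sub continuous_id))).integrable_of_hasCompactSupport hc.smul_right

lemma isTest_conv {k : Space → ℝ} (hk : IsTest k) {f : Space → F} (hf : LocallyIntegrable f) (hc : HasCompactSupport f) :
    IsTest (conv k f) :=
  ⟨hk.compact.contDiff_convolution_left (n := ⊤) _ hk.smooth hf, hk.compact.convolution _ hc⟩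

lemma IsTest.locallyIntegrable {f : Space → F} (hf : IsTest f) : LocallyIntegrable f := hf.cont.locallyIntegrable

lemma pd_conv {k : Space → ℝ} (hk : IsTest k) {f : Space → F} (hf : IsTest f) (j : Fin 3) (x : Space) :
    pd j (conv k f) x = conv k (pd j f) x := by
  have h1 := hf.compact.hasFDerivAt_convolution_right (ContinuousLinearMap.lsmul ℝ ℝ) (μ := volume)
    hk.cont.locallyIntegrable (hf.smooth.of_le (by simp)) x
  rw [pd, conv, h1.fderiv, convolution_precompR_apply _ hk.cont.locallyIntegrable
    (hf.compact.fderiv ℝ) (hf.smooth.continuous_fderiv (by simp))]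
  rfl

lemma IsTest.pd {f : Space → F} (hf : IsTest f) (j : Fin 3) : IsTest (pd j f) :=
  ⟨ContDiff.pd_infty hf.smooth j, .intro hf.compact fun x hx => by simp [CurvedDirac.pd, fderiv_of_notMem_tsupport ℝ hx]⟩

lemma pd_comp_sub {G : Type*} [NormedAddCommGroup G] [NormedSpace ℝ G] {f : Space → G} {x t : Space}
    (hf : DiffAt f (x - t)) (j : Fin 3) : pd j (fun t => f (x - t)) t = -pd j f (x - t) := by
  have h1 : HasFDerivAt (fun t : Space => x - t) (-ContinuousLinearMap.id ℝ Space) t := (hasFDerivAt_id t).const_sub x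
  have h2 : HasFDerivAt (fun t : Space => f (x - t)) _ t := hf.hasFDerivAt.comp t h1; rw [pd, h2.fderiv]; simp [pd]

lemma integral_pd_eq_zero' {f : Space → F} (hf : IsTest f) (j : Fin 3) : ∫ x, pd j f x = 0 := by
  have : CompleteSpace F := FiniteDimensional.complete ℝ F; refine ext_inner_left ℝ fun v => ?_
  have hi : Integrable (pd j f) := (hf.pd j).cont.integrable_of_hasCompactSupport (hf.pd j).compact
  rw [inner_zero_right, ← integral_inner hi v, ← integral_pd_eq_zero (f := fun x => ⟪v, f x⟫) ?_ ?_ j]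
  · refine integral_congr_ae (.of_forall fun x => ?_)
    rw [pd_inner (differentiableAt_const v) (hf.diff x), pd_const, inner_zero_left, zero_add]
  · exact contDiff_const.inner ℝ (hf.smooth.of_le (by simp))
  · exact .intro hf.compact fun x hx => by simp [off_tsupport hx]

/-- A first order differential operator. -/
def firstOrder (a : Fin 3 → Space → F →L[ℝ] F) (b : Space → F →L[ℝ] F) (ψ : Space → F) (x : Space) : F := ∑ j, a j x (pd j ψ x) + b x (ψ x)

lemma IsTest.firstOrder {a : Fin 3 → Space → F →L[ℝ] F} {b : Space → F →L[ℝ] F} (ha : ∀ j, 𝒞 ∞ (a j))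
    (hb : 𝒞 ∞ b) (hψ : IsTest ψ) : IsTest (firstOrder a b ψ) :=
  ⟨(ContDiff.sum fun j _ => (ha j).clm_apply (hψ.pd j).smooth).add (hb.clm_apply hψ.smooth), .intro hψ.compact fun x hx => by
      simp [CurvedDirac.firstOrder, CurvedDirac.pd, fderiv_of_notMem_tsupport ℝ hx, off_tsupport hx]⟩

/-- The kernel of the commutator of a first order operator with a convolution. -/
lemma conv_firstOrder_sub {a : Fin 3 → Space → F →L[ℝ] F} {b : Space → F →L[ℝ] F} (ha : ∀ j, 𝒞 ∞ (a j))
    (hb : 𝒞 ∞ b) {k : Space → ℝ} (hk : IsTest k) (hψ : IsTest ψ) (x : Space) :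
    conv k (firstOrder a b ψ) x - firstOrder a b (conv k ψ) x
      = ∫ t, (∑ j, (pd j k t • (a j (x - t) - a j x) (ψ (x - t)) - k t • pd j (a j) (x - t) (ψ (x - t)))
          + k t • (b (x - t) - b x) (ψ (x - t))) := by
  have : CompleteSpace F := FiniteDimensional.complete ℝ F; have hsub : 𝒞 ∞ fun t : Space => x - t := contDiff_const.sub contDiff_id
  have hψ' : 𝒞 ∞ fun t => ψ (x - t) := hψ.smooth.comp hsub
  have ha' : ∀ j, 𝒞 ∞ fun t => a j (x - t) - a j x := fun j => ((ha j).comp hsub).sub contDiff_const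
  have hG : ∀ j, IsTest fun t => k t • (a j (x - t) - a j x) (ψ (x - t)) := fun j =>
    ⟨hk.smooth.smul ((ha' j).clm_apply hψ'), hk.compact.smul_right⟩
  have i1 := integrable_conv hk.cont hk.compact (hψ.firstOrder ha hb).cont x
  have i2 := fun j => integrable_conv hk.cont hk.compact (hψ.pd j).cont x; have i3 := integrable_conv hk.cont hk.compact hψ.cont x
  have e1 : firstOrder a b (conv k ψ) x = ∫ t, (∑ j, a j x (k t • pd j ψ (x - t)) + b x (k t • ψ (x - t))) := by
    rw [integral_add (integrable_finsetSum _ fun j _ => (a j x).integrable_comp (i2 j)) ((b x).integrable_comp i3),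
      integral_finsetSum _ fun j _ => (a j x).integrable_comp (i2 j), (b x).integral_comp_comm i3]
    simp only [fun j => (a j x).integral_comp_comm (i2 j), firstOrder, pd_conv hk hψ, conv_apply]
  have i4 : Integrable fun t => ∑ j, a j x (k t • pd j ψ (x - t)) + b x (k t • ψ (x - t)) :=
    (integrable_finsetSum _ fun j _ => (a j x).integrable_comp (i2 j)).add ((b x).integrable_comp i3)
  have i5 : ∀ j, Integrable (pd j fun t => k t • (a j (x - t) - a j x) (ψ (x - t))) := fun j =>
    ((hG j).pd j).cont.integrable_of_hasCompactSupport ((hG j).pd j).compact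
  have i6 : Integrable fun t => ∑ j, pd j (fun t => k t • (a j (x - t) - a j x) (ψ (x - t))) t := integrable_finsetSum _ fun j _ => i5 j
  have e2 : ∫ t, ∑ j, pd j (fun t => k t • (a j (x - t) - a j x) (ψ (x - t))) t = 0 := by
    rw [integral_finsetSum _ fun j _ => i5 j]; exact Finset.sum_eq_zero fun j _ => integral_pd_eq_zero' (hG j) j
  have i7 : Integrable fun t => k t • firstOrder a b ψ (x - t) - (∑ j, a j x (k t • pd j ψ (x - t)) + b x (k t • ψ (x - t))) := i1.sub i4
  rw [e1, conv_apply, ← integral_sub i1 i4, ← sub_zero (∫ t, _), ← neg_zero, ← e2, sub_neg_eq_add, ← integral_add i7 i6]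
  refine integral_congr_ae (.of_forall fun t => ?_); have hd1 : DiffAt (fun t => ψ (x - t)) t := hψ'.diff t
  have hd2 : ∀ j, DiffAt (fun t => a j (x - t) - a j x) t := fun j => (ha' j).diff t
  have e3 : ∀ j, pd j (fun t => k t • (a j (x - t) - a j x) (ψ (x - t))) t = pd j k t • (a j (x - t) - a j x) (ψ (x - t))
        + k t • (-(pd j (a j) (x - t)) (ψ (x - t)) - (a j (x - t) - a j x) (pd j ψ (x - t))) := fun j => by
    rw [pd_smul (hk.diff t) ((hd2 j).clm_apply hd1), pd_clm_apply (hd2 j) hd1,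
      pd_sub (f := fun t => a j (x - t)) (((ha j).comp hsub).diff t) (differentiableAt_const _),
      pd_const, sub_zero,
      pd_comp_sub ((ha j).diff _), pd_comp_sub (hψ.diff _),
      map_neg, neg_apply, sub_eq_add_neg (-_)]
  beta_reduce; rw [sum_ext fun j => e3 j]
  simp only [firstOrder, sub_apply, map_smul, smul_add, smul_sub, smul_neg, sum_add_distrib, sum_sub_distrib, smul_sum, sum_neg_distrib]
  abel

lemma conv_sq_le {k g : Space → ℝ} (hk : Continuous k) (hkc : HasCompactSupport k) (hk0 : ∀ x, 0 ≤ k x)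
    (hg : Continuous g) (x : Space) : conv k g x ^ 2 ≤ (∫ x, k x) * conv k (fun x => g x ^ 2) x := by
  have ik : Integrable k := hk.integrable_of_hasCompactSupport hkc
  have i1 : Integrable fun t => k t * g (x - t) := integrable_conv hk hkc hg x
  have i2 : Integrable fun t => k t * g (x - t) ^ 2 := integrable_conv hk hkc (hg.pow 2) x
  have e1 : conv k g x = ∫ t, k t * g (x - t) := rfl
  have e2 : conv k (fun x => g x ^ 2) x = ∫ t, k t * g (x - t) ^ 2 := rfl
  rw [e1, e2]
  have key : ∀ r : ℝ, 0 ≤ (∫ x, k x) * (r * r) + (-2 * ∫ t, k t * g (x - t)) * r + ∫ t, k t * g (x - t) ^ 2 := by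
    intro r; have i3 : Integrable fun t => (-2 * r) * (k t * g (x - t)) + k t * g (x - t) ^ 2 := (i1.const_mul _).add i2
    have e : (∫ x, k x) * (r * r) + (-2 * ∫ t, k t * g (x - t)) * r + ∫ t, k t * g (x - t) ^ 2
        = ∫ t, ((r * r) * k t + ((-2 * r) * (k t * g (x - t)) + k t * g (x - t) ^ 2)) := by
      rw [integral_add (ik.const_mul _) i3, integral_add (i1.const_mul _) i2, integral_const_mul, integral_const_mul]; ring
    rw [e]; refine integral_nonneg fun t => ?_
    have : (r * r) * k t + ((-2 * r) * (k t * g (x - t)) + k t * g (x - t) ^ 2) = k t * (r - g (x - t)) ^ 2 := by ring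
    rw [this]; exact mul_nonneg (hk0 t) (sq_nonneg _)
  have := discrim_le_zero key; rw [discrim] at this; linarith

lemma integral_conv {k g : Space → ℝ} (hk : Integrable k) (hg : Integrable g) : ∫ x, conv k g x = (∫ x, k x) * ∫ x, g x :=
  integral_convolution (ContinuousLinearMap.lsmul ℝ ℝ) hk hg

/-- Young's inequality for a nonnegative kernel. -/
lemma integral_conv_sq_le {k g : Space → ℝ} (hk : Continuous k) (hkc : HasCompactSupport k) (hk0 : ∀ x, 0 ≤ k x)
    (hg : Continuous g) (hgc : HasCompactSupport g) :
    ∫ x, conv k g x ^ 2 ≤ (∫ x, k x) ^ 2 * ∫ x, g x ^ 2 := by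
  have hg2 : Continuous fun x => g x ^ 2 := hg.pow 2
  have hg2c : HasCompactSupport fun x => g x ^ 2 := .intro hgc fun x hx => by simp [off_tsupport hx]
  have c1 : Continuous (conv k g) := hgc.continuous_convolution_right _ hk.locallyIntegrable hg
  have c2 : Continuous (conv k fun x => g x ^ 2) := hg2c.continuous_convolution_right _ hk.locallyIntegrable hg2
  have c3 : HasCompactSupport (conv k g) := hkc.convolution _ hgc
  have i1 : Integrable fun x => conv k g x ^ 2 := (c1.pow 2).integrable_of_hasCompactSupport (.intro c3 fun x hx => by
      change conv k g x ^ 2 = 0; rw [off_tsupport hx]; norm_num)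
  have i2 : Integrable (conv k fun x => g x ^ 2) := c2.integrable_of_hasCompactSupport (hkc.convolution _ hg2c)
  calc ∫ x, conv k g x ^ 2 ≤ ∫ x, (∫ x, k x) * conv k (fun x => g x ^ 2) x :=
        integral_mono i1 (i2.const_mul _) fun x => conv_sq_le hk hkc hk0 hg x
    _ = (∫ x, k x) ^ 2 * ∫ x, g x ^ 2 := by
        rw [integral_const_mul, integral_conv (hk.integrable_of_hasCompactSupport hkc) (hg2.integrable_of_hasCompactSupport hg2c)]; ring

lemma norm_lp_conv_le {k g : Space → ℝ} (hk : Continuous k) (hkc : HasCompactSupport k) (hk0 : ∀ x, 0 ≤ k x)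
    (hg : Continuous g) (hgc : HasCompactSupport g) :
    ‖lp volume (conv k g)‖ ≤ (∫ x, k x) * ‖lp volume g‖ := by
  have c1 : Continuous (conv k g) := hgc.continuous_convolution_right _ hk.locallyIntegrable hg
  have h0 : 0 ≤ ∫ x, k x := integral_nonneg hk0
  refine (pow_le_pow_iff_left₀ (norm_nonneg _) (mul_nonneg h0 (norm_nonneg _)) two_ne_zero).1 ?_
  rw [mul_pow, norm_lp_sq (c1.memLp_of_hasCompactSupport (hkc.convolution _ hgc)), norm_lp_sq (hg.memLp_of_hasCompactSupport hgc)]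
  simpa using integral_conv_sq_le hk hkc hk0 hg hgc

lemma norm_conv_le {k : Space → ℝ} (hk : Continuous k) (hkc : HasCompactSupport k) (hk0 : ∀ x, 0 ≤ k x)
    (hψ : Continuous ψ) (x : Space) : ‖conv k ψ x‖ ≤ conv k (fun y => ‖ψ y‖) x := by
  rw [conv_apply, conv_apply]; refine norm_integral_le_of_norm_le (integrable_conv hk hkc hψ.norm x) (.of_forall fun t => ?_)
  rw [norm_smul, Real.norm_of_nonneg (hk0 t), smul_eq_mul]

/-- Convolution with an even kernel is symmetric. -/
lemma integral_inner_conv {k : Space → ℝ} (hk : Continuous k) (hkc : HasCompactSupport k) (hke : ∀ x, k (-x) = k x)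
    {f ψ : Space → F} (hf : Integrable f) (hψ : Continuous ψ) (hψc : HasCompactSupport ψ) :
    ∫ x, ⟪conv k f x, ψ x⟫ = ∫ x, ⟪f x, conv k ψ x⟫ := by
  have : CompleteSpace F := FiniteDimensional.complete ℝ F; have hψi : Integrable ψ := hψ.integrable_of_hasCompactSupport hψc
  obtain ⟨C, hC⟩ := hkc.exists_bound_of_continuous hk
  have h1 : ∀ x, ⟪conv k f x, ψ x⟫ = ∫ y, k (x - y) * ⟪f y, ψ x⟫ := fun x => by
    have e : conv k f x = ∫ y, k (x - y) • f y := convolution_lsmul_swap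
    have i : Integrable fun y => k (x - y) • f y :=
      Integrable.bdd_smul hf C (hk.comp (continuous_sub_left _)).aestronglyMeasurable (.of_forall fun y => hC _)
    rw [e, real_inner_comm, ← integral_inner i]; refine integral_congr_ae (.of_forall fun y => ?_)
    simp only [real_inner_smul_right, real_inner_comm]
  have h2 : ∀ y, ⟪f y, conv k ψ y⟫ = ∫ x, k (x - y) * ⟪f y, ψ x⟫ := fun y => by
    have e : conv k ψ y = ∫ x, k (y - x) • ψ x := convolution_lsmul_swap
    have i : Integrable fun x => k (y - x) • ψ x :=
      Integrable.bdd_smul hψi C (hk.comp (continuous_sub_left _)).aestronglyMeasurable (.of_forall fun y => hC _)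
    rw [e, ← integral_inner i]; refine integral_congr_ae (.of_forall fun x => ?_); simp only [real_inner_smul_right]; rw [← hke, neg_sub]
  simp only [h1, h2]; refine integral_integral_swap ?_
  have h3 : Integrable (fun p : Space × Space => ⟪f p.2, ψ p.1⟫) (volume.prod volume) := by
    refine (Integrable.mul_prod hψi.norm hf.norm).mono ?_ (.of_forall fun p => ?_)
    · exact (hf.aestronglyMeasurable.comp_snd (μ := volume)).inner (hψi.aestronglyMeasurable.comp_fst (ν := volume))
    · rw [norm_mul, norm_norm, norm_norm, mul_comm]; exact norm_inner_le_norm _ _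
  exact h3.bdd_mul (c := C) (hk.comp (by fun_prop)).aestronglyMeasurable
    (.of_forall fun y => hC _)

end mollify

/-! ### Friedrichs mollifiers -/

lemma exists_mollifier : ∃ (ρ : ℕ → Space → ℝ) (C : ℝ), 0 ≤ C ∧ ∀ n : ℕ, IsTest (ρ n) ∧ (∀ x, 0 ≤ ρ n x) ∧
    (∀ x, ρ n (-x) = ρ n x) ∧ ∫ x, ρ n x = 1 ∧ tsupport (ρ n) ⊆ Metric.closedBall 0 (1 / (n + 1)) ∧
    ∀ j, ∫ x, |pd j (ρ n) x| ≤ C * (n + 1) := by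
  let β : ContDiffBump (0 : Space) := ⟨1 / 2, 1, by norm_num, by norm_num⟩
  set β₁ : Space → ℝ := β.normed volume with hβ; have hs : 𝒞 ∞ β₁ := β.contDiff_normed
  have hN : ∀ n : ℕ, (0 : ℝ) < n + 1 := fun n => by positivity
  have hint : ∀ (n : ℕ) (f : Space → ℝ), ∫ x, f (((n : ℝ) + 1) • x) = (((n : ℝ) + 1) ^ 3)⁻¹ * ∫ x, f x := fun n f => by
    have := Measure.integral_comp_smul (volume : Measure Space) f ((n : ℝ) + 1)
    rw [this, finrank_euclideanSpace_fin, abs_of_pos (by positivity), smul_eq_mul]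
  have hpd : ∀ (n : ℕ) (j : Fin 3) (x : Space), pd j (fun x => ((n : ℝ) + 1) ^ 3 * β₁ (((n : ℝ) + 1) • x)) x
      = ((n : ℝ) + 1) ^ 4 * pd j β₁ (((n : ℝ) + 1) • x) := fun n j x => by
    have h1 : HasFDerivAt (fun x : Space => ((n : ℝ) + 1) • x) (((n : ℝ) + 1) • ContinuousLinearMap.id ℝ Space) x :=
      (((n : ℝ) + 1) • ContinuousLinearMap.id ℝ Space).hasFDerivAt
    have h2 : HasFDerivAt (fun x : Space => β₁ (((n : ℝ) + 1) • x)) _ x := (hs.diff _).hasFDerivAt.comp x h1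
    rw [pd, (h2.const_mul _).fderiv, pd]; simp; ring
  have hsupp : ∀ n : ℕ, tsupport (fun x => ((n : ℝ) + 1) ^ 3 * β₁ (((n : ℝ) + 1) • x)) ⊆ Metric.closedBall 0 (1 / (n + 1)) :=
    fun n => closure_minimal (fun x hx => by
      have h1 : ((n : ℝ) + 1) • x ∈ Function.support β₁ := fun h0 => hx (by simp [h0])
      rw [hβ, β.support_normed_eq, mem_ball_zero_iff, norm_smul, Real.norm_of_nonneg (hN n).le] at h1
      rw [mem_closedBall_zero_iff, le_div_iff₀ (hN n), mul_comm]; exact h1.le) Metric.isClosed_closedBall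
  refine ⟨fun n x => ((n : ℝ) + 1) ^ 3 * β₁ (((n : ℝ) + 1) • x), ∑ j, ∫ x, |pd j β₁ x|,
    sum_nonneg fun j _ => integral_nonneg fun x => abs_nonneg _, fun n => ⟨⟨?_, ?_⟩, fun x => ?_, fun x => ?_, ?_, hsupp n,
    fun j => ?_⟩⟩
  · exact contDiff_const.mul (hs.comp (contDiff_const_smul _))
  · exact (isCompact_closedBall (0 : Space) _).of_isClosed_subset (isClosed_tsupport _) (hsupp n)
  · exact mul_nonneg (pow_nonneg (hN n).le _) (β.nonneg_normed _)
  · beta_reduce; rw [smul_neg, hβ, β.normed_neg]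
  · rw [integral_const_mul, hint n β₁, hβ, β.integral_normed, mul_one, mul_inv_cancel₀ (pow_pos (hN n) 3).ne']
  · simp only [hpd, abs_mul]; rw [integral_const_mul, hint n fun x => |pd j β₁ x|, abs_of_pos (pow_pos (hN n) 4)]
    have h1 : ((n : ℝ) + 1) ^ 4 * ((((n : ℝ) + 1) ^ 3)⁻¹ * ∫ x, |pd j β₁ x|) = (∫ x, |pd j β₁ x|) * (n + 1) := by
      have := (hN n).ne'; field_simp
    rw [h1]
    exact mul_le_mul_of_nonneg_right (single_le_sum (f := fun j => ∫ x, |pd j β₁ x|)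
      (fun j _ => integral_nonneg fun x => abs_nonneg _) (Finset.mem_univ j)) (hN n).le

section friedrichs

variable [FiniteDimensional ℝ F]

lemma integrable_inner {α : Type*} [MeasurableSpace α] {μ : Measure α} {f g : α → F} (hf : MemLp f 2 μ)
    (hg : MemLp g 2 μ) : Integrable (fun x => ⟪f x, g x⟫) μ := by
  refine (L2.integrable_inner (𝕜 := ℝ) (lp μ f) (lp μ g)).congr ?_; filter_upwards [coeFn_lp hf, coeFn_lp hg] with x h1 h2; rw [h1, h2]

lemma abs_integral_inner_le {α : Type*} [MeasurableSpace α] {μ : Measure α} {f g : α → F} (hf : MemLp f 2 μ)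
    (hg : MemLp g 2 μ) : |∫ x, ⟪f x, g x⟫ ∂μ| ≤ ‖lp μ f‖ * ‖lp μ g‖ := by
  rw [← inner_lp hf hg]; exact abs_real_inner_le_norm _ _

lemma IsTest.memLp_volume {f : Space → F} (hf : IsTest f) : MemLp f 2 volume := hf.cont.memLp_of_hasCompactSupport hf.compact

lemma norm_lp_conv_vector_le {k : Space → ℝ} (hk : IsTest k) (hk0 : ∀ x, 0 ≤ k x) (h1 : ∫ x, k x = 1) (hψ : IsTest ψ) : ‖lp volume (conv k ψ)‖ ≤ ‖lp volume ψ‖ := by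
  have hc : Continuous fun x => ‖ψ x‖ := hψ.cont.norm; have hcc : HasCompactSupport fun x => ‖ψ x‖ := hψ.compact.norm
  have c1 : Continuous (conv k fun x => ‖ψ x‖) := hcc.continuous_convolution_right _ hk.cont.locallyIntegrable hc
  refine (norm_lp_le (isTest_conv hk hψ.locallyIntegrable hψ.compact).memLp_volume
    (c1.memLp_of_hasCompactSupport (hk.compact.convolution _ hcc))
    (norm_conv_le hk.cont hk.compact hk0 hψ.cont)).trans ?_
  refine (norm_lp_conv_le hk.cont hk.compact hk0 hc hcc).trans (le_of_eq ?_); rw [h1, one_mul, norm_lp_norm hψ.memLp_volume]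

/-- Local Lipschitz and boundedness constants of a smooth field. -/
lemma exists_lipschitz_bound {G : Type*} [NormedAddCommGroup G] [NormedSpace ℝ G] {a : Space → G} (ha : 𝒞 ∞ a)
    (R : ℝ) : ∃ L, 0 ≤ L ∧ (∀ x ∈ Metric.closedBall (0 : Space) R, ‖a x‖ ≤ L) ∧
      (∀ j, ∀ x ∈ Metric.closedBall (0 : Space) R, ‖pd j a x‖ ≤ L) ∧
      ∀ x ∈ Metric.closedBall (0 : Space) R, ∀ y ∈ Metric.closedBall (0 : Space) R, ‖a y - a x‖ ≤ L * ‖y - x‖ := by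
  have hK := isCompact_closedBall (0 : Space) R; obtain ⟨C₁, h1⟩ := hK.exists_bound_of_continuousOn ha.continuous.continuousOn
  obtain ⟨C₂, h2⟩ := hK.exists_bound_of_continuousOn (ha.continuous_fderiv (by simp)).continuousOn
  refine ⟨max (max C₁ C₂) 0, le_max_right _ _, fun x hx => (h1 x hx).trans (by simp), fun j x hx => ?_, fun x hx y hy => ?_⟩
  · refine ((fderiv ℝ a x).le_opNorm _).trans ?_; simpa using Or.inl (Or.inr (h2 x hx))
  · exact (convex_closedBall (0 : Space) R).norm_image_sub_le_of_norm_fderiv_le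
      (fun x _ => ha.diff x) (fun z hz => (h2 z hz).trans (by simp)) hx hy

lemma norm_conv_firstOrder_sub_le {a : Fin 3 → Space → F →L[ℝ] F} {b : Space → F →L[ℝ] F} (ha : ∀ j, 𝒞 ∞ (a j))
    (hb : 𝒞 ∞ b) {R : ℝ} : ∃ L, 0 ≤ L ∧ ∀ {δ : ℝ}, δ ≤ 1 → ∀ {k : Space → ℝ}, IsTest k → (∀ x, 0 ≤ k x) →
      tsupport k ⊆ Metric.closedBall 0 δ → ∀ {ψ : Space → F}, IsTest ψ → ∀ x ∈ Metric.closedBall (0 : Space) R,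
      ‖conv k (firstOrder a b ψ) x - firstOrder a b (conv k ψ) x‖ ≤ conv (fun t => L * (δ * ∑ j, |pd j k t| + k t)) (fun y => ‖ψ y‖) x := by
  choose L₁ hL0 hL1 hL2 hL3 using fun j => exists_lipschitz_bound (ha j) (R + 1)
  obtain ⟨L₂, hM0, hM1, -, -⟩ := exists_lipschitz_bound hb (R + 1)
  have hle : ∀ j, L₁ j ≤ ∑ j, L₁ j := fun j => single_le_sum (fun j _ => hL0 j) (Finset.mem_univ j)
  refine ⟨∑ j, L₁ j + 2 * L₂, add_nonneg (sum_nonneg fun j _ => hL0 j) (by linarith), fun {δ} hδ {k} hk hk0 hks {ψ} hψ x hx => ?_⟩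
  set L := ∑ j, L₁ j with hL; have hL' : 0 ≤ L := sum_nonneg fun j _ => hL0 j
  have hc : Continuous fun t => (L + 2 * L₂) * (δ * ∑ j, |pd j k t| + k t) := by have := fun j => (hk.pd j).cont; have := hk.cont; fun_prop
  have hcs : HasCompactSupport fun t => (L + 2 * L₂) * (δ * ∑ j, |pd j k t| + k t) := .intro hk.compact fun x hx => by
      simp [pd, fderiv_of_notMem_tsupport ℝ hx, off_tsupport hx]
  rw [conv_firstOrder_sub ha hb hk hψ]; refine norm_integral_le_of_norm_le (integrable_conv hc hcs hψ.cont.norm x) (.of_forall fun t => ?_)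
  change _ ≤ (L + 2 * L₂) * (δ * ∑ j, |pd j k t| + k t) * ‖ψ (x - t)‖
  by_cases ht : t ∈ tsupport k
  · have htδ : ‖t‖ ≤ δ := by simpa using hks ht
    have hx1 : x ∈ Metric.closedBall (0 : Space) (R + 1) := Metric.closedBall_subset_closedBall (by linarith) hx
    have hx2 : x - t ∈ Metric.closedBall (0 : Space) (R + 1) := by rw [mem_closedBall_zero_iff] at hx ⊢; linarith [norm_sub_le x t]
    set p := ‖ψ (x - t)‖ with hp; have hp0 : 0 ≤ p := norm_nonneg _
    have e1 : ∀ j, ‖pd j k t • (a j (x - t) - a j x) (ψ (x - t)) - k t • pd j (a j) (x - t) (ψ (x - t))‖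
        ≤ L * δ * p * |pd j k t| + L₁ j * (k t * p) := fun j => by
      have h1 : ‖(a j (x - t) - a j x) (ψ (x - t))‖ ≤ L * δ * p := by
        refine (ContinuousLinearMap.le_opNorm _ _).trans (mul_le_mul_of_nonneg_right ?_ hp0)
        refine (hL3 j x hx1 (x - t) hx2).trans ?_; rw [sub_sub_cancel_left, norm_neg]; exact mul_le_mul (hle j) htδ (norm_nonneg _) hL'
      have h2 : ‖pd j (a j) (x - t) (ψ (x - t))‖ ≤ L₁ j * p :=
        (ContinuousLinearMap.le_opNorm _ _).trans (mul_le_mul_of_nonneg_right (hL2 j j _ hx2) hp0)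
      refine (norm_sub_le _ _).trans ?_; rw [norm_smul, norm_smul, Real.norm_eq_abs, Real.norm_of_nonneg (hk0 t)]
      have h3 := mul_le_mul_of_nonneg_left h1 (abs_nonneg (pd j k t)); have h4 := mul_le_mul_of_nonneg_left h2 (hk0 t); linarith
    have e2 : ‖k t • (b (x - t) - b x) (ψ (x - t))‖ ≤ 2 * L₂ * (k t * p) := by
      rw [norm_smul, Real.norm_of_nonneg (hk0 t)]
      have h1 : ‖(b (x - t) - b x) (ψ (x - t))‖ ≤ 2 * L₂ * p := by
        refine (ContinuousLinearMap.le_opNorm _ _).trans (mul_le_mul_of_nonneg_right ?_ hp0)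
        linarith [norm_sub_le (b (x - t)) (b x), hM1 x hx1, hM1 _ hx2]
      have h4 := mul_le_mul_of_nonneg_left h1 (hk0 t); linarith
    have e3 := (norm_add_le _ _).trans (add_le_add ((norm_sum_le Finset.univ _).trans (sum_le_sum fun j _ => e1 j)) e2)
    rw [sum_add_distrib, ← mul_sum, ← sum_mul, ← hL] at e3; refine e3.trans ?_
    have h5 : 0 ≤ L₂ * (δ * p * ∑ j, |pd j k t|) := mul_nonneg hM0 (mul_nonneg (mul_nonneg
      ((norm_nonneg t).trans htδ) hp0) (sum_nonneg fun j _ => abs_nonneg _))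
    nlinarith
  · simp [pd, fderiv_of_notMem_tsupport ℝ ht, off_tsupport ht]

/-- Mollification of a compactly supported weak pair of a symmetric first order operator. -/
lemma exists_bounded_approx {a : Fin 3 → Space → F →L[ℝ] F} {b : Space → F →L[ℝ] F} (ha : ∀ j, 𝒞 ∞ (a j))
    (hb : 𝒞 ∞ b) (hsymm : ∀ φ ψ : Space → F, IsTest φ → IsTest ψ → ∫ x, ⟪firstOrder a b φ x, ψ x⟫ = ∫ x, ⟪φ x, firstOrder a b ψ x⟫)
    {f g : Space → F} (hf : MemLp f 2 volume) (hfc : HasCompactSupport f) (hg : MemLp g 2 volume)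
    (hfg : ∀ ψ : Space → F, IsTest ψ → ∫ x, ⟪f x, firstOrder a b ψ x⟫ = ∫ x, ⟪g x, ψ x⟫) :
    ∃ (φ : ℕ → Space → F) (C : ℝ), (∀ n, IsTest (φ n)) ∧ (∀ n, ‖lp volume (φ n)‖ ≤ C) ∧ (∀ n, ‖lp volume (firstOrder a b (φ n))‖ ≤ C) ∧
      ∀ ψ : Space → F, IsTest ψ → Tendsto (fun n => ∫ x, ⟪φ n x, ψ x⟫) atTop (𝓝 (∫ x, ⟪f x, ψ x⟫)) := by
  obtain ⟨ρ, Cρ, hCρ, hρ⟩ := exists_mollifier; obtain ⟨R, hR⟩ := hfc.isBounded.subset_closedBall (0 : Space)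
  obtain ⟨L, hL, hcomm⟩ := norm_conv_firstOrder_sub_le ha hb (R := R); have hfl : LocallyIntegrable f := hf.locallyIntegrable (by norm_num)
  have hfi : Integrable f := (integrableOn_iff_integrable_of_support_subset (subset_tsupport f)).1 (hfl.integrableOn_isCompact hfc)
  have hT : ∀ n, IsTest (conv (ρ n) f) := fun n => isTest_conv (hρ n).1 hfl hfc
  have hTψ : ∀ n {ψ : Space → F}, IsTest ψ → IsTest (conv (ρ n) ψ) := fun n {ψ} hψ => isTest_conv (hρ n).1 hψ.locallyIntegrable hψ.compact
  have hsw : ∀ n {ψ : Space → F}, IsTest ψ → ∫ x, ⟪conv (ρ n) f x, ψ x⟫ = ∫ x, ⟪f x, conv (ρ n) ψ x⟫ :=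
    fun n {ψ} hψ => integral_inner_conv (hρ n).1.cont (hρ n).1.compact (hρ n).2.2.1 hfi hψ.cont hψ.compact
  have hsq : ∀ {ψ : Space → F}, IsTest ψ → ‖lp volume ψ‖ ^ 2 = ∫ x, ⟪ψ x, ψ x⟫ := fun {ψ} hψ => by
    rw [norm_lp_sq hψ.memLp_volume]; simp only [real_inner_self_eq_norm_sq]
  have cancel : ∀ {r s : ℝ}, 0 ≤ r → 0 ≤ s → r ^ 2 ≤ s * r → r ≤ s := fun {r s} hr hs h => by
    by_contra hlt; nlinarith [mul_pos (sub_pos.2 (not_le.1 hlt)) (hs.trans_lt (not_le.1 hlt))]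
  have hnorm : ∀ n {ψ : Space → F}, IsTest ψ → ‖lp volume (conv (ρ n) ψ)‖ ≤ ‖lp volume ψ‖ := fun n {ψ} hψ =>
    norm_lp_conv_vector_le (hρ n).1 (hρ n).2.1 (hρ n).2.2.2.1 hψ
  have b1 : ∀ n, ‖lp volume (conv (ρ n) f)‖ ≤ ‖lp volume f‖ := fun n => by
    refine cancel (norm_nonneg _) (norm_nonneg _) ?_; rw [hsq (hT n), hsw n (hT n)]
    exact (le_abs_self _).trans ((abs_integral_inner_le hf (hTψ n (hT n)).memLp_volume).trans
      (mul_le_mul_of_nonneg_left (hnorm n (hT n)) (norm_nonneg _)))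
  have hN : ∀ n : ℕ, (0 : ℝ) < n + 1 := fun n => by positivity
  have b2 : ∀ n, ‖lp volume (firstOrder a b (conv (ρ n) f))‖ ≤ ‖lp volume g‖ + L * (3 * Cρ + 1) * ‖lp volume f‖ := fun n => by
    have hψ := (hT n).firstOrder ha hb; have hδ : 1 / ((n : ℝ) + 1) ≤ 1 := by rw [div_le_one (hN n)]; linarith [n.cast_nonneg (α := ℝ)]
    set ψ := firstOrder a b (conv (ρ n) f) with hψd; refine cancel (norm_nonneg _) (by positivity) ?_
    set κ : Space → ℝ := fun t => L * (1 / ((n : ℝ) + 1) * ∑ j, |pd j (ρ n) t| + ρ n t) with hκ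
    have hκc : Continuous κ := by have := fun j => ((hρ n).1.pd j).cont; have := (hρ n).1.cont; fun_prop
    have hκs : HasCompactSupport κ := HasCompactSupport.intro (hρ n).1.compact fun x hx => by
      simp [hκ, pd, fderiv_of_notMem_tsupport ℝ hx, off_tsupport hx]
    have hκ0 : ∀ x, 0 ≤ κ x := fun x => mul_nonneg hL (add_nonneg (mul_nonneg (one_div_nonneg.2 (hN n).le)
      (sum_nonneg fun j _ => abs_nonneg _)) ((hρ n).2.1 x))
    have iρ : ∀ j, Integrable fun x => |pd j (ρ n) x| := fun j =>
      (((hρ n).1.pd j).cont.integrable_of_hasCompactSupport ((hρ n).1.pd j).compact).abs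
    have hκi : ∫ x, κ x ≤ L * (3 * Cρ + 1) := by
      have i1 : Integrable fun x => 1 / ((n : ℝ) + 1) * ∑ j, |pd j (ρ n) x| := (integrable_finsetSum _ fun j _ => iρ j).const_mul _
      rw [hκ, integral_const_mul, integral_add i1 ((hρ n).1.cont.integrable_of_hasCompactSupport (hρ n).1.compact),
        integral_const_mul, integral_finsetSum _ fun j _ => iρ j, (hρ n).2.2.2.1]
      refine mul_le_mul_of_nonneg_left (add_le_add_left ?_ _) hL
      have h3 : ∑ j, ∫ x, |pd j (ρ n) x| ≤ ∑ _j : Fin 3, Cρ * (n + 1) := sum_le_sum fun j _ => (hρ n).2.2.2.2.2 j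
      rw [Finset.sum_const, Finset.card_univ, Fintype.card_fin, nsmul_eq_mul] at h3
      rw [div_mul_eq_mul_div, one_mul, div_le_iff₀ (hN n)]; push_cast at h3; linarith
    have hψn : Continuous fun x => ‖ψ x‖ := hψ.cont.norm
    have c1 : Continuous (conv κ fun x => ‖ψ x‖) := hψ.compact.norm.continuous_convolution_right _ hκc.locallyIntegrable hψn
    have m1 : MemLp (conv κ fun x => ‖ψ x‖) 2 volume := c1.memLp_of_hasCompactSupport (hκs.convolution _ hψ.compact.norm)
    have hPψ := hψ.firstOrder ha hb; have m2 := (hTψ n hPψ).memLp_volume; have m3 := ((hTψ n hψ).firstOrder ha hb).memLp_volume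
    have i1 : Integrable fun x => ⟪f x, conv (ρ n) (firstOrder a b ψ) x - firstOrder a b (conv (ρ n) ψ) x⟫ :=
      integrable_inner hf (m2.sub m3)
    have i2 : Integrable fun x => ⟪f x, firstOrder a b (conv (ρ n) ψ) x⟫ := integrable_inner hf m3
    have e1 : ‖lp volume ψ‖ ^ 2 = (∫ x, ⟪f x, conv (ρ n) (firstOrder a b ψ) x - firstOrder a b (conv (ρ n) ψ) x⟫)
        + ∫ x, ⟪g x, conv (ρ n) ψ x⟫ := by
      rw [hsq hψ, ← hfg _ (hTψ n hψ), ← integral_add i1 i2]; simp only [inner_sub_right, sub_add_cancel]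
      rw [← hsw n hPψ, ← hsymm _ _ (hT n) hψ]
    have e2 : ∫ x, ⟪f x, conv (ρ n) (firstOrder a b ψ) x - firstOrder a b (conv (ρ n) ψ) x⟫
        ≤ ‖lp volume f‖ * (L * (3 * Cρ + 1) * ‖lp volume ψ‖) := by
      have h1 : ∫ x, ⟪f x, conv (ρ n) (firstOrder a b ψ) x - firstOrder a b (conv (ρ n) ψ) x⟫
          ≤ ∫ x, inner ℝ ‖f x‖ (conv κ (fun x => ‖ψ x‖) x) := by
        refine integral_mono i1 (integrable_inner hf.norm m1) fun x => ?_
        by_cases hx : x ∈ tsupport f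
        · refine (real_inner_le_norm _ _).trans ?_; rw [Real.inner_apply]
          exact mul_le_mul_of_nonneg_left (hcomm hδ (hρ n).1 (hρ n).2.1 (hρ n).2.2.2.2.1 hψ x (hR hx)) (norm_nonneg _)
        · simp [off_tsupport hx]
      refine h1.trans ((le_abs_self _).trans ((abs_integral_inner_le hf.norm m1).trans ?_)); rw [norm_lp_norm hf]
      refine mul_le_mul_of_nonneg_left ((norm_lp_conv_le hκc hκs hκ0 hψn hψ.compact.norm).trans ?_) (norm_nonneg _)
      rw [norm_lp_norm hψ.memLp_volume]; exact mul_le_mul_of_nonneg_right hκi (norm_nonneg _)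
    have e3 : ∫ x, ⟪g x, conv (ρ n) ψ x⟫ ≤ ‖lp volume g‖ * ‖lp volume ψ‖ :=
      (le_abs_self _).trans ((abs_integral_inner_le hg (hTψ n hψ).memLp_volume).trans
        (mul_le_mul_of_nonneg_left (hnorm n hψ) (norm_nonneg _)))
    rw [e1]; linarith
  refine ⟨fun n => conv (ρ n) f, ‖lp volume f‖ + (‖lp volume g‖ + L * (3 * Cρ + 1) * ‖lp volume f‖), hT,
    fun n => (b1 n).trans (le_add_of_nonneg_right (by positivity)),
    fun n => (b2 n).trans (le_add_of_nonneg_left (norm_nonneg _)), fun ψ hψ => ?_⟩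
  have hI : 0 ≤ ∫ x, ‖f x‖ := integral_nonneg fun x => norm_nonneg _; rw [Metric.tendsto_atTop]; intro ε hε
  obtain ⟨δ, hδ, hu⟩ := Metric.uniformContinuous_iff.1 (hψ.compact.uniformContinuous_of_continuous hψ.cont)
    (ε / (2 * ((∫ x, ‖f x‖) + 1))) (by positivity)
  obtain ⟨N, hNδ⟩ := exists_nat_one_div_lt hδ; refine ⟨N, fun n hn => ?_⟩
  have h1 : ∀ x, ‖conv (ρ n) ψ x - ψ x‖ ≤ ε / (2 * ((∫ x, ‖f x‖) + 1)) := fun x => by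
    rw [← dist_eq_norm]
    refine dist_convolution_le (R := δ) (by positivity) (fun t ht => ?_) (hρ n).2.1 (hρ n).2.2.2.1
      hψ.cont.aestronglyMeasurable fun y hy => (hu (Metric.mem_ball.1 hy)).le
    have h2 := (hρ n).2.2.2.2.1 (subset_tsupport _ ht); rw [mem_closedBall_zero_iff] at h2; rw [mem_ball_zero_iff]
    exact h2.trans_lt ((one_div_le_one_div_of_le (hN N) (by gcongr)).trans_lt hNδ)
  have i1 := integrable_inner hf (hTψ n hψ).memLp_volume; have i2 := integrable_inner hf hψ.memLp_volume
  rw [hsw n hψ, Real.dist_eq, ← integral_sub i1 i2]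
  have h3 : |∫ x, (⟪f x, conv (ρ n) ψ x⟫ - ⟪f x, ψ x⟫)| ≤ ∫ x, ‖f x‖ * (ε / (2 * ((∫ x, ‖f x‖) + 1))) := by
    rw [← Real.norm_eq_abs]; refine norm_integral_le_of_norm_le (hfi.norm.mul_const _) (.of_forall fun x => ?_)
    rw [← inner_sub_right]; exact (norm_inner_le_norm _ _).trans (mul_le_mul_of_nonneg_left (h1 x) (norm_nonneg _))
  rw [integral_mul_const] at h3; refine h3.trans_lt ?_; rw [mul_div_assoc', div_lt_iff₀ (by positivity)]; nlinarith

end friedrichs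

/-! ### Essential self-adjointness of the Dirac operator -/

lemma tendsto_inner_of_dense {E : Type*} [NormedAddCommGroup E] [InnerProductSpace ℝ E] {x : ℕ → E} {x₀ : E} {C : ℝ}
    (hb : ∀ n, ‖x n‖ ≤ C) {S : Set E} (hS : Dense S)
    (h : ∀ s ∈ S, Tendsto (fun n => ⟪x n, s⟫) atTop (𝓝 ⟪x₀, s⟫)) (y : E) :
    Tendsto (fun n => ⟪x n, y⟫) atTop (𝓝 ⟪x₀, y⟫) := by
  have hC : 0 ≤ C := (norm_nonneg _).trans (hb 0); rw [Metric.tendsto_atTop]; intro ε hε; have hM : 0 < C + ‖x₀‖ + 1 := by positivity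
  obtain ⟨s, hs, hsy⟩ := Metric.dense_iff.1 hS y (ε / (2 * (C + ‖x₀‖ + 1))) (by positivity)
  rw [Metric.mem_ball, dist_eq_norm, ← norm_neg, neg_sub] at hs
  obtain ⟨N, hN⟩ := Metric.tendsto_atTop.1 (h s hsy) (ε / 2) (by positivity); refine ⟨N, fun n hn => ?_⟩; have h1 := hN n hn
  rw [Real.dist_eq] at h1 ⊢
  have e : ⟪x n, y⟫ - ⟪x₀, y⟫ = (⟪x n, s⟫ - ⟪x₀, s⟫) + ⟪x n - x₀, y - s⟫ := by simp only [inner_sub_left, inner_sub_right]; ring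
  have h2 : |⟪x n - x₀, y - s⟫| ≤ (C + ‖x₀‖ + 1) * (ε / (2 * (C + ‖x₀‖ + 1))) :=
    (abs_real_inner_le_norm _ _).trans (mul_le_mul ((norm_sub_le _ _).trans (by linarith [hb n])) hs.le (norm_nonneg _) hM.le)
  have h3 : (C + ‖x₀‖ + 1) * (ε / (2 * (C + ‖x₀‖ + 1))) = ε / 2 := by field_simp
  rw [e]; linarith [abs_add_le (⟪x n, s⟫ - ⟪x₀, s⟫) ⟪x n - x₀, y - s⟫]

lemma IsTest.smul {f : Space → ℝ} (hf : 𝒞 ∞ f) (hφ : IsTest φ) : IsTest fun x => f x • φ x := ⟨hf.smul hφ.smooth, hφ.compact.smul_left⟩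

lemma memLp_of_withDensity {α G : Type*} [MeasurableSpace α] {μ : Measure α} [NormedAddCommGroup G] {f : α → G} {g : α → ℝ}
    (hg : ∀ x, 1 / 2 ≤ g x) (h2 : MemLp f 2 (μ.withDensity fun x => ENNReal.ofReal (g x))) : MemLp f 2 μ := by
  refine h2.of_measure_le_smul (c := 2) (by norm_num) ?_
  have h1 : μ ≤ μ.withDensity ((2 : ℝ≥0∞) • fun x => ENNReal.ofReal (g x)) := by
    conv_lhs => rw [← withDensity_one (μ := μ)]
    refine withDensity_mono (.of_forall fun x => ?_); change (1 : ℝ≥0∞) ≤ 2 * ENNReal.ofReal (g x)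
    rw [← ENNReal.ofReal_ofNat, ← ENNReal.ofReal_mul (by norm_num), ENNReal.one_le_ofReal]; linarith [hg x]
  rwa [withDensity_smul' _ _ (by norm_num)] at h1

lemma NearFlat.memLp_volume {κ : Space → ℝ} (hf : NearFlat h κ) {F : Type*}
    [NormedAddCommGroup F] {f : Space → F} (h2 : MemLp f 2 𝔯 h) : MemLp f 2 volume :=
  memLp_of_withDensity hf.le_vol h2

lemma dense_test [FiniteDimensional ℝ F] (hh : IsMetric h) : Dense {f : Lp F 2 𝔯 h | ∃ φ : Space → F, IsTest φ ∧ f = lp 𝔯 h φ} := by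
  have := isLocallyFinite_riemVol hh
  refine (Lp.dense_hasCompactSupport_contDiff (μ := 𝔯 h) (F := F) (p := 2) (by norm_num)).mono ?_; rintro f ⟨g, h1, h2, h3⟩
  exact ⟨g, ⟨h3, h2⟩, by rw [← lp_congr h1, lp_coeFn]⟩

/-- Smooth cutoff functions. -/
lemma exists_cutoff : ∃ (χ : ℕ → Space → ℝ) (C : ℝ), 0 ≤ C ∧ (∀ n, IsTest (χ n)) ∧ (∀ n x, |χ n x| ≤ 1) ∧
    (∀ x, Tendsto (fun n => χ n x) atTop (𝓝 1)) ∧ (∀ n j x, |pd j (χ n) x| ≤ C) ∧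
    ∀ j x, Tendsto (fun n => pd j (χ n) x) atTop (𝓝 0) := by
  let β : ContDiffBump (0 : Space) := ⟨1, 2, by norm_num, by norm_num⟩
  have hβ : 𝒞 ∞ β := β.contDiff; have hc : HasCompactSupport β := β.hasCompactSupport
  obtain ⟨C, hC⟩ := (hc.fderiv ℝ).exists_bound_of_continuous (hβ.continuous_fderiv (by simp))
  have hC0 : 0 ≤ C := (norm_nonneg _).trans (hC 0); have hN : ∀ n : ℕ, (0 : ℝ) < n + 1 := fun n => by positivity
  have hN1 : ∀ n : ℕ, ((n : ℝ) + 1)⁻¹ ≤ 1 := fun n => inv_le_one_of_one_le₀ (by linarith [n.cast_nonneg (α := ℝ)])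
  have ht : Tendsto (fun n : ℕ => ((n : ℝ) + 1)⁻¹) atTop (𝓝 0) := by simpa [one_div] using tendsto_one_div_add_atTop_nhds_zero_nat (𝕜 := ℝ)
  have hpd : ∀ (n : ℕ) j x, |pd j (fun x => β (((n : ℝ) + 1)⁻¹ • x)) x| ≤ ((n : ℝ) + 1)⁻¹ * C := fun n j x => by
    have h2 : HasFDerivAt (fun x : Space => β (((n : ℝ) + 1)⁻¹ • x)) _ x :=
      (hβ.diff _).hasFDerivAt.comp x ((((n : ℝ) + 1)⁻¹ • ContinuousLinearMap.id ℝ Space).hasFDerivAt)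
    rw [pd, h2.fderiv]
    simp only [ContinuousLinearMap.comp_apply, ContinuousLinearMap.smul_apply, ContinuousLinearMap.id_apply, map_smul, smul_eq_mul, abs_mul]
    rw [abs_of_pos (inv_pos.2 (hN n))]; refine mul_le_mul_of_nonneg_left ?_ (inv_pos.2 (hN n)).le
    refine (((fderiv ℝ β _).le_opNorm _).trans ?_); simpa using hC _
  refine ⟨fun n x => β (((n : ℝ) + 1)⁻¹ • x), C, hC0, fun n => ⟨hβ.comp (contDiff_const_smul _), ?_⟩, fun n x => ?_,
    fun x => ?_, fun n j x => (hpd n j x).trans (mul_le_of_le_one_left hC0 (hN1 n)), fun j x => ?_⟩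
  · exact hc.comp_homeomorph (Homeomorph.smulOfNeZero _ (inv_pos.2 (hN n)).ne')
  · rw [abs_of_nonneg β.nonneg]; exact β.le_one
  · have h1 : Tendsto (fun n : ℕ => ((n : ℝ) + 1)⁻¹ • x) atTop (𝓝 ((0 : ℝ) • x)) := ht.smul_const x; rw [zero_smul] at h1
    have h2 := (hβ.continuous.tendsto 0).comp h1
    rwa [β.one_of_mem_closedBall (by simp [β])] at h2
  · refine squeeze_zero_norm (fun n => hpd n j x) ?_; simpa using ht.mul_const C

namespace CliffordRep

variable [FiniteDimensional ℝ F]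

/-- `Hu = k` in the sense of distributions. -/
def IsWeakPair (h e : MatField) (m : ℝ) (u k : Lp F 2 𝔯 h) : Prop := ∀ ψ : Space → F, IsTest ψ → ⟪lp 𝔯 h (c.H h e m ψ), u⟫ = ⟪lp 𝔯 h ψ, k⟫

lemma vol_smul_H (m : ℝ) (ψ : Space → F) (x : Space) : 𝔳 h x • c.H h e m ψ x = firstOrder (fun j x => 𝔳 h x • -(c.J * c.A e j x))
      (fun x => 𝔳 h x • (-(c.J * ∑ j, c.A e j x * c.B h e j x) - m • c.bt)) ψ x := by
  simp only [H, H0, D, firstOrder, smul_apply, neg_apply, sub_apply, mul_apply_eq_comp, sum_apply,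
    map_add, map_sum, sum_add_distrib, smul_neg, smul_sub, smul_sum, sum_neg_distrib, smul_add]
  abel

include hh he hf

lemma inner_eq_of_hasCompactSupport (m : ℝ) {f : Space → F} (hfm : MemLp f 2 𝔯 h) (hfc : HasCompactSupport f)
    {g q l : Lp F 2 𝔯 h} (h1 : c.IsWeakPair h e m (lp 𝔯 h f) g) (h2 : c.IsWeakPair h e m q l) :
    ⟪g, q⟫ = ⟪lp 𝔯 h f, l⟫ := by
  have hv := hh.contDiff_volDensity
  have ha : ∀ j, 𝒞 ∞ fun x => 𝔳 h x • -(c.J * c.A e j x) := fun j =>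
    hv.smul ((ContinuousLinearMap.mul ℝ (F →L[ℝ] F) c.J).contDiff.comp (c.contDiff_A he j)).neg
  have hb : 𝒞 ∞ fun x => 𝔳 h x • (-(c.J * ∑ j, c.A e j x * c.B h e j x) - m • c.bt) :=
    hv.smul (((ContinuousLinearMap.mul ℝ (F →L[ℝ] F) c.J).contDiff.comp (ContDiff.sum fun j _ =>
      (c.contDiff_A he j).clm_comp (c.contDiff_B hh he j))).neg.sub contDiff_const)
  have hv2 : ∀ x, ‖𝔳 h x‖ ≤ 2 := fun x => by rw [Real.norm_of_nonneg (hh.volDensity_pos x).le]; exact hf.vol_le x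
  have key : ∀ {φ ψ : Space → F}, ∫ x, ⟪φ x, 𝔳 h x • ψ x⟫ = ∫ x, ⟪φ x, ψ x⟫ ∂𝔯 h := by
    intro φ ψ; rw [hh.integral_riemVol]; exact integral_congr_ae (.of_forall fun x => real_inner_smul_right _ _ _)
  have key' : ∀ {φ ψ : Space → F}, ∫ x, ⟪𝔳 h x • φ x, ψ x⟫ = ∫ x, ⟪φ x, ψ x⟫ ∂𝔯 h := by
    intro φ ψ; rw [hh.integral_riemVol]; exact integral_congr_ae (.of_forall fun x => real_inner_smul_left _ _ _)
  obtain ⟨φ, C, hφ, b1, b2, hlim⟩ := exists_bounded_approx (g := fun x => 𝔳 h x • g x) ha hb (fun φ ψ hφ hψ => by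
      simp only [← c.vol_smul_H]
      rw [key, key', ← inner_lp ((hφ.H hh he c m).memLp hh) (hψ.memLp hh), ← inner_lp (hφ.memLp hh) ((hψ.H hh he c m).memLp hh),
        c.inner_lp_H hh he m hφ hψ])
    (hf.memLp_volume hfm) hfc
    (memLp_smul_fun (memLp_of_continuous_bound hv.continuous hv2) (hf.memLp_volume (Lp.memLp g)))
    (fun ψ hψ => by
      simp only [← c.vol_smul_H]
      rw [key, key', ← inner_lp hfm ((hψ.H hh he c m).memLp hh), real_inner_comm, h1 ψ hψ, inner_lp_left (hψ.memLp hh)]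
      simp only [real_inner_comm])
  have i0 : ∀ {ψ : Space → F}, IsTest ψ → Integrable fun x => ‖ψ x‖ ^ 2 := fun {ψ} hψ =>
    integrable_of_eq_zero (hψ.cont.norm.pow 2) hψ.compact fun x hx => by simp [off_tsupport hx]
  have i1 : ∀ {ψ : Space → F}, IsTest ψ → Integrable fun x => 𝔳 h x * ‖ψ x‖ ^ 2 := fun {ψ} hψ =>
    integrable_of_eq_zero (hv.continuous.mul (hψ.cont.norm.pow 2)) hψ.compact fun x hx => by simp [off_tsupport hx]
  have hC : 0 ≤ C := (norm_nonneg _).trans (b1 0)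
  have n1 : ∀ n, ‖lp 𝔯 h (φ n)‖ ≤ 2 * C := fun n => by
    refine abs_le_of_sq_le_sq' ?_ (by positivity) |>.2; rw [norm_lp_sq ((hφ n).memLp hh), hh.integral_riemVol]
    have h3 : ∫ x, 𝔳 h x * ‖φ n x‖ ^ 2 ≤ ∫ x, 2 * ‖φ n x‖ ^ 2 := integral_mono (i1 (hφ n)) ((i0 (hφ n)).const_mul 2)
      fun x => mul_le_mul_of_nonneg_right (hf.vol_le x) (sq_nonneg _)
    rw [integral_const_mul, ← norm_lp_sq (hφ n).memLp_volume] at h3; nlinarith [b1 n, norm_nonneg (lp volume (φ n))]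
  have n2 : ∀ n, ‖lp 𝔯 h (c.H h e m (φ n))‖ ≤ 2 * C := fun n => by
    refine abs_le_of_sq_le_sq' ?_ (by positivity) |>.2; have hHn := (hφ n).H hh he c m; have hP := (hφ n).firstOrder ha hb
    rw [norm_lp_sq (hHn.memLp hh), hh.integral_riemVol]
    have h3 : ∫ x, 𝔳 h x * ‖c.H h e m (φ n) x‖ ^ 2 ≤ ∫ x, 2 * ‖𝔳 h x • c.H h e m (φ n) x‖ ^ 2 := by
      refine integral_mono (i1 hHn) ((i0 (hHn.smul hv)).const_mul 2) fun x => ?_; have h4 := hf.le_vol x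
      have h5 := hh.volDensity_pos x; change 𝔳 h x * ‖c.H h e m (φ n) x‖ ^ 2 ≤ 2 * ‖𝔳 h x • c.H h e m (φ n) x‖ ^ 2
      rw [norm_smul, mul_pow, Real.norm_of_nonneg h5.le]
      nlinarith [mul_nonneg (mul_nonneg h5.le (by linarith : 0 ≤ 2 * 𝔳 h x - 1)) (sq_nonneg ‖c.H h e m (φ n) x‖)]
    simp only [c.vol_smul_H] at h3; rw [integral_const_mul, ← norm_lp_sq hP.memLp_volume] at h3
    have h6 := pow_le_pow_left₀ (norm_nonneg _) (b2 n) 2; nlinarith [sq_nonneg C]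
  have t1 := tendsto_inner_of_dense (x₀ := lp 𝔯 h f) n1 (dense_test hh) (by
    rintro s ⟨ψ, hψ, rfl⟩; rw [inner_lp hfm (hψ.memLp hh), ← key]; refine (hlim _ (hψ.smul hv)).congr fun n => ?_
    rw [key, inner_lp ((hφ n).memLp hh) (hψ.memLp hh)]) l
  have t2 := tendsto_inner_of_dense (x₀ := g) n2 (dense_test hh) (by
    rintro s ⟨ψ, hψ, rfl⟩; have hHψ := hψ.H hh he c m; rw [real_inner_comm, ← h1 ψ hψ, real_inner_comm, inner_lp hfm (hHψ.memLp hh), ← key]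
    refine (hlim _ (hHψ.smul hv)).congr fun n => ?_
    rw [key, ← inner_lp ((hφ n).memLp hh) (hHψ.memLp hh), c.inner_lp_H hh he m (hφ n) hψ]) q
  exact tendsto_nhds_unique t2 (t1.congr fun n => (h2 _ (hφ n)).symm)

omit hf in
lemma H_smul (m : ℝ) {f : Space → ℝ} {x : Space} (hf' : DiffAt f x)
    (hφ : DiffAt φ x) : c.H h e m (fun y => f y • φ y) x = f x • c.H h e m φ x + (∑ j, pd j f x • -(c.J * c.A e j x)) (φ x) := by
  simp only [H, H0, fun j => c.D_smul (h := h) (e := e) hf' hφ j, map_add, map_smul, sum_add_distrib, smul_sub,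
    sum_apply, smul_apply, neg_apply, mul_apply_eq_comp, map_sum, smul_neg, sum_neg_distrib, smul_comm m (f x),
    ← smul_sum]
  abel

/-- The adjoint of the Dirac operator on test fields is symmetric. -/
lemma IsWeakPair.inner_eq {u k q l : Lp F 2 𝔯 h} (h1 : c.IsWeakPair h e m u k) (h2 : c.IsWeakPair h e m q l) : ⟪k, q⟫ = ⟪u, l⟫ := by
  obtain ⟨χ, C, hC, hχ, hχ1, hχt, hdχ, hdχt⟩ := exists_cutoff
  let T : ℕ → Space → F →L[ℝ] F := fun n x => ∑ j, pd j (χ n) x • -(c.J * c.A e j x)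
  have hTb : ∀ n x, ‖T n x‖ ≤ 18 * C := fun n x => by
    refine (norm_sum_le _ _).trans ((sum_le_sum fun j _ => (?_ : _ ≤ C * 6)).trans (le_of_eq ?_))
    · rw [norm_smul, norm_neg, Real.norm_eq_abs]
      refine mul_le_mul (hdχ n j x) (ContinuousLinearMap.opNorm_le_bound _ (by norm_num) fun v => ?_) (norm_nonneg _) hC
      rw [mul_apply_eq_comp, c.norm_J]; exact c.norm_A_le hh he hf j x v
    · simp; ring
  have hTc : ∀ n, Continuous (T n) := fun n => continuous_finsetSum _ fun j _ =>
    ((hχ n).pd j).cont.smul (continuous_const.mul (c.contDiff_A he j).continuous).neg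
  have hTm : ∀ n, MemLp (T n) ∞ 𝔯 h := fun n => memLp_of_continuous_bound (hTc n) (hTb n)
  have hTs : ∀ n x v w, ⟪T n x v, w⟫ = -⟪v, T n x w⟫ := fun n x v w => by
    simp only [T, sum_apply, smul_apply, neg_apply, mul_apply_eq_comp, sum_inner, inner_sum, real_inner_smul_left,
      real_inner_smul_right, inner_neg_left, inner_neg_right, c.inner_J, c.inner_A, c.A_J]
    simp
  have hχm : ∀ n, MemLp (χ n) ∞ 𝔯 h := fun n => memLp_of_continuous_bound (hχ n).cont fun x => hχ1 n x
  have hm1 : ∀ n, MemLp (fun x => χ n x • u x) 2 𝔯 h := fun n => memLp_smul_fun (hχm n) (Lp.memLp u)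
  have hm3 : ∀ n, MemLp (fun x => χ n x • k x + T n x (u x)) 2 𝔯 h := fun n =>
    (memLp_smul_fun (hχm n) (Lp.memLp k)).add (memLp_clm_apply (hTm n) (Lp.memLp u))
  have hw : ∀ n, c.IsWeakPair h e m (lp 𝔯 h fun x => χ n x • u x) (lp 𝔯 h fun x => χ n x • k x + T n x (u x)) := fun n ψ hψ => by
    have hχψ := hψ.smul (hχ n).smooth; have hHm := (hψ.H hh he c m).memLp hh; have hψm := hψ.memLp hh
    have a1 : ⟪lp 𝔯 h (c.H h e m ψ), lp 𝔯 h fun x => χ n x • u x⟫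
        = ⟪lp 𝔯 h (c.H h e m fun x => χ n x • ψ x), u⟫ - ∫ x, ⟪T n x (ψ x), u x⟫ ∂𝔯 h := by
      rw [inner_lp hHm (hm1 n), inner_lp_left ((hχψ.H hh he c m).memLp hh),
        ← integral_sub (integrable_inner ((hχψ.H hh he c m).memLp hh) (Lp.memLp u))
          (integrable_inner (memLp_clm_apply (hTm n) hψm) (Lp.memLp u))]
      refine integral_congr_ae (.of_forall fun x => ?_); beta_reduce
      rw [c.H_smul hh he m ((hχ n).diff x) (hψ.diff x), inner_add_left, add_sub_cancel_right, real_inner_smul_left, real_inner_smul_right]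
    rw [a1, h1 _ hχψ, inner_lp_left (hχψ.memLp hh), inner_lp hψm (hm3 n),
      ← integral_sub (integrable_inner (hχψ.memLp hh) (Lp.memLp k)) (integrable_inner (memLp_clm_apply (hTm n) hψm) (Lp.memLp u))]
    refine integral_congr_ae (.of_forall fun x => ?_); beta_reduce
    rw [hTs, inner_add_right, real_inner_smul_left, real_inner_smul_right, sub_neg_eq_add]
  have hu : ∀ n, HasCompactSupport fun x => χ n x • u x := fun n => (hχ n).compact.smul_right
  have e1 := fun n => c.inner_eq_of_hasCompactSupport hh he hf m (hm1 n) (hu n) (hw n) h2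
  have t1 : Tendsto (fun n => ⟪lp 𝔯 h fun x => χ n x • u x, l⟫) atTop (𝓝 ⟪u, l⟫) := by
    simp only [fun n => inner_lp_left (hm1 n) l]; rw [L2.inner_def]
    refine tendsto_integral_of_dominated_convergence (fun x => ‖⟪u x, l x⟫‖) (fun n =>
      (integrable_inner (hm1 n) (Lp.memLp l)).aestronglyMeasurable) (integrable_inner (Lp.memLp u) (Lp.memLp l)).norm
      (fun n => .of_forall fun x => ?_) (.of_forall fun x => ?_)
    · rw [real_inner_smul_left, norm_mul]; exact mul_le_of_le_one_left (norm_nonneg _) (hχ1 n x)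
    · simp only [real_inner_smul_left]; simpa using (hχt x).mul_const ⟪u x, l x⟫
  have t2 : Tendsto (fun n => ⟪lp 𝔯 h fun x => χ n x • k x + T n x (u x), q⟫) atTop (𝓝 ⟪k, q⟫) := by
    simp only [fun n => inner_lp_left (hm3 n) q]; rw [L2.inner_def]
    refine tendsto_integral_of_dominated_convergence (fun x => ‖⟪k x, q x⟫‖ + 18 * C * inner ℝ ‖u x‖ ‖q x‖) (fun n =>
      (integrable_inner (hm3 n) (Lp.memLp q)).aestronglyMeasurable) ((integrable_inner (Lp.memLp k) (Lp.memLp q)).norm.add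
      ((integrable_inner (Lp.memLp u).norm (Lp.memLp q).norm).const_mul _))
      (fun n => .of_forall fun x => ?_) (.of_forall fun x => ?_)
    · rw [inner_add_left, real_inner_smul_left, Real.inner_apply]; refine (norm_add_le _ _).trans (add_le_add ?_ ?_)
      · rw [norm_mul]; exact mul_le_of_le_one_left (norm_nonneg _) (hχ1 n x)
      · refine (norm_inner_le_norm _ _).trans ?_; rw [← mul_assoc]
        exact mul_le_mul_of_nonneg_right (((T n x).le_opNorm _).trans
          (mul_le_mul_of_nonneg_right (hTb n x) (norm_nonneg _))) (norm_nonneg _)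
    · have h3 : Tendsto (fun n => T n x (u x)) atTop (𝓝 0) := by
        have : Tendsto (fun n => ∑ j, pd j (χ n) x • (-(c.J * c.A e j x)) (u x)) atTop (𝓝 (∑ j : Fin 3, (0 : ℝ) • (-(c.J * c.A e j x)) (u x))) :=
          tendsto_finsetSum _ fun j _ => (hdχt j x).smul_const _
        simpa [T] using this
      have h4 : Tendsto (fun n => χ n x • k x + T n x (u x)) atTop (𝓝 ((1 : ℝ) • k x + 0)) := ((hχt x).smul_const (k x)).add h3
      rw [one_smul, add_zero] at h4; exact h4.inner tendsto_const_nhds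
  exact tendsto_nhds_unique t2 (t1.congr fun n => (e1 n).symm)

/-- Weak solutions lie in the closure of the operator on test fields. -/
lemma IsWeakPair.exists_inGraph [Nontrivial F] (hκ : κ ≤ 1 / 10 ^ 6) {u k : Lp F 2 𝔯 h}
    (h1 : c.IsWeakPair h e m u k) : ∃ d, c.InGraph h e m u k d := by
  let G : Submodule ℝ (WithLp 2 (Lp F 2 𝔯 h × Lp F 2 𝔯 h)) :=
    { carrier := {p | ∃ φ : Space → F, IsTest φ ∧ p = WithLp.toLp 2 (lp 𝔯 h φ, lp 𝔯 h (c.H h e m φ))}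
      add_mem' := by
        rintro _ _ ⟨φ, hφ, rfl⟩ ⟨ψ, hψ, rfl⟩; refine ⟨_, hφ.add hψ, ?_⟩
        have eH : c.H h e m (fun x => φ x + ψ x) = fun x => c.H h e m φ x + c.H h e m ψ x :=
          funext fun x => c.H_add m (hφ.diff x) (hψ.diff x)
        rw [lp_add (hφ.memLp hh) (hψ.memLp hh), eH, lp_add ((hφ.H hh he c m).memLp hh) ((hψ.H hh he c m).memLp hh)]; rfl
      zero_mem' := by
        have h0 : IsTest fun _ : Space => (0 : F) := ⟨contDiff_const, HasCompactSupport.zero⟩; refine ⟨_, h0, ?_⟩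
        have e1 := lp_const_smul (h0.memLp hh) (0 : ℝ); have e2 := lp_const_smul ((h0.H hh he c m).memLp hh) (0 : ℝ)
        have e3 : c.H h e m (fun _ => (0 : F)) = fun x => (0 : ℝ) • c.H h e m (fun _ => (0 : F)) x := by funext x; simp [H, H0, D, pd_const]
        simp only [zero_smul, smul_zero] at e1 e2 e3; rw [e1, e3, e2]; rfl
      smul_mem' := by
        rintro a _ ⟨φ, hφ, rfl⟩; refine ⟨_, hφ.const_smul a, ?_⟩
        have eH : (c.H h e m fun x => a • φ x) = fun x => a • c.H h e m φ x := by
          funext x; rw [c.H_smul hh he m (differentiableAt_const a) (hφ.diff x)]; simp [pd_const]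
        rw [lp_const_smul (hφ.memLp hh), eH, lp_const_smul ((hφ.H hh he c m).memLp hh)]; rfl }
  have hmem : WithLp.toLp 2 (u, k) ∈ G.topologicalClosure := by
    rw [← Submodule.orthogonal_orthogonal_eq_closure, Submodule.mem_orthogonal]; intro p hp
    have h2 : c.IsWeakPair h e m p.snd (-p.fst) := fun ψ hψ => by
      have h3 : ⟪lp 𝔯 h ψ, p.fst⟫ + ⟪lp 𝔯 h (c.H h e m ψ), p.snd⟫ = 0 := (Submodule.mem_orthogonal _ _).1 hp _ ⟨ψ, hψ, rfl⟩
      rw [inner_neg_right]; linarith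
    have h4 := h1.inner_eq hh he c hf h2; rw [inner_neg_right] at h4; change ⟪p.fst, u⟫ + ⟪p.snd, k⟫ = 0
    rw [real_inner_comm, real_inner_comm k]; linarith
  obtain ⟨p, hpG, hpt⟩ := mem_closure_iff_seq_limit.1 hmem; choose φ hφ hpe using hpG
  have t1 : Tendsto (fun n => lp 𝔯 h (φ n)) atTop (𝓝 u) := by
    have := ((WithLp.prod_continuous_ofLp 2 _ _).fst.tendsto _).comp hpt; simpa [Function.comp_def, hpe] using this
  have t2 : Tendsto (fun n => lp 𝔯 h (c.H h e m (φ n))) atTop (𝓝 k) := by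
    have := ((WithLp.prod_continuous_ofLp 2 _ _).snd.tendsto _).comp hpt; simpa [Function.comp_def, hpe] using this
  have hcau : ∀ j, CauchySeq fun n => lp 𝔯 h (c.D h e j (φ n)) := fun j => by
    refine Metric.cauchySeq_iff.2 fun ε hε => ?_; obtain ⟨N, hN⟩ := Metric.cauchySeq_iff.1 t2.cauchySeq (ε / 2) (by positivity)
    refine ⟨N, fun n hn n' hn' => ?_⟩; have h3 := hN n hn n' hn'; have h4 := c.sum_norm_lp_D_sq_le hh he hf hκ m ((hφ n).sub (hφ n'))
    rw [c.lp_H_sub hh he (hφ n) (hφ n'), ← dist_eq_norm] at h4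
    have h5 := (single_le_sum (f := fun j => ‖lp 𝔯 h (c.D h e j fun x => φ n x - φ n' x)‖ ^ 2)
      (fun j _ => sq_nonneg _) (Finset.mem_univ j)).trans h4
    beta_reduce at h5; rw [c.lp_D_sub hh he (hφ n) (hφ n'), ← dist_eq_norm] at h5
    nlinarith [dist_nonneg (x := lp 𝔯 h (c.D h e j (φ n))) (y := lp 𝔯 h (c.D h e j (φ n'))),
      dist_nonneg (x := lp 𝔯 h (c.H h e m (φ n))) (y := lp 𝔯 h (c.H h e m (φ n')))]
  choose d hdt using fun j => cauchySeq_tendsto_of_complete (hcau j); exact ⟨d, φ, hφ, t1, t2, hdt⟩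

end CliffordRep

/-! ### Averages in time -/

lemma hasDerivAt_of_sq_le {E : Type*} [NormedAddCommGroup E] [NormedSpace ℝ E] {f : ℝ → E} {f' : E} {t C r : ℝ} (hr : 0 < r)
    (h : ∀ τ, |τ| < r → ‖f (t + τ) - f t - τ • f'‖ ≤ C * τ ^ 2) : HasDerivAt f f' t := by
  rw [hasDerivAt_iff_isLittleO_nhds_zero]
  refine (Asymptotics.IsBigO.of_bound C ?_).trans_isLittleO (Asymptotics.isLittleO_pow_id (𝕜 := ℝ) (n := 2) (by norm_num))
  filter_upwards [Metric.ball_mem_nhds (0 : ℝ) hr] with τ hτ; rw [Real.norm_of_nonneg (sq_nonneg τ)]; exact h τ (by simpa using hτ)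

lemma exists_notMem_tsupport {θ : ℝ → ℝ} (hc : HasCompactSupport θ) : ∃ R, 0 < R ∧ ∀ s, R ≤ |s| → s ∉ tsupport θ := by
  obtain ⟨R, hR⟩ := hc.isBounded.subset_closedBall (0 : ℝ); refine ⟨|R| + 1, by positivity, fun s hs h1 => ?_⟩; have := hR h1
  rw [mem_closedBall_zero_iff, Real.norm_eq_abs] at this; linarith [le_abs_self R]

section timeAvg

variable [FiniteDimensional ℝ F]
variable {u : ℝ → Space → F} {θ : ℝ → ℝ} {T : ℝ}

/-- Square integrability on every bounded time interval. -/
def IsLocL2 (h : MatField) (u : ℝ → Space → F) : Prop := ∀ T : ℝ, 0 < T → MemLp (uncurry u) 2 𝔫 h T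

variable (hu : IsLocL2 h u)
include hh

lemma spacetimeVol_restrict (T : ℝ) : (𝔪 h).restrict (Ioo 0 T ×ˢ univ) = 𝔫 h T := by
  have := isLocallyFinite_riemVol hh
  rw [spacetimeVol, ← Measure.prod_restrict, Measure.restrict_restrict measurableSet_Ioo, Measure.restrict_univ,
    inter_eq_left.2 Ioo_subset_Ioi_self, spacetimeVol]

lemma integrable_spacetime {G : Type*} [NormedAddCommGroup G] {f : ℝ × Space → G} (hf : ∀ p : ℝ × Space, T ≤ p.1 → f p = 0)
    (hi : Integrable f 𝔫 h T) : Integrable f 𝔪 h := by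
  have := isLocallyFinite_riemVol hh; rw [← spacetimeVol_restrict hh] at hi
  have h1 : Integrable ((Iio T ×ˢ univ : Set (ℝ × Space)).indicator f) 𝔪 h := by
    rw [integrable_indicator_iff (measurableSet_Iio.prod MeasurableSet.univ), IntegrableOn]
    have e : (𝔪 h).restrict (Iio T ×ˢ univ) = (𝔪 h).restrict (Ioo 0 T ×ˢ univ) := by
      rw [spacetimeVol, ← Measure.prod_restrict, ← Measure.prod_restrict, Measure.restrict_restrict measurableSet_Iio,
        Measure.restrict_restrict measurableSet_Ioo]
      congr 2; ext t; simp; tauto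
    rwa [e]
  refine h1.congr (.of_forall fun p => ?_)
  by_cases hp : p.1 < T
  · simp [indicator, hp]
  · simp [indicator, hp, hf p (not_lt.1 hp)]

lemma integral_spacetime {f : ℝ × Space → ℝ} (hf : ∀ p : ℝ × Space, T ≤ p.1 → f p = 0) : ∫ p, f p ∂𝔪 h = ∫ p, f p ∂𝔫 h T := by
  have := isLocallyFinite_riemVol hh; rw [← spacetimeVol_restrict hh]
  conv_lhs => rw [← Measure.restrict_univ (μ := 𝔪 h)]
  refine setIntegral_eq_of_subset_of_ae_sdiff_eq_zero MeasurableSet.univ.nullMeasurableSet (subset_univ _) ?_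
  have h0 : ∀ᵐ p ∂𝔪 h, p.1 ∈ Ioi (0 : ℝ) := Measure.quasiMeasurePreserving_fst.ae (ae_restrict_mem measurableSet_Ioi)
  filter_upwards [h0] with p hp hp2; exact hf p (not_lt.1 fun h1 => hp2.2 ⟨⟨hp, h1⟩, mem_univ _⟩)

lemma memLp_comp_snd (T : ℝ) (g : Lp F 2 𝔯 h) : MemLp (fun p : ℝ × Space => g p.2) 2 𝔫 h T := by
  have := isLocallyFinite_riemVol hh; exact (Lp.memLp g).comp_snd _

lemma memLp_smul_comp_snd (hθ : Continuous θ) (hc : HasCompactSupport θ) (T : ℝ) (g : Lp F 2 𝔯 h) :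
    MemLp (fun p : ℝ × Space => θ p.1 • g p.2) 2 𝔫 h T := by
  obtain ⟨C, hC⟩ := hc.exists_bound_of_continuous hθ
  exact memLp_smul_fun (memLp_of_continuous_bound (hθ.comp continuous_fst) fun p => hC p.1) (memLp_comp_snd hh T g)

include hu in
lemma integrable_timeAvg (hθ : Continuous θ) (hc : HasCompactSupport θ) (g : Lp F 2 𝔯 h) :
    Integrable (fun p : ℝ × Space => θ p.1 * ⟪g p.2, u p.1 p.2⟫) 𝔪 h := by
  obtain ⟨R, -, hR⟩ := exists_notMem_tsupport hc; refine integrable_spacetime hh (T := |R| + 1) (fun p hp => ?_) ?_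
  · have : p.1 ∉ tsupport θ := hR _ (by linarith [le_abs_self p.1, le_abs_self R]); rw [off_tsupport this, zero_mul]
  · refine (integrable_inner (memLp_smul_comp_snd hh hθ hc _ g) (hu _ (by positivity))).congr
      (.of_forall fun p => real_inner_smul_left _ _ _)

/-- `𝒰 θ` is the average of `u` in time with weight `θ`. -/
structure IsTimeAvg (h : MatField) (u : ℝ → Space → F) (𝒰 : (ℝ → ℝ) → Lp F 2 𝔯 h) : Prop where
  inner_eq : ∀ θ, Continuous θ → HasCompactSupport θ → ∀ g : Lp F 2 𝔯 h, ⟪g, 𝒰 θ⟫ = ∫ p, θ p.1 * ⟪g p.2, u p.1 p.2⟫ ∂𝔪 h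
  bound : ∀ T, 0 < T → ∃ C, ∀ θ M, Continuous θ → HasCompactSupport θ → (∀ s, |θ s| ≤ M) → (∀ s, T ≤ s → θ s = 0) → ‖𝒰 θ‖ ≤ C * M

lemma IsTimeAvg.inner_lp {𝒰 : (ℝ → ℝ) → Lp F 2 𝔯 h} (h𝒰 : IsTimeAvg h u 𝒰) (hθ : Continuous θ)
    (hc : HasCompactSupport θ) {g : Space → F} (hg : MemLp g 2 𝔯 h) :
    ⟪lp 𝔯 h g, 𝒰 θ⟫ = ∫ p, θ p.1 * ⟪g p.2, u p.1 p.2⟫ ∂𝔪 h := by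
  have := isLocallyFinite_riemVol hh; rw [h𝒰.inner_eq θ hθ hc]; refine integral_congr_ae ?_
  filter_upwards [Measure.quasiMeasurePreserving_snd.ae (coeFn_lp hg)] with p hp; rw [hp]

include hu in
lemma exists_isTimeAvg : ∃ 𝒰, IsTimeAvg h u 𝒰 := by
  have := isLocallyFinite_riemVol hh
  have key : ∀ T : ℝ, 0 < T → ∀ θ M, Continuous θ → HasCompactSupport θ → (∀ s, |θ s| ≤ M) → (∀ s, T ≤ s → θ s = 0) →
      ∀ g : Lp F 2 𝔯 h, |∫ p, θ p.1 * ⟪g p.2, u p.1 p.2⟫ ∂𝔪 h| ≤ (√T * ‖lp 𝔫 h T (uncurry u)‖) * M * ‖g‖ := by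
    intro T hT θ M hθ hc hM hs g; have hM0 : 0 ≤ M := (abs_nonneg _).trans (hM 0)
    have e1 : ∫ p, θ p.1 * ⟪g p.2, u p.1 p.2⟫ ∂𝔪 h = ∫ p, ⟪θ p.1 • g p.2, u p.1 p.2⟫ ∂𝔫 h T := by
      rw [integral_spacetime hh fun p hp => by rw [hs _ hp, zero_mul]]; simp only [real_inner_smul_left]
    have m1 := memLp_smul_comp_snd hh hθ hc T g
    have e2 : ‖lp 𝔫 h T fun p => g p.2‖ = √T * ‖g‖ := by
      refine (pow_left_inj₀ (norm_nonneg _) (by positivity) two_ne_zero).1 ?_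
      rw [norm_lp_sq (memLp_comp_snd hh T g), spacetimeVol, integral_fun_snd fun x => ‖g x‖ ^ 2, mul_pow, Real.sq_sqrt hT.le,
        ← norm_lp_sq (Lp.memLp g), lp_coeFn]
      simp [hT.le]
    have e3 : ‖lp 𝔫 h T fun p => θ p.1 • g p.2‖ ≤ M * (√T * ‖g‖) := by
      rw [← e2]; refine Lp.norm_le_mul_norm_of_ae_le_mul ?_
      filter_upwards [coeFn_lp m1, coeFn_lp (memLp_comp_snd hh T g)] with p h1 h2; rw [h1, h2, norm_smul]
      exact mul_le_mul_of_nonneg_right (hM _) (norm_nonneg _)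
    rw [e1]; refine (abs_integral_inner_le m1 (hu T hT)).trans ((mul_le_mul_of_nonneg_right e3 (norm_nonneg _)).trans (le_of_eq ?_)); ring
  have ex : ∀ θ, ∃ v : Lp F 2 𝔯 h, Continuous θ → HasCompactSupport θ → ∀ g : Lp F 2 𝔯 h,
      ⟪g, v⟫ = ∫ p, θ p.1 * ⟪g p.2, u p.1 p.2⟫ ∂𝔪 h := by
    intro θ
    by_cases hθ : Continuous θ ∧ HasCompactSupport θ
    swap
    · exact ⟨0, fun h1 h2 => absurd ⟨h1, h2⟩ hθ⟩
    obtain ⟨M, hM⟩ := hθ.2.exists_bound_of_continuous hθ.1; obtain ⟨R, hR0, hR⟩ := exists_notMem_tsupport hθ.2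
    have hs : ∀ s, R ≤ s → θ s = 0 := fun s h1 => off_tsupport (hR s (h1.trans (le_abs_self s)))
    let ℓ : Lp F 2 𝔯 h →ₗ[ℝ] ℝ :=
      { toFun := fun g => ∫ p, θ p.1 * ⟪g p.2, u p.1 p.2⟫ ∂𝔪 h
        map_add' := fun g g' => by
          rw [← integral_add (integrable_timeAvg hh hu hθ.1 hθ.2 g) (integrable_timeAvg hh hu hθ.1 hθ.2 g')]
          refine integral_congr_ae ?_; filter_upwards [Measure.quasiMeasurePreserving_snd.ae (Lp.coeFn_add g g')] with p hp
          rw [hp, Pi.add_apply, inner_add_left, mul_add]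
        map_smul' := fun a g => by
          rw [RingHom.id_apply, smul_eq_mul, ← integral_const_mul]; refine integral_congr_ae ?_
          filter_upwards [Measure.quasiMeasurePreserving_snd.ae (Lp.coeFn_smul a g)] with p hp
          rw [hp, Pi.smul_apply, real_inner_smul_left]; ring }
    refine ⟨(InnerProductSpace.toDual ℝ _).symm (ℓ.mkContinuous _ fun g => key R hR0 θ M hθ.1 hθ.2 hM hs g), fun _ _ g => ?_⟩
    rw [real_inner_comm, InnerProductSpace.toDual_symm_apply]; rfl
  choose 𝒰 h𝒰 using ex; refine ⟨𝒰, h𝒰, fun T hT => ⟨√T * ‖lp 𝔫 h T (uncurry u)‖, fun θ M hθ hc hM hs => ?_⟩⟩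
  have h1 := (le_abs_self _).trans (key T hT θ M hθ hc hM hs (𝒰 θ)); rw [← h𝒰 θ hθ hc, real_inner_self_eq_norm_sq, sq] at h1
  rcases (norm_nonneg (𝒰 θ)).eq_or_lt with h0 | h0
  · rw [← h0]; exact mul_nonneg (by positivity) ((abs_nonneg _).trans (hM 0))
  · exact le_of_mul_le_mul_right h1 h0

omit hh in
lemma IsTest.deriv (hθ : IsTest θ) : IsTest (deriv θ) := ⟨(contDiff_infty_iff_deriv.1 hθ.smooth).2, hθ.compact.deriv⟩

omit hh in
lemma IsTest.shift (hθ : IsTest θ) (t : ℝ) : IsTest fun s => θ (s - t) :=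
  ⟨hθ.smooth.comp (contDiff_id.sub contDiff_const), hθ.compact.comp_homeomorph (Homeomorph.subRight t)⟩

include hu

lemma IsTimeAvg.linear {𝒰 : (ℝ → ℝ) → Lp F 2 𝔯 h} (h𝒰 : IsTimeAvg h u 𝒰) {θ₁ θ₂ θ₃ : ℝ → ℝ} (h1 : IsTest θ₁) (h2 : IsTest θ₂)
    (h3 : IsTest θ₃) (a : ℝ) (ht : IsTest fun s => θ₁ s - θ₂ s - a * θ₃ s) :
    𝒰 (fun s => θ₁ s - θ₂ s - a * θ₃ s) = 𝒰 θ₁ - 𝒰 θ₂ - a • 𝒰 θ₃ := by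
  refine ext_inner_left ℝ fun g => ?_; have i := fun {θ : ℝ → ℝ} (hθ : IsTest θ) => integrable_timeAvg hh hu hθ.cont hθ.compact g
  have e := fun {θ : ℝ → ℝ} (hθ : IsTest θ) => h𝒰.inner_eq θ hθ.cont hθ.compact g
  have i12 : Integrable (fun p : ℝ × Space => θ₁ p.1 * ⟪g p.2, u p.1 p.2⟫ - θ₂ p.1 * ⟪g p.2, u p.1 p.2⟫)
    𝔪 h := (i h1).sub (i h2)
  rw [inner_sub_right, inner_sub_right, real_inner_smul_right, e ht, e h1, e h2, e h3, ← integral_sub (i h1) (i h2),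
    ← integral_const_mul, ← integral_sub i12 ((i h3).const_mul a)]
  refine integral_congr_ae (.of_forall fun p => ?_); beta_reduce; ring

lemma IsTimeAvg.hasDerivAt {𝒰 : (ℝ → ℝ) → Lp F 2 𝔯 h} (h𝒰 : IsTimeAvg h u 𝒰) (hθ : IsTest θ) (t : ℝ) :
    HasDerivAt (fun t => 𝒰 fun s => θ (s - t)) (-𝒰 fun s => deriv θ (s - t)) t := by
  obtain ⟨R, hR0, hR⟩ := exists_notMem_tsupport hθ.compact
  obtain ⟨M, hM⟩ := hθ.deriv.deriv.compact.exists_bound_of_continuous hθ.deriv.deriv.cont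
  obtain ⟨C, hC⟩ := h𝒰.bound (|t| + R + 2) (by positivity); refine hasDerivAt_of_sq_le (C := C * M) one_pos fun τ hτ => ?_
  have hT : IsTest fun s => θ (s - (t + τ)) - θ (s - t) - (-τ) * deriv θ (s - t) :=
    ⟨((hθ.shift _).smooth.sub (hθ.shift _).smooth).sub (contDiff_const.mul (hθ.deriv.shift t).smooth),
      ((hθ.shift _).compact.sub (hθ.shift _).compact).sub (hθ.deriv.shift t).compact.mul_left⟩
  rw [smul_neg, ← neg_smul, ← h𝒰.linear hh hu (hθ.shift _) (hθ.shift _) (hθ.deriv.shift t) (-τ) hT, mul_assoc]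
  refine hC _ _ hT.cont hT.compact (fun s => ?_) fun s hs => ?_
  · have hd : ∀ r, HasDerivAt (fun r => θ (s - t - r) + r * deriv θ (s - t)) (-deriv θ (s - t - r) + deriv θ (s - t)) r := fun r => by
      have h1 : HasDerivAt (fun r => θ (s - t - r)) _ r := (hθ.diff (s - t - r)).hasDerivAt.scomp r ((hasDerivAt_id r).const_sub (s - t))
      refine (h1.fun_add ((hasDerivAt_id r).mul_const (deriv θ (s - t)))).congr_deriv ?_; simp
    have hl : ∀ r ∈ Metric.closedBall (0 : ℝ) |τ|, ‖-deriv θ (s - t - r) + deriv θ (s - t)‖ ≤ M * |τ| := fun r hr => by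
      have h1 := convex_univ.norm_image_sub_le_of_norm_deriv_le (f := deriv θ) (C := M)
        (fun x _ => hθ.deriv.diff x) (fun x _ => hM x) (mem_univ (s - t - r)) (mem_univ (s - t))
      rw [sub_sub_cancel] at h1; rw [neg_add_eq_sub]
      exact h1.trans (mul_le_mul_of_nonneg_left (by simpa using hr) ((norm_nonneg _).trans (hM 0)))
    have h3 := (convex_closedBall (0 : ℝ) |τ|).norm_image_sub_le_of_norm_hasDerivWithin_le
      (fun r _ => (hd r).hasDerivWithinAt) hl (by simp : (0 : ℝ) ∈ Metric.closedBall (0 : ℝ) |τ|) (by simp : τ ∈ Metric.closedBall (0 : ℝ) |τ|)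
    rw [sub_zero, sub_zero, Real.norm_eq_abs, Real.norm_eq_abs, mul_assoc, ← sq, sq_abs] at h3
    refine le_trans (le_of_eq (congrArg _ ?_)) h3; rw [sub_add_eq_sub_sub]; ring_nf
  · have h1 := (abs_lt.1 hτ).2; have a1 : R ≤ |s - (t + τ)| := by linarith [le_abs_self (s - (t + τ)), le_abs_self t]
    have a2 : R ≤ |s - t| := by linarith [le_abs_self (s - t), le_abs_self t]
    rw [off_tsupport (hR _ a1), off_tsupport (hR _ a2), off_tsupport fun h2 => hR _ a2 (tsupport_deriv_subset h2)]; ring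

end timeAvg

namespace CliffordRep

/-! ### The smoothing estimate for regular solutions -/

variable [FiniteDimensional ℝ F] [Nontrivial F]

include hh he in
lemma IsWeakPair.JL {u k : Lp F 2 𝔯 h} (h1 : c.IsWeakPair h e m u k) : c.IsWeakPair h e m (c.JL _ u) (c.JL _ k) := fun ψ hψ => by
  have e1 : ∀ f g : Lp F 2 𝔯 h, ⟪f, c.JL _ g⟫ = -⟪c.JL _ f, g⟫ := fun f g => by rw [c.inner_JL, neg_neg]
  have e2 : c.JL _ (lp 𝔯 h (c.H h e m ψ)) = lp 𝔯 h (c.H h e m fun x => c.J (ψ x)) := by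
    rw [c.JL_lp ((hψ.H hh he c m).memLp hh), funext fun x => (c.H_J m (hψ.diff x)).symm]
  rw [e1, e1, e2, c.JL_lp (hψ.memLp hh), h1 _ (hψ.clm c.J)]

/-- A solution of `U' = v`, `HU = Jv`, `Hv = Jv'` in positive time. -/
structure IsRegular (h e : MatField) (m M : ℝ) (U v v' : ℝ → Lp F 2 𝔯 h) : Prop where
  continuous : Continuous U
  hasDerivAt : ∀ t, HasDerivAt v (v' t) t
  continuous' : Continuous v'
  pair : ∀ t, 0 ≤ t → c.IsWeakPair h e m (U t) (c.JL _ (v t))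
  pair' : ∀ t, 0 ≤ t → c.IsWeakPair h e m (v t) (c.JL _ (v' t))
  bound : ∀ t, ‖v t‖ ^ 2 ≤ M

include hh he hf in
lemma IsRegular.smoothing (hκ : κ ≤ 1 / 10 ^ 10) {m M : ℝ} {U v v' : ℝ → Lp F 2 𝔯 h}
    (hr : c.IsRegular h e m M U v v') : ∃ d : ℝ → Fin 3 → Lp F 2 𝔯 h,
      (∀ t, 0 ≤ t → c.InGraph h e m (U t) (c.JL _ (v t)) (d t)) ∧ (∀ η, ContinuousOn (fun t => smoothingSq h η (U t) (d t)) (Ioi 0)) ∧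
      ∀ η : ℝ, 0 < η → ∀ a b, 0 < a → a ≤ b → ∫ t in a..b, smoothingSq h η (U t) (d t) ≤ 50 * (1 - (2 : ℝ) ^ (-2 * η))⁻¹ * (33 * M) := by
  have hκ' : κ ≤ 1 / 10 ^ 6 := hκ.trans (by norm_num); have hκ0 : 0 ≤ κ := hf.nonneg 0; have hM : 0 ≤ M := (sq_nonneg _).trans (hr.bound 0)
  have ex : ∀ t, ∃ d, 0 ≤ t → c.InGraph h e m (U t) (c.JL _ (v t)) d := fun t => by
    by_cases ht : 0 ≤ t
    · exact ((hr.pair t ht).exists_inGraph hh he c hf hκ').imp fun d hd _ => hd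
    · exact ⟨0, fun h0 => absurd h0 ht⟩
  choose d hd using ex; have hvc : Continuous v := continuous_iff_continuousAt.2 fun t => (hr.hasDerivAt t).continuousAt
  have hJ : Continuous fun t => c.JL 𝔯 h (v t) := (c.JL _).continuous.comp hvc
  have hdc : ∀ j, ContinuousOn (fun t => d t j) (Ioi 0) := fun j => by
    refine continuousOn_of_forall_continuousAt fun t ht => ?_
    refine tendsto_iff_norm_sub_tendsto_zero.2 (squeeze_zero' (.of_forall fun _ => norm_nonneg _) ?_
      (g := fun s => 2 * ‖c.JL _ (v s) - c.JL _ (v t)‖) ?_)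
    · filter_upwards [Ioi_mem_nhds ht] with s hs
      have h1 := ((hd s (le_of_lt hs)).sub hh he c (hd t (le_of_lt ht))).sum_norm_sq_le hh he hf hκ'
      have h2 := (single_le_sum (f := fun j => ‖d s j - d t j‖ ^ 2) (fun j _ => sq_nonneg _) (Finset.mem_univ j)).trans h1
      exact abs_le_of_sq_le_sq' (by linarith) (by positivity) |>.2
    · simpa using ((tendsto_iff_norm_sub_tendsto_zero.1 (hJ.tendsto t)).const_mul 2)
  have hEc : ∀ s : ℝ, ContinuousOn (fun t => radialL h s (U t) (d t)) (Ioi 0) := fun s =>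
    (continuousOn_finsetSum _ fun i _ => (mulL 𝔯 h _).continuous.comp_continuousOn (hdc i)).add
      ((mulL 𝔯 h _).continuous.comp hr.continuous).continuousOn
  have hSc : ∀ η : ℝ, ContinuousOn (fun t => smoothingSq h η (U t) (d t)) (Ioi 0) := fun η =>
    (continuousOn_finsetSum _ fun i _ => ((mulL 𝔯 h _).continuous.comp_continuousOn (hdc i)).norm.pow 2).add
      (((mulL 𝔯 h _).continuous.comp hr.continuous).norm.pow 2).continuousOn
  have hS0 : ∀ η t, 0 ≤ smoothingSq h η (U t) (d t) := fun η t => add_nonneg (sum_nonneg fun i _ => sq_nonneg _) (sq_nonneg _)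
  have hs : ∀ i : ℕ, (1 : ℝ) ≤ 2 ^ i := fun i => one_le_pow₀ (by norm_num)
  have hY : ∀ (i : ℕ) t, 0 < t → HasDerivAt (fun t => ⟪v t, radialL h (2 ^ i) (U t) (d t)⟫)
      ⟪v' t, radialL h (2 ^ i) (U t) (d t)⟫ t := fun i t ht => by
    obtain ⟨d', hd'⟩ := (hr.pair' t ht.le).exists_inGraph hh he c hf hκ'
    have h1 : HasDerivAt (fun t => radialL h (2 ^ i) (U t) (d t)) (radialL h (2 ^ i) (v t) d') t := by
      refine .of_isLittleO (Asymptotics.IsBigO.trans_isLittleO (Asymptotics.IsBigO.of_bound 13 ?_) (hr.hasDerivAt t).isLittleO)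
      filter_upwards [Ioi_mem_nhds ht] with s hs'
      have h3 := (((hd s (le_of_lt hs')).sub hh he c (hd t ht.le)).sub hh he c (hd'.const_smul hh he c (s - t))).norm_radialL_sq_le
        hh he (hs i) hf hκ'
      rw [← map_smul, ← map_sub, ← map_sub, c.norm_JL] at h3
      have e1 : radialL h (2 ^ i) (U s) (d s) - radialL h (2 ^ i) (U t) (d t) - (s - t) • radialL h (2 ^ i) (v t) d'
          = radialL h (2 ^ i) (U s - U t - (s - t) • v t) fun j => d s j - d t j - (s - t) • d' j := by
        simp only [radialL, map_sub, map_smul, sum_sub_distrib, smul_add, smul_sum]; abel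
      rw [e1]; exact abs_le_of_sq_le_sq' (by nlinarith [sq_nonneg ‖v s - v t - (s - t) • v' t‖]) (by positivity) |>.2
    have h2 := (hr.hasDerivAt t).inner ℝ h1
    rwa [hd'.inner_radialL_self hh he (hs i) hf, zero_add] at h2
  have hYb : ∀ (i : ℕ) t, 0 ≤ t → |⟪v t, radialL h (2 ^ i) (U t) (d t)⟫| ≤ 13 * M := fun i t ht => by
    have h1 := (hd t ht).norm_radialL_sq_le hh he (hs i) hf hκ'; rw [c.norm_JL] at h1
    have h2 : ‖radialL h (2 ^ i) (U t) (d t)‖ ≤ 13 * ‖v t‖ := abs_le_of_sq_le_sq' (by nlinarith [sq_nonneg ‖v t‖]) (by positivity) |>.2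
    refine (abs_real_inner_le_norm _ _).trans ((mul_le_mul_of_nonneg_left h2 (norm_nonneg _)).trans ?_); nlinarith [hr.bound t]
  have hint : ∀ {f : ℝ → ℝ}, ContinuousOn f (Ioi 0) → ∀ {a b}, 0 < a → a ≤ b → IntervalIntegrable f volume a b :=
    fun {f} hfc {a b} ha hab => (hfc.mono fun t ht => by rw [uIcc_of_le hab] at ht; exact ha.trans_le ht.1).intervalIntegrable
  have key : ∀ η : ℝ, 0 < η → ∀ a b, 0 < a → a ≤ b → ∫ t in a..b, smoothingSq h η (U t) (d t)
      ≤ 50 * (1 - (2 : ℝ) ^ (-2 * η))⁻¹ * (26 * M + 2 * 10 ^ 7 * κ * ∫ t in a..b, smoothingSq h (1 / 2) (U t) (d t)) := by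
    intro η hη a b ha hab; set q := (2 : ℝ) ^ (-2 * η) with hq; have hq0 : 0 ≤ q := by positivity
    have hq1 : q < 1 := Real.rpow_lt_one_of_one_lt_of_neg (by norm_num) (by linarith)
    set I := ∫ t in a..b, smoothingSq h (1 / 2) (U t) (d t) with hI
    have hI0 : 0 ≤ I := intervalIntegral.integral_nonneg hab fun t _ => hS0 _ t
    set R : ℝ → ℝ := fun t => 2 * (∑ j, ‖d t j‖ ^ 2 + ‖U t‖ ^ 2) with hR
    have hRc : ContinuousOn R (Ioi 0) := continuousOn_const.mul
      ((continuousOn_finsetSum _ fun j _ => (hdc j).norm.pow 2).add (hr.continuous.norm.pow 2).continuousOn)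
    have hGc : ∀ i : ℕ, ContinuousOn (fun t => ⟪v' t, radialL h (2 ^ i) (U t) (d t)⟫) (Ioi 0) := fun i =>
      hr.continuous'.continuousOn.inner (hEc _)
    have hTc : ∀ i : ℕ, ContinuousOn (fun t => q ^ i * (-⟪v' t, radialL h (2 ^ i) (U t) (d t)⟫
        + 2 * 10 ^ 7 * κ * smoothingSq h (1 / 2) (U t) (d t))) (Ioi 0) := fun i =>
      continuousOn_const.mul ((hGc i).neg.add (continuousOn_const.mul (hSc _)))
    have hK : ∀ K : ℕ, ∫ t in a..b, smoothingSq h η (U t) (d t)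
        ≤ 50 * (1 - q)⁻¹ * (26 * M + 2 * 10 ^ 7 * κ * I) + (1 / 2) ^ K * ∫ t in a..b, R t := fun K => by
      have hsum : ContinuousOn (fun t => 50 * ∑ i ∈ Finset.range K, q ^ i * (-⟪v' t, radialL h (2 ^ i) (U t) (d t)⟫
        + 2 * 10 ^ 7 * κ * smoothingSq h (1 / 2) (U t) (d t))) (Ioi 0) :=
        continuousOn_const.mul (continuousOn_finsetSum _ fun i _ => hTc i)
      have hRK : ContinuousOn (fun t => (1 / 2 : ℝ) ^ K * R t) (Ioi 0) := continuousOn_const.mul hRc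
      have h1 := intervalIntegral.integral_mono_on hab (hint (hSc η) ha hab) (hint (hsum.add hRK) ha hab) fun t ht => by
        change smoothingSq h η (U t) (d t) ≤ 50 * ∑ i ∈ Finset.range K, q ^ i * (-⟪v' t, radialL h (2 ^ i) (U t) (d t)⟫
          + 2 * 10 ^ 7 * κ * smoothingSq h (1 / 2) (U t) (d t)) + (1 / 2) ^ K * R t
        have ht0 : 0 ≤ t := ha.le.trans ht.1; obtain ⟨d', hd'⟩ := (hr.pair' t ht0).exists_inGraph hh he c hf hκ'
        have h2 := InGraph.smoothingSq_le hh he hf hη K (hd t ht0) hd'; simpa only [c.JL_JL, inner_neg_left] using h2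
      refine h1.trans ?_; simp only [Pi.add_apply]
      rw [intervalIntegral.integral_add (hint hsum ha hab) (hint hRK ha hab), intervalIntegral.integral_const_mul,
        intervalIntegral.integral_const_mul, intervalIntegral.integral_finsetSum fun i _ => hint (hTc i) ha hab]
      refine add_le_add_left ?_ _; rw [mul_assoc 50 (1 - q)⁻¹]; refine mul_le_mul_of_nonneg_left ?_ (by norm_num : (0 : ℝ) ≤ 50)
      have hB : 0 ≤ 26 * M + 2 * 10 ^ 7 * κ * I := by positivity
      refine (sum_le_sum (g := fun i => q ^ i * (26 * M + 2 * 10 ^ 7 * κ * I)) fun i _ => ?_).trans ?_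
      · have c1 : ContinuousOn (fun t => -⟪v' t, radialL h (2 ^ i) (U t) (d t)⟫) (Ioi 0) := (hGc i).neg
        have c2 : ContinuousOn (fun t => 2 * 10 ^ 7 * κ * smoothingSq h (1 / 2) (U t) (d t)) (Ioi 0) := continuousOn_const.mul (hSc _)
        rw [intervalIntegral.integral_const_mul, intervalIntegral.integral_add (hint c1 ha hab) (hint c2 ha hab), intervalIntegral.integral_neg, intervalIntegral.integral_const_mul,
          intervalIntegral.integral_eq_sub_of_hasDerivAt (fun t ht => hY i t ?_) (hint (hGc i) ha hab)]
        · have b1 := abs_le.1 (hYb i a ha.le); have b2 := abs_le.1 (hYb i b (ha.le.trans hab))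
          exact mul_le_mul_of_nonneg_left (by linarith) (pow_nonneg hq0 i)
        · rw [uIcc_of_le hab] at ht; exact ha.trans_le ht.1
      · rw [← sum_mul, ← tsum_geometric_of_lt_one hq0 hq1]
        exact mul_le_mul_of_nonneg_right ((summable_geometric_of_lt_one hq0 hq1).sum_le_tsum _ fun i _ => pow_nonneg hq0 i) hB
    refine ge_of_tendsto' (x := atTop) (f := fun K : ℕ => 50 * (1 - q)⁻¹ * (26 * M + 2 * 10 ^ 7 * κ * I)
      + (1 / 2) ^ K * ∫ t in a..b, R t) ?_ hK
    simpa using ((tendsto_pow_atTop_nhds_zero_of_lt_one (by norm_num : (0 : ℝ) ≤ 1 / 2) (by norm_num)).mul_const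
      (∫ t in a..b, R t)).const_add (50 * (1 - q)⁻¹ * (26 * M + 2 * 10 ^ 7 * κ * I))
  refine ⟨d, hd, hSc, fun η hη a b ha hab => (key η hη a b ha hab).trans ?_⟩; have h1 := key (1 / 2) (by norm_num) a b ha hab
  have h2 : (2 : ℝ) ^ (-2 * (1 / 2) : ℝ) = 1 / 2 := by rw [show (-2 * (1 / 2) : ℝ) = -1 by norm_num, Real.rpow_neg_one]; norm_num
  rw [h2] at h1; set I := ∫ t in a..b, smoothingSq h (1 / 2) (U t) (d t)
  have hI0 : 0 ≤ I := intervalIntegral.integral_nonneg hab fun t _ => hS0 _ t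
  have h3 : κ * I ≤ 1 / 10 ^ 10 * I := mul_le_mul_of_nonneg_right hκ hI0
  have hq1 : (2 : ℝ) ^ (-2 * η) < 1 := Real.rpow_lt_one_of_one_lt_of_neg (by norm_num) (by linarith)
  refine mul_le_mul_of_nonneg_left ?_ (mul_nonneg (by norm_num) (inv_nonneg.2 (by linarith))); norm_num at h1; linarith

end CliffordRep

/-! ### Weak solutions -/

lemma exists_time_mollifier (n : ℕ) : ∃ ρ : ℝ → ℝ, IsTest ρ ∧ (∀ s, 0 ≤ ρ s) ∧ ∫ s, ρ s = 1 ∧ (∀ s, s ≤ 0 → ρ s = 0) ∧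
    ∀ s, 1 / ((n : ℝ) + 1) ≤ s → ρ s = 0 := by
  have hr : 0 < 1 / (2 * ((n : ℝ) + 1)) := by positivity
  let β : ContDiffBump (1 / (2 * ((n : ℝ) + 1))) := ⟨1 / (2 * ((n : ℝ) + 1)) / 2, 1 / (2 * ((n : ℝ) + 1)), by positivity, half_lt_self hr⟩
  have hz : ∀ s, s ∉ Metric.ball (1 / (2 * ((n : ℝ) + 1))) (1 / (2 * ((n : ℝ) + 1))) → β.normed volume s = 0 := fun s hs => by
    rw [← Function.notMem_support, β.support_normed_eq]; exact hs
  refine ⟨β.normed volume, ⟨β.contDiff_normed, β.hasCompactSupport_normed⟩, β.nonneg_normed, β.integral_normed,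
    fun s hs => hz s fun h1 => ?_, fun s hs => hz s fun h1 => ?_⟩
  · rw [Metric.mem_ball, Real.dist_eq, abs_lt] at h1; linarith
  · rw [Metric.mem_ball, Real.dist_eq, abs_lt] at h1
    have : 1 / ((n : ℝ) + 1) = 1 / (2 * ((n : ℝ) + 1)) + 1 / (2 * ((n : ℝ) + 1)) := by field_simp; norm_num
    linarith

namespace CliffordRep

variable [FiniteDimensional ℝ F] [Nontrivial F]

include hh he hf in
lemma IsTimeAvg.isRegular {u : ℝ → Space → F} (hu : IsLocL2 h u)
    {𝒰 : (ℝ → ℝ) → Lp F 2 𝔯 h} (h𝒰 : IsTimeAvg h u 𝒰) {u₀ f : Lp F 2 𝔯 h} (h0 : c.IsWeakPair h e m u₀ f)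
    (hw : ∀ θ, IsTest θ → c.IsWeakPair h e m (𝒰 θ) (-c.JL _ (𝒰 (deriv θ) + θ 0 • u₀)))
    {ρ : ℝ → ℝ} (hρ : IsTest ρ) (hρ0 : ∀ s, 0 ≤ ρ s) (hρ1 : ∫ s, ρ s = 1) (hρs : ∀ s, s ≤ 0 → ρ s = 0) :
    c.IsRegular h e m (4 * ‖f‖ ^ 2) (fun t => 𝒰 fun s => ρ (s - t))
      (fun t => -((𝒰 fun s => deriv ρ (s - t)) + ρ (-t) • u₀)) (fun t => (𝒰 fun s => deriv (deriv ρ) (s - t)) + deriv ρ (-t) • u₀) := by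
  have hw' : ∀ {θ}, IsTest θ → ∀ t, c.IsWeakPair h e m (𝒰 fun s => θ (s - t))
      (-c.JL _ ((𝒰 fun s => deriv θ (s - t)) + θ (-t) • u₀)) := fun {θ} hθ t => by
    have h1 := hw _ (hθ.shift t)
    rwa [funext fun s => deriv_comp_sub_const θ t s, zero_sub] at h1
  have hneg : ∀ {θ : ℝ → ℝ}, IsTest θ → ∀ t, HasDerivAt (fun t => θ (-t)) (-deriv θ (-t)) t := fun {θ} hθ t => by
    have h1 : HasDerivAt (fun t => θ (-t)) _ t := (hθ.diff (-t)).hasDerivAt.scomp t (hasDerivAt_neg t); simpa using h1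
  have hU := fun {θ} (hθ : IsTest θ) t => h𝒰.hasDerivAt hh hu hθ t
  have hv : ∀ t, HasDerivAt (fun t => -((𝒰 fun s => deriv ρ (s - t)) + ρ (-t) • u₀))
      ((𝒰 fun s => deriv (deriv ρ) (s - t)) + deriv ρ (-t) • u₀) t := fun t =>
    ((hU hρ.deriv t).add ((hneg hρ t).smul_const u₀)).neg.congr_deriv (by rw [neg_smul]; abel)
  have hv' : Continuous fun t => (𝒰 fun s => deriv (deriv ρ) (s - t)) + deriv ρ (-t) • u₀ :=
    continuous_iff_continuousAt.2 fun t => ((hU hρ.deriv.deriv t).add ((hneg hρ.deriv t).smul_const u₀)).continuousAt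
  have hp : ∀ t, c.IsWeakPair h e m (-((𝒰 fun s => deriv ρ (s - t)) + ρ (-t) • u₀))
      (c.JL _ ((𝒰 fun s => deriv (deriv ρ) (s - t)) + deriv ρ (-t) • u₀) - ρ (-t) • f) := fun t ψ hψ => by
    have h1 := hw' hρ.deriv t ψ hψ; rw [inner_neg_right] at h1
    rw [inner_neg_right, inner_add_right, inner_sub_right, real_inner_smul_right, real_inner_smul_right, h0 ψ hψ, h1]; ring
  set v : ℝ → Lp F 2 𝔯 h := fun t => -((𝒰 fun s => deriv ρ (s - t)) + ρ (-t) • u₀) with hvd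
  set v' : ℝ → Lp F 2 𝔯 h := fun t => (𝒰 fun s => deriv (deriv ρ) (s - t)) + deriv ρ (-t) • u₀ with hv'd
  have hz : ∀ t, ⟪v t, v' t⟫ = -(ρ (-t) * ⟪v t, c.JL _ f⟫) := fun t => by
    set k := c.JL _ (v' t) - ρ (-t) • f with hk; have h1 := (hp t).inner_eq hh he c hf ((hp t).JL hh he c)
    have h2 := c.inner_JL k (v t); have h3 : c.JL _ k = -(v' t) - ρ (-t) • c.JL _ f := by rw [hk, map_sub, map_smul, c.JL_JL]
    have h4 : ⟪c.JL _ k, v t⟫ = ⟪v t, c.JL _ k⟫ := real_inner_comm _ _; have h5 : ⟪v t, c.JL _ k⟫ = 0 := by linarith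
    rw [h3, inner_sub_right, inner_neg_right, real_inner_smul_right] at h5; linarith
  refine ⟨continuous_iff_continuousAt.2 fun t => (hU hρ t).continuousAt, hv, hv', fun t _ => ?_, fun t ht => ?_, fun t => ?_⟩
  · rw [hvd, map_neg]; exact hw' hρ t
  · have e : c.JL _ (v' t) - ρ (-t) • f = c.JL _ (v' t) := by rw [hρs (-t) (by linarith), zero_smul, sub_zero]
    exact e ▸ hp t
  · obtain ⟨R, hR0, hR⟩ := exists_notMem_tsupport hρ.compact; set a := -(R + |t|) with ha; have hθ := hρ.deriv.shift a
    have hva : v a = 0 := by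
      have e1 : (𝒰 fun s => deriv ρ (s - a)) = 0 := by
        rw [← inner_self_eq_zero (𝕜 := ℝ), h𝒰.inner_eq _ hθ.cont hθ.compact, integral_spacetime hh (T := 0)]
        · simp [spacetimeVol]
        · intro p hp; rw [off_tsupport fun h2 => hR _ ?_ (tsupport_deriv_subset h2), zero_mul]; have : 0 ≤ |t| := abs_nonneg t
          rw [abs_of_nonneg] <;> linarith
      have e2 : ρ (-a) = 0 := off_tsupport (hR _ (by rw [ha, neg_neg, abs_of_nonneg (by positivity)]; linarith [abs_nonneg t]))
      rw [hvd]; simp only [e1, e2, zero_smul, add_zero, neg_zero]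
    have hat : a ≤ t := by linarith [neg_abs_le t]
    have hvc : Continuous v := continuous_iff_continuousAt.2 fun t => (hv t).continuousAt
    have hρc : Continuous fun t => ρ (-t) := hρ.cont.comp continuous_neg
    have h1 := energy_growth_le (E := fun t => ‖v t‖ ^ 2) (E' := fun t => 2 * ⟪v t, v' t⟫) (g := fun t => ρ (-t) * ‖f‖)
      (a := a) (b := t) (t := t) (t₀ := a) (fun s => (hv s).norm_sq) (continuous_const.mul (hvc.inner hv'))
      (hρc.mul continuous_const) (fun s => mul_nonneg (hρ0 _) (norm_nonneg _)) (fun s => sq_nonneg _) (fun s => by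
        rw [hz, abs_mul, abs_neg, abs_mul, abs_of_nonneg (hρ0 _), Real.sqrt_sq (norm_nonneg _), abs_two, mul_assoc (ρ _)]
        refine mul_le_mul_of_nonneg_left (mul_le_mul_of_nonneg_left ?_ (hρ0 _)) zero_le_two
        refine (abs_real_inner_le_norm _ _).trans (le_of_eq ?_); rw [c.norm_JL, mul_comm]) ⟨hat, le_rfl⟩ ⟨le_rfl, hat⟩
    refine h1.trans ?_
    have h2 : ∫ r in a..t, ρ (-r) ≤ 1 := by
      rw [intervalIntegral.integral_of_le hat, ← hρ1, ← integral_neg_eq_self ρ]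
      exact setIntegral_le_integral (hρ.cont.integrable_of_hasCompactSupport hρ.compact).comp_neg (.of_forall fun s => hρ0 _)
    have h3 : 0 ≤ ∫ r in a..t, ρ (-r) := intervalIntegral.integral_nonneg hat fun s _ => hρ0 _
    rw [hva, norm_zero, intervalIntegral.integral_mul_const, mul_pow]
    have h4 : (∫ r in a..t, ρ (-r)) ^ 2 ≤ 1 := pow_le_one₀ h3 h2; nlinarith [sq_nonneg ‖f‖]

end CliffordRep

lemma continuous_rpow_bracket (a : ℝ) : Continuous fun x => bracket x ^ a :=
  contDiff_bracket.continuous.rpow_const fun x => Or.inl (bracket_pos x).ne'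

namespace CliffordRep

/-! ### Pairing with test fields -/

variable [FiniteDimensional ℝ F] [Nontrivial F]

include hh hf in
lemma sq_inner_lp_le {a : ℝ} (ha : a ≤ 0) (hψ : Continuous ψ) (hc : HasCompactSupport ψ)
    (U : Lp F 2 𝔯 h) : ⟪lp 𝔯 h fun x => (𝔳 h x)⁻¹ • ψ x, U⟫ ^ 2 ≤ (∫ x, (𝔳 h x)⁻¹ * (bracket x ^ (-a) * ‖ψ x‖ ^ 2) ∂𝔯 h)
        * ‖mulL 𝔯 h (fun x => √(bracket x ^ a / 𝔳 h x)) U‖ ^ 2 := by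
  have hw := memLp_smoothingWeight hh hf ha 𝔯 h
  have hpos : ∀ x, 0 < bracket x ^ a / 𝔳 h x := fun x => div_pos (Real.rpow_pos_of_pos (bracket_pos x) _) (hh.volDensity_pos x)
  have hvc := hh.contDiff_volDensity.continuous; have hv : ∀ x, 𝔳 h x ≠ 0 := fun x => (hh.volDensity_pos x).ne'
  have hsc : Continuous fun x => (√(bracket x ^ a / 𝔳 h x))⁻¹ :=
    (((continuous_rpow_bracket a).div hvc hv).sqrt).inv₀ fun x => (Real.sqrt_pos.2 (hpos x)).ne'
  have hg : MemLp (fun x => ((√(bracket x ^ a / 𝔳 h x))⁻¹ * (𝔳 h x)⁻¹) • ψ x) 2 𝔯 h :=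
    hh.memLp ((hsc.mul (hvc.inv₀ hv)).smul hψ) hc.smul_left
  have e1 : lp 𝔯 h (fun x => (𝔳 h x)⁻¹ • ψ x) = mulL 𝔯 h (fun x => √(bracket x ^ a / 𝔳 h x)) (lp 𝔯 h fun x =>
        ((√(bracket x ^ a / 𝔳 h x))⁻¹ * (𝔳 h x)⁻¹) • ψ x) := by
    rw [mulL_lp hw hg]; congr 1 with x; rw [smul_smul, mul_inv_cancel_left₀ (Real.sqrt_pos.2 (hpos x)).ne']
  have e2 : ‖lp 𝔯 h fun x => ((√(bracket x ^ a / 𝔳 h x))⁻¹ * (𝔳 h x)⁻¹) • ψ x‖ ^ 2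
      = ∫ x, (𝔳 h x)⁻¹ * (bracket x ^ (-a) * ‖ψ x‖ ^ 2) ∂𝔯 h := by
    rw [norm_lp_sq hg]; congr 1 with x
    rw [norm_smul, mul_pow, Real.norm_eq_abs, sq_abs, mul_pow, inv_pow, Real.sq_sqrt (hpos x).le, Real.rpow_neg (bracket_pos x).le]
    have := hv x; field_simp
  rw [e1, mulL, inner_opL_comm (memLp_smul_one hw) (memLp_smul_one hw) fun x v w => by
    exact (real_inner_smul_left v w _).trans (real_inner_smul_right v w _).symm, ← e2, ← mul_pow]
  exact sq_le_sq' (neg_le_of_abs_le (abs_real_inner_le_norm _ _)) (real_inner_le_norm _ _)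

lemma inner_lp_le_smoothingSq (hh : IsMetric h) (hf : NearFlat h fun _ => κ) {η : ℝ} (hη : 0 < η) (hψ : IsTest ψ)
    (u : Lp F 2 𝔯 h) (d : Fin 3 → Lp F 2 𝔯 h) :
    ⟪lp 𝔯 h fun x => (𝔳 h x)⁻¹ • ψ x, u⟫ ^ 2 ≤ (∫ x, (𝔳 h x)⁻¹ * (bracket x ^ (3 + 2 * η) * ‖ψ x‖ ^ 2) ∂𝔯 h) * smoothingSq h η u d := by
  have h1 := sq_inner_lp_le hh hf (a := -3 - 2 * η) (by linarith) hψ.cont hψ.compact u; rw [show -(-3 - 2 * η) = 3 + 2 * η by ring] at h1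
  refine h1.trans (mul_le_mul_of_nonneg_left (le_add_of_nonneg_left (sum_nonneg fun i _ => sq_nonneg _)) (integral_nonneg fun x => ?_))
  have := hh.volDensity_pos x; have := bracket_pos x; change 0 ≤ _; positivity

include hh he in
lemma InGraph.inner_lp_D {u k : Lp F 2 𝔯 h} {d : Fin 3 → Lp F 2 𝔯 h} (h1 : c.InGraph h e m u k d)
    (hψ : IsTest ψ) (i : Fin 3) : ⟪lp 𝔯 h fun x => (𝔳 h x)⁻¹ • c.D h e i ψ x, u⟫ = -⟪lp 𝔯 h fun x => (𝔳 h x)⁻¹ • ψ x, d i⟫ := by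
  obtain ⟨φ, hφ, a1, -, a3⟩ := h1; have hvs := hh.contDiff_inv_vol
  refine tendsto_nhds_unique (tendsto_const_nhds.inner a1) ((tendsto_const_nhds.inner (a3 i)).neg.congr fun n => ?_)
  rw [inner_lp ((hψ.smul hvs).memLp hh) (((hφ n).D hh he c i).memLp hh),
    inner_lp (((hψ.D hh he c i).smul hvs).memLp hh) ((hφ n).memLp hh), hh.integral_riemVol, hh.integral_riemVol, neg_eq_iff_add_eq_zero, add_comm]
  have hd : ∀ {f g : Space → F}, IsTest f → IsTest g → Integrable fun x => 𝔳 h x * ⟪(𝔳 h x)⁻¹ • f x, g x⟫ :=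
    fun {f g} hf hg => (integrable_inner hf.memLp_volume hg.memLp_volume).congr (.of_forall fun x => by
      beta_reduce; rw [real_inner_smul_left, mul_inv_cancel_left₀ (hh.volDensity_pos x).ne'])
  rw [← integral_add (hd (hψ.D hh he c i) (hφ n)) (hd hψ ((hφ n).D hh he c i))]
  have hs : HasCompactSupport fun x => ⟪ψ x, φ n x⟫ := hψ.compact.mono' fun x hx => subset_tsupport _ fun h0 => hx (by simp [h0])
  refine (integral_congr_ae (.of_forall fun x => ?_)).trans (integral_pd_eq_zero
    ((hψ.smooth.inner ℝ (hφ n).smooth).of_le (by norm_cast)) hs i)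
  rw [real_inner_smul_left, real_inner_smul_left, mul_inv_cancel_left₀ (hh.volDensity_pos x).ne',
    mul_inv_cancel_left₀ (hh.volDensity_pos x).ne', c.pd_inner_D (h := h) (e := e) (hψ.diff x) ((hφ n).diff x) i]

include hh he hf in
lemma InGraph.inner_lp_pd_le {m η K : ℝ} (hη : 0 < η) (hK : ∀ j x (v : F), ‖c.B h e j x v‖ ≤ K * (bracket x)⁻¹ * ‖v‖)
    {u k : Lp F 2 𝔯 h} {d : Fin 3 → Lp F 2 𝔯 h} (h1 : c.InGraph h e m u k d) (hψ : IsTest ψ)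
    (i : Fin 3) : ⟪lp 𝔯 h fun x => (𝔳 h x)⁻¹ • pd i ψ x, u⟫ ^ 2
      ≤ 2 * (1 + K ^ 2) * (∫ x, (𝔳 h x)⁻¹ * (bracket x ^ (1 + 2 * η) * ‖ψ x‖ ^ 2) ∂𝔯 h) * smoothingSq h η u d := by
  have hvs := hh.contDiff_inv_vol
  have hB : IsTest fun x => c.B h e i x (ψ x) := ⟨(c.contDiff_B hh he i).clm_apply hψ.smooth,
    .intro hψ.compact fun x hx => by rw [off_tsupport hx, map_zero]⟩
  have e1 : lp 𝔯 h (fun x => (𝔳 h x)⁻¹ • pd i ψ x) = lp 𝔯 h (fun x => (𝔳 h x)⁻¹ • c.D h e i ψ x)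
      - lp 𝔯 h (fun x => (𝔳 h x)⁻¹ • c.B h e i x (ψ x)) := by
    rw [← lp_sub (((hψ.D hh he c i).smul hvs).memLp hh) ((hB.smul hvs).memLp hh)]; congr 1 with x; rw [← smul_sub, D, add_sub_cancel_right]
  have a1 := sq_inner_lp_le hh hf (a := -1 - 2 * η) (by linarith) hψ.cont hψ.compact (d i)
  have a2 := inner_lp_le_smoothingSq hh hf hη hB u d; rw [show -(-1 - 2 * η) = 1 + 2 * η by ring] at a1
  have hi : ∀ {b : ℝ} {φ : Space → F}, IsTest φ → Integrable (fun x => (𝔳 h x)⁻¹ * (bracket x ^ b * ‖φ x‖ ^ 2)) 𝔯 h := fun {b φ} hφ => by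
      have := isLocallyFinite_riemVol hh
      exact (hvs.continuous.mul ((continuous_rpow_bracket b).mul (hφ.cont.norm.pow 2))).integrable_of_hasCompactSupport
        (.intro hφ.compact fun x hx => by simp [off_tsupport hx])
  have a3 : ∫ x, (𝔳 h x)⁻¹ * (bracket x ^ (3 + 2 * η) * ‖c.B h e i x (ψ x)‖ ^ 2) ∂𝔯 h
      ≤ K ^ 2 * ∫ x, (𝔳 h x)⁻¹ * (bracket x ^ (1 + 2 * η) * ‖ψ x‖ ^ 2) ∂𝔯 h := by
    rw [← integral_const_mul]; refine integral_mono (hi hB) ((hi hψ).const_mul _) fun x => ?_; have hb := bracket_pos x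
    have h2 := pow_le_pow_left₀ (norm_nonneg _) (hK i x (ψ x)) 2
    have h3 : bracket x ^ (3 + 2 * η) = bracket x ^ (1 + 2 * η) * bracket x ^ 2 := by
      rw [← Real.rpow_natCast, ← Real.rpow_add hb]; push_cast; ring_nf
    beta_reduce; rw [mul_left_comm (K ^ 2), h3]; refine mul_le_mul_of_nonneg_left ?_ (inv_nonneg.2 (hh.volDensity_pos x).le)
    refine (mul_le_mul_of_nonneg_left h2 (by positivity)).trans (le_of_eq ?_); field_simp
  set N := ∫ x, (𝔳 h x)⁻¹ * (bracket x ^ (1 + 2 * η) * ‖ψ x‖ ^ 2) ∂𝔯 h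
  have hS0 : 0 ≤ smoothingSq h η u d := add_nonneg (sum_nonneg fun i _ => sq_nonneg _) (sq_nonneg _)
  have hN : 0 ≤ N := integral_nonneg fun x => by have := hh.volDensity_pos x; have := bracket_pos x; change 0 ≤ _; positivity
  have a4 : ‖mulL 𝔯 h (fun x => √(bracket x ^ (-1 - 2 * η) / 𝔳 h x)) (d i)‖ ^ 2 ≤ smoothingSq h η u d :=
    (single_le_sum (f := fun i => ‖mulL 𝔯 h (fun x => √(bracket x ^ (-1 - 2 * η) / 𝔳 h x)) (d i)‖ ^ 2)
      (fun j _ => sq_nonneg _) (Finset.mem_univ i)).trans (le_add_of_nonneg_right (sq_nonneg _))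
  have a5 := mul_le_mul_of_nonneg_left a4 hN; have a6 := mul_le_mul_of_nonneg_right a3 hS0
  rw [e1, inner_sub_left, h1.inner_lp_D hh he c hψ i]; set p := ⟪lp 𝔯 h fun x => (𝔳 h x)⁻¹ • ψ x, d i⟫
  set q := ⟪lp 𝔯 h fun x => (𝔳 h x)⁻¹ • c.B h e i x (ψ x), u⟫; nlinarith [sq_nonneg (p - q)]

end CliffordRep

namespace CliffordRep

variable [FiniteDimensional ℝ F] [Nontrivial F]
variable {u₀ f : Lp F 2 𝔯 h} {u : ℝ → Space → F}

/-- A weak solution of `J ∂_t u = Hu`, `u(0) = u₀`, with `Hu₀ = f`. -/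
structure IsSolution (h e : MatField) (m : ℝ) (u₀ f : Lp F 2 𝔯 h) (u : ℝ → Space → F) : Prop where
  memLp : IsLocL2 h u
  pair : c.IsWeakPair h e m u₀ f
  equation : ∀ θ, IsTest θ → ∀ ψ : Space → F, IsTest ψ →
    ∫ p, ⟪deriv θ p.1 • c.J (ψ p.2) - θ p.1 • c.H h e m ψ p.2, u p.1 p.2⟫ ∂𝔪 h = θ 0 * ⟪lp 𝔯 h ψ, c.JL _ u₀⟫

lemma exists_support_bounds {γ : ℝ × Space → F} (hc : HasCompactSupport γ) (hs : tsupport γ ⊆ Ioi 0 ×ˢ univ) :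
    ∃ a R : ℝ, 0 < a ∧ a ≤ R ∧ ∀ p, γ p ≠ 0 → a < p.1 ∧ p.1 ≤ R ∧ ‖p.2‖ ≤ R := by
  obtain ⟨a, ha, h1⟩ := hc.isCompact.exists_forall_le' continuous_fst.continuousOn fun p hp => (hs hp).1
  obtain ⟨R, hR⟩ := hc.isBounded.subset_closedBall (0 : ℝ × Space)
  refine ⟨a / 2, max R a, by linarith, by linarith [le_max_right R a], fun p hp => ?_⟩; have h2 := subset_tsupport γ hp
  have h3 := hR h2; rw [mem_closedBall_zero_iff, Prod.norm_def, max_le_iff] at h3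
  exact ⟨by linarith [h1 p h2], (le_abs_self _).trans (h3.1.trans (le_max_left _ _)), h3.2.trans (le_max_left _ _)⟩

namespace IsSolution

include hh he in
lemma pair_timeAvg {𝒰 : (ℝ → ℝ) → Lp F 2 𝔯 h} (hs : c.IsSolution h e m u₀ f u) (h𝒰 : IsTimeAvg h u 𝒰) {θ : ℝ → ℝ}
    (hθ : IsTest θ) : c.IsWeakPair h e m (𝒰 θ) (-c.JL _ (𝒰 (deriv θ) + θ 0 • u₀)) := fun ψ hψ => by
  have hJ : IsTest fun x => c.J (ψ x) := hψ.clm c.J; have hH := hψ.H hh he c m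
  have i : ∀ {θ : ℝ → ℝ}, IsTest θ → ∀ {g : Space → F}, IsTest g →
      Integrable (fun p : ℝ × Space => θ p.1 * ⟪g p.2, u p.1 p.2⟫) 𝔪 h := fun {θ} hθ {g} hg => by
    have := isLocallyFinite_riemVol hh; refine (integrable_timeAvg hh hs.memLp hθ.cont hθ.compact (lp 𝔯 h g)).congr ?_
    filter_upwards [Measure.quasiMeasurePreserving_snd.ae (coeFn_lp (hg.memLp hh))] with p hp; rw [hp]
  have h1 := hs.equation θ hθ ψ hψ; simp only [inner_sub_left, real_inner_smul_left] at h1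
  rw [integral_sub (i hθ.deriv hJ) (i hθ hH), ← h𝒰.inner_lp hh hθ.deriv.cont hθ.deriv.compact (hJ.memLp hh),
    ← h𝒰.inner_lp hh hθ.cont hθ.compact (hH.memLp hh), ← c.JL_lp (hψ.memLp hh), c.inner_JL] at h1
  rw [inner_neg_right, map_add, map_smul, inner_add_right, real_inner_smul_right]; linarith

include hh he hf in
lemma sq_integral_inner_le (hκ : κ ≤ 1 / 10 ^ 10) (hs : c.IsSolution h e m u₀ f u) {η : ℝ} (hη : 0 < η)
    {γ : ℝ × Space → F} (hγ : 𝒞 ∞ γ) (hc : HasCompactSupport γ) (hsupp : tsupport γ ⊆ Ioi 0 ×ˢ univ)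
    {k : ℝ × Space → ℝ} (hk : Integrable k 𝔪 h) (hk0 : ∀ p, 0 ≤ k p)
    (hle : ∀ t v l d, c.InGraph h e m v l d → ⟪(lp 𝔯 h fun x => γ (t, x)), v⟫ ^ 2 ≤ (∫ x, k (t, x) ∂𝔯 h) * smoothingSq h η v d) :
    (∫ p, ⟪γ p, u p.1 p.2⟫ ∂𝔪 h) ^ 2 ≤ (∫ p, k p ∂𝔪 h) * (50 * (1 - (2 : ℝ) ^ (-2 * η))⁻¹ * (33 * (4 * ‖f‖ ^ 2))) := by
  have := isLocallyFinite_riemVol hh; obtain ⟨𝒰, h𝒰⟩ := exists_isTimeAvg hh hs.memLp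
  obtain ⟨a, R, ha, haR, hR⟩ := exists_support_bounds hc hsupp
  obtain ⟨L, hL⟩ := hγ.lipschitzWith_of_hasCompactSupport hc (by simp); choose ρ hρ hρ0 hρ1 hρs hρn using exists_time_mollifier
  set S₀ := 50 * (1 - (2 : ℝ) ^ (-2 * η))⁻¹ * (33 * (4 * ‖f‖ ^ 2)); set N := ∫ p, k p ∂𝔪 h with hN
  set I := ∫ p, ⟪γ p, u p.1 p.2⟫ ∂𝔪 h with hI
  have hz : ∀ {t x}, t ∉ Ioc a R → γ (t, x) = 0 := fun {t x} ht => by by_contra h0; exact ht ⟨(hR _ h0).1, (hR _ h0).2.1⟩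
  have hzx : ∀ {t x}, R < ‖x‖ → γ (t, x) = 0 := fun {t x} hx => by by_contra h0; exact not_le.2 hx (hR _ h0).2.2
  have hg : ∀ t, IsTest fun x => γ (t, x) := fun t => ⟨hγ.comp (contDiff_const.prodMk contDiff_id),
    HasCompactSupport.intro (isCompact_closedBall (0 : Space) R) fun x hx => hzx (by simpa using hx)⟩
  have hρz : ∀ {n t s}, R + 2 ≤ s → t ≤ R → ρ n (s - t) = 0 := fun {n t s} h1 h2 => hρn n _ (by
    have : 1 / ((n : ℝ) + 1) ≤ 1 := div_le_one_of_le₀ (by linarith [n.cast_nonneg (α := ℝ)]) (by positivity); linarith)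
  set J : ℕ → ℝ := fun n => ∫ t in a..R, ⟪(lp 𝔯 h fun x => γ (t, x)), 𝒰 fun s => ρ n (s - t)⟫ with hJ
  have hJle : ∀ n r, 2 * r * J n ≤ r ^ 2 * N + S₀ := fun n r => by
    obtain ⟨d, hd, hdc, hdi⟩ := (IsTimeAvg.isRegular hh he c hf hs.memLp h𝒰 hs.pair (fun θ hθ => hs.pair_timeAvg hh he c h𝒰 hθ) (hρ n) (hρ0 n)
      (hρ1 n) (hρs n)).smoothing hh he c hf hκ
    have hki := hk.integral_prod_left
    have hkR : IntegrableOn (fun t => ∫ x, k (t, x) ∂𝔯 h) (Ioc a R) :=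
      hki.mono_measure (Measure.restrict_mono (fun t ht => ha.trans ht.1) le_rfl)
    have i1 : IntervalIntegrable (fun t => r ^ 2 * ∫ x, k (t, x) ∂𝔯 h) volume a R :=
      ((intervalIntegrable_iff_integrableOn_Ioc_of_le haR).2 hkR).const_mul _
    have i2 := ((hdc η).mono fun t ht => by
      rw [uIcc_of_le haR] at ht; exact ha.trans_le ht.1).intervalIntegrable (μ := volume) (a := a) (b := R)
    have h1 := intervalIntegral.norm_integral_le_of_norm_le haR (μ := volume)
      (f := fun t => 2 * r * ⟪(lp 𝔯 h fun x => γ (t, x)), 𝒰 fun s => ρ n (s - t)⟫) (.of_forall fun t ht => by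
        have h2 := hle t _ _ _ (hd t (ha.trans ht.1).le); have h3 : 0 ≤ ∫ x, k (t, x) ∂𝔯 h := integral_nonneg fun x => hk0 _
        have h4 : 0 ≤ smoothingSq h η (𝒰 fun s => ρ n (s - t)) (d t) := add_nonneg (sum_nonneg fun i _ => sq_nonneg _) (sq_nonneg _)
        refine abs_le_of_sq_le_sq ?_ (add_nonneg (mul_nonneg (sq_nonneg r) h3) h4); set P := ∫ x, k (t, x) ∂𝔯 h
        set Q := smoothingSq h η (𝒰 fun s => ρ n (s - t)) (d t)
        nlinarith [sq_nonneg (r ^ 2 * P - Q), mul_le_mul_of_nonneg_left h2 (sq_nonneg r)]) (i1.add i2)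
    rw [intervalIntegral.integral_add i1 i2, intervalIntegral.integral_const_mul, intervalIntegral.integral_const_mul] at h1
    refine (le_abs_self _).trans (h1.trans (add_le_add (mul_le_mul_of_nonneg_left ?_ (sq_nonneg r)) (hdi η hη a R ha haR)))
    rw [intervalIntegral.integral_of_le haR, hN, spacetimeVol, integral_prod _ hk]
    exact setIntegral_mono_set hki (.of_forall fun t => integral_nonneg fun x => hk0 _)
      (.of_forall fun t (ht : t ∈ Ioc a R) => ha.trans ht.1)
  have hT : 0 < R + 2 := by linarith
  have : SFinite (spacetimeVol h (Ioo 0 (R + 2))) := by rw [spacetimeVol]; infer_instance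
  have : IsLocallyFiniteMeasure (spacetimeVol h (Ioo 0 (R + 2))) := by rw [spacetimeVol]; infer_instance
  have huT := hs.memLp _ hT
  have hJeq : ∀ n, Integrable (fun p : ℝ × Space => ∫ t, ρ n (p.1 - t) * ⟪(γ (t, p.2)), u p.1 p.2⟫) (spacetimeVol h (Ioo 0 (R + 2))) ∧
      J n = ∫ p, (∫ t, ρ n (p.1 - t) * ⟪(γ (t, p.2)), u p.1 p.2⟫) ∂(spacetimeVol h (Ioo 0 (R + 2))) := fun n => by
    have hG : MemLp (fun q : ℝ × ℝ × Space => ρ n (q.2.1 - q.1) • γ (q.1, q.2.2)) 2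
        ((volume.restrict (Ioc a R)).prod (spacetimeVol h (Ioo 0 (R + 2)))) := by
      refine Continuous.memLp_of_hasCompactSupport ?_ (HasCompactSupport.intro (K := Icc a R ×ˢ Icc a (R + 2) ×ˢ Metric.closedBall 0 R)
        (isCompact_Icc.prod (isCompact_Icc.prod (isCompact_closedBall _ _))) fun q hq => ?_)
      · exact ((hρ n).cont.comp (by fun_prop)).smul (hγ.continuous.comp (by fun_prop))
      · by_contra h0; rw [smul_eq_zero, not_or] at h0; obtain ⟨b1, b2, b3⟩ := hR _ h0.2
        refine hq ⟨⟨b1.le, b2⟩, ⟨?_, ?_⟩, by simpa using b3⟩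
        · by_contra h1; exact h0.1 (hρs n _ (by dsimp only at b1; linarith))
        · by_contra h1; exact h0.1 (hρz (not_le.1 h1).le b2)
    have hu2 : MemLp (fun q : ℝ × ℝ × Space => u q.2.1 q.2.2) 2 ((volume.restrict (Ioc a R)).prod (spacetimeVol h (Ioo 0 (R + 2)))) :=
      huT.comp_snd _
    have e1 : ∀ t, ⟪(lp 𝔯 h fun x => γ (t, x)), 𝒰 fun s => ρ n (s - t)⟫
        = ∫ p, ρ n (p.1 - t) * ⟪(γ (t, p.2)), u p.1 p.2⟫ ∂(spacetimeVol h (Ioo 0 (R + 2))) := fun t => by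
      have h1 := (hρ n).shift t; rw [h𝒰.inner_lp hh h1.cont h1.compact ((hg t).memLp hh), integral_spacetime hh fun p hp => ?_]
      by_cases ht : t ∈ Ioc a R
      · rw [hρz hp ht.2, zero_mul]
      · rw [hz ht, inner_zero_left, mul_zero]
    have hi : Integrable (fun q : ℝ × ℝ × Space => ρ n (q.2.1 - q.1) * ⟪(γ (q.1, q.2.2)), u q.2.1 q.2.2⟫)
        ((volume.restrict (Ioc a R)).prod (spacetimeVol h (Ioo 0 (R + 2)))) :=
      (integrable_inner hG hu2).congr (.of_forall fun q => real_inner_smul_left _ _ _)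
    have e2 : ∀ p : ℝ × Space, ∫ t in Ioc a R, ρ n (p.1 - t) * ⟪(γ (t, p.2)), u p.1 p.2⟫
        = ∫ t, ρ n (p.1 - t) * ⟪(γ (t, p.2)), u p.1 p.2⟫ := fun p =>
      setIntegral_eq_integral_of_forall_compl_eq_zero fun t ht => by rw [hz ht, inner_zero_left, mul_zero]
    have h2 := hi.integral_prod_right; rw [hJ]; simp only [e1, e2] at h2 ⊢; refine ⟨h2, ?_⟩
    rw [intervalIntegral.integral_of_le haR, integral_integral_swap hi]; simp only [e2]
  have hγT : MemLp γ 2 (spacetimeVol h (Ioo 0 (R + 2))) := hγ.continuous.memLp_of_hasCompactSupport hc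
  have hIeq : I = ∫ p, ⟪γ p, u p.1 p.2⟫ ∂(spacetimeVol h (Ioo 0 (R + 2))) := integral_spacetime hh fun p hp => by
    rw [← Prod.mk.eta (p := p), hz fun h1 => by linarith [h1.2], inner_zero_left]
  have herr : ∀ n (p : ℝ × Space), |(∫ t, ρ n (p.1 - t) * ⟪(γ (t, p.2)), u p.1 p.2⟫) - ⟪γ p, u p.1 p.2⟫|
      ≤ L / ((n : ℝ) + 1) * ((Metric.closedBall (0 : Space) R).indicator (fun _ => (1 : ℝ)) p.2 * ‖u p.1 p.2‖) := fun n p => by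
    by_cases hp : ‖p.2‖ ≤ R
    swap
    · rw [← Prod.mk.eta (p := p)]; simp only [hzx (not_le.1 hp), inner_zero_left, mul_zero, integral_zero, sub_zero, abs_zero]
      exact mul_nonneg (by positivity) (mul_nonneg (indicator_nonneg (fun _ _ => zero_le_one) _) (norm_nonneg _))
    rw [indicator_of_mem (by simpa using hp), one_mul]; have h1 : ∫ t, ρ n (p.1 - t) = 1 := by rw [integral_sub_left_eq_self (ρ n), hρ1]
    have i0 : Integrable fun t => ρ n (p.1 - t) := ((hρ n).cont.integrable_of_hasCompactSupport (hρ n).compact).comp_sub_left p.1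
    have ic : ∀ {g : ℝ → ℝ}, Continuous g → Integrable fun t => ρ n (p.1 - t) * g t := fun {g} hg =>
      (((hρ n).cont.comp (continuous_const.sub continuous_id)).mul hg).integrable_of_hasCompactSupport
        (HasCompactSupport.mul_right ((hρ n).compact.comp_homeomorph (Homeomorph.subLeft p.1)))
    have hgc : Continuous fun t => ⟪(γ (t, p.2)), u p.1 p.2⟫ := (hγ.continuous.comp (by fun_prop)).inner continuous_const
    have e1 : (∫ t, ρ n (p.1 - t) * ⟪(γ (t, p.2)), u p.1 p.2⟫) - ⟪γ p, u p.1 p.2⟫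
        = ∫ t, ρ n (p.1 - t) * ⟪(γ (t, p.2) - γ p), u p.1 p.2⟫ := by
      simp only [inner_sub_left, mul_sub]; rw [integral_sub (ic hgc) (i0.mul_const _), integral_mul_const, h1, one_mul]
    rw [e1]
    refine (norm_integral_le_of_norm_le (f := fun t => ρ n (p.1 - t) * ⟪(γ (t, p.2) - γ p), u p.1 p.2⟫)
      (g := fun t => ρ n (p.1 - t) * (L / ((n : ℝ) + 1) * ‖u p.1 p.2‖)) (i0.mul_const _)
      (.of_forall fun t => ?_)).trans (by rw [integral_mul_const, h1, one_mul])
    rw [norm_mul, Real.norm_of_nonneg (hρ0 n _)]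
    by_cases ht : 0 ≤ p.1 - t ∧ p.1 - t ≤ 1 / ((n : ℝ) + 1)
    · refine mul_le_mul_of_nonneg_left ((abs_real_inner_le_norm _ _).trans (mul_le_mul_of_nonneg_right ?_ (norm_nonneg _))) (hρ0 n _)
      refine (hL.norm_sub_le _ _).trans ?_; rw [div_eq_mul_one_div (L : ℝ)]
      refine mul_le_mul_of_nonneg_left (le_trans (le_of_eq ?_) ht.2) L.2
      rw [Prod.norm_def, Prod.fst_sub, Prod.snd_sub, sub_self, norm_zero, max_eq_left (norm_nonneg _), Real.norm_eq_abs, abs_sub_comm,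
        abs_of_nonneg ht.1]
    · have : ρ n (p.1 - t) = 0 := by
        by_cases h0 : p.1 - t ≤ 0
        · exact hρs n _ h0
        · exact hρn n _ (not_le.1 fun h2 => ht ⟨(not_le.1 h0).le, h2⟩).le
      rw [this, zero_mul, zero_mul]
  have hlim : Tendsto J atTop (𝓝 I) := by
    have hb : Integrable (fun p : ℝ × Space => (Metric.closedBall (0 : Space) R).indicator (fun _ => (1 : ℝ)) p.2 * ‖u p.1 p.2‖)
        (spacetimeVol h (Ioo 0 (R + 2))) := by
      have h1 : MemLp ((Metric.closedBall (0 : Space) R).indicator fun _ => (1 : ℝ)) 2 𝔯 h :=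
        memLp_indicator_const 2 measurableSet_closedBall 1 (Or.inr (isCompact_closedBall _ _).measure_lt_top.ne)
      exact (integrable_inner (h1.comp_snd _) huT.norm).congr (.of_forall fun p => by exact Real.inner_apply _ _)
    refine tendsto_iff_norm_sub_tendsto_zero.2 (squeeze_zero (g := fun n : ℕ => 1 / ((n : ℝ) + 1) *
      (L * ∫ p : ℝ × Space, (Metric.closedBall (0 : Space) R).indicator (fun _ => (1 : ℝ)) p.2 * ‖u p.1 p.2‖ ∂(spacetimeVol h (Ioo 0 (R + 2)))))
      (fun _ => norm_nonneg _) (fun n => ?_) ?_)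
    · have i2 : Integrable (fun p => ⟪γ p, u p.1 p.2⟫) (spacetimeVol h (Ioo 0 (R + 2))) := integrable_inner hγT huT
      rw [(hJeq n).2, hIeq, ← integral_sub (hJeq n).1 i2]
      refine (norm_integral_le_of_norm_le (hb.const_mul (L / ((n : ℝ) + 1))) (.of_forall (herr n))).trans (le_of_eq ?_)
      rw [integral_const_mul]; ring
    · simpa using (tendsto_one_div_add_atTop_nhds_zero_nat (𝕜 := ℝ)).mul_const (L * ∫ p : ℝ × Space,
        (Metric.closedBall (0 : Space) R).indicator (fun _ => (1 : ℝ)) p.2 * ‖u p.1 p.2‖ ∂(spacetimeVol h (Ioo 0 (R + 2))))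
  have hfin : ∀ r, 0 ≤ N * (r * r) + (-2 * I) * r + S₀ := fun r => by
    have := ge_of_tendsto' ((tendsto_const_nhds (x := r ^ 2 * N + S₀)).sub (hlim.const_mul (2 * r))) fun n => sub_nonneg.2 (hJle n r)
    linarith
  have := discrim_le_zero hfin; rw [discrim] at this; linarith

end IsSolution
end CliffordRep

/-! ### Duality in space-time -/

lemma exists_inner_eq_of_abs_le {V E : Type*} [AddCommGroup V] [Module ℝ V] [NormedAddCommGroup E] [InnerProductSpace ℝ E]
    [CompleteSpace E] (T : V →ₗ[ℝ] E) (Λ : V →ₗ[ℝ] ℝ) {C : ℝ} (hC : 0 ≤ C) (h : ∀ v, |Λ v| ≤ C * ‖T v‖) :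
    ∃ W : E, ‖W‖ ≤ C ∧ ∀ v, Λ v = ⟪T v, W⟫ := by
  have hk : T.ker ≤ Λ.ker := fun v hv => by
    have := h v; rw [LinearMap.mem_ker.1 hv, norm_zero, mul_zero] at this; exact abs_nonpos_iff.1 this
  let g : T.range →ₗ[ℝ] ℝ := (T.ker.liftQ Λ hk).comp T.quotKerEquivRange.symm.toLinearMap
  have hg : ∀ v, g ⟨T v, v, rfl⟩ = Λ v := fun v => by
    have : T.quotKerEquivRange.symm ⟨T v, v, rfl⟩ = T.ker.mkQ v := by rw [LinearEquiv.symm_apply_eq]; rfl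
    change T.ker.liftQ Λ hk (T.quotKerEquivRange.symm ⟨T v, v, rfl⟩) = _; rw [this]; rfl
  obtain ⟨G, hG, hn⟩ := exists_extension_norm_eq T.range (g.mkContinuous C fun w => by obtain ⟨_, v, rfl⟩ := w; rw [hg]; exact h v)
  refine ⟨(InnerProductSpace.toDual ℝ E).symm G, ?_, fun v => ?_⟩
  · rw [LinearIsometryEquiv.norm_map, hn]; exact LinearMap.mkContinuous_norm_le _ hC _
  · rw [real_inner_comm, InnerProductSpace.toDual_symm_apply, hG ⟨T v, v, rfl⟩]; exact (hg v).symm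

section

variable [FiniteDimensional ℝ F] [Nontrivial F]

/-- Space-time test fields supported in positive time. -/
def testSpace (F : Type*) [NormedAddCommGroup F] [InnerProductSpace ℝ F] : Submodule ℝ (ℝ × Space → F) where
  carrier := {φ | 𝒞 ∞ φ ∧ HasCompactSupport φ ∧ tsupport φ ⊆ Ioi 0 ×ˢ univ}
  zero_mem' := ⟨contDiff_const, HasCompactSupport.zero, by simp [Pi.zero_def, tsupport]⟩
  add_mem' := fun h1 h2 => ⟨h1.1.add h2.1, h1.2.1.add h2.2.1, (tsupport_add _ _).trans (union_subset h1.2.2 h2.2.2)⟩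
  smul_mem' := fun a _ h1 => ⟨contDiff_const.smul h1.1, h1.2.1.smul_left (f := fun _ => a),
    (tsupport_smul_subset_right (fun _ => a) _).trans h1.2.2⟩

lemma testSpace_smul {φ : ℝ × Space → F} (hφ : φ ∈ testSpace F) {a : Space → ℝ} (ha : 𝒞 ∞ a) : (fun p => a p.2 • φ p) ∈ testSpace F :=
  ⟨(ha.comp contDiff_snd).smul hφ.1, hφ.2.1.smul_left (f := fun p : ℝ × Space => a p.2),
    (tsupport_smul_subset_right (fun p : ℝ × Space => a p.2) _).trans hφ.2.2⟩

lemma isTest_slice {φ : ℝ × Space → F} (hφ : φ ∈ testSpace F) (t : ℝ) : IsTest fun x => φ (t, x) :=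
  ⟨hφ.1.comp (contDiff_const.prodMk contDiff_id), HasCompactSupport.intro (hφ.2.1.isCompact.image continuous_snd) fun x hx =>
    off_tsupport fun h1 => hx ⟨_, h1, rfl⟩⟩

/-- The spatial derivative of a space-time test field. -/
def pdTest (i : Fin 3) : testSpace F →ₗ[ℝ] testSpace F where
  toFun φ := ⟨fun p => fderiv ℝ φ.1 p (0, single i 1), (φ.2.1.fderiv_right (by simp)).clm_apply contDiff_const,
    φ.2.2.1.fderiv_apply ℝ _, (tsupport_fderiv_apply_subset ℝ _).trans φ.2.2.2⟩
  map_add' φ ψ := Subtype.ext (funext fun p => by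
    change fderiv ℝ (φ.1 + ψ.1) p _ = _; rw [fderiv_add (φ.2.1.diff p) (ψ.2.1.diff p)]; rfl)
  map_smul' a φ := Subtype.ext (funext fun p => by change fderiv ℝ (a • φ.1) p _ = _; rw [fderiv_const_smul (φ.2.1.diff p)]; rfl)

lemma pdTest_apply (i : Fin 3) (φ : testSpace F) (t : ℝ) (x : Space) : (pdTest i φ).1 (t, x) = pd i (fun y => φ.1 (t, y)) x := by
  have h1 : HasFDerivAt (fun y : Space => φ.1 (t, y)) _ x :=
    (φ.2.1.diff (t, x)).hasFDerivAt.comp x ((hasFDerivAt_const t x).prodMk (hasFDerivAt_id x))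
  rw [pd, h1.fderiv]; rfl

include hh

lemma isLocallyFinite_spacetimeVol (I : Set ℝ) : IsLocallyFiniteMeasure (spacetimeVol h I) := by
  have := isLocallyFinite_riemVol hh; rw [spacetimeVol]; infer_instance

lemma integrable_inner_of_hasCompactSupport {u : ℝ → Space → F} (hu : IsLocL2 h u) {φ : ℝ × Space → F} (hφ : Continuous φ)
    (hc : HasCompactSupport φ) : Integrable (fun p => ⟪φ p, u p.1 p.2⟫) 𝔪 h := by
  obtain ⟨R, hR⟩ := hc.isBounded.subset_closedBall (0 : ℝ × Space); have := isLocallyFinite_spacetimeVol hh (Ioo 0 (|R| + 1))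
  refine integrable_spacetime hh (T := |R| + 1) (fun p hp => ?_)
    (integrable_inner (hφ.memLp_of_hasCompactSupport hc) (hu _ (by positivity)))
  have h0 : φ p = 0 := off_tsupport fun h1 => by
    have h3 := hR h1; rw [mem_closedBall_zero_iff, Prod.norm_def, max_le_iff, Real.norm_eq_abs] at h3
    linarith [le_abs_self p.1, le_abs_self R]
  rw [h0, inner_zero_left]

lemma locallyIntegrableOn_of_memLp {u : ℝ × Space → F} (hu : ∀ T : ℝ, 0 < T → MemLp u 2 𝔫 h T) :
    LocallyIntegrableOn u (Ioi 0 ×ˢ univ) 𝔪 h := by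
  have := isLocallyFinite_spacetimeVol hh (Ioi 0)
  refine (locallyIntegrableOn_iff (isOpen_Ioi.prod isOpen_univ).isLocallyClosed).2 fun k hk hc => ?_
  obtain ⟨R, hR⟩ := hc.isBounded.subset_closedBall (0 : ℝ × Space)
  have h1 : k ⊆ Ioo 0 (|R| + 1) ×ˢ univ := fun p hp => by
    have h3 := hR hp; rw [mem_closedBall_zero_iff, Prod.norm_def, max_le_iff, Real.norm_eq_abs] at h3
    exact ⟨⟨(hk hp).1, by linarith [le_abs_self p.1, le_abs_self R]⟩, mem_univ _⟩
  have h2 := hu (|R| + 1) (by positivity); rw [← spacetimeVol_restrict hh] at h2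
  have : IsFiniteMeasure ((𝔪 h).restrict k) := ⟨by rw [Measure.restrict_apply_univ]; exact hc.measure_lt_top⟩
  exact (h2.mono_measure (Measure.restrict_mono h1 le_rfl)).integrable (by norm_num)

lemma ae_eq_of_integral_test {u w : ℝ × Space → F} (hu : LocallyIntegrableOn u (Ioi 0 ×ˢ univ) 𝔪 h)
    (hw : LocallyIntegrableOn w (Ioi 0 ×ˢ univ) 𝔪 h)
    (hi : ∀ φ ∈ testSpace F, ∫ p, ⟪φ p, u p - w p⟫ ∂𝔪 h = 0) :
    u =ᵐ[𝔪 h] w := by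
  have h1 := (isOpen_Ioi.prod isOpen_univ).ae_eq_zero_of_integral_contDiff_smul_eq_zero (hu.sub hw) fun g h1 h2 h3 => by
    by_cases hg : Integrable (fun p => g p • (u - w) p) 𝔪 h
    swap
    · exact integral_undef hg
    refine ext_inner_left ℝ fun v => ?_; refine (integral_inner (𝕜 := ℝ) hg v).symm.trans ?_; rw [inner_zero_right]
    refine (integral_congr_ae (.of_forall fun p => ?_)).trans (hi (fun p => g p • v)
      ⟨h1.smul contDiff_const, h2.smul_right (f' := fun _ => v), (tsupport_smul_subset_left g _).trans h3⟩)
    change ⟪v, g p • (u p - w p)⟫ = ⟪g p • v, u p - w p⟫; rw [real_inner_smul_left, real_inner_smul_right]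
  have h0 : ∀ᵐ p ∂𝔪 h, p.1 ∈ Ioi (0 : ℝ) := by
    have := isLocallyFinite_riemVol hh; exact Measure.quasiMeasurePreserving_fst.ae (ae_restrict_mem measurableSet_Ioi)
  filter_upwards [h1, h0] with p hp hp0; exact sub_eq_zero.1 (hp ⟨hp0, mem_univ _⟩)

namespace CliffordRep.IsSolution

variable {c} {u₀ f : Lp F 2 𝔯 h} {u : ℝ → Space → F}

include hh he hf

lemma exists_dual (hκ : κ ≤ 1 / 10 ^ 10) (hs : c.IsSolution h e m u₀ f u) {η : ℝ} (hη : 0 < η) (P : testSpace F →ₗ[ℝ] testSpace F)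
    {A s : ℝ} (hA : 0 ≤ A) (hP : ∀ (φ : testSpace F) t v l d, c.InGraph h e m v l d → ⟪(lp 𝔯 h fun x => (𝔳 h x)⁻¹ • (P φ).1 (t, x)), v⟫ ^ 2
        ≤ A * (∫ x, (𝔳 h x)⁻¹ * (bracket x ^ (2 * s) * ‖φ.1 (t, x)‖ ^ 2) ∂𝔯 h) * smoothingSq h η v d) :
    ∃ W : Lp F 2 𝔪 h, ‖W‖ ≤ √(2 * A * (50 * (1 - (2 : ℝ) ^ (-2 * η))⁻¹ * 132)) * ‖f‖ ∧
      ∀ φ : testSpace F, ∫ p, ⟪(𝔳 h p.2)⁻¹ • (P φ).1 p, u p.1 p.2⟫ ∂𝔪 h = ∫ p, ⟪(𝔳 h p.2)⁻¹ • φ.1 p, bracket p.2 ^ s • W p⟫ ∂𝔪 h := by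
  have := isLocallyFinite_spacetimeVol hh (Ioi 0); have hvs := hh.contDiff_inv_vol
  have hq : (2 : ℝ) ^ (-2 * η) < 1 := Real.rpow_lt_one_of_one_lt_of_neg (by norm_num) (by linarith)
  have hq' : 0 < (1 - (2 : ℝ) ^ (-2 * η))⁻¹ := inv_pos.2 (by linarith)
  have i := fun φ : testSpace F => have h1 := testSpace_smul φ.2 hvs; integrable_inner_of_hasCompactSupport hh hs.memLp h1.1.continuous h1.2.1
  have hc : Continuous fun p : ℝ × Space => (𝔳 h p.2)⁻¹ * bracket p.2 ^ s :=
    (hvs.continuous.mul (continuous_rpow_bracket s)).comp continuous_snd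
  have hm : ∀ φ : testSpace F, MemLp (fun p => ((𝔳 h p.2)⁻¹ * bracket p.2 ^ s) • φ.1 p) 2 𝔪 h := fun φ =>
    (hc.smul φ.2.1.continuous).memLp_of_hasCompactSupport (φ.2.2.1.smul_left (f := fun p : ℝ × Space => (𝔳 h p.2)⁻¹ * bracket p.2 ^ s))
  let T : testSpace F →ₗ[ℝ] Lp F 2 𝔪 h :=
    { toFun := fun φ => lp _ fun p => ((𝔳 h p.2)⁻¹ * bracket p.2 ^ s) • φ.1 p
      map_add' := fun φ ψ => by rw [← lp_add (hm φ) (hm ψ)]; simp only [← smul_add]; rfl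
      map_smul' := fun a φ => by rw [RingHom.id_apply, ← lp_const_smul (hm φ) a]; simp only [smul_comm a]; rfl }
  let Λ : testSpace F →ₗ[ℝ] ℝ :=
    { toFun := fun φ => ∫ p, ⟪(𝔳 h p.2)⁻¹ • (P φ).1 p, u p.1 p.2⟫ ∂𝔪 h
      map_add' := fun φ ψ => by rw [← integral_add (i (P φ)) (i (P ψ)), map_add]; simp only [← inner_add_left, ← smul_add]; rfl
      map_smul' := fun a φ => by
        rw [RingHom.id_apply, smul_eq_mul, ← integral_const_mul, map_smul]; simp only [← real_inner_smul_left, smul_comm a]; rfl }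
  obtain ⟨W, hW, h1⟩ := exists_inner_eq_of_abs_le T Λ (C := √(2 * A * (50 * (1 - (2 : ℝ) ^ (-2 * η))⁻¹ * 132)) * ‖f‖) (by positivity)
    fun φ => by
      have hγ := testSpace_smul (P φ).2 hvs
      have kc : Continuous fun p : ℝ × Space => (𝔳 h p.2)⁻¹ * (bracket p.2 ^ (2 * s) * ‖φ.1 p‖ ^ 2) :=
        (hvs.continuous.comp continuous_snd).mul (((continuous_rpow_bracket _).comp continuous_snd).mul (φ.2.1.continuous.norm.pow 2))
      have ki : Integrable (fun p : ℝ × Space => (𝔳 h p.2)⁻¹ * (bracket p.2 ^ (2 * s) * ‖φ.1 p‖ ^ 2)) 𝔪 h :=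
        kc.integrable_of_hasCompactSupport (.intro φ.2.2.1 fun p hp => by simp [off_tsupport hp])
      have h1 := hs.sq_integral_inner_le hh he c hf hκ hη hγ.1 hγ.2.1 hγ.2.2 (ki.const_mul A) (fun p => by
        have := hh.volDensity_pos p.2; have := bracket_pos p.2
        positivity) fun t v l d hd => by rw [integral_const_mul]; exact hP φ t v l d hd
      have h2 : ∫ p : ℝ × Space, (𝔳 h p.2)⁻¹ * (bracket p.2 ^ (2 * s) * ‖φ.1 p‖ ^ 2) ∂𝔪 h ≤ 2 * ‖T φ‖ ^ 2 := by
        change _ ≤ 2 * ‖lp _ _‖ ^ 2; rw [norm_lp_sq (hm φ), ← integral_const_mul]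
        refine integral_mono ki (((memLp_two_iff_integrable_sq_norm (hm φ).1).1 (hm φ)).const_mul 2) fun p => ?_
        have hv := hh.volDensity_pos p.2; have hb := Real.rpow_pos_of_pos (bracket_pos p.2) s
        have h3 : 1 ≤ 2 * (𝔳 h p.2)⁻¹ := by rw [← div_eq_mul_inv, one_le_div hv]; exact hf.vol_le p.2
        have h4 : bracket p.2 ^ (2 * s) = (bracket p.2 ^ s) ^ 2 := by rw [← Real.rpow_mul_natCast (bracket_pos p.2).le]; norm_num [mul_comm]
        beta_reduce; rw [h4, norm_smul, Real.norm_of_nonneg (by positivity)]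
        have := mul_le_mul_of_nonneg_right h3 (by positivity : 0 ≤ (𝔳 h p.2)⁻¹ * ((bracket p.2 ^ s) ^ 2 * ‖φ.1 p‖ ^ 2)); nlinarith
      rw [integral_const_mul] at h1; refine abs_le_of_sq_le_sq (h1.trans ?_) (by positivity)
      rw [mul_pow, mul_pow, Real.sq_sqrt (by positivity)]
      have h5 := mul_le_mul_of_nonneg_left h2 (by positivity : 0 ≤ A * (50 * (1 - (2 : ℝ) ^ (-2 * η))⁻¹ * (33 * (4 * ‖f‖ ^ 2)))); linarith
  refine ⟨W, hW, fun φ => (h1 φ).trans ?_⟩; change ⟪lp _ _, W⟫ = _; rw [inner_lp_left (hm φ)]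
  simp only [real_inner_smul_left, real_inner_smul_right, mul_assoc, mul_left_comm]

lemma exists_weighted_gradient (hκ : κ ≤ 1 / 10 ^ 10) (hs : c.IsSolution h e m u₀ f u) {η K : ℝ} (hη : 0 < η)
    (hK : ∀ j x (v : F), ‖c.B h e j x v‖ ≤ K * (bracket x)⁻¹ * ‖v‖) :
    ∃ (W : Lp F 2 𝔪 h) (V : Fin 3 → Lp F 2 𝔪 h), ‖W‖ ≤ √(2 * (2 * (1 + K ^ 2)) * (50 * (1 - (2 : ℝ) ^ (-2 * η))⁻¹ * 132)) * ‖f‖ ∧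
      (∀ i, ‖V i‖ ≤ √(2 * (2 * (1 + K ^ 2)) * (50 * (1 - (2 : ℝ) ^ (-2 * η))⁻¹ * 132)) * ‖f‖) ∧
      (uncurry u =ᵐ[𝔪 h] fun p => bracket p.2 ^ (3 / 2 + η) • W p) ∧
      ∀ i (φ : testSpace F), ∫ p, ⟪(𝔳 h p.2)⁻¹ • (pdTest i φ).1 p, u p.1 p.2⟫ ∂𝔪 h
        = ∫ p, ⟪(𝔳 h p.2)⁻¹ • φ.1 p, bracket p.2 ^ (1 / 2 + η) • V i p⟫ ∂𝔪 h := by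
  have hA : 0 ≤ 2 * (1 + K ^ 2) := by positivity
  have hη2 : (3 : ℝ) + 2 * η = 2 * (3 / 2 + η) := by ring
  have hη1 : (1 : ℝ) + 2 * η = 2 * (1 / 2 + η) := by ring
  obtain ⟨W, hW, h1⟩ := hs.exists_dual hh he hf hκ hη LinearMap.id (s := 3 / 2 + η) hA fun φ t v l d hd => by
    have h2 := inner_lp_le_smoothingSq hh hf hη (isTest_slice φ.2 t) v d; rw [hη2] at h2
    refine h2.trans (mul_le_mul_of_nonneg_right (le_mul_of_one_le_left (integral_nonneg fun x => ?_) (by nlinarith))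
      (add_nonneg (sum_nonneg fun i _ => sq_nonneg _) (sq_nonneg _)))
    have := hh.volDensity_pos x; have := bracket_pos x; change 0 ≤ _; positivity
  choose V hV h2 using fun i => hs.exists_dual hh he hf hκ hη (pdTest i) (s := 1 / 2 + η) hA fun φ t v l d hd => by
    simp only [pdTest_apply]; rw [← hη1]; exact hd.inner_lp_pd_le hh he c hf hη hK (isTest_slice φ.2 t) i
  refine ⟨W, V, hW, hV, ?_, h2⟩
  have hWT : ∀ T : ℝ, 0 < T → MemLp W 2 𝔫 h T := fun T _ => by rw [← spacetimeVol_restrict hh]; exact (Lp.memLp W).restrict _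
  have hb : Continuous fun p : ℝ × Space => bracket p.2 ^ (3 / 2 + η) := (continuous_rpow_bracket _).comp continuous_snd
  refine ae_eq_of_integral_test hh (locallyIntegrableOn_of_memLp hh hs.memLp) ((locallyIntegrableOn_of_memLp hh hWT).continuousOn_smul
    (isOpen_Ioi.prod isOpen_univ).isLocallyClosed hb.continuousOn) fun φ hφ => ?_
  have h3 := h1 ⟨_, testSpace_smul hφ hh.contDiff_volDensity⟩
  simp only [LinearMap.id_apply, smul_smul, inv_mul_cancel₀ (hh.volDensity_pos _).ne', one_smul] at h3
  have hbφ : (fun p => bracket p.2 ^ (3 / 2 + η) • φ p) ∈ testSpace F :=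
    testSpace_smul hφ (contDiff_bracket.rpow_const_of_ne fun x => (bracket_pos x).ne')
  have i2 : Integrable (fun p => ⟪φ p, bracket p.2 ^ (3 / 2 + η) • W p⟫) 𝔪 h := by
    refine (integrable_inner_of_hasCompactSupport hh (u := fun t x => W (t, x)) hWT hbφ.1.continuous hbφ.2.1).congr (.of_forall fun p => ?_)
    beta_reduce; rw [real_inner_smul_left, real_inner_smul_right]
  simp only [inner_sub_right, uncurry]
  rw [integral_sub (integrable_inner_of_hasCompactSupport hh hs.memLp hφ.1.continuous hφ.2.1) i2, sub_eq_zero]; exact h3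

end CliffordRep.IsSolution
end

/-! ### Weak solutions of the Dirac equation -/

lemma inner_complex_eq (v w : Spinor) : inner ℂ v w = (⟪v, w⟫ : ℝ) + (⟪drep.J v, w⟫ : ℝ) * Complex.I := by
  rw [inner_real_eq, inner_real_eq, drep_J, inner_smul_left]; apply Complex.ext <;> simp

lemma integral_inner_complex {α : Type*} [MeasurableSpace α] {μ : Measure α} {a b : α → Spinor}
    (h1 : Integrable (fun x => ⟪a x, b x⟫) μ) (h2 : Integrable (fun x => ⟪drep.J (a x), b x⟫) μ) :
    ∫ x, inner ℂ (a x) (b x) ∂μ = (∫ x, ⟪a x, b x⟫ ∂μ : ℝ) + (∫ x, ⟪drep.J (a x), b x⟫ ∂μ : ℝ) * Complex.I := by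
  simp only [inner_complex_eq]
  rw [integral_add h1.ofReal (h2.ofReal.mul_const _), integral_mul_const, integral_complex_ofReal, integral_complex_ofReal]

lemma norm_act_le {M : Matrix (Fin 4) (Fin 4) ℂ} {C : ℝ} (hM : ∀ k l, ‖M k l‖ ≤ C) (v : Spinor) : ‖act M v‖ ≤ 8 * C * ‖v‖ := by
  have hC : 0 ≤ C := (norm_nonneg _).trans (hM 0 0); refine le_of_sq_le_sq ?_ (by positivity)
  have h1 : ∀ k, ‖act M v k‖ ≤ 4 * C * ‖v‖ := fun k => by
    have e : act M v k = ∑ l, M k l * v l := by simp [act, Matrix.toLpLin_apply, Matrix.mulVec, dotProduct]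
    rw [e]; refine (norm_sum_le_of_le (n := fun _ => C * ‖v‖) _ fun l _ => ?_).trans (by simp; linarith); rw [norm_mul]
    exact mul_le_mul (hM k l) (PiLp.norm_apply_le v l) (norm_nonneg _) hC
  rw [EuclideanSpace.norm_sq_eq]; refine (sum_le_sum fun k _ => pow_le_pow_left₀ (norm_nonneg _) (h1 k) 2).trans (le_of_eq ?_); simp; ring

section

variable {u₀ f : Space → Spinor} {u : ℝ → Space → Spinor}

include hh hf

lemma formNorm_le (w : Fin 3 → Spinor) (x : Space) : formNorm h w x ≤ 2 * ∑ i, ‖w i‖ := by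
  refine Real.sqrt_le_iff.2 ⟨by positivity, ?_⟩
  have h1 : ∀ i j, hInv h i j x * (inner ℂ (w i) (w j)).re ≤ 2 * (‖w i‖ * ‖w j‖) := fun i j => (le_abs_self _).trans (by
      rw [abs_mul, ← inner_real_eq]; exact mul_le_mul (hf.hInv_le hh i j x) (abs_real_inner_le_norm _ _) (abs_nonneg _) zero_le_two)
  refine (sum_le_sum fun i _ => sum_le_sum fun j _ => h1 i j).trans ?_; simp only [← mul_sum, ← sum_mul]; nlinarith [sq_nonneg (∑ i, ‖w i‖)]

omit hf

include he in
lemma IsWeakDiracSolution.isSolution (hu : IsWeakDiracSolution h e m u₀ u) (hfm : MemLp f 2 𝔯 h) (hw : IsWeakDirac h e m u₀ f) :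
    drep.IsSolution h e m (lp _ u₀) (lp _ f) u where
  memLp := hu.memLp
  pair ψ hψ := by
    have h1 := hw ψ hψ.smooth hψ.compact; have hH := hψ.H hh he drep m
    have i := fun {a b : Space → Spinor} (ha : IsTest a) (hb : MemLp b 2 𝔯 h) => integrable_inner (ha.memLp hh) hb
    rw [dirac_eq, integral_inner_complex (i hH hu.memLp_initial) (i (hH.clm drep.J) hu.memLp_initial),
      integral_inner_complex (i hψ hfm) (i (hψ.clm drep.J) hfm)] at h1
    rw [inner_lp (hH.memLp hh) hu.memLp_initial, inner_lp (hψ.memLp hh) hfm]; simpa using congrArg Complex.re h1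
  equation θ hθ ψ hψ := by
    have hH := hψ.H hh he drep m; have hJ := hψ.clm drep.J
    have ht : ∀ {θ : ℝ → ℝ}, IsTest θ → ∀ {g : Space → Spinor}, IsTest g →
        𝒞 ∞ (fun p : ℝ × Space => θ p.1 • g p.2) ∧ HasCompactSupport fun p : ℝ × Space => θ p.1 • g p.2 := fun {θ} hθ {g} hg =>
      ⟨(hθ.smooth.comp contDiff_fst).smul (hg.smooth.comp contDiff_snd),
        HasCompactSupport.intro (hθ.compact.isCompact.prod hg.compact.isCompact) fun p hp => by
          by_cases h1 : p.1 ∈ tsupport θ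
          · rw [off_tsupport fun h2 => hp ⟨h1, h2⟩, smul_zero]
          · rw [off_tsupport h1, zero_smul]⟩
    have h1 := hu.equation (fun t x => θ t • ψ x) ⟨(ht hθ hψ).1, (ht hθ hψ).2⟩
    have hd : ∀ p : ℝ × Space, Complex.I • deriv (fun s => θ s • ψ p.2) p.1 - dirac h e m (fun x => θ p.1 • ψ x) p.2
        = deriv θ p.1 • drep.J (ψ p.2) - θ p.1 • drep.H h e m ψ p.2 := fun p => by
      rw [deriv_smul_const (hθ.diff p.1), dirac_eq, drep.H_const_smul m (hψ.diff) (θ p.1), drep_J, smul_comm]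
    have c1 : Continuous fun p : ℝ × Space => deriv θ p.1 • drep.J (ψ p.2) - θ p.1 • drep.H h e m ψ p.2 :=
      (ht hθ.deriv hJ).1.continuous.sub (ht hθ hH).1.continuous
    have c2 : HasCompactSupport fun p : ℝ × Space => deriv θ p.1 • drep.J (ψ p.2) - θ p.1 • drep.H h e m ψ p.2 :=
      (ht hθ.deriv hJ).2.sub (ht hθ hH).2
    have hψ0 := hψ.const_smul (θ 0); simp only [hd] at h1
    rw [integral_inner_complex (integrable_inner_of_hasCompactSupport hh hu.memLp c1 c2)
        (integrable_inner_of_hasCompactSupport hh hu.memLp (drep.J.continuous.comp c1) (c2.comp_left (map_zero drep.J))),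
      integral_inner_complex (integrable_inner (hψ0.memLp hh) hu.memLp_initial)
        (integrable_inner ((hψ0.clm drep.J).memLp hh) hu.memLp_initial)] at h1
    have h2 := congrArg Complex.re h1
    have h3 : ⟪lp 𝔯 h ψ, drep.JL _ (lp 𝔯 h u₀)⟫ = -∫ x, ⟪drep.J (ψ x), u₀ x⟫ ∂𝔯 h := by
      rw [← inner_lp (hJ.memLp hh) hu.memLp_initial, ← drep.JL_lp (hψ.memLp hh), drep.inner_JL, neg_neg]
    have h4 : ∀ x, ⟪drep.J (θ 0 • ψ x), u₀ x⟫ = θ 0 * ⟪drep.J (ψ x), u₀ x⟫ := fun x => by rw [map_smul, real_inner_smul_left]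
    rw [h3]; simp only [h4, integral_const_mul] at h2; simpa using h2

lemma spacetimeVol_eq : 𝔪 h = ((volume : Measure (ℝ × Space)).restrict (Ioi 0 ×ˢ univ)).withDensity
    fun p => ENNReal.ofReal (𝔳 h p.2) := by
  rw [spacetimeVol, riemVol, prod_withDensity_right hh.contDiff_volDensity.continuous.measurable.ennreal_ofReal, Measure.volume_eq_prod,
    ← Measure.prod_restrict, Measure.restrict_univ]

lemma integral_volume_eq {G : ℝ × Space → ℂ} (hG : ∀ p, p ∉ (Ioi 0 ×ˢ univ : Set (ℝ × Space)) → G p = 0) :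
    ∫ p, G p = ∫ p, (𝔳 h p.2)⁻¹ • G p ∂𝔪 h := by
  rw [spacetimeVol_eq hh, integral_withDensity_eq_integral_toReal_smul (f := fun p : ℝ × Space => ENNReal.ofReal (𝔳 h p.2))
    (hh.contDiff_volDensity.continuous.comp continuous_snd).measurable.ennreal_ofReal (by simp),
    ← setIntegral_eq_integral_of_forall_compl_eq_zero hG]
  refine integral_congr_ae (.of_forall fun p => ?_); have := hh.volDensity_pos p.2; beta_reduce
  rw [ENNReal.toReal_ofReal this.le, smul_inv_smul₀ this.ne']

include hf

lemma locallyIntegrableOn_volume {G : Type*} [NormedAddCommGroup G] {v : ℝ × Space → G} (h1 : MemLp v 2 𝔪 h) :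
    LocallyIntegrableOn v (Ioi 0 ×ˢ univ) := by
  rw [spacetimeVol_eq hh] at h1; have h2 := memLp_of_withDensity (g := fun p : ℝ × Space => 𝔳 h p.2) (fun p => hf.le_vol p.2) h1
  exact locallyIntegrableOn_of_locallyIntegrable_restrict (h2.locallyIntegrable (by norm_num))

/-- Multiplication of a test field by the imaginary unit. -/
def smulI (φ : testSpace Spinor) : testSpace Spinor :=
  ⟨fun p => drep.J (φ.1 p), drep.J.contDiff.comp φ.2.1, φ.2.2.1.comp_left (map_zero drep.J),
    (tsupport_comp_subset (map_zero drep.J) _).trans φ.2.2.2⟩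

omit hh hf in
lemma pdTest_smulI (i : Fin 3) (φ : testSpace Spinor) (p : ℝ × Space) : (pdTest i (smulI φ)).1 p = drep.J ((pdTest i φ).1 p) := by
  have h1 : HasFDerivAt (smulI φ).1 _ p := drep.J.hasFDerivAt.comp p (φ.2.1.diff p).hasFDerivAt
  change fderiv ℝ (smulI φ).1 p _ = _; rw [h1.fderiv]; rfl

include he

lemma IsWeakDiracSolution.exists_gradient (hκ : κ ≤ 1 / 10 ^ 10) (hu : IsWeakDiracSolution h e m u₀ u) (hfm : MemLp f 2 𝔯 h)
    (hw : IsWeakDirac h e m u₀ f) {η K : ℝ} (hη : 0 < η) (hK : ∀ j x k l, ‖spinB h e j x k l‖ ≤ K * (bracket x)⁻¹) :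
    ∃ w : Fin 3 → ℝ → Space → Spinor, IsWeakGradient u w ∧ weightedNorm h (3 / 2 + η) u + weightedFormNorm h (1 / 2 + η) w
      ≤ (7 * Real.toNNReal √(2 * (2 * (1 + (8 * K) ^ 2)) * (50 * (1 - (2 : ℝ) ^ (-2 * η))⁻¹ * 132)) : ℝ≥0) * eLpNorm f 2 𝔯 h := by
  obtain ⟨W, V, hW, hV, hWu, hVu⟩ := (hu.isSolution hh he hfm hw).exists_weighted_gradient hh he hf hκ hη (K := 8 * K) fun j x v => by
    rw [drep_B, mul_assoc 8 K]; exact norm_act_le (hK j x) v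
  have hb : Continuous fun p : ℝ × Space => bracket p.2 ^ (1 / 2 + η) := (continuous_rpow_bracket _).comp continuous_snd
  have hvs := hh.contDiff_inv_vol; refine ⟨fun i t x => -(bracket x ^ (1 / 2 + η) • V i (t, x)), ⟨fun i => ?_, fun i φ hφ hs => ?_⟩, ?_⟩
  · exact ((locallyIntegrableOn_volume hh hf (Lp.memLp (V i))).continuousOn_smul (isOpen_Ioi.prod isOpen_univ).isLocallyClosed hb.continuousOn).neg
  · let φ' : testSpace Spinor := ⟨uncurry φ, hφ.smooth, hφ.compact, hs⟩
    have hVT : ∀ T : ℝ, 0 < T → MemLp (V i) 2 𝔫 h T := fun T _ => by rw [← spacetimeVol_restrict hh]; exact (Lp.memLp (V i)).restrict _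
    have hbs : 𝒞 ∞ fun x => bracket x ^ (1 / 2 + η) := contDiff_bracket.rpow_const_of_ne fun x => (bracket_pos x).ne'
    have i1 : ∀ ψ : testSpace Spinor, Integrable (fun p => ⟪(𝔳 h p.2)⁻¹ • ψ.1 p, u p.1 p.2⟫) 𝔪 h := fun ψ => by
      have h1 := testSpace_smul ψ.2 hvs; exact integrable_inner_of_hasCompactSupport hh hu.memLp h1.1.continuous h1.2.1
    have i2 : ∀ ψ : testSpace Spinor, Integrable (fun p => ⟪(𝔳 h p.2)⁻¹ • ψ.1 p, bracket p.2 ^ (1 / 2 + η) • V i p⟫)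
        𝔪 h := fun ψ => by
      have h1 := testSpace_smul (testSpace_smul ψ.2 hvs) hbs
      refine (integrable_inner_of_hasCompactSupport hh (u := fun t x => V i (t, x)) hVT h1.1.continuous h1.2.1).congr
        (.of_forall fun p => ?_)
      exact (real_inner_smul_left _ _ _).trans (real_inner_smul_right _ _ _).symm
    have e1 : ∀ p : ℝ × Space, pd i (φ p.1) p.2 = (pdTest i φ').1 p := fun p => (pdTest_apply i φ' p.1 p.2).symm
    have e2 : ∀ p : ℝ × Space, φ p.1 p.2 = φ'.1 p := fun p => rfl
    have z : ∀ ψ : testSpace Spinor, ∀ p, p ∉ (Ioi 0 ×ˢ univ : Set (ℝ × Space)) → ψ.1 p = 0 := fun ψ p hp =>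
      off_tsupport fun h1 => hp (ψ.2.2.2 h1)
    have sm : ∀ (a : ℝ) (v w : Spinor), a • inner ℂ v w = inner ℂ (a • v) w := fun a v w => by
      rw [← coe_smul_spinor, inner_smul_left, Complex.conj_ofReal]; rfl
    simp only [e1, e2, inner_neg_right, integral_neg, neg_neg]
    rw [integral_volume_eq hh fun p hp => by rw [z _ p hp, inner_zero_left], integral_volume_eq hh fun p hp => by rw [z _ p hp, inner_zero_left]]
    simp only [sm]; have eI : ∀ p, (smulI φ').1 p = drep.J (φ'.1 p) := fun p => rfl; have j1 := i1 (pdTest i (smulI φ'))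
    have j2 := i2 (smulI φ'); have h3 := hVu i (smulI φ'); simp only [pdTest_smulI, eI, ← map_smul] at j1 j2 h3
    rw [integral_inner_complex (i1 _) j1, integral_inner_complex (i2 _) j2, hVu i φ', h3]
  · set R := √(2 * (2 * (1 + (8 * K) ^ 2)) * (50 * (1 - (2 : ℝ) ^ (-2 * η))⁻¹ * 132)); have hR : 0 ≤ R := Real.sqrt_nonneg _
    have key : ∀ V : Lp Spinor 2 𝔪 h, ‖V‖ ≤ R * ‖lp 𝔯 h f‖ → eLpNorm V 2 𝔪 h ≤ R.toNNReal * eLpNorm f 2 𝔯 h := fun V hV => by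
      rw [← Lp.enorm_def, ← enorm_lp hfm, ← ofReal_norm, ← ofReal_norm]
      exact (ENNReal.ofReal_le_ofReal hV).trans (le_of_eq (ENNReal.ofReal_mul hR))
    have h1 : weightedNorm h (3 / 2 + η) u = eLpNorm W 2 𝔪 h := by
      refine eLpNorm_congr_ae ?_; filter_upwards [hWu] with p hp; have hp' : u p.1 p.2 = _ := hp
      rw [hp', smul_smul, ← Real.rpow_add (bracket_pos _), neg_add_cancel, Real.rpow_zero, one_smul]
    have h2 : weightedFormNorm h (1 / 2 + η) (fun i t x => -(bracket x ^ (1 / 2 + η) • V i (t, x)))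
        ≤ eLpNorm (fun p => (2 : ℝ) • ∑ i, ‖V i p‖) 2 𝔪 h := by
      refine eLpNorm_mono_real fun p => ?_; have hb := Real.rpow_pos_of_pos (bracket_pos p.2) (1 / 2 + η)
      have h3 := formNorm_le hh hf (fun i => -(bracket p.2 ^ (1 / 2 + η) • V i p)) p.2
      simp only [norm_neg, norm_smul, Real.norm_of_nonneg hb.le, ← mul_sum] at h3
      refine (Real.norm_of_nonneg (mul_nonneg (Real.rpow_nonneg (bracket_pos _).le _) (Real.sqrt_nonneg _))).trans_le ?_
      rw [Real.rpow_neg (bracket_pos _).le, inv_mul_le_iff₀ hb, smul_eq_mul, mul_left_comm]; exact h3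
    have h3 : eLpNorm (fun p => (2 : ℝ) • ∑ i, ‖V i p‖) 2 𝔪 h ≤ 2 * ∑ i, eLpNorm (V i) 2 𝔪 h := by
      refine (eLpNorm_const_smul_le (c := (2 : ℝ))).trans ?_; have e2 : ‖(2 : ℝ)‖ₑ = 2 := by simp [enorm_eq_nnnorm]
      rw [e2]
      have h4 := eLpNorm_sum_le (μ := 𝔪 h) (p := 2) (f := fun i p => ‖V i p‖) (s := Finset.univ)
        (fun i _ => (Lp.aestronglyMeasurable (V i)).norm) (by norm_num)
      simp only [eLpNorm_norm] at h4; refine mul_le_mul_right (le_trans (le_of_eq ?_) h4) 2; congr 1 with p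
    refine (add_le_add (h1.trans_le (key W hW)) (h2.trans (h3.trans (mul_le_mul_right (sum_le_sum fun i _ => key _ (hV i)) 2)))).trans
      (le_of_eq ?_)
    rw [Finset.sum_const, Finset.card_univ, Fintype.card_fin, nsmul_eq_mul]; push_cast; ring

end

end CurvedDirac
end

open CurvedDirac in
theorem theorem2p2 :
    (∀ h : Space → Matrix (Fin 3) (Fin 3) ℝ, IsMetric h →
      ∀ e : Space → Matrix (Fin 3) (Fin 3) ℝ, IsDreibein h e →
        (∀ m : ℝ, 0 ≤ m → ∀ (u₀ : Space → Spinor) (u : ℝ → Space → Spinor),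
          IsClassicalDiracSolution h e m u₀ u →
          IsClassicalKGSolution h e m u₀ (fun x => -(Complex.I • dirac h e m u₀ x)) u) ∧
        (∀ m : ℝ, 0 ≤ m → ∀ (u₀ : Space → Spinor) (u : ℝ → Space → Spinor),
          IsWeakDiracSolution h e m u₀ u → IsWeakKGSolution h e m u₀ u) ∧
        (∀ v : Space → Spinor, ContDiff ℝ 2 v → ∀ x : Space,
          spinLaplacian h e v x =
            laplaceBeltrami h v x + ∑ i, act (spinBUp h e i x) (pd i v x)
              + ∑ i, scalarCovUp h i i (fun k y => act (spinB h e k y) (v y)) x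
              + ∑ i, act (spinBUp h e i x) (act (spinB h e i x) (v x)))) ∧
    (∀ σ : ℝ, 0 < σ → σ < 1 → ∃ ε : ℝ, 0 < ε ∧
      (∃ CB : ℝ, 0 < CB ∧ ∀ (h : Space → Matrix (Fin 3) (Fin 3) ℝ) (Ch : ℝ),
        IsMetric h → AsymptoticallyFlat h Ch σ → Ch ≤ ε →
        ∃ e : Space → Matrix (Fin 3) (Fin 3) ℝ, IsDreibein h e ∧ (∀ x, (e x).PosDef) ∧
          ∀ (j : Fin 3) (x : Space) (k l : Fin 4),
            ‖spinB h e j x k l‖ ≤ CB * Ch * bracket x ^ (-2 - σ)) ∧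
      (∀ m : ℝ, 0 ≤ m → ∀ η : ℝ, 0 < η → ∀ K : ℝ, ∃ C : ℝ≥0,
        ∀ (h : Space → Matrix (Fin 3) (Fin 3) ℝ) (Ch : ℝ),
          IsMetric h → AsymptoticallyFlat h Ch σ → Ch ≤ ε →
        ∀ e : Space → Matrix (Fin 3) (Fin 3) ℝ, IsDreibein h e →
          (∀ (j : Fin 3) (x : Space) (k l : Fin 4),
            ‖spinB h e j x k l‖ ≤ K * bracket x ^ (-2 - σ)) →
        ∀ (u₀ f : Space → Spinor) (u : ℝ → Space → Spinor),
          IsWeakDiracSolution h e m u₀ u → MemLp f 2 (riemVol h) → IsWeakDirac h e m u₀ f →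
        ∃ w : Fin 3 → ℝ → Space → Spinor, IsWeakGradient u w ∧
          weightedNorm h (3 / 2 + η) u + weightedFormNorm h (1 / 2 + η) w
            ≤ C * eLpNorm f 2 (riemVol h))) := by
  refine ⟨fun h hh e he => ⟨fun m _ u₀ u hu => classical_kg hh he m u₀ u hu, fun m _ u₀ u hu => weak_kg hh he m u₀ u hu,
    fun v hv x => laplacian_expansion hh he hv x⟩, fun σ hσ _ => ?_⟩
  obtain ⟨ε, CB, hε, hCB, hd⟩ := exists_dreibein_spinB_le
  refine ⟨min ε (1 / 10 ^ 10), by positivity, ⟨CB, hCB, fun h Ch hh hf hC => hd σ h Ch hσ hh hf (hC.trans (min_le_left _ _))⟩,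
    fun m _ η hη K => ⟨7 * Real.toNNReal √(2 * (2 * (1 + (8 * |K|) ^ 2)) * (50 * (1 - (2 : ℝ) ^ (-2 * η))⁻¹ * 132)), fun h Ch hh hf hC e he hK u₀ f u hu hfm hw => ?_⟩⟩
  have hC' : Ch ≤ 1 / 10 ^ 10 := hC.trans (min_le_right _ _)
  have hn : NearFlat h fun _ => Ch := (hf.nearFlat hh hσ (hC'.trans (by norm_num))).mono (fun x => mul_le_of_le_one_right hf.nonneg
    (Real.rpow_le_one_of_one_le_of_nonpos (one_le_bracket x) (by linarith))) fun _ => hC'.trans (by norm_num)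
  refine hu.exists_gradient hh he hn hC' hfm hw hη (K := |K|) fun j x k l => (hK j x k l).trans ?_
  have hb : bracket x ^ (-2 - σ) ≤ (bracket x)⁻¹ := by
    rw [← Real.rpow_neg_one]
    exact Real.rpow_le_rpow_of_exponent_le (one_le_bracket x) (by linarith)
  exact mul_le_mul (le_abs_self K) hb (Real.rpow_nonneg (bracket_pos x).le _) (abs_nonneg K)
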